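/- Let $P$ and $Q$ be finite non-empty sets of points in the Euclidean plane. A point $p_1$ *spatially dominates* $p_2$ if $d(p_1,q)\le d(p_2,q)$ for all $q\in Q$, with strict inequality for some $q\in Q$; let $S$ be the set of points of $P$ that no other point of $P$ spatially dominates. Let $\mathcal{CH}(Q)$ be the convex hull of $Q$ and $|\mathcal{CH}(Q)|$ the number of its vertices. The Voronoi cell of $p\in P$ is the open set $\mathcal V(p)=\{x: d(x,p)<d(x,p')\ \text{for all } p'\in P\setminus\{p\}\}$, and two sites are adjacent in the Delaunay graph if their closed cells share an edge (more than one point). The machine is a real RAM: memory holds variables and arrays of natural numbers (with addition, truncated subtraction, halving, comparison) and of real numbers (with $+,-,\cdot,/$, comparison, no rounding to integers); every operation, test, memory access and assignment costs one step, programs are finite, and memory outside the input is initially zero. Suppose the following is given in memory: - $\mathcal{CH}(Q)$, as the list $q_0,\dots,q_{m-1}$ of its vertices in counterclockwise order, $m=|\mathcal{CH}(Q)|$; its edges are $e_i=\overline{q_iq_{i+1}}$ with indices modulo $m$ (for $m=1$, $e_0=\{q_0\}$); - the Voronoi diagram of $P$ with its Delaunay graph: for every site, the edges of its cell in counterclockwise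 order in a contiguous block, each edge with its end points (an edge may be a ray or a line), the neighbouring cell across it, and its position in that neighbour's block; - a point location structure for this diagram: a search structure whose inner nodes compare a point with a line and whose leaves name a site, such that the search for any point $x$ of the plane ends, after at most $D$ comparisons, at a site nearest to $x$, where $D\le K\log(|P|+1)$ for a constant $K$. Then there is an algorithm SeedSkyline, i.e. one program independent of $P$, $Q$, $K$, of the following form: first find a Voronoi cell whose closure contains $q_0$; then, for $i=0,\dots,|\mathcal{CH}(Q)|-1$ in turn, process the edge $e_i$; finally traverse the Delaunay graph. For every $K$ there is a constant $C$, depending only on $K$, such that on all inputs as above: 1. the first part finds a cell whose closure contains $q_0$ within $C\log(|P|+1)$ steps; 2. for every $k\le|\mathcal{CH}(Q)|$, after the edges $e_0,\dots,e_{k-1}$ have been processed the output list consists exactly of the points $p\in P$ whose cell $\mathcal V(p)$ meets $e_0\cup\dots\cup e_{k-1}$, each listed once; 3. the algorithm halts within $C\,(|S|+|\mathcal{CH}(Q)|)\log(|P|+1)$ steps, and its output list then consists exactly of the points $p\in P$ for which $\mathcal V(p)$ meets the boundary of $\mathcal{CH}(Q)$ or $\mathcal V(p)\subseteq\mathcal{CH}(Q)$,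 each listed once. -/

import Mathlib

noncomputable section

/-! ## Spatial skylines, Voronoi cells, Delaunay graph -/

abbrev Plane : Type := EuclideanSpace ℝ (Fin 2)

/-- `p₁` spatially dominates `p₂` with respect to the query points `Q`. -/
def SpatiallyDominates (Q : Finset Plane) (p₁ p₂ : Plane) : Prop :=
  (∀ q ∈ Q, dist p₁ q ≤ dist p₂ q) ∧ ∃ q ∈ Q, dist p₁ q < dist p₂ q

/-- The set `S` of spatial skyline points of `P` with respect to `Q`. -/
def skyline (P Q : Finset Plane) : Set Plane :=
  {p | p ∈ P ∧ ∀ p' ∈ P, p' ≠ p → ¬ SpatiallyDominates Q p' p}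

/-- The (open) Voronoi cell of `p`: the points closer to `p` than to any other site. -/
def voronoiCell (P : Finset Plane) (p : Plane) : Set Plane :=
  {x | ∀ p' ∈ P, p' ≠ p → dist x p < dist x p'}

/-- The Voronoi cell of `p` together with its boundary. -/
def closedVoronoiCell (P : Finset Plane) (p : Plane) : Set Plane :=
  {x | ∀ p' ∈ P, dist x p ≤ dist x p'}

/-- The common boundary of the cells of `p` and `p'`. -/
def sharedBoundary (P : Finset Plane) (p p' : Plane) : Set Plane :=
  closedVoronoiCell P p ∩ closedVoronoiCell P p'

/-- Adjacency in the Delaunay graph: the cells share an edge (not just a vertex). -/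
def DelaunayAdj (P : Finset Plane) (p p' : Plane) : Prop :=
  p ∈ P ∧ p' ∈ P ∧ p ≠ p' ∧ (sharedBoundary P p p').Nontrivial

/-- The convex hull of the query points. -/
def queryHull (Q : Finset Plane) : Set Plane := convexHull ℝ (Q : Set Plane)

/-- The number of vertices of the convex hull of the query points. -/
def hullSize (Q : Finset Plane) : ℕ := (Set.extremePoints ℝ (queryHull Q)).ncard

/-- The sites whose Voronoi cell meets the boundary of the hull or lies inside the hull. -/
def seedPoints (P Q : Finset Plane) : Set Plane :=
  {p | p ∈ P ∧ ((voronoiCell P p ∩ frontier (queryHull Q)).Nonempty ∨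
    voronoiCell P p ⊆ queryHull Q)}

/-! ## The given geometric data -/

/-- Rotation by a quarter turn counterclockwise. -/
def rot90 (w : Plane) : Plane := !₂[-(w 1), w 0]

/-- The determinant of two plane vectors; positive when `w` is to the left of `v`. -/
def cross (v w : Plane) : ℝ := v 0 * w 1 - v 1 * w 0

/-- The cyclic successor on `Fin m`. -/
def cyclicNext {m : ℕ} (i : Fin m) : Fin m :=
  ⟨(i.val + 1) % m, Nat.mod_lt _ (Nat.lt_of_le_of_lt (Nat.zero_le _) i.isLt)⟩

/-- The convex hull of `Q`, given as the list of its vertices in counterclockwise order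
(a single vertex, or the two end points, if the hull is a point or a segment). -/
structure HullRep (Q : Finset Plane) where
  size : ℕ
  vertex : Fin size → Plane
  vertex_injective : Function.Injective vertex
  range_vertex : Set.range vertex = Set.extremePoints ℝ (queryHull Q)
  ccw : ∀ i j : Fin size, j ≠ i → j ≠ cyclicNext i →
    0 < cross (vertex (cyclicNext i) - vertex i) (vertex j - vertex i)

/-- The `i`-th hull edge, from the `i`-th vertex to the next one. -/
def HullRep.edge {Q : Finset Plane} (H : HullRep Q) (i : Fin H.size) : Set Plane :=
  segment ℝ (H.vertex i) (H.vertex (cyclicNext i))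

/-- The Voronoi diagram of `P` with its dual Delaunay graph, given cell by cell: an enumeration of
the sites and, for every cell, a contiguous block of half-edges, one for every edge of that cell,
sorted counterclockwise along the boundary of the cell.  A half-edge stores the cell it bounds
(`owner`), the neighbouring cell across the edge (`nbr`), the same edge seen from that
neighbour (`twin`), and the end points of the edge.  An edge may be a ray or a line; the flags
`hasSrc`, `hasTgt` tell which of its two ends exist as Voronoi vertices. -/
structure VoronoiRep (P : Finset Plane) where
  site : Fin P.card → Plane
  site_injective : Function.Injective site
  range_site : Set.range site = (P : Set Plane)
  numEdges : ℕ
  first : Fin P.card → ℕ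
  deg : Fin P.card → ℕ
  owner : Fin numEdges → Fin P.card
  nbr : Fin numEdges → Fin P.card
  twin : Fin numEdges → Fin numEdges
  hasSrc : Fin numEdges → Bool
  hasTgt : Fin numEdges → Bool
  src : Fin numEdges → Plane
  tgt : Fin numEdges → Plane
  block_le : ∀ i, first i + deg i ≤ numEdges
  mem_block : ∀ e i, owner e = i ↔ first i ≤ e.val ∧ e.val < first i + deg i
  adj : ∀ e, DelaunayAdj P (site (owner e)) (site (nbr e))
  complete : ∀ i j, DelaunayAdj P (site i) (site j) → ∃! e, owner e = i ∧ nbr e = j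
  twin_spec : ∀ e, owner (twin e) = nbr e ∧ nbr (twin e) = owner e
  src_mem : ∀ e, hasSrc e = true → src e ∈ sharedBoundary P (site (owner e)) (site (nbr e))
  tgt_mem : ∀ e, hasTgt e = true → tgt e ∈ sharedBoundary P (site (owner e)) (site (nbr e))
  /-- The edge is the part of the bisector from `src` (if any) to `tgt` (if any), in the direction
  that has the cell of the owner to the left. -/
  edge_eq : ∀ e, sharedBoundary P (site (owner e)) (site (nbr e)) =
    {x | dist x (site (owner e)) = dist x (site (nbr e)) ∧
      (hasSrc e = true → 0 ≤ inner ℝ (rot90 (site (nbr e) - site (owner e))) (x - src e)) ∧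
      (hasTgt e = true → inner ℝ (rot90 (site (nbr e) - site (owner e))) (x - tgt e) ≤ 0)}
  /-- Successive edges of a cell share a Voronoi vertex, unless the cell is a strip between two
  parallel lines. -/
  chain : ∀ e f : Fin numEdges, owner e = owner f → f.val = e.val + 1 →
    (hasTgt e = true ∧ hasSrc f = true ∧ tgt e = src f) ∨
    (hasSrc e = false ∧ hasTgt e = false ∧ hasSrc f = false ∧ hasTgt f = false)
  /-- The last edge of a cell closes up with the first, or both are unbounded there. -/
  wrap : ∀ e f : Fin numEdges, owner e = owner f → e.val = first (owner e) →
    f.val + 1 = first (owner e) + deg (owner e) →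
    hasTgt f = hasSrc e ∧ (hasSrc e = true → tgt f = src e)

/-- A point location structure for the Voronoi diagram: a search structure whose inner nodes carry
a line `a * x + b * y = c` and whose leaves carry a site.  Descending from the root for `depth`
steps leads every point `x` of the plane to a leaf with a site nearest to `x`. -/
structure PointLocator {P : Finset Plane} (V : VoronoiRep P) where
  size : ℕ
  root : Fin size
  isLeaf : Fin size → Bool
  a : Fin size → ℝ
  b : Fin size → ℝ
  c : Fin size → ℝ
  lo : Fin size → Fin size
  hi : Fin size → Fin size
  label : Fin size → Fin P.card
  depth : ℕ
  locates : ∀ x : Plane,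
    let v := (fun v => if isLeaf v = true then v
      else if a v * x 0 + b v * x 1 ≤ c v then lo v else hi v)^[depth] root
    isLeaf v = true ∧ x ∈ closedVoronoiCell P (V.site (label v))

/-! ## The machine model: a real RAM with unit costs

Memory consists of variables and arrays for natural numbers (indices, pointers) and for real
numbers.  Programs are finite.  Every arithmetic operation, comparison, memory access and
assignment costs one step.  Index arithmetic has addition, truncated subtraction and halving; real
arithmetic has the four field operations; there is no rounding from reals to integers. -/

structure RamState where
  nvar : ℕ → ℕ
  rvar : ℕ → ℝ
  narr : ℕ → ℕ → ℕ
  rarr : ℕ → ℕ → ℝ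

/-- Index expressions. -/
inductive NExp where
  | const (k : ℕ)
  | var (x : ℕ)
  | load (a : ℕ) (i : NExp)
  | add (e₁ e₂ : NExp)
  | sub (e₁ e₂ : NExp)
  | half (e : NExp)

def NExp.eval (s : RamState) : NExp → ℕ
  | .const k => k
  | .var x => s.nvar x
  | .load a i => s.narr a (i.eval s)
  | .add e₁ e₂ => e₁.eval s + e₂.eval s
  | .sub e₁ e₂ => e₁.eval s - e₂.eval s
  | .half e => e.eval s / 2

def NExp.cost : NExp → ℕ
  | .const _ => 1
  | .var _ => 1
  | .load _ i => i.cost + 1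
  | .add e₁ e₂ => e₁.cost + e₂.cost + 1
  | .sub e₁ e₂ => e₁.cost + e₂.cost + 1
  | .half e => e.cost + 1

/-- Real expressions. -/
inductive RExp where
  | const (k : ℤ)
  | var (x : ℕ)
  | load (a : ℕ) (i : NExp)
  | add (e₁ e₂ : RExp)
  | sub (e₁ e₂ : RExp)
  | mul (e₁ e₂ : RExp)
  | div (e₁ e₂ : RExp)

def RExp.eval (s : RamState) : RExp → ℝ
  | .const k => (k : ℝ)
  | .var x => s.rvar x
  | .load a i => s.rarr a (i.eval s)
  | .add e₁ e₂ => e₁.eval s + e₂.eval s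
  | .sub e₁ e₂ => e₁.eval s - e₂.eval s
  | .mul e₁ e₂ => e₁.eval s * e₂.eval s
  | .div e₁ e₂ => e₁.eval s / e₂.eval s

def RExp.cost : RExp → ℕ
  | .const _ => 1
  | .var _ => 1
  | .load _ i => i.cost + 1
  | .add e₁ e₂ => e₁.cost + e₂.cost + 1
  | .sub e₁ e₂ => e₁.cost + e₂.cost + 1
  | .mul e₁ e₂ => e₁.cost + e₂.cost + 1
  | .div e₁ e₂ => e₁.cost + e₂.cost + 1

/-- Tests. -/
inductive BExp where
  | nlt (e₁ e₂ : NExp)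
  | neq (e₁ e₂ : NExp)
  | rlt (e₁ e₂ : RExp)
  | req (e₁ e₂ : RExp)
  | not (b : BExp)
  | and (b₁ b₂ : BExp)
  | or (b₁ b₂ : BExp)

/-- `nlt`, `rlt` are `<` and `neq`, `req` are equality, on naturals and on reals. -/
def BExp.eval (s : RamState) : BExp → Prop
  | .nlt e₁ e₂ => e₁.eval s < e₂.eval s
  | .neq e₁ e₂ => e₁.eval s = e₂.eval s
  | .rlt e₁ e₂ => e₁.eval s < e₂.eval s
  | .req e₁ e₂ => e₁.eval s = e₂.eval s
  | .not b => ¬ b.eval s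
  | .and b₁ b₂ => b₁.eval s ∧ b₂.eval s
  | .or b₁ b₂ => b₁.eval s ∨ b₂.eval s

def BExp.cost : BExp → ℕ
  | .nlt e₁ e₂ => e₁.cost + e₂.cost + 1
  | .neq e₁ e₂ => e₁.cost + e₂.cost + 1
  | .rlt e₁ e₂ => e₁.cost + e₂.cost + 1
  | .req e₁ e₂ => e₁.cost + e₂.cost + 1
  | .not b => b.cost + 1
  | .and b₁ b₂ => b₁.cost + b₂.cost + 1
  | .or b₁ b₂ => b₁.cost + b₂.cost + 1

/-- Programs. -/
inductive Cmd where
  | skip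
  | nset (x : ℕ) (e : NExp)
  | rset (x : ℕ) (e : RExp)
  | nstore (a : ℕ) (i : NExp) (e : NExp)
  | rstore (a : ℕ) (i : NExp) (e : RExp)
  | seq (c₁ c₂ : Cmd)
  | ite (b : BExp) (c₁ c₂ : Cmd)
  | loop (b : BExp) (c : Cmd)

/-- `Exec c s t s'`: started in memory state `s`, the program `c` halts after exactly `t` steps in
memory state `s'`. -/
inductive Exec : Cmd → RamState → ℕ → RamState → Prop where
  | skip (s : RamState) : Exec .skip s 1 s
  | nset (x : ℕ) (e : NExp) (s : RamState) :
      Exec (.nset x e) s (e.cost + 1) { s with nvar := Function.update s.nvar x (e.eval s) }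
  | rset (x : ℕ) (e : RExp) (s : RamState) :
      Exec (.rset x e) s (e.cost + 1) { s with rvar := Function.update s.rvar x (e.eval s) }
  | nstore (a : ℕ) (i e : NExp) (s : RamState) :
      Exec (.nstore a i e) s (i.cost + e.cost + 1)
        { s with narr := Function.update s.narr a (Function.update (s.narr a) (i.eval s) (e.eval s)) }
  | rstore (a : ℕ) (i : NExp) (e : RExp) (s : RamState) :
      Exec (.rstore a i e) s (i.cost + e.cost + 1)
        { s with rarr := Function.update s.rarr a (Function.update (s.rarr a) (i.eval s) (e.eval s)) }
  | seq {c₁ c₂ : Cmd} {s s₁ s₂ : RamState} {t₁ t₂ : ℕ} :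
      Exec c₁ s t₁ s₁ → Exec c₂ s₁ t₂ s₂ → Exec (.seq c₁ c₂) s (t₁ + t₂) s₂
  | iteTrue {b : BExp} {c₁ c₂ : Cmd} {s s' : RamState} {t : ℕ} :
      b.eval s → Exec c₁ s t s' → Exec (.ite b c₁ c₂) s (b.cost + t) s'
  | iteFalse {b : BExp} {c₁ c₂ : Cmd} {s s' : RamState} {t : ℕ} :
      ¬ b.eval s → Exec c₂ s t s' → Exec (.ite b c₁ c₂) s (b.cost + t) s'
  | loopFalse {b : BExp} {c : Cmd} {s : RamState} :
      ¬ b.eval s → Exec (.loop b c) s b.cost s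
  | loopTrue {b : BExp} {c : Cmd} {s s₁ s₂ : RamState} {t₁ t₂ : ℕ} :
      b.eval s → Exec c s t₁ s₁ → Exec (.loop b c) s₁ t₂ s₂ →
      Exec (.loop b c) s (b.cost + t₁ + t₂) s₂

/-! ## Input, output and the shape of the algorithm -/

/-- A finite table as the contents of an array, with zeros after its end. -/
def tableArray {α : Type} [Zero α] {n : ℕ} (f : Fin n → α) : ℕ → α :=
  fun k => if h : k < n then f ⟨k, h⟩ else 0

/-- The initial memory: the Voronoi diagram, its point location structure and the hull, and
zeros everywhere else. -/
def inputState {P Q : Finset Plane} (V : VoronoiRep P) (L : PointLocator V) (H : HullRep Q) :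
    RamState where
  nvar := fun x => match x with
    | 0 => P.card
    | 1 => V.numEdges
    | 2 => L.root.val
    | 3 => H.size
    | _ => 0
  rvar := fun _ => 0
  narr := fun a => match a with
    | 0 => tableArray V.first
    | 1 => tableArray V.deg
    | 2 => tableArray fun e => (V.owner e).val
    | 3 => tableArray fun e => (V.nbr e).val
    | 4 => tableArray fun e => (V.twin e).val
    | 5 => tableArray fun e => (V.hasSrc e).toNat
    | 6 => tableArray fun e => (V.hasTgt e).toNat
    | 7 => tableArray fun v => (L.isLeaf v).toNat
    | 8 => tableArray fun v => (L.lo v).val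
    | 9 => tableArray fun v => (L.hi v).val
    | 10 => tableArray fun v => (L.label v).val
    | _ => fun _ => 0
  rarr := fun a => match a with
    | 0 => tableArray fun i => V.site i 0
    | 1 => tableArray fun i => V.site i 1
    | 2 => tableArray fun e => V.src e 0
    | 3 => tableArray fun e => V.src e 1
    | 4 => tableArray fun e => V.tgt e 0
    | 5 => tableArray fun e => V.tgt e 1
    | 6 => tableArray L.a
    | 7 => tableArray L.b
    | 8 => tableArray L.c
    | 9 => tableArray fun i => H.vertex i 0
    | 10 => tableArray fun i => H.vertex i 1
    | _ => fun _ => 0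

/-- The variable that holds the number of hull edges. -/
def hullSizeVar : ℕ := 3

/-- The loop counter over the hull edges. -/
def edgeVar : ℕ := 4

/-- The variable in which the located cell is returned. -/
def cellVar : ℕ := 5

/-- The variable that holds the length of the output list. -/
def outLenVar : ℕ := 6

/-- The array that holds the output list of site indices. -/
def outArr : ℕ := 11

/-- The output list of the memory state `s` consists of the points of `A`, each listed once, by
their indices as sites. -/
def Outputs {P : Finset Plane} (V : VoronoiRep P) (s : RamState) (A : Set Plane) : Prop :=
  (∀ k < s.nvar outLenVar, s.narr outArr k < P.card) ∧
  Set.InjOn (s.narr outArr) (Set.Iio (s.nvar outLenVar)) ∧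
  {p | ∃ k < s.nvar outLenVar, ∃ i : Fin P.card, s.narr outArr k = i.val ∧ V.site i = p} = A

/-- One round of the loop over the hull edges. -/
def edgeRound (edge : Cmd) : Cmd :=
  .seq edge (.nset edgeVar (.add (.var edgeVar) (.const 1)))

/-- Locate a cell that contains the first hull vertex and set the loop counter to 0. -/
def startWalk (locate : Cmd) : Cmd :=
  .seq locate (.nset edgeVar (.const 0))

/-- The algorithm cut off after `k` hull edges. -/
def walkEdges (locate edge : Cmd) : ℕ → Cmd
  | 0 => startWalk locate
  | k + 1 => .seq (walkEdges locate edge k) (edgeRound edge)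

/-- The whole algorithm: locate the first hull vertex; for `i = 0, …, |CH(Q)| - 1` process the
`i`-th hull edge; then traverse the Delaunay graph. -/
def seedSkyline (locate edge traverse : Cmd) : Cmd :=
  .seq (startWalk locate)
    (.seq (.loop (.nlt (.var edgeVar) (.var hullSizeVar)) (edgeRound edge)) traverse)

end

noncomputable section

open Filter Topology

/-! ## Reasoning about programs -/

/-- Started in `s`, the program halts within `B` steps in a state that satisfies `post`. -/
def Runs (c : Cmd) (s : RamState) (B : ℕ) (post : RamState → Prop) : Prop :=
  ∃ t s', Exec c s t s' ∧ t ≤ B ∧ post s'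

theorem Runs.mono {c : Cmd} {s : RamState} {B B' : ℕ} {p q : RamState → Prop}
    (h : Runs c s B p) (hB : B ≤ B') (hpq : ∀ s', p s' → q s') : Runs c s B' q := by
  obtain ⟨t, s', h1, h2, h3⟩ := h
  exact ⟨t, s', h1, h2.trans hB, hpq _ h3⟩

theorem Runs.seq {c₁ c₂ : Cmd} {s : RamState} {B₁ B₂ : ℕ} {p q : RamState → Prop}
    (h₁ : Runs c₁ s B₁ p) (h₂ : ∀ s', p s' → Runs c₂ s' B₂ q) :
    Runs (.seq c₁ c₂) s (B₁ + B₂) q := by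
  obtain ⟨t, s', h1, h2, h3⟩ := h₁
  obtain ⟨t', s'', h1', h2', h3'⟩ := h₂ s' h3
  exact ⟨_, _, .seq h1 h1', by omega, h3'⟩

theorem Runs.ite {b : BExp} {c₁ c₂ : Cmd} {s : RamState} {B : ℕ} {q : RamState → Prop}
    (h₁ : b.eval s → Runs c₁ s B q) (h₂ : ¬ b.eval s → Runs c₂ s B q) :
    Runs (.ite b c₁ c₂) s (b.cost + B) q := by
  by_cases hb : b.eval s
  · obtain ⟨t, s', h1, h2, h3⟩ := h₁ hb
    exact ⟨_, _, .iteTrue hb h1, by omega, h3⟩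
  · obtain ⟨t, s', h1, h2, h3⟩ := h₂ hb
    exact ⟨_, _, .iteFalse hb h1, by omega, h3⟩

theorem BExp.cost_pos (b : BExp) : 0 < b.cost := by
  cases b <;> simp [BExp.cost]

/-- A loop rule with a potential: `I k s` bounds the remaining running time by `k`. -/
theorem Runs.loop {b : BExp} {c : Cmd} {q : RamState → Prop} (I : ℕ → RamState → Prop)
    (hstep : ∀ k s, I k s → b.eval s →
      ∃ B, Runs c s B (fun s' => ∃ k', b.cost + B + k' ≤ k ∧ I k' s'))
    (hexit : ∀ k s, I k s → ¬ b.eval s → b.cost ≤ k ∧ q s) :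
    ∀ k s, I k s → Runs (.loop b c) s k q := by
  intro k
  induction k using Nat.strong_induction_on with
  | _ k ih =>
    intro s hI
    by_cases hb : b.eval s
    · obtain ⟨B, t, s', h1, h2, k', h3, h4⟩ := hstep k s hI hb
      have := b.cost_pos
      obtain ⟨t', s'', g1, g2, g3⟩ := ih k' (by omega) s' h4
      exact ⟨_, _, .loopTrue hb h1 g1, by omega, g3⟩
    · obtain ⟨h1, h2⟩ := hexit k s hI hb
      exact ⟨_, _, .loopFalse hb, h1, h2⟩

/-- The natural number variables that a program assigns. -/
def Cmd.nvars : Cmd → List ℕ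
  | .nset x _ => [x]
  | .seq c₁ c₂ => c₁.nvars ++ c₂.nvars
  | .ite _ c₁ c₂ => c₁.nvars ++ c₂.nvars
  | .loop _ c => c.nvars
  | _ => []

/-- The real variables that a program assigns. -/
def Cmd.rvars : Cmd → List ℕ
  | .rset x _ => [x]
  | .seq c₁ c₂ => c₁.rvars ++ c₂.rvars
  | .ite _ c₁ c₂ => c₁.rvars ++ c₂.rvars
  | .loop _ c => c.rvars
  | _ => []

/-- The natural number arrays that a program writes. -/
def Cmd.narrs : Cmd → List ℕ
  | .nstore a _ _ => [a]
  | .seq c₁ c₂ => c₁.narrs ++ c₂.narrs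
  | .ite _ c₁ c₂ => c₁.narrs ++ c₂.narrs
  | .loop _ c => c.narrs
  | _ => []

/-- The real arrays that a program writes. -/
def Cmd.rarrs : Cmd → List ℕ
  | .rstore a _ _ => [a]
  | .seq c₁ c₂ => c₁.rarrs ++ c₂.rarrs
  | .ite _ c₁ c₂ => c₁.rarrs ++ c₂.rarrs
  | .loop _ c => c.rarrs
  | _ => []

/-- Memory that the program does not mention as a target is unchanged. -/
structure Frame (c : Cmd) (s s' : RamState) : Prop where
  nvar (x : ℕ) (h : x ∉ c.nvars := by decide) : s'.nvar x = s.nvar x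
  rvar (x : ℕ) (h : x ∉ c.rvars := by decide) : s'.rvar x = s.rvar x
  narr (x : ℕ) (h : x ∉ c.narrs := by decide) : s'.narr x = s.narr x
  rarr (x : ℕ) (h : x ∉ c.rarrs := by decide) : s'.rarr x = s.rarr x

theorem Exec.frame {c : Cmd} {s s' : RamState} {t : ℕ} (h : Exec c s t s') : Frame c s s' := by
  induction h with
  | seq _ _ h1 h2 =>
    constructor <;> intro x hx <;>
      simp only [Cmd.nvars, Cmd.rvars, Cmd.narrs, Cmd.rarrs, List.mem_append, not_or] at hx
    exacts [(h2.nvar x hx.2).trans (h1.nvar x hx.1), (h2.rvar x hx.2).trans (h1.rvar x hx.1),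
      (h2.narr x hx.2).trans (h1.narr x hx.1), (h2.rarr x hx.2).trans (h1.rarr x hx.1)]
  | loopTrue _ _ _ h1 h2 =>
    exact ⟨fun x hx => (h2.nvar x hx).trans (h1.nvar x hx),
      fun x hx => (h2.rvar x hx).trans (h1.rvar x hx),
      fun x hx => (h2.narr x hx).trans (h1.narr x hx),
      fun x hx => (h2.rarr x hx).trans (h1.rarr x hx)⟩
  | iteTrue _ _ h | iteFalse _ _ h =>
    constructor <;> intro x hx <;> simp [Cmd.nvars, Cmd.rvars, Cmd.narrs, Cmd.rarrs] at hx <;>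
      first | exact h.nvar x (by tauto) | exact h.rvar x (by tauto) | exact h.narr x (by tauto)
            | exact h.rarr x (by tauto)
  | _ =>
    constructor <;> intro y hy <;> simp_all [Cmd.nvars, Cmd.rvars, Cmd.narrs, Cmd.rarrs]

theorem Runs.frame {c : Cmd} {s : RamState} {B : ℕ} {p : RamState → Prop} (h : Runs c s B p) :
    Runs c s B (fun s' => p s' ∧ Frame c s s') := by
  obtain ⟨t, s', h1, h2, h3⟩ := h
  exact ⟨t, s', h1, h2, h3, h1.frame⟩

/-- Programs without loops. -/
def Cmd.straight : Cmd → Bool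
  | .seq c₁ c₂ => c₁.straight && c₂.straight
  | .ite _ c₁ c₂ => c₁.straight && c₂.straight
  | .loop _ _ => false
  | _ => true

/-- A bound for the running time of a program without loops. -/
def Cmd.cost : Cmd → ℕ
  | .skip => 1
  | .nset _ e => e.cost + 1
  | .rset _ e => e.cost + 1
  | .nstore _ i e => i.cost + e.cost + 1
  | .rstore _ i e => i.cost + e.cost + 1
  | .seq c₁ c₂ => c₁.cost + c₂.cost
  | .ite b c₁ c₂ => b.cost + (c₁.cost + c₂.cost)
  | .loop b _ => b.cost

open Classical in
/-- The result of a program without loops. -/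
def Cmd.run : Cmd → RamState → RamState
  | .skip, s => s
  | .nset x e, s => { s with nvar := Function.update s.nvar x (e.eval s) }
  | .rset x e, s => { s with rvar := Function.update s.rvar x (e.eval s) }
  | .nstore a i e, s =>
      { s with narr := Function.update s.narr a (Function.update (s.narr a) (i.eval s) (e.eval s)) }
  | .rstore a i e, s =>
      { s with rarr := Function.update s.rarr a (Function.update (s.rarr a) (i.eval s) (e.eval s)) }
  | .seq c₁ c₂, s => c₂.run (c₁.run s)
  | .ite b c₁ c₂, s => if b.eval s then c₁.run s else c₂.run s
  | .loop _ _, s => s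

theorem Cmd.exec_run (c : Cmd) : ∀ s, c.straight = true → ∃ t ≤ c.cost, Exec c s t (c.run s) := by
  induction c with
  | skip => exact fun s _ => ⟨_, le_rfl, .skip s⟩
  | nset x e => exact fun s _ => ⟨_, le_rfl, .nset x e s⟩
  | rset x e => exact fun s _ => ⟨_, le_rfl, .rset x e s⟩
  | nstore a i e => exact fun s _ => ⟨_, le_rfl, .nstore a i e s⟩
  | rstore a i e => exact fun s _ => ⟨_, le_rfl, .rstore a i e s⟩
  | seq c₁ c₂ h₁ h₂ =>
    intro s h
    simp only [Cmd.straight, Bool.and_eq_true] at h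
    obtain ⟨t, ht, e⟩ := h₁ s h.1
    obtain ⟨t', ht', e'⟩ := h₂ (c₁.run s) h.2
    exact ⟨_, by simp only [Cmd.cost]; omega, .seq e e'⟩
  | ite b c₁ c₂ h₁ h₂ =>
    intro s h
    simp only [Cmd.straight, Bool.and_eq_true] at h
    obtain ⟨t, ht, e⟩ := h₁ s h.1
    obtain ⟨t', ht', e'⟩ := h₂ s h.2
    by_cases hb : b.eval s
    · refine ⟨b.cost + t, by simp only [Cmd.cost]; omega, ?_⟩
      simp only [Cmd.run, if_pos hb]
      exact .iteTrue hb e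
    · refine ⟨b.cost + t', by simp only [Cmd.cost]; omega, ?_⟩
      simp only [Cmd.run, if_neg hb]
      exact .iteFalse hb e'
  | loop b c _ => intro s h; simp [Cmd.straight] at h

theorem Runs.straight {c : Cmd} {s : RamState} {B : ℕ} {p : RamState → Prop}
    (h : c.straight = true) (hB : c.cost ≤ B) (hp : p (c.run s)) : Runs c s B p := by
  obtain ⟨t, ht, e⟩ := c.exec_run s h
  exact ⟨t, _, e, ht.trans hB, hp⟩

/-- Sequential composition of a list of programs. -/
def block : List Cmd → Cmd
  | [] => .skip
  | [c] => c
  | c :: cs => .seq c (block cs)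

/-! ## The program -/

/-- Point location: the input is in the real variables 0 and 1, the label is returned in the
variable 11. -/
def locAt : Cmd := block [.nset 10 (.var 2), .loop (.neq (.load 7 (.var 10)) (.const 0))
    (.ite (.rlt (.load 8 (.var 10))
        (.add (.mul (.load 6 (.var 10)) (.var 0)) (.mul (.load 7 (.var 10)) (.var 1))))
      (.nset 10 (.load 9 (.var 10))) (.nset 10 (.load 8 (.var 10)))),
  .nset 11 (.load 10 (.var 10))]

/-- Find a cell that contains the first hull vertex. -/
def locateCmd : Cmd := block [.rset 0 (.load 9 (.const 0)), .rset 1 (.load 10 (.const 0)), locAt,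
  .nset 5 (.var 11)]

/-- Append the cell `c` to the output list and mark it. -/
def output (c : NExp) : Cmd := block [.nstore 11 (.var 6) c, .nset 6 (.add (.var 6) (.const 1)),
  .nstore 14 c (.const 1)]

def RExp.sq (e : RExp) : RExp := .mul e e

/-- The point in the real variables 20, 21 is equidistant from the sites `c` and `c'`. -/
def tieTest (c c' : NExp) : BExp :=
  .req (.add (.sq (.sub (.var 20) (.load 0 c))) (.sq (.sub (.var 21) (.load 1 c))))
    (.add (.sq (.sub (.var 20) (.load 0 c'))) (.sq (.sub (.var 21) (.load 1 c'))))

/-- The point in the real variables 20, 21 lies on the half-edge in the variable 21, and is not its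
end. -/
def onEdgeTest : BExp :=
  .and (tieTest (.var 20) (.load 3 (.var 21)))
    (.not (.and (.neq (.load 6 (.var 21)) (.const 1))
      (.and (.req (.var 20) (.load 4 (.var 21))) (.req (.var 21) (.load 5 (.var 21))))))

/-- Binary search among the half-edges from the third on. -/
def searchLoop : Cmd :=
  .loop (.nlt (.add (.var 23) (.const 1)) (.var 24)) (block [
    .nset 25 (.half (.add (.var 23) (.var 24))),
    .nset 28 (.add (.var 26) (.var 25)),
    .ite (.rlt (.sub (.mul (.sub (.load 4 (.var 28)) (.var 22)) (.sub (.var 21) (.var 23)))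
        (.mul (.sub (.load 5 (.var 28)) (.var 23)) (.sub (.var 20) (.var 22)))) (.const 0))
      (.nset 24 (.var 25)) (.nset 23 (.var 25))])

/-- Find the half-edge of the cell in the variable 20 that contains the point in the real variables
20, 21 other than as its end.  It is returned in the variable 21, the variable 22 tells whether there is
one. -/
def search : Cmd := block [.nset 26 (.load 0 (.var 20)), .nset 27 (.load 1 (.var 20)),
  .nset 22 (.const 0),
  .nset 21 (.var 26),
  .ite (.nlt (.const 0) (.var 27))
    (.ite onEdgeTest (.nset 22 (.const 1)) (.ite (.nlt (.const 1) (.var 27)) (block [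
        .nset 21 (.add (.var 26) (.const 1)),
        .ite onEdgeTest (.nset 22 (.const 1))
          (.ite (.nlt (.const 2) (.var 27)) (block [
            .rset 22 (.load 4 (.var 26)),
            .rset 23 (.load 5 (.var 26)),
            .nset 23 (.const 1),
            .nset 24 (.sub (.var 27) (.const 1)),
            searchLoop,
            .nset 21 (.add (.var 26) (.var 24)),
            .ite onEdgeTest (.nset 22 (.const 1)) .skip]) .skip)]) .skip)) .skip]

/-- Slope along the current hull edge of the affine function that belongs to the site `p`. -/
def slopeExp (p : NExp) : RExp :=
  .mul (.const 2) (.add (.mul (.var 4) (.sub (.var 2) (.load 0 p)))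
    (.mul (.var 5) (.sub (.var 3) (.load 1 p))))

/-- Value of that function at the start of the hull edge. -/
def baseExp (p : NExp) : RExp :=
  .add (.sq (.sub (.var 2) (.load 0 p))) (.sq (.sub (.var 3) (.load 1 p)))

/-- The coordinates of a point of the current hull edge. -/
def edgeX (t : RExp) : RExp := .add (.var 2) (.mul t (.var 4))
def edgeY (t : RExp) : RExp := .add (.var 3) (.mul t (.var 5))

/-- Record that the cell in the variable 5 contains the part of the current hull edge between the
parameters in the real variables 6 and 14. -/
def emitCmd : Cmd := block [.rset 15 (.div (.mul (.const 2) (.sub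
      (.mul (.var 4) (.sub (.load 1 (.var 5)) (.var 3)))
      (.mul (.var 5) (.sub (.load 0 (.var 5)) (.var 2)))))
    (.add (.sq (.var 4)) (.sq (.var 5)))),
  .rset 0 (.add (.load 0 (.var 5)) (.mul (.var 15) (.var 5))),
  .rset 1 (.sub (.load 1 (.var 5)) (.mul (.var 15) (.var 4))),
  locAt,
  .ite (.and (.and (.req (.load 0 (.var 11)) (.var 0)) (.req (.load 1 (.var 11)) (.var 1)))
      (.not (.neq (.var 11) (.var 5))))
    (.ite (.rlt (.const 0) (.var 15)) (block [.nset 15 (.var 5), .nstore 14 (.var 11) (.const 1)])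
      (block [.nset 15 (.var 11), .nstore 14 (.var 5) (.const 1)]))
    (block [.nset 15 (.var 5),
      .ite (.neq (.load 14 (.var 5)) (.const 0)) (output (.var 5)) .skip]),
  .nstore 13 (.var 16) (.var 15),
  .rstore 13 (.var 16) (edgeX (.var 6)),
  .rstore 14 (.var 16) (edgeY (.var 6)),
  .rstore 15 (.var 16) (edgeX (.var 14)),
  .rstore 16 (.var 16) (edgeY (.var 14)),
  .nset 16 (.add (.var 16) (.const 1))]

/-- One step of the subdivision of a hull edge. -/
def walkStep : Cmd := block [.nset 14 (.load 12 (.sub (.var 13) (.const 1))),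
  .rset 7 (slopeExp (.var 5)),
  .rset 8 (baseExp (.var 5)),
  .rset 11 (.div (.sub (baseExp (.var 14)) (.var 8)) (.sub (.var 7) (slopeExp (.var 14)))),
  .rset 0 (edgeX (.var 11)),
  .rset 1 (edgeY (.var 11)),
  locAt,
  .ite (.rlt (.add (baseExp (.var 11)) (.mul (slopeExp (.var 11)) (.var 11)))
      (.add (.var 8) (.mul (.var 7) (.var 11))))
    (block [.nstore 12 (.var 13) (.var 11), .nset 13 (.add (.var 13) (.const 1))])
    (block [
      .ite (.rlt (.var 6) (.var 11)) (.seq (.rset 14 (.var 11)) emitCmd) .skip,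
      .rset 6 (.var 11),
      .nset 5 (.var 14),
      .nset 13 (.sub (.var 13) (.const 1))])]

/-- The current hull edge as a point and a direction. -/
def edgeSetup : Cmd := block [
  .ite (.nlt (.add (.var 4) (.const 1)) (.var 3)) (.nset 12 (.add (.var 4) (.const 1)))
    (.nset 12 (.const 0)),
  .rset 2 (.load 9 (.var 4)),
  .rset 3 (.load 10 (.var 4)),
  .rset 4 (.sub (.load 9 (.var 12)) (.var 2)),
  .rset 5 (.sub (.load 10 (.var 12)) (.var 3)),
  .rset 6 (.const 0)]

/-- Output the cell if the only hull vertex is not on its boundary. -/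
def pointCmd : Cmd := block [.nset 20 (.var 5), .rset 20 (.var 2), .rset 21 (.var 3), search,
  .ite (.neq (.var 22) (.const 0)) (output (.var 5)) .skip]

/-- Subdivide a hull edge. -/
def segmentCmd : Cmd := block [.rset 0 (.load 9 (.var 12)), .rset 1 (.load 10 (.var 12)), locAt,
  .nset 13 (.const 0),
  .ite (.req (slopeExp (.var 5)) (slopeExp (.var 11))) .skip
    (block [.nstore 12 (.const 0) (.var 11), .nset 13 (.const 1)]),
  .loop (.nlt (.const 0) (.var 13)) walkStep,
  .ite (.rlt (.var 6) (.const 1)) (.seq (.rset 14 (.const 1)) emitCmd) .skip]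

def edgeCmd : Cmd := .seq edgeSetup
  (.ite (.neq (.var 3) (.const 1)) pointCmd segmentCmd)

/-- The indices of the records after and before the one in the variable 18. -/
def neighbours : Cmd := block [
  .ite (.nlt (.add (.var 18) (.const 1)) (.var 16)) (.nset 19 (.add (.var 18) (.const 1)))
    (.nset 19 (.const 0)),
  .ite (.nlt (.const 0) (.var 18)) (.nset 33 (.sub (.var 18) (.const 1)))
    (.nset 33 (.sub (.var 16) (.const 1)))]

/-- Find the half-edge at the end of the record. -/
def markBegin : Cmd :=
  .ite (.neq (.load 13 (.var 19)) (.var 20)) .skip (block [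
    .rset 20 (.load 15 (.var 18)),
    .rset 21 (.load 16 (.var 18)),
    search,
    .nstore 15 (.var 18) (.var 21)])

/-- Replace a half-edge by the previous one if the point in question is its start. -/
def stepBack : Cmd :=
  .ite (.and (.neq (.load 5 (.var 21)) (.const 1))
        (.and (.req (.var 20) (.load 2 (.var 21))) (.req (.var 21) (.load 3 (.var 21)))))
      (.ite (.neq (.var 21) (.var 26)) (.nset 21 (.sub (.add (.var 26) (.var 27)) (.const 1)))
        (.nset 21 (.sub (.var 21) (.const 1)))) .skip

/-- Find the half-edge at the start of the record and mark it. -/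
def markEnd : Cmd :=
  .ite (.neq (.load 13 (.var 33)) (.var 20)) .skip (block [
    .rset 20 (.load 13 (.var 18)),
    .rset 21 (.load 14 (.var 18)),
    search,
    stepBack,
    .nstore 16 (.var 21) (.const 1)])

/-- Find the half-edges at the two ends of the record in the variable 18. -/
def markStep : Cmd := block [neighbours, .nset 20 (.load 13 (.var 18)), markBegin, markEnd,
  .nset 18 (.add (.var 18) (.const 1))]

/-- Output the neighbour across the half-edge `e` unless it is marked. -/
def visit (e : NExp) : Cmd := .seq (.nset 30 (.load 3 e))
  (.ite (.neq (.load 14 (.var 30)) (.const 0)) (output (.var 30)) .skip)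

/-- Scan one half-edge of a cell. -/
def scanBody : Cmd :=
  .ite (.neq (.load 17 (.var 21)) (.const 1)) (.nset 29 (.const 0)) (block [
      .nstore 17 (.var 21) (.const 1),
      visit (.var 21),
      .ite (.neq (.load 16 (.var 21)) (.const 1)) (.nset 29 (.const 0))
        (.ite (.nlt (.add (.var 21) (.const 1)) (.add (.var 26) (.var 27)))
          (.nset 21 (.add (.var 21) (.const 1))) (.nset 21 (.var 26)))])

/-- Walk along the boundary of a cell inside the hull. -/
def scanLoop : Cmd :=
  .loop (.neq (.var 29) (.const 1)) scanBody

def scanStep : Cmd := block [neighbours, .nset 20 (.load 13 (.var 18)),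
  .ite (.neq (.load 14 (.var 20)) (.const 0)) (output (.var 20)) .skip,
  .ite (.neq (.load 13 (.var 19)) (.var 20)) .skip (block [
    .nset 26 (.load 0 (.var 20)),
    .nset 27 (.load 1 (.var 20)),
    .nset 21 (.load 15 (.var 18)),
    .nset 29 (.const 1),
    scanLoop]),
  .nset 18 (.add (.var 18) (.const 1))]

/-- Visit all the neighbours of the cell at the front of the queue. -/
def queueStep : Cmd := block [.nset 20 (.load 11 (.var 17)), .nset 31 (.load 0 (.var 20)),
  .nset 32 (.add (.var 31) (.load 1 (.var 20))),
  .loop (.nlt (.var 31) (.var 32)) (.seq (visit (.var 31)) (.nset 31 (.add (.var 31) (.const 1)))),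
  .nset 17 (.add (.var 17) (.const 1))]

def traverseCmd : Cmd :=
  .ite (.nlt (.const 2) (.var 3)) (block [
    .nset 17 (.var 6),
    .nset 18 (.const 0),
    .loop (.nlt (.var 18) (.var 16)) markStep,
    .nset 18 (.const 0),
    .loop (.nlt (.var 18) (.var 16)) scanStep,
    .loop (.nlt (.var 17) (.var 6)) queueStep]) .skip

/-! ## Squared distances and closed cells -/

/-- The squared distance. -/
def sqd (x a : Plane) : ℝ := (x 0 - a 0) ^ 2 + (x 1 - a 1) ^ 2

theorem sqd_nonneg (x a : Plane) : 0 ≤ sqd x a := by unfold sqd; positivity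

theorem dist_eq_sqrt_sqd (x a : Plane) : dist x a = √(sqd x a) := by
  rw [EuclideanSpace.dist_eq]
  simp [sqd, Fin.sum_univ_two, Real.dist_eq, sq_abs]

theorem dist_le_dist_iff (x a y b : Plane) : dist x a ≤ dist y b ↔ sqd x a ≤ sqd y b := by
  rw [dist_eq_sqrt_sqd, dist_eq_sqrt_sqd, Real.sqrt_le_sqrt_iff (sqd_nonneg y b)]

theorem dist_lt_dist_iff (x a y b : Plane) : dist x a < dist y b ↔ sqd x a < sqd y b := by
  rw [dist_eq_sqrt_sqd, dist_eq_sqrt_sqd, Real.sqrt_lt_sqrt_iff (sqd_nonneg x a)]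

theorem dist_eq_dist_iff (x a y b : Plane) : dist x a = dist y b ↔ sqd x a = sqd y b := by
  rw [le_antisymm_iff, le_antisymm_iff, dist_le_dist_iff, dist_le_dist_iff]

/-- The scalar product in coordinates. -/
def dot (v w : Plane) : ℝ := v 0 * w 0 + v 1 * w 1

theorem plane_ext {x y : Plane} (h0 : x 0 = y 0) (h1 : x 1 = y 1) : x = y := by
  ext i; fin_cases i
  · exact h0
  · exact h1

theorem inner_rot90 (v w : Plane) : inner ℝ (rot90 v) w = cross v w := by
  simp [rot90, cross, PiLp.inner_apply, Fin.sum_univ_two]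
  ring

@[simp] theorem rot90_zero (v : Plane) : rot90 v 0 = -(v 1) := by simp [rot90]
@[simp] theorem rot90_one (v : Plane) : rot90 v 1 = v 0 := by simp [rot90]

theorem sqd_eq_zero {x a : Plane} : sqd x a = 0 ↔ x = a := by
  constructor
  · intro h
    unfold sqd at h
    have h0 : (x 0 - a 0) ^ 2 = 0 := by nlinarith [sq_nonneg (x 0 - a 0), sq_nonneg (x 1 - a 1)]
    have h1 : (x 1 - a 1) ^ 2 = 0 := by nlinarith [sq_nonneg (x 0 - a 0), sq_nonneg (x 1 - a 1)]
    exact plane_ext (by nlinarith) (by nlinarith)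
  · rintro rfl; simp [sqd]

theorem dot_self_pos {v : Plane} (h : v ≠ 0) : 0 < dot v v := by
  have h1 : sqd v 0 ≠ 0 := fun h2 => h (sqd_eq_zero.1 h2)
  have h2 : sqd v 0 = dot v v := by simp [sqd, dot]; ring
  rw [← h2]
  exact lt_of_le_of_ne (sqd_nonneg _ _) (Ne.symm h1)

theorem mem_closedVoronoiCell {P : Finset Plane} {p x : Plane} :
    x ∈ closedVoronoiCell P p ↔ ∀ p' ∈ P, sqd x p ≤ sqd x p' := by
  simp only [closedVoronoiCell, Set.mem_ofPred_eq, dist_le_dist_iff]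

theorem mem_voronoiCell {P : Finset Plane} {p x : Plane} :
    x ∈ voronoiCell P p ↔ ∀ p' ∈ P, p' ≠ p → sqd x p < sqd x p' := by
  simp only [voronoiCell, Set.mem_ofPred_eq, dist_lt_dist_iff]

theorem voronoiCell_subset_closed {P : Finset Plane} {p : Plane} :
    voronoiCell P p ⊆ closedVoronoiCell P p := by
  intro x hx
  rw [mem_closedVoronoiCell]
  intro p' hp'
  rcases eq_or_ne p' p with rfl | h
  · rfl
  · exact (mem_voronoiCell.1 hx p' hp' h).le

/-- The difference of the squared distances to `s` and to `c`, an affine function. -/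
def gap (c s x : Plane) : ℝ := sqd x s - sqd x c

theorem gap_add_smul (c s x d : Plane) (t : ℝ) :
    gap c s (x + t • d) = gap c s x - 2 * t * dot (s - c) d := by
  simp [gap, sqd, dot]; ring

theorem gap_add_rot (c s x m : Plane) (t : ℝ) :
    gap c s (x + t • rot90 m) = gap c s x - 2 * t * cross m (s - c) := by
  simp [gap, sqd, cross]; ring

theorem gap_eq (c s x : Plane) : gap c s x = dot (s - c) (s - c) - 2 * dot (s - c) (x - c) := by
  simp [gap, sqd, dot]; ring

theorem gap_comb (c s x y : Plane) (a b : ℝ) (hab : a + b = 1) :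
    gap c s (a • x + b • y) = a * gap c s x + b * gap c s y := by
  obtain rfl : b = 1 - a := by linarith
  simp [gap, sqd]; ring

theorem gap_swap (c s x : Plane) : gap s c x = - gap c s x := by simp [gap]

theorem continuous_gap (c s : Plane) : Continuous (gap c s) := by
  unfold gap sqd; fun_prop

theorem mem_closed_iff_gap {P : Finset Plane} {p x : Plane} :
    x ∈ closedVoronoiCell P p ↔ ∀ s ∈ P, 0 ≤ gap p s x := by
  rw [mem_closedVoronoiCell]; simp [gap]

theorem mem_open_iff_gap {P : Finset Plane} {p x : Plane} :
    x ∈ voronoiCell P p ↔ ∀ s ∈ P, s ≠ p → 0 < gap p s x := by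
  rw [mem_voronoiCell]; simp [gap]

theorem isClosed_closedVoronoiCell (P : Finset Plane) (p : Plane) :
    IsClosed (closedVoronoiCell P p) := by
  have : closedVoronoiCell P p = ⋂ s ∈ P, {x | 0 ≤ gap p s x} := by
    ext x; simp [mem_closed_iff_gap]
  rw [this]
  exact isClosed_biInter fun s _ => isClosed_le continuous_const (continuous_gap p s)

theorem isOpen_voronoiCell (P : Finset Plane) (p : Plane) : IsOpen (voronoiCell P p) := by
  classical
  have : voronoiCell P p = ⋂ s ∈ P.filter (· ≠ p), {x | 0 < gap p s x} := by
    ext x; simp [mem_open_iff_gap]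
  rw [this]
  exact isOpen_biInter_finset fun s _ => isOpen_lt continuous_const (continuous_gap p s)

theorem convex_closedVoronoiCell (P : Finset Plane) (p : Plane) :
    Convex ℝ (closedVoronoiCell P p) := by
  intro x hx y hy a b ha hb hab
  rw [mem_closed_iff_gap] at *
  intro s hs
  rw [gap_comb _ _ _ _ _ _ hab]
  have := hx s hs
  have := hy s hs
  positivity

theorem convex_voronoiCell (P : Finset Plane) (p : Plane) : Convex ℝ (voronoiCell P p) := by
  intro x hx y hy a b ha hb hab
  rw [mem_open_iff_gap] at *
  intro s hs hsp
  rw [gap_comb _ _ _ _ _ _ hab]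
  have h1 := hx s hs hsp
  have h2 := hy s hs hsp
  rcases ha.eq_or_lt with rfl | ha
  · simp at hab; subst hab; simpa using h2
  · have := mul_pos ha h1
    have := mul_nonneg hb h2.le
    linarith

theorem self_mem_voronoiCell (P : Finset Plane) (p : Plane) : p ∈ voronoiCell P p := by
  rw [mem_voronoiCell]
  intro p' _ h
  have h0 : sqd p p = 0 := sqd_eq_zero.2 rfl
  have : sqd p p' ≠ 0 := fun h' => h (sqd_eq_zero.1 h').symm
  rw [h0]
  exact lt_of_le_of_ne (sqd_nonneg _ _) this.symm

/-- A point of an open cell lies in no other closed cell. -/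
theorem eq_of_mem_open_of_mem_closed {P : Finset Plane} {p p' x : Plane} (hp : p ∈ P) (hp' : p' ∈ P)
    (h : x ∈ voronoiCell P p) (h' : x ∈ closedVoronoiCell P p') : p' = p := by
  by_contra hne
  have h1 := mem_voronoiCell.1 h p' hp' hne
  have h2 := mem_closedVoronoiCell.1 h' p hp
  linarith

/-- A point between a point of the open cell and a point of the closed cell is in the open cell. -/
theorem comb_mem_voronoiCell {P : Finset Plane} {p x y : Plane} (hx : x ∈ voronoiCell P p)
    (hy : y ∈ closedVoronoiCell P p) {a b : ℝ} (ha : 0 < a) (hb : 0 ≤ b) (hab : a + b = 1) :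
    a • x + b • y ∈ voronoiCell P p := by
  rw [mem_open_iff_gap] at *
  intro s hs hsp
  rw [gap_comb _ _ _ _ _ _ hab]
  have h1 := mul_pos ha (hx s hs hsp)
  have h2 := mul_nonneg hb (mem_closed_iff_gap.1 hy s hs)
  linarith

theorem mem_open_of_closed_no_tie {P : Finset Plane} {p x : Plane}
    (h : x ∈ closedVoronoiCell P p) (hn : ∀ s ∈ P, s ≠ p → gap p s x ≠ 0) :
    x ∈ voronoiCell P p := by
  rw [mem_open_iff_gap]
  intro s hs hsp
  exact lt_of_le_of_ne (mem_closed_iff_gap.1 h s hs) (hn s hs hsp).symm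

theorem exists_mem_closedVoronoiCell {P : Finset Plane} (hP : P.Nonempty) (x : Plane) :
    ∃ p ∈ P, x ∈ closedVoronoiCell P p := by
  obtain ⟨p, hp, h⟩ := P.exists_min_image (sqd x) hP
  exact ⟨p, hp, mem_closedVoronoiCell.2 h⟩

/-! ## Half-edges -/

namespace VoronoiRep

variable {P : Finset Plane} (V : VoronoiRep P)

theorem site_mem (i : Fin P.card) : V.site i ∈ P := by
  have : V.site i ∈ Set.range V.site := ⟨i, rfl⟩
  rw [V.range_site] at this
  exact this

theorem exists_site {p : Plane} (hp : p ∈ P) : ∃ i, V.site i = p := by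
  have : p ∈ Set.range V.site := by rw [V.range_site]; exact hp
  exact this

/-- The site of the cell bounded by a half-edge. -/
def so (e : Fin V.numEdges) : Plane := V.site (V.owner e)

/-- The site across a half-edge. -/
def sn (e : Fin V.numEdges) : Plane := V.site (V.nbr e)

/-- The normal vector of a half-edge. -/
def nrm (e : Fin V.numEdges) : Plane := V.sn e - V.so e

/-- The direction of a half-edge. -/
def dir (e : Fin V.numEdges) : Plane := rot90 (V.nrm e)

/-- The Voronoi edge of a half-edge. -/
def edge (e : Fin V.numEdges) : Set Plane := sharedBoundary P (V.so e) (V.sn e)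

theorem so_mem (e : Fin V.numEdges) : V.so e ∈ P := V.site_mem _
theorem sn_mem (e : Fin V.numEdges) : V.sn e ∈ P := V.site_mem _

theorem sn_ne_so (e : Fin V.numEdges) : V.sn e ≠ V.so e := (V.adj e).2.2.1.symm

theorem nrm_ne_zero (e : Fin V.numEdges) : V.nrm e ≠ 0 := sub_ne_zero.2 (V.sn_ne_so e)

theorem edge_nontrivial (e : Fin V.numEdges) : (V.edge e).Nontrivial := (V.adj e).2.2.2

theorem mem_edge {e : Fin V.numEdges} {x : Plane} : x ∈ V.edge e ↔ gap (V.so e) (V.sn e) x = 0 ∧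
    (V.hasSrc e = true → 0 ≤ cross (V.nrm e) (x - V.src e)) ∧
    (V.hasTgt e = true → cross (V.nrm e) (x - V.tgt e) ≤ 0) := by
  have h := V.edge_eq e
  unfold edge
  rw [show sharedBoundary P (V.so e) (V.sn e) = _ from h]
  simp only [Set.mem_ofPred_eq, inner_rot90, dist_eq_dist_iff, nrm, so, sn, gap, sub_eq_zero]
  exact and_congr_left fun _ => eq_comm

theorem edge_subset_owner (e : Fin V.numEdges) : V.edge e ⊆ closedVoronoiCell P (V.so e) :=
  fun _ h => h.1

theorem edge_subset_nbr (e : Fin V.numEdges) : V.edge e ⊆ closedVoronoiCell P (V.sn e) :=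
  fun _ h => h.2

theorem mem_edge_of_tie {e : Fin V.numEdges} {x : Plane} (h : x ∈ closedVoronoiCell P (V.so e))
    (h' : gap (V.so e) (V.sn e) x = 0) : x ∈ V.edge e := by
  refine ⟨h, mem_closedVoronoiCell.2 fun p' hp' => ?_⟩
  have := mem_closedVoronoiCell.1 h p' hp'
  unfold gap at h'
  linarith

theorem convex_edge (e : Fin V.numEdges) : Convex ℝ (V.edge e) :=
  (convex_closedVoronoiCell P _).inter (convex_closedVoronoiCell P _)

theorem src_mem_edge {e : Fin V.numEdges} (h : V.hasSrc e = true) : V.src e ∈ V.edge e :=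
  V.src_mem e h

theorem tgt_mem_edge {e : Fin V.numEdges} (h : V.hasTgt e = true) : V.tgt e ∈ V.edge e :=
  V.tgt_mem e h

theorem dot_nrm_pos (e : Fin V.numEdges) : 0 < dot (V.nrm e) (V.nrm e) :=
  dot_self_pos (V.nrm_ne_zero e)

/-- Points equidistant from the two sites of a half-edge differ by a multiple of its direction. -/
theorem eq_add_smul_dir {e : Fin V.numEdges} {x y : Plane} (hx : gap (V.so e) (V.sn e) x = 0)
    (hy : gap (V.so e) (V.sn e) y = 0) :
    y = x + (cross (V.nrm e) (y - x) / dot (V.nrm e) (V.nrm e)) • V.dir e := by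
  have hn := V.dot_nrm_pos e
  have h : dot (V.nrm e) (y - x) = 0 := by
    rw [gap_eq] at hx hy
    simp only [nrm, dot, PiLp.sub_apply] at *
    linarith
  have h0 : (y 0 - x 0) * dot (V.nrm e) (V.nrm e) = - cross (V.nrm e) (y - x) * V.nrm e 1 := by
    simp only [dot, cross, PiLp.sub_apply] at *
    linear_combination (V.nrm e 0) * h
  have h1 : (y 1 - x 1) * dot (V.nrm e) (V.nrm e) = cross (V.nrm e) (y - x) * V.nrm e 0 := by
    simp only [dot, cross, PiLp.sub_apply] at *
    linear_combination (V.nrm e 1) * h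
  apply plane_ext
  · simp [dir]
    field_simp
    linarith
  · simp [dir]
    field_simp
    linarith

theorem cross_nrm_dir (e : Fin V.numEdges) (t : ℝ) :
    cross (V.nrm e) (t • V.dir e) = t * dot (V.nrm e) (V.nrm e) := by
  simp [cross, dot, dir]; ring

theorem gap_add_dir (e : Fin V.numEdges) (x : Plane) (t : ℝ) :
    gap (V.so e) (V.sn e) (x + t • V.dir e) = gap (V.so e) (V.sn e) x := by
  rw [dir, gap_add_rot]
  simp [cross, nrm]; right; ring

/-- The point lies on the half-edge, but is not its end. -/
def Fwd (e : Fin V.numEdges) (z : Plane) : Prop :=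
  z ∈ V.edge e ∧ ¬ (V.hasTgt e = true ∧ z = V.tgt e)

/-- The point lies on the half-edge, but is not its start. -/
def Bwd (e : Fin V.numEdges) (z : Plane) : Prop :=
  z ∈ V.edge e ∧ ¬ (V.hasSrc e = true ∧ z = V.src e)

variable {V}

theorem fwd_of_smul {e : Fin V.numEdges} {z : Plane} {t : ℝ} (ht : 0 < t) (hz : z ∈ V.edge e)
    (hz' : z + t • V.dir e ∈ V.edge e) : V.Fwd e z := by
  refine ⟨hz, fun ⟨h1, h2⟩ => ?_⟩
  have h3 := (V.mem_edge.1 hz').2.2 h1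
  rw [← h2, add_sub_cancel_left, cross_nrm_dir] at h3
  have := mul_pos ht (V.dot_nrm_pos e)
  linarith

theorem bwd_of_smul {e : Fin V.numEdges} {z : Plane} {t : ℝ} (ht : 0 < t) (hz : z ∈ V.edge e)
    (hz' : z - t • V.dir e ∈ V.edge e) : V.Bwd e z := by
  refine ⟨hz, fun ⟨h1, h2⟩ => ?_⟩
  have h3 := (V.mem_edge.1 hz').2.1 h1
  rw [← h2, show z - t • V.dir e - z = (-t) • V.dir e by simp, cross_nrm_dir] at h3
  have := mul_pos ht (V.dot_nrm_pos e)
  linarith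

theorem Fwd.exists_smul {e : Fin V.numEdges} {z : Plane} (h : V.Fwd e z) :
    ∃ t : ℝ, 0 < t ∧ z + t • V.dir e ∈ V.edge e := by
  obtain ⟨hz, hne⟩ := h
  have hz' := V.mem_edge.1 hz
  have hn := V.dot_nrm_pos e
  by_cases ht : V.hasTgt e = true
  · have hg := (V.mem_edge.1 (V.tgt_mem_edge ht)).1
    have := V.eq_add_smul_dir hz'.1 hg
    refine ⟨_, ?_, this ▸ V.tgt_mem_edge ht⟩
    have h1 := hz'.2.2 ht
    have h2 : cross (V.nrm e) (V.tgt e - z) = - cross (V.nrm e) (z - V.tgt e) := by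
      simp [cross]; ring
    apply div_pos _ hn
    rw [h2]
    rcases h1.eq_or_lt with h3 | h3
    · exfalso
      rw [h2, h3] at this
      simp at this
      exact hne ⟨ht, this.symm⟩
    · linarith
  · refine ⟨1, one_pos, V.mem_edge.2 ⟨?_, fun h => ?_, fun h => absurd h ht⟩⟩
    · rw [gap_add_dir]; exact hz'.1
    · have := hz'.2.1 h
      have h2 : cross (V.nrm e) (z + (1 : ℝ) • V.dir e - V.src e) =
          cross (V.nrm e) (z - V.src e) + 1 * dot (V.nrm e) (V.nrm e) := by
        rw [← cross_nrm_dir]; simp [cross]; ring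
      rw [h2]; linarith

theorem Bwd.exists_smul {e : Fin V.numEdges} {z : Plane} (h : V.Bwd e z) :
    ∃ t : ℝ, 0 < t ∧ z - t • V.dir e ∈ V.edge e := by
  obtain ⟨hz, hne⟩ := h
  have hz' := V.mem_edge.1 hz
  have hn := V.dot_nrm_pos e
  by_cases ht : V.hasSrc e = true
  · have hg := (V.mem_edge.1 (V.src_mem_edge ht)).1
    have := V.eq_add_smul_dir hz'.1 hg
    have h1 := hz'.2.1 ht
    have h2 : cross (V.nrm e) (V.src e - z) = - cross (V.nrm e) (z - V.src e) := by
      simp [cross]; ring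
    refine ⟨cross (V.nrm e) (z - V.src e) / dot (V.nrm e) (V.nrm e), ?_, ?_⟩
    · apply div_pos _ hn
      rcases h1.eq_or_lt with h3 | h3
      · exfalso
        rw [h2, ← h3] at this
        simp at this
        exact hne ⟨ht, this.symm⟩
      · linarith
    · rw [h2, neg_div, neg_smul, ← sub_eq_add_neg] at this
      rw [← this]; exact V.src_mem_edge ht
  · refine ⟨1, one_pos, V.mem_edge.2 ⟨?_, fun h => absurd h ht, fun h => ?_⟩⟩
    · rw [sub_eq_add_neg, ← neg_smul, gap_add_dir]; exact hz'.1
    · have := hz'.2.2 h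
      have h2 : cross (V.nrm e) (z - (1 : ℝ) • V.dir e - V.tgt e) =
          cross (V.nrm e) (z - V.tgt e) - 1 * dot (V.nrm e) (V.nrm e) := by
        rw [← cross_nrm_dir]; simp [cross]; ring
      rw [h2]; linarith

/-- The cell of the owner lies to the left of a half-edge. -/
theorem dot_nrm_le {e : Fin V.numEdges} {x z : Plane} (hx : x ∈ closedVoronoiCell P (V.so e))
    (hz : gap (V.so e) (V.sn e) z = 0) : dot (V.nrm e) (x - z) ≤ 0 := by
  have h1 := mem_closed_iff_gap.1 hx _ (V.sn_mem e)
  rw [gap_eq] at h1 hz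
  simp only [nrm, dot, PiLp.sub_apply] at *
  linarith

theorem cross_dir_nonneg {e : Fin V.numEdges} {x z : Plane} (hx : x ∈ closedVoronoiCell P (V.so e))
    (hz : z ∈ V.edge e) : 0 ≤ cross (V.dir e) (x - z) := by
  have h := dot_nrm_le hx (V.mem_edge.1 hz).1
  simp [dot, dir, cross] at *
  linarith

theorem cross_dir_pos {e : Fin V.numEdges} {x z : Plane} (hx : x ∈ closedVoronoiCell P (V.so e))
    (hx' : x ∉ V.edge e) (hz : z ∈ V.edge e) : 0 < cross (V.dir e) (x - z) := by
  refine lt_of_le_of_ne (cross_dir_nonneg hx hz) fun h => hx' (V.mem_edge_of_tie hx ?_)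
  have h1 := (V.mem_edge.1 hz).1
  rw [gap_eq] at h1 ⊢
  simp [dot, dir, cross, nrm] at *
  linarith

/-- Sites equidistant from a point of a half-edge are on one side, looking back. -/
theorem Fwd.cross_le {e : Fin V.numEdges} {z u : Plane} (h : V.Fwd e z) (hu : u ∈ P)
    (ht : gap (V.so e) u z = 0) : cross (V.nrm e) (u - V.so e) ≤ 0 := by
  obtain ⟨t, ht0, hz⟩ := h.exists_smul
  have h1 := mem_closed_iff_gap.1 (V.edge_subset_owner e hz) u hu
  rw [dir, gap_add_rot, ht] at h1
  nlinarith

theorem Bwd.le_cross {e : Fin V.numEdges} {z u : Plane} (h : V.Bwd e z) (hu : u ∈ P)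
    (ht : gap (V.so e) u z = 0) : 0 ≤ cross (V.nrm e) (u - V.so e) := by
  obtain ⟨t, ht0, hz⟩ := h.exists_smul
  have h1 := mem_closed_iff_gap.1 (V.edge_subset_owner e hz) u hu
  rw [sub_eq_add_neg, ← neg_smul, dir, gap_add_rot, ht] at h1
  nlinarith

theorem dot_nrm_pos_of_mem {e : Fin V.numEdges} {z : Plane} (h : z ∈ V.edge e) :
    0 < dot (V.nrm e) (z - V.so e) := by
  have h1 := (V.mem_edge.1 h).1
  have := V.dot_nrm_pos e
  rw [gap_eq] at h1
  unfold nrm at *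
  linarith

theorem eq_of_nbr {e f : Fin V.numEdges} (ho : V.owner e = V.owner f) (hn : V.nbr e = V.nbr f) :
    e = f := (V.complete _ _ (V.adj e)).unique ⟨rfl, rfl⟩ ⟨ho.symm, hn.symm⟩

theorem so_congr {e f : Fin V.numEdges} (ho : V.owner e = V.owner f) : V.so e = V.so f := by
  unfold so; rw [ho]

/-- Half-edges of the same cell with the same direction are equal. -/
theorem eq_of_parallel {e f : Fin V.numEdges} (ho : V.owner e = V.owner f)
    (hc : cross (V.nrm e) (V.nrm f) = 0) (hd : 0 < dot (V.nrm e) (V.nrm f)) : e = f := by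
  obtain ⟨x, hx⟩ := (V.edge_nontrivial e).nonempty
  obtain ⟨y, hy⟩ := (V.edge_nontrivial f).nonempty
  have hso := so_congr ho
  have hx1 := (V.mem_edge.1 hx).1
  have hy1 := (V.mem_edge.1 hy).1
  have hx2 := mem_closed_iff_gap.1 (V.edge_subset_owner e hx) _ (V.sn_mem f)
  have hy2 := mem_closed_iff_gap.1 (V.edge_subset_owner f hy) _ (V.sn_mem e)
  rw [hso] at hx1 hx2
  rw [gap_eq] at hx1 hx2 hy1 hy2
  have he := V.dot_nrm_pos e
  have hf := V.dot_nrm_pos f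
  have hee : V.sn e - V.so f = V.nrm e := by rw [nrm, hso]
  have hff : V.sn f - V.so f = V.nrm f := rfl
  rw [hee] at hx1 hy2
  rw [hff] at hx2 hy1
  set l := dot (V.nrm e) (V.nrm f) / dot (V.nrm e) (V.nrm e) with hl
  have hlpos : 0 < l := div_pos hd he
  have hle : l * dot (V.nrm e) (V.nrm e) = dot (V.nrm e) (V.nrm f) := by
    rw [hl]; field_simp
  have h0 : V.nrm f 0 = l * V.nrm e 0 := by
    have : V.nrm f 0 * dot (V.nrm e) (V.nrm e) = l * V.nrm e 0 * dot (V.nrm e) (V.nrm e) := by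
      rw [mul_right_comm, hle]
      simp only [dot, cross] at *
      linear_combination (-V.nrm e 1) * hc
    exact mul_right_cancel₀ he.ne' this
  have h1 : V.nrm f 1 = l * V.nrm e 1 := by
    have : V.nrm f 1 * dot (V.nrm e) (V.nrm e) = l * V.nrm e 1 * dot (V.nrm e) (V.nrm e) := by
      rw [mul_right_comm, hle]
      simp only [dot, cross] at *
      linear_combination (V.nrm e 0) * hc
    exact mul_right_cancel₀ he.ne' this
  have hfd : ∀ w, dot (V.nrm f) w = l * dot (V.nrm e) w := by
    intro w; simp only [dot, h0, h1]; ring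
  have hff2 : dot (V.nrm f) (V.nrm f) = l * l * dot (V.nrm e) (V.nrm e) := by
    simp only [dot, h0, h1]; ring
  rw [hff2, hfd] at hx2 hy1
  have l1 : 1 ≤ l := by
    have : 0 ≤ l * ((l - 1) * dot (V.nrm e) (V.nrm e)) := by nlinarith
    have := nonneg_of_mul_nonneg_right this hlpos
    nlinarith
  have l2 : l ≤ 1 := by
    have : l * (l * dot (V.nrm e) (V.nrm e) - 2 * dot (V.nrm e) (y - V.so f)) = 0 := by linarith
    have := (mul_eq_zero.1 this).resolve_left hlpos.ne'
    nlinarith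
  have l3 : l = 1 := le_antisymm l2 l1
  apply eq_of_nbr ho
  apply V.site_injective
  have : V.nrm e = V.nrm f := plane_ext (by rw [h0, l3, one_mul]) (by rw [h1, l3, one_mul])
  unfold nrm at this
  rw [hso] at this
  exact sub_left_injective this

theorem eq_of_cross_zero_of_mem {e f : Fin V.numEdges} {z : Plane} (ho : V.owner e = V.owner f)
    (hc : cross (V.nrm e) (V.nrm f) = 0) (he : z ∈ V.edge e) (hf : z ∈ V.edge f) : e = f := by
  apply eq_of_parallel ho hc
  have h1 := dot_nrm_pos_of_mem he
  have h2 := dot_nrm_pos_of_mem hf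
  rw [so_congr ho] at h1
  set w := z - V.so f with hw
  have hw0 : w ≠ 0 := by
    rintro h; rw [h] at h1; simp [dot] at h1
  have hww := dot_self_pos hw0
  have key : dot (V.nrm e) (V.nrm f) * dot w w = dot (V.nrm e) w * dot (V.nrm f) w +
      cross (V.nrm e) w * cross (V.nrm f) w := by simp [dot, cross]; ring
  have key2 : dot (V.nrm e) w * cross (V.nrm f) w = dot (V.nrm f) w * cross (V.nrm e) w := by
    simp only [dot, cross] at *
    linear_combination (-(w 0 ^ 2 + w 1 ^ 2)) * hc
  have h3 : 0 ≤ cross (V.nrm e) w * cross (V.nrm f) w := by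
    have : 0 ≤ dot (V.nrm e) w * (cross (V.nrm e) w * cross (V.nrm f) w) := by
      calc 0 ≤ dot (V.nrm f) w * cross (V.nrm e) w ^ 2 := by positivity
        _ = cross (V.nrm e) w * (dot (V.nrm f) w * cross (V.nrm e) w) := by ring
        _ = _ := by rw [← key2]; ring
    exact nonneg_of_mul_nonneg_right this h1
  have := mul_pos h1 h2
  by_contra hneg
  have : dot (V.nrm e) (V.nrm f) * dot w w ≤ 0 :=
    mul_nonpos_of_nonpos_of_nonneg (not_lt.1 hneg) hww.le
  linarith

theorem gap_zero_of_mem {e f : Fin V.numEdges} {z : Plane} (ho : V.owner e = V.owner f)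
    (hf : z ∈ V.edge f) : gap (V.so e) (V.sn f) z = 0 := by
  rw [so_congr ho]; exact (V.mem_edge.1 hf).1

theorem Fwd.unique {e f : Fin V.numEdges} {z : Plane} (ho : V.owner e = V.owner f)
    (he : V.Fwd e z) (hf : V.Fwd f z) : e = f := by
  apply eq_of_cross_zero_of_mem ho _ he.1 hf.1
  have h1 := he.cross_le (V.sn_mem f) (gap_zero_of_mem ho hf.1)
  have h2 := hf.cross_le (V.sn_mem e) (gap_zero_of_mem ho.symm he.1)
  have hso := so_congr ho
  rw [hso] at h1
  rw [← hso] at h2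
  have h3 : cross (V.nrm f) (V.sn e - V.so e) = - cross (V.nrm e) (V.nrm f) := by
    simp [cross, nrm]; ring
  unfold nrm at *
  linarith

theorem Bwd.unique {e f : Fin V.numEdges} {z : Plane} (ho : V.owner e = V.owner f)
    (he : V.Bwd e z) (hf : V.Bwd f z) : e = f := by
  apply eq_of_cross_zero_of_mem ho _ he.1 hf.1
  have h1 := he.le_cross (V.sn_mem f) (gap_zero_of_mem ho hf.1)
  have h2 := hf.le_cross (V.sn_mem e) (gap_zero_of_mem ho.symm he.1)
  have hso := so_congr ho
  rw [hso] at h1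
  rw [← hso] at h2
  have h3 : cross (V.nrm f) (V.sn e - V.so e) = - cross (V.nrm e) (V.nrm f) := by
    simp [cross, nrm]; ring
  unfold nrm at *
  linarith

end VoronoiRep

theorem cross_swap (v w : Plane) : cross w v = - cross v w := by simp [cross]; ring

theorem cross_eq_zero_self (v : Plane) : cross v v = 0 := by simp [cross]; ring

/-- In a half-plane, being counterclockwise is transitive. -/
theorem cross_trans {u a b c : Plane} (ha : 0 < cross u a) (hb : 0 < cross u b)
    (hc : 0 < cross u c) (hab : 0 ≤ cross a b) (hbc : 0 ≤ cross b c) : 0 ≤ cross a c := by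
  have key : cross u b * cross a c = cross u a * cross b c + cross u c * cross a b := by
    simp [cross]; ring
  have : 0 ≤ cross u b * cross a c := by rw [key]; positivity
  exact nonneg_of_mul_nonneg_right this hb

theorem cross_trans_lt {u a b c : Plane} (ha : 0 < cross u a) (hb : 0 < cross u b)
    (hc : 0 < cross u c) (hab : 0 < cross a b) (hbc : 0 ≤ cross b c) : 0 < cross a c := by
  have key : cross u b * cross a c = cross u a * cross b c + cross u c * cross a b := by
    simp [cross]; ring
  have : 0 < cross u b * cross a c := by rw [key]; positivity
  exact pos_of_mul_pos_right this hb.le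

/-- A sequence of vectors in a half-plane that turns left at every step is sorted. -/
theorem cross_sorted {u : Plane} {w : ℕ → Plane} {M N : ℕ}
    (h1 : ∀ j, M ≤ j → j ≤ N → 0 < cross u (w j))
    (h2 : ∀ j, M ≤ j → j < N → 0 ≤ cross (w j) (w (j + 1))) {i j : ℕ} (hi : M ≤ i) (hij : i ≤ j)
    (hj : j ≤ N) : 0 ≤ cross (w i) (w j) := by
  induction j, hij using Nat.le_induction with
  | base => rw [cross_eq_zero_self]
  | succ j hij ih =>
    exact cross_trans (h1 i hi (by omega)) (h1 j (by omega) (by omega)) (h1 _ (by omega) hj)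
      (ih (by omega)) (h2 j (by omega) (by omega))

/-- A direction that no equidistant site forbids stays in the closed cell for a while. -/
theorem exists_step_mem_closed {P : Finset Plane} {c z d : Plane} (hz : z ∈ closedVoronoiCell P c)
    (hd : ∀ u ∈ P, gap c u z = 0 → dot (u - c) d ≤ 0) :
    ∃ τ : ℝ, 0 < τ ∧ ∀ t, 0 < t → t ≤ τ → z + t • d ∈ closedVoronoiCell P c := by
  have h : ∀ᶠ t in 𝓝[>] (0 : ℝ), ∀ u ∈ P, 0 ≤ gap c u (z + t • d) := by
    rw [Filter.eventually_all_finset]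
    intro u hu
    rcases (mem_closed_iff_gap.1 hz u hu).eq_or_lt with h0 | h0
    · filter_upwards [self_mem_nhdsWithin] with t ht
      rw [gap_add_smul, ← h0]
      have h1 := hd u hu h0.symm
      have h2 : (0 : ℝ) < t := ht
      nlinarith
    · have : Continuous fun t : ℝ => gap c u (z + t • d) := (continuous_gap c u).comp (by fun_prop)
      have h1 := this.tendsto 0
      simp only [zero_smul, add_zero] at h1
      have h2 := h1.eventually (lt_mem_nhds h0)
      exact (h2.filter_mono nhdsWithin_le_nhds).mono fun t ht => le_of_lt ht
  obtain ⟨τ, hτ, h'⟩ := mem_nhdsGT_iff_exists_Ioc_subset.1 h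
  exact ⟨τ, hτ, fun t h1 h2 => mem_closed_iff_gap.2 (h' ⟨h1, h2⟩)⟩

namespace VoronoiRep

variable {P : Finset Plane} {V : VoronoiRep P}

theorem tie_of_step {c u z : Plane} {t : ℝ} (ht : gap c u z = 0) :
    gap c u (z + t • rot90 (u - c)) = 0 := by
  rw [gap_add_rot, ht, cross_eq_zero_self]; simp

theorem exists_edge_of_step {c : Fin P.card} {z u d : Plane} (hu : u ∈ P) (hne : u ≠ V.site c)
    (hz : z ∈ closedVoronoiCell P (V.site c)) (ht : gap (V.site c) u z = 0)
    (hd : d ≠ 0) (hz' : z + d ∈ closedVoronoiCell P (V.site c))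
    (ht' : gap (V.site c) u (z + d) = 0) :
    ∃ e, V.owner e = c ∧ V.sn e = u ∧ z ∈ V.edge e ∧ z + d ∈ V.edge e := by
  obtain ⟨i, rfl⟩ := V.exists_site hu
  have hmem : ∀ x ∈ closedVoronoiCell P (V.site c), gap (V.site c) (V.site i) x = 0 →
      x ∈ sharedBoundary P (V.site c) (V.site i) := by
    intro x hx hx'
    refine ⟨hx, mem_closedVoronoiCell.2 fun p' hp' => ?_⟩
    have := mem_closedVoronoiCell.1 hx p' hp'
    unfold gap at hx'
    linarith
  have hadj : DelaunayAdj P (V.site c) (V.site i) :=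
    ⟨V.site_mem c, hu, hne.symm, z, hmem z hz ht, z + d, hmem _ hz' ht', by simpa using hd⟩
  obtain ⟨e, ⟨h1, h2⟩, _⟩ := V.complete c i hadj
  refine ⟨e, h1, by rw [sn, h2], ?_, ?_⟩
  · rw [edge, so, sn, h1, h2]; exact hmem z hz ht
  · rw [edge, so, sn, h1, h2]; exact hmem _ hz' ht'

theorem tie_dot_pos {c u z : Plane} (hne : u ≠ c) (ht : gap c u z = 0) :
    0 < dot (z - c) (u - c) := by
  have := dot_self_pos (sub_ne_zero.2 hne)
  rw [gap_eq] at ht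
  have h : dot (z - c) (u - c) = dot (u - c) (z - c) := by simp [dot]; ring
  linarith

theorem rot90_ne_zero {v : Plane} (h : v ≠ 0) : rot90 v ≠ 0 := by
  intro h'
  apply h
  have h0 := congrArg (· 0) h'
  have h1 := congrArg (· 1) h'
  simp at h0 h1
  exact plane_ext (by simpa using h1) (by simpa using h0)

theorem cross_nonneg_of_tan_le {w a b : Plane} (ha : 0 < dot w a) (hb : 0 < dot w b)
    (h : cross w a / dot w a ≤ cross w b / dot w b) : 0 ≤ cross a b := by
  rw [div_le_div_iff₀ ha hb] at h
  have hw : w ≠ 0 := by rintro rfl; simp [dot] at ha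
  have key : cross a b * dot w w = cross w b * dot w a - cross w a * dot w b := by
    simp [dot, cross]; ring
  have := dot_self_pos hw
  by_contra hneg
  have := mul_neg_of_neg_of_pos (not_le.1 hneg) this
  linarith

/-- The boundary of a cell is covered by its half-edges. -/
theorem exists_fwd {c : Fin P.card} {z u : Plane} (hz : z ∈ closedVoronoiCell P (V.site c))
    (hu : u ∈ P) (hne : u ≠ V.site c) (ht : gap (V.site c) u z = 0) :
    ∃ e, V.owner e = c ∧ V.Fwd e z := by
  classical
  set p := V.site c with hp
  obtain ⟨s, hs, hmax⟩ := (P.filter fun s => s ≠ p ∧ gap p s z = 0).exists_max_image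
    (fun s => cross (z - p) (s - p) / dot (z - p) (s - p)) ⟨u, by simp [hu, hne, ht]⟩
  simp only [Finset.mem_filter] at hs hmax
  obtain ⟨hsP, hsp, hst⟩ := hs
  have hstep : ∀ v ∈ P, gap p v z = 0 → dot (v - p) (rot90 (s - p)) ≤ 0 := by
    intro v hv hvt
    rcases eq_or_ne v p with rfl | hvp
    · simp [dot]
    · have h1 := cross_nonneg_of_tan_le (tie_dot_pos hvp hvt) (tie_dot_pos hsp hst)
        (hmax v ⟨hv, hvp, hvt⟩)
      have : dot (v - p) (rot90 (s - p)) = - cross (v - p) (s - p) := by simp [dot, cross]; ring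
      linarith
  obtain ⟨τ, hτ, hmem⟩ := exists_step_mem_closed hz hstep
  obtain ⟨e, h1, h2, h3, h4⟩ := exists_edge_of_step (V := V) (d := τ • rot90 (s - p)) hsP hsp hz hst
    (smul_ne_zero hτ.ne' (rot90_ne_zero (sub_ne_zero.2 hsp))) (hmem τ hτ le_rfl) (tie_of_step hst)
  refine ⟨e, h1, fwd_of_smul hτ h3 ?_⟩
  have : V.dir e = rot90 (s - p) := by rw [dir, nrm, h2, so, h1]
  rwa [this]

/-! ## The cyclic order of the half-edges of a cell -/

theorem first_le (e : Fin V.numEdges) : V.first (V.owner e) ≤ e.val :=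
  ((V.mem_block e _).1 rfl).1

theorem lt_block (e : Fin V.numEdges) : e.val < V.first (V.owner e) + V.deg (V.owner e) :=
  ((V.mem_block e _).1 rfl).2

variable (V) in
/-- The next half-edge of the same cell, cyclically. -/
def nxt (e : Fin V.numEdges) : Fin V.numEdges :=
  if h : e.val + 1 < V.first (V.owner e) + V.deg (V.owner e) then
    ⟨e.val + 1, h.trans_le (V.block_le _)⟩
  else ⟨V.first (V.owner e), (V.first_le e).trans_lt e.isLt⟩

variable (V) in
/-- The previous half-edge of the same cell, cyclically. -/
def prv (e : Fin V.numEdges) : Fin V.numEdges :=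
  if e.val = V.first (V.owner e) then
    ⟨V.first (V.owner e) + V.deg (V.owner e) - 1, by
      have := V.block_le (V.owner e); have := V.lt_block e; have := e.isLt; omega⟩
  else ⟨e.val - 1, by have := e.isLt; omega⟩

theorem owner_nxt (e : Fin V.numEdges) : V.owner (V.nxt e) = V.owner e := by
  rw [V.mem_block]
  have h1 := V.first_le e
  have h2 := V.lt_block e
  unfold nxt
  split_ifs with h <;> simp <;> omega

theorem owner_prv (e : Fin V.numEdges) : V.owner (V.prv e) = V.owner e := by
  rw [V.mem_block]
  have h1 := V.first_le e
  have h2 := V.lt_block e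
  unfold prv
  split_ifs with h <;> simp <;> omega

theorem nxt_prv (e : Fin V.numEdges) : V.nxt (V.prv e) = e := by
  have h1 := V.first_le e
  have h2 := V.lt_block e
  have h3 := owner_prv e
  apply Fin.ext
  by_cases h : e.val = V.first (V.owner e)
  · have h4 : (V.prv e).val = V.first (V.owner e) + V.deg (V.owner e) - 1 := by
      unfold prv; rw [if_pos h]
    unfold nxt
    split_ifs with h' <;> rw [h3] at h' <;> simp only [h3] <;> omega
  · have h4 : (V.prv e).val = e.val - 1 := by unfold prv; rw [if_neg h]
    unfold nxt
    split_ifs with h' <;> rw [h3] at h' <;> simp only [h3] <;> omega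

theorem prv_nxt (e : Fin V.numEdges) : V.prv (V.nxt e) = e := by
  have h1 := V.first_le e
  have h2 := V.lt_block e
  have h3 := owner_nxt e
  apply Fin.ext
  by_cases h : e.val + 1 < V.first (V.owner e) + V.deg (V.owner e)
  · have h4 : (V.nxt e).val = e.val + 1 := by unfold nxt; rw [dif_pos h]
    unfold prv
    split_ifs with h' <;> rw [h3] at h' <;> simp only [h3] <;> omega
  · have h4 : (V.nxt e).val = V.first (V.owner e) := by unfold nxt; rw [dif_neg h]
    unfold prv
    split_ifs with h' <;> rw [h3] at h' <;> simp only [h3] <;> omega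

/-- The second half-edge starts where the first one ends. -/
structure Next (e f : Fin V.numEdges) : Prop where
  owner_eq : V.owner e = V.owner f
  hasTgt : V.hasTgt e = true
  hasSrc : V.hasSrc f = true
  tgt_eq : V.tgt e = V.src f

theorem next_nxt {e : Fin V.numEdges} (h : V.hasTgt e = true) : V.Next e (V.nxt e) := by
  have h1 := V.first_le e
  have h2 := V.lt_block e
  by_cases h' : e.val + 1 < V.first (V.owner e) + V.deg (V.owner e)
  · have h4 : (V.nxt e).val = e.val + 1 := by unfold nxt; rw [dif_pos h']
    rcases V.chain e (V.nxt e) (owner_nxt e).symm h4 with h5 | h5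
    · exact ⟨(owner_nxt e).symm, h5.1, h5.2.1, h5.2.2⟩
    · rw [h] at h5; simp at h5
  · have h4 : (V.nxt e).val = V.first (V.owner e) := by unfold nxt; rw [dif_neg h']
    have h5 := V.wrap (V.nxt e) e (owner_nxt e) (by rw [owner_nxt, h4])
      (by rw [owner_nxt]; omega)
    have h6 : V.hasSrc (V.nxt e) = true := by rw [← h5.1, h]
    exact ⟨(owner_nxt e).symm, h, h6, h5.2 h6⟩

theorem next_prv {e : Fin V.numEdges} (h : V.hasSrc e = true) : V.Next (V.prv e) e := by
  have h1 := V.first_le e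
  have h2 := V.lt_block e
  by_cases h' : e.val = V.first (V.owner e)
  · have h4 : (V.prv e).val = V.first (V.owner e) + V.deg (V.owner e) - 1 := by
      unfold prv; rw [if_pos h']
    have h5 := V.wrap e (V.prv e) (owner_prv e).symm h' (by omega)
    exact ⟨owner_prv e, by rw [h5.1, h], h, h5.2 h⟩
  · have h4 : (V.prv e).val = e.val - 1 := by unfold prv; rw [if_neg h']
    rcases V.chain (V.prv e) e (owner_prv e) (by omega) with h5 | h5
    · exact ⟨owner_prv e, h5.1, h5.2.1, h5.2.2⟩
    · rw [h] at h5; simp at h5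

theorem prv_induction {c : Fin P.card} {S : Fin V.numEdges → Prop}
    (hS : ∀ e, V.owner e = c → S e → S (V.prv e)) {e : Fin V.numEdges} (he : V.owner e = c)
    (h : S e) : ∀ f, V.owner f = c → S f := by
  have down : ∀ k : ℕ, ∀ e f : Fin V.numEdges, V.owner e = c → V.owner f = c → S e →
      f.val + k = e.val → S f := by
    intro k
    induction k with
    | zero => intro e f _ _ h hk; rwa [show f = e from Fin.ext (by omega)]
    | succ k ih =>
      intro e f he hf h hk
      have h1 := V.first_le f
      rw [hf] at h1
      have h4 : (V.prv e).val = e.val - 1 := by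
        unfold prv; rw [if_neg (by rw [he]; omega)]
      exact ih (V.prv e) f ((owner_prv e).trans he) hf (hS e he h) (by omega)
  intro f hf
  have h1 := V.first_le e
  have h2 := V.lt_block e
  have h3 := V.lt_block f
  have h4 := V.first_le f
  rw [he] at h1 h2
  rw [hf] at h3 h4
  let e0 : Fin V.numEdges := ⟨V.first c, by have := e.isLt; omega⟩
  have ho : V.owner e0 = c := (V.mem_block _ _).2 ⟨le_rfl, by simp [e0]; omega⟩
  have h0 : S e0 := down (e.val - V.first c) e e0 he ho h (by simp [e0]; omega)
  have h5 : (V.prv e0).val = V.first c + V.deg c - 1 := by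
    unfold prv; rw [if_pos (by rw [ho])]; simp only [ho]
  exact down (V.first c + V.deg c - 1 - f.val) (V.prv e0) f ((owner_prv e0).trans ho) hf
    (hS e0 ho h0) (by omega)

theorem tgt_ne_src {e : Fin V.numEdges} (h : V.hasTgt e = true) (h' : V.hasSrc e = true) :
    V.tgt e ≠ V.src e := by
  intro heq
  obtain ⟨x, hx, y, hy, hxy⟩ := V.edge_nontrivial e
  have key : ∀ x ∈ V.edge e, x = V.src e := by
    intro x hx
    have h1 := V.mem_edge.1 hx
    have h2 := h1.2.1 h'
    have h3 := h1.2.2 h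
    rw [heq] at h3
    have h4 := V.eq_add_smul_dir (V.mem_edge.1 (V.src_mem_edge h')).1 h1.1
    rw [le_antisymm h3 h2] at h4
    simpa using h4
  exact hxy ((key x hx).trans (key y hy).symm)

theorem Next.bwd {e f : Fin V.numEdges} (h : V.Next e f) : V.Bwd e (V.tgt e) :=
  ⟨V.tgt_mem_edge h.hasTgt, fun h' => tgt_ne_src h.hasTgt h'.1 h'.2⟩

theorem Next.fwd {e f : Fin V.numEdges} (h : V.Next e f) : V.Fwd f (V.tgt e) := by
  rw [h.tgt_eq]
  exact ⟨V.src_mem_edge h.hasSrc, fun h' => tgt_ne_src h'.1 h.hasSrc h'.2.symm⟩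

theorem Next.cross_pos {e f : Fin V.numEdges} (h : V.Next e f) :
    0 < cross (V.nrm e) (V.nrm f) := by
  have h1 := h.bwd.le_cross (V.sn_mem f) (gap_zero_of_mem h.owner_eq h.fwd.1)
  have h2 : V.sn f - V.so e = V.nrm f := by rw [nrm, so_congr h.owner_eq]
  rw [h2] at h1
  refine lt_of_le_of_ne h1 fun h0 => ?_
  have := eq_of_cross_zero_of_mem h.owner_eq h0.symm h.bwd.1 h.fwd.1
  subst this
  exact tgt_ne_src h.hasTgt h.hasSrc h.tgt_eq

theorem deg_le (c : Fin P.card) : V.deg c ≤ P.card := by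
  have hf : ∀ j : Fin (V.deg c), V.first c + j.val < V.numEdges := fun j => by
    have := V.block_le c; have := j.isLt; omega
  let f : Fin (V.deg c) → Fin P.card := fun j => V.nbr ⟨V.first c + j.val, hf j⟩
  have : Function.Injective f := by
    intro i j hij
    have ho : ∀ j : Fin (V.deg c), V.owner ⟨V.first c + j.val, hf j⟩ = c := fun j =>
      (V.mem_block _ _).2 ⟨by simp, by simp⟩
    have := eq_of_nbr ((ho i).trans (ho j).symm) hij
    have h2 := congrArg Fin.val this
    simp only at h2
    exact Fin.ext (by omega)
  simpa using Fintype.card_le_of_injective f this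

theorem antiparallel_of_line {e f : Fin V.numEdges} (ho : V.owner e = V.owner f) (hne : e ≠ f)
    (hs : V.hasSrc e = false) (ht : V.hasTgt e = false) :
    cross (V.nrm e) (V.nrm f) = 0 ∧ dot (V.nrm e) (V.nrm f) < 0 := by
  obtain ⟨x, hx⟩ := (V.edge_nontrivial e).nonempty
  have hso := so_congr ho
  have hline : ∀ t : ℝ, x + t • V.dir e ∈ V.edge e := by
    intro t
    refine V.mem_edge.2 ⟨?_, by simp [hs], by simp [ht]⟩
    rw [gap_add_dir]; exact (V.mem_edge.1 hx).1
  have hg : ∀ t : ℝ, 0 ≤ gap (V.so e) (V.sn f) x - 2 * t * cross (V.nrm e) (V.nrm f) := by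
    intro t
    have := mem_closed_iff_gap.1 (V.edge_subset_owner e (hline t)) _ (V.sn_mem f)
    rw [dir, gap_add_rot] at this
    rwa [show V.sn f - V.so e = V.nrm f by rw [nrm, hso]] at this
  have hc : cross (V.nrm e) (V.nrm f) = 0 := by
    by_contra hc
    have := hg ((gap (V.so e) (V.sn f) x + 1) / (2 * cross (V.nrm e) (V.nrm f)))
    field_simp at this
    linarith
  refine ⟨hc, lt_of_not_ge fun hd => ?_⟩
  rcases hd.eq_or_lt with h0 | h0
  · have key : dot (V.nrm e) (V.nrm e) * dot (V.nrm f) (V.nrm f) =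
        dot (V.nrm e) (V.nrm f) ^ 2 + cross (V.nrm e) (V.nrm f) ^ 2 := by simp [dot, cross]; ring
    rw [← h0, hc] at key
    have := mul_pos (V.dot_nrm_pos e) (V.dot_nrm_pos f)
    simp at key
    rcases key with h | h
    · exact (V.dot_nrm_pos e).ne' h
    · exact (V.dot_nrm_pos f).ne' h
  · exact hne (eq_of_parallel ho hc h0)

/-- The `j`-th half-edge of a cell. -/
def IsBlock (V : VoronoiRep P) (c : Fin P.card) (E : ℕ → Fin V.numEdges) : Prop :=
  ∀ j < V.deg c, (E j).val = V.first c + j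

theorem IsBlock.owner {c : Fin P.card} {E : ℕ → Fin V.numEdges} (hE : V.IsBlock c E) {j : ℕ}
    (hj : j < V.deg c) : V.owner (E j) = c :=
  (V.mem_block _ _).2 (by rw [hE j hj]; omega)

theorem IsBlock.inj {c : Fin P.card} {E : ℕ → Fin V.numEdges} (hE : V.IsBlock c E) {i j : ℕ}
    (hi : i < V.deg c) (hj : j < V.deg c) (h : E i = E j) : i = j := by
  have h1 := hE i hi
  have h2 := hE j hj
  rw [h] at h1
  omega

theorem IsBlock.next {c : Fin P.card} {E : ℕ → Fin V.numEdges} (hE : V.IsBlock c E)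
    (h3 : 2 < V.deg c) {j : ℕ} (hj : j + 1 < V.deg c) : V.Next (E j) (E (j + 1)) := by
  have ho : ∀ i < V.deg c, V.owner (E i) = c := fun i hi => hE.owner hi
  have ho' := (ho j (by omega)).trans (ho (j + 1) hj).symm
  rcases V.chain (E j) (E (j + 1)) ho' (by rw [hE _ hj, hE j (by omega)]; omega) with h | h
  · exact ⟨ho', h.1, h.2.1, h.2.2⟩
  · exfalso
    obtain ⟨l, hl, hl1, hl2⟩ : ∃ l, l < V.deg c ∧ l ≠ j ∧ l ≠ j + 1 := by
      rcases j with _ | j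
      · exact ⟨2, h3, by omega, by omega⟩
      · exact ⟨0, by omega, by omega, by omega⟩
    have h1 := antiparallel_of_line ho' (fun h => by have := hE.inj (by omega) hj h; omega) h.1 h.2.1
    have h2 := antiparallel_of_line ((ho j (by omega)).trans (ho l hl).symm)
      (fun h => by have := hE.inj (by omega) hl h; omega) h.1 h.2.1
    have h4 := antiparallel_of_line ((ho (j + 1) hj).trans (ho l hl).symm)
      (fun h => by have := hE.inj hj hl h; omega) h.2.2.1 h.2.2.2
    have key : dot (V.nrm (E j)) (V.nrm (E (j + 1))) * dot (V.nrm (E j)) (V.nrm (E l)) +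
        cross (V.nrm (E j)) (V.nrm (E (j + 1))) * cross (V.nrm (E j)) (V.nrm (E l)) =
        dot (V.nrm (E j)) (V.nrm (E j)) * dot (V.nrm (E (j + 1))) (V.nrm (E l)) := by
      simp [dot, cross]; ring
    rw [h1.1, zero_mul, add_zero] at key
    have k1 := mul_pos_of_neg_of_neg h1.2 h2.2
    have k2 := mul_neg_of_pos_of_neg (V.dot_nrm_pos (E j)) h4.2
    linarith

theorem fwd_not_mem {e f : Fin V.numEdges} {z : Plane} (ho : V.owner e = V.owner f) (hne : e ≠ f)
    (he : V.Fwd e z) (hf : z ∈ V.edge f) : V.hasTgt f = true ∧ z = V.tgt f := by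
  by_contra h
  exact hne (he.unique ho ⟨hf, h⟩)

theorem eq_src_add {e : Fin V.numEdges} {z : Plane} (hs : V.hasSrc e = true) (hz : z ∈ V.edge e) :
    ∃ l : ℝ, 0 ≤ l ∧ z = V.src e + l • V.dir e :=
  ⟨_, div_nonneg ((V.mem_edge.1 hz).2.1 hs) (V.dot_nrm_pos e).le,
    V.eq_add_smul_dir (V.mem_edge.1 (V.src_mem_edge hs)).1 (V.mem_edge.1 hz).1⟩

theorem Fwd.eq_tgt_sub {e : Fin V.numEdges} {z : Plane} (ht : V.hasTgt e = true)
    (hz : V.Fwd e z) : ∃ l : ℝ, 0 < l ∧ V.tgt e = z + l • V.dir e := by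
  have h := V.eq_add_smul_dir (V.mem_edge.1 hz.1).1 (V.mem_edge.1 (V.tgt_mem_edge ht)).1
  refine ⟨_, div_pos (lt_of_le_of_ne ?_ fun h0 => hz.2 ⟨ht, ?_⟩) (V.dot_nrm_pos e), h⟩
  · have := (V.mem_edge.1 hz.1).2.2 ht
    have h2 : cross (V.nrm e) (V.tgt e - z) = - cross (V.nrm e) (z - V.tgt e) := by
      simp [cross]; ring
    linarith
  · rw [← h0] at h; simpa using h.symm

theorem cross_add_smul_dir (a z d : Plane) (l : ℝ) :
    cross (z - a) (z + l • d - a) = l * cross d (a - z) := by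
  simp [cross]; ring

theorem IsBlock.search {c : Fin P.card} {E : ℕ → Fin V.numEdges} (hE : V.IsBlock c E)
    {J : ℕ} (hJ : J < V.deg c) (hJ2 : 2 ≤ J) {z : Plane} (hz : V.Fwd (E J) z) {i : ℕ} (hi : 1 ≤ i)
    (hi' : i + 1 < V.deg c) :
    (i < J → 0 ≤ cross (V.tgt (E i) - V.tgt (E 0)) (z - V.tgt (E 0))) ∧
    (J ≤ i → cross (V.tgt (E i) - V.tgt (E 0)) (z - V.tgt (E 0)) < 0) := by
  set a := V.tgt (E 0) with ha
  set k := V.deg c with hk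
  have hnext : ∀ j, j + 1 < k → V.Next (E j) (E (j + 1)) := fun j hj => hE.next (by omega) hj
  have ho : ∀ i j, i < k → j < k → V.owner (E i) = V.owner (E j) := fun i j hi hj =>
    (hE.owner hi).trans (hE.owner hj).symm
  have hC : ∀ j, j < k → ∀ i, i < k → ∀ x ∈ V.edge (E j), x ∈ closedVoronoiCell P (V.so (E i)) := by
    intro j hj i hi x hx
    rw [so_congr (ho i j hi hj)]
    exact V.edge_subset_owner _ hx
  have htm : ∀ j, j + 1 < k → V.tgt (E j) ∈ V.edge (E j) := fun j hj => (hnext j hj).bwd.1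
  have haE : ∀ i < k, a ∈ closedVoronoiCell P (V.so (E i)) := fun i hi =>
    hC 0 (by omega) i hi a (htm 0 (by omega))
  -- Consecutive points turn left.
  have turn : ∀ j, j + 1 < k → 0 < j → ∀ x ∈ V.edge (E (j + 1)),
      0 ≤ cross (V.tgt (E j) - a) (x - a) := by
    intro j hj _ x hx
    have hn := hnext j hj
    obtain ⟨l, hl, rfl⟩ := eq_src_add hn.hasSrc hx
    rw [← hn.tgt_eq, cross_add_smul_dir]
    exact mul_nonneg hl (cross_dir_nonneg (haE (j + 1) hj) hn.fwd.1)
  have hfw0 := (hnext 0 (by omega)).fwd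
  have hu : ∃ l : ℝ, 0 < l ∧ V.tgt (E 1) - a = l • V.dir (E 1) := by
    obtain ⟨l, hl, h⟩ := hfw0.eq_tgt_sub (hnext 1 (by omega)).hasTgt
    exact ⟨l, hl, by rw [h]; simp [ha]⟩
  obtain ⟨l, hl, hl1⟩ := hu
  have hhalf : ∀ x ∈ closedVoronoiCell P (V.so (E 1)), x ∉ V.edge (E 1) →
      0 < cross (V.tgt (E 1) - a) (x - a) := by
    intro x hx hx'
    rw [hl1]
    have := cross_dir_pos hx hx' hfw0.1
    have h2 : cross (l • V.dir (E 1)) (x - a) = l * cross (V.dir (E 1)) (x - a) := by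
      simp [cross]; ring
    rw [h2]
    exact mul_pos hl this
  have hpos : ∀ j, 2 ≤ j → j + 1 < k → 0 < cross (V.tgt (E 1) - a) (V.tgt (E j) - a) := by
    intro j h2 hj
    refine hhalf _ (hC j (by omega) 1 (by omega) _ (htm j hj)) fun hmem => ?_
    have h3 := fwd_not_mem (ho (j + 1) 1 hj (by omega))
      (fun h => by have := hE.inj hj (by omega) h; omega) (hnext j hj).fwd hmem
    have h4 := (hnext 1 (by omega)).fwd
    rw [← h3.2] at h4
    have := hE.inj (by omega) (by omega) (h4.unique (ho 2 (j + 1) (by omega) hj) (hnext j hj).fwd)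
    omega
  have hsort : ∀ p q, 2 ≤ p → p ≤ q → q + 1 < k →
      0 ≤ cross (V.tgt (E p) - a) (V.tgt (E q) - a) := by
    intro p q hp hpq hq
    exact cross_sorted (u := V.tgt (E 1) - a) (w := fun j => V.tgt (E j) - a) (M := 2) (N := q)
      (fun j h1 h2 => hpos j h1 (by omega))
      (fun j h1 h2 => turn j (by omega) (by omega) _ (htm (j + 1) (by omega))) hp hpq le_rfl
  have hzcase : z = V.tgt (E 1) ∧ J = 2 ∨ 0 < cross (V.tgt (E 1) - a) (z - a) := by
    by_cases hmem : z ∈ V.edge (E 1)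
    · left
      have h3 := fwd_not_mem (ho J 1 hJ (by omega))
        (fun h => by have := hE.inj hJ (by omega) h; omega) hz hmem
      refine ⟨h3.2, ?_⟩
      have h4 := (hnext 1 (by omega)).fwd
      rw [← h3.2] at h4
      exact hE.inj hJ (by omega) (hz.unique (ho J 2 hJ (by omega)) h4)
    · exact Or.inr (hhalf z (hC J hJ 1 (by omega) z hz.1) hmem)
  constructor
  · intro hiJ
    rcases hzcase with ⟨h1, h2⟩ | hzc
    · obtain rfl : i = 1 := by omega
      rw [h1, cross_eq_zero_self]
    · rcases hi.eq_or_lt with rfl | hi2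
      · exact hzc.le
      · obtain ⟨J', rfl⟩ : ∃ J', J = J' + 1 := ⟨J - 1, by omega⟩
        exact cross_trans (hpos i hi2 hi') (hpos J' (by omega) hJ) hzc
          (hsort i J' hi2 (by omega) hJ) (turn J' hJ (by omega) z hz.1)
  · intro hJi
    rw [cross_swap]
    suffices h : 0 < cross (z - a) (V.tgt (E i) - a) by linarith
    rcases hzcase with ⟨h1, h2⟩ | hzc
    · rw [h1]; exact hpos i (by omega) hi'
    · have hstrict : 0 < cross (z - a) (V.tgt (E J) - a) := by
        obtain ⟨m, hm, h⟩ := hz.eq_tgt_sub (hnext J (by omega)).hasTgt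
        rw [h, cross_add_smul_dir]
        refine mul_pos hm (cross_dir_pos (haE J hJ) (fun hmem => ?_) hz.1)
        have h3 := fwd_not_mem (ho 1 J (by omega) hJ)
          (fun h => by have := hE.inj (by omega) hJ h; omega) hfw0 hmem
        have h4 := (hnext J (by omega)).fwd
        rw [← h3.2] at h4
        have := hE.inj (by omega) (by omega) (h4.unique (ho (J + 1) 1 (by omega) (by omega)) hfw0)
        omega
      exact cross_trans_lt hzc (hpos J hJ2 (by omega)) (hpos i (by omega) hi') hstrict
        (hsort J i hJ2 hJi hi')

end VoronoiRep

/-- Small steps from `z` in direction `w` stay in `K`. -/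
def Enters (K : Set Plane) (z w : Plane) : Prop :=
  ∃ τ : ℝ, 0 < τ ∧ ∀ t, 0 < t → t ≤ τ → z + t • w ∈ K

theorem enters_of_eventually {K : Set Plane} {z w : Plane}
    (h : ∀ᶠ t in 𝓝[>] (0 : ℝ), z + t • w ∈ K) : Enters K z w := by
  obtain ⟨τ, hτ, h'⟩ := mem_nhdsGT_iff_exists_Ioc_subset.1 h
  exact ⟨τ, hτ, fun t h1 h2 => h' ⟨h1, h2⟩⟩

theorem enters_of_mem_interior {K : Set Plane} {z : Plane} (hz : z ∈ interior K) (w : Plane) :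
    Enters K z w := by
  apply enters_of_eventually
  have : Continuous fun t : ℝ => z + t • w := by fun_prop
  have h1 := this.tendsto 0
  simp only [zero_smul, add_zero] at h1
  exact (h1.eventually (mem_interior_iff_mem_nhds.1 hz)).filter_mono nhdsWithin_le_nhds

theorem cross_add_right (v w w' : Plane) : cross v (w + w') = cross v w + cross v w' := by
  simp [cross]; ring

theorem cross_smul_right (v w : Plane) (t : ℝ) : cross v (t • w) = t * cross v w := by
  simp [cross]; ring

theorem cross_smul_left (v w : Plane) (t : ℝ) : cross (t • v) w = t * cross v w := by
  simp [cross]; ring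

theorem cross_neg_right (v w : Plane) : cross v (-w) = - cross v w := by
  simp [cross]; ring

theorem cross_neg_left (v w : Plane) : cross (-v) w = - cross v w := by
  simp [cross]; ring

theorem continuous_cross_sub (v a : Plane) : Continuous fun x : Plane => cross v (x - a) := by
  unfold cross; fun_prop

theorem interior_eq_empty_of_line {K : Set Plane} {w a : Plane} (hw : w ≠ 0)
    (h : ∀ x ∈ K, cross w (x - a) = 0) : interior K = ∅ := by
  rw [Set.eq_empty_iff_forall_notMem]
  intro x hx
  obtain ⟨τ, hτ, h1⟩ := enters_of_mem_interior hx (rot90 w)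
  have h2 := h _ (h1 τ hτ le_rfl)
  have h3 := h x (interior_subset hx)
  have h4 : cross w (x + τ • rot90 w - a) = cross w (x - a) + τ * dot w w := by
    simp [cross, dot]; ring
  rw [h4, h3] at h2
  have := mul_pos hτ (dot_self_pos hw)
  linarith

/-- A vector in coordinates with respect to two directions. -/
theorem eq_comb_of_cross {a b y : Plane} (h : cross a b ≠ 0) :
    y = (cross y b / cross a b) • a + (cross a y / cross a b) • b := by
  apply plane_ext
  · simp; field_simp; simp [cross]; ring
  · simp; field_simp; simp [cross]; ring

/-- The local shape of a convex set at a boundary point `z`: boundary rays in the directions `u`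
(counterclockwise) and `v` (clockwise). -/
structure Corner (K : Set Plane) (z u v : Plane) : Prop where
  left : ∀ x ∈ K, 0 ≤ cross u (x - z)
  right : ∀ x ∈ K, 0 ≤ cross (x - z) v
  left_int : ∀ x ∈ interior K, 0 < cross u (x - z)
  right_int : ∀ x ∈ interior K, 0 < cross (x - z) v
  enter : ∀ w, 0 < cross u w → 0 < cross w v → Enters (interior K) z w

namespace HullRep

variable {Q : Finset Plane} (H : HullRep Q)

theorem isCompact_hull (Q : Finset Plane) : IsCompact (queryHull Q) :=
  Q.finite_toSet.isCompact_convexHull (𝕜 := ℝ)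

theorem convex_hull' (Q : Finset Plane) : Convex ℝ (queryHull Q) := convex_convexHull ℝ _

theorem hull_eq : queryHull Q = convexHull ℝ (Set.range H.vertex) := by
  have h := closure_convexHull_extremePoints (isCompact_hull Q) (convex_hull' Q)
  rw [← H.range_vertex] at h
  rw [← h]
  exact ((Set.finite_range H.vertex).isClosed_convexHull (𝕜 := ℝ)).closure_eq

theorem size_eq : hullSize Q = H.size := by
  unfold hullSize
  rw [← H.range_vertex, ← Set.image_univ, Set.ncard_image_of_injective _ H.vertex_injective]
  simp

theorem size_pos (hQ : Q.Nonempty) : 0 < H.size := by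
  have h : (Set.extremePoints ℝ (queryHull Q)).Nonempty :=
    (isCompact_hull Q).extremePoints_nonempty (by
      obtain ⟨q, hq⟩ := hQ
      exact ⟨q, subset_convexHull ℝ _ hq⟩)
  rw [← H.range_vertex] at h
  obtain ⟨_, i, _⟩ := h
  exact i.pos

/-- The vertices, indexed periodically. -/
def pt (k : ℕ) : Plane :=
  if h : 0 < H.size then H.vertex ⟨k % H.size, Nat.mod_lt _ h⟩ else 0

/-- The direction of the `k`-th edge. -/
def ed (k : ℕ) : Plane := H.pt (k + 1) - H.pt k

/-- The position of a point relative to the `k`-th edge, positive to its left. -/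
def pos (k : ℕ) (x : Plane) : ℝ := cross (H.ed k) (x - H.pt k)

variable {H}

theorem pt_of_lt {k : ℕ} (hk : k < H.size) : H.pt k = H.vertex ⟨k, hk⟩ := by
  unfold pt
  rw [dif_pos (by omega)]
  congr 2
  exact Nat.mod_eq_of_lt hk

theorem pt_mod (k : ℕ) : H.pt (k % H.size) = H.pt k := by
  unfold pt; simp only [Nat.mod_mod]

theorem pt_add_size (k : ℕ) : H.pt (k + H.size) = H.pt k := by
  unfold pt; simp only [Nat.add_mod_right]

theorem vertex_next {k : ℕ} (hk : k < H.size) : H.vertex (cyclicNext ⟨k, hk⟩) = H.pt (k + 1) := by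
  unfold pt
  rw [dif_pos (by omega)]
  rfl

theorem edge_eq {k : ℕ} (hk : k < H.size) :
    H.edge ⟨k, hk⟩ = segment ℝ (H.pt k) (H.pt (k + 1)) := by
  rw [edge, vertex_next, pt_of_lt hk]

theorem pt_inj {j k : ℕ} (hs : 0 < H.size) (h : H.pt j = H.pt k) : j % H.size = k % H.size := by
  unfold pt at h
  rw [dif_pos hs, dif_pos hs] at h
  simpa using H.vertex_injective h

theorem ed_mod (_hs : 0 < H.size) (k : ℕ) : H.ed (k % H.size) = H.ed k := by
  unfold ed
  rw [pt_mod, ← pt_mod (k % H.size + 1), ← pt_mod (k + 1), Nat.mod_add_mod]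

theorem pos_mod (hs : 0 < H.size) (k : ℕ) (x : Plane) : H.pos (k % H.size) x = H.pos k x := by
  unfold pos; rw [ed_mod hs, pt_mod]

theorem pos_pt {j k : ℕ} (hs : 0 < H.size) (h1 : j % H.size ≠ k % H.size)
    (h2 : j % H.size ≠ (k + 1) % H.size) : 0 < H.pos k (H.pt j) := by
  have hk : k % H.size < H.size := Nat.mod_lt _ hs
  have hj : j % H.size < H.size := Nat.mod_lt _ hs
  have := H.ccw ⟨k % H.size, hk⟩ ⟨j % H.size, hj⟩ (by simpa using h1)
    (by simpa [cyclicNext] using h2)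
  rw [← pos_mod hs, ← pt_mod j, pos, ed, pt_of_lt hk, pt_of_lt hj, ← vertex_next hk]
  exact this

theorem pos_comb (k : ℕ) (x y : Plane) (a b : ℝ) (hab : a + b = 1) :
    H.pos k (a • x + b • y) = a * H.pos k x + b * H.pos k y := by
  obtain rfl : b = 1 - a := by linarith
  simp [pos, cross]; ring

theorem pos_self (k : ℕ) : H.pos k (H.pt k) = 0 := by simp [pos, cross]

theorem pos_succ (k : ℕ) : H.pos k (H.pt (k + 1)) = 0 := by simp [pos, ed, cross]; ring

theorem pos_add_smul (k : ℕ) (x w : Plane) (t : ℝ) :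
    H.pos k (x + t • w) = H.pos k x + t * cross (H.ed k) w := by
  simp [pos, cross]; ring

theorem pos_pt_nonneg (hs : 0 < H.size) (j k : ℕ) : 0 ≤ H.pos k (H.pt j) := by
  by_cases h1 : j % H.size = k % H.size
  · rw [← pt_mod j, h1, pt_mod, pos_self]
  · by_cases h2 : j % H.size = (k + 1) % H.size
    · rw [← pt_mod j, h2, pt_mod, pos_succ]
    · exact (pos_pt hs h1 h2).le

theorem convex_pos (k : ℕ) : Convex ℝ {x | 0 ≤ H.pos k x} := by
  intro x hx y hy a b ha hb hab
  simp only [Set.mem_ofPred_eq] at *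
  rw [pos_comb _ _ _ _ _ hab]; positivity

theorem pt_mem (hs : 0 < H.size) (k : ℕ) : H.pt k ∈ queryHull Q := by
  rw [H.hull_eq]
  apply subset_convexHull
  unfold pt
  rw [dif_pos hs]
  exact ⟨_, rfl⟩

theorem pos_nonneg (hs : 0 < H.size) (k : ℕ) {x : Plane} (hx : x ∈ queryHull Q) :
    0 ≤ H.pos k x := by
  rw [H.hull_eq] at hx
  refine convexHull_min ?_ (convex_pos k) hx
  rintro _ ⟨i, rfl⟩
  have := pos_pt_nonneg (H := H) hs i.val k
  rwa [pt_of_lt i.isLt] at this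

theorem ed_ne_zero (hs : 2 ≤ H.size) (k : ℕ) : H.ed k ≠ 0 := by
  intro h
  have := pt_inj (by omega) (sub_eq_zero.1 h)
  have h2 : (k + 1) % H.size ≠ k % H.size := by
    intro h3
    have h4 : (k + 1) ≡ k + 0 [MOD H.size] := h3
    have h5 := Nat.ModEq.add_left_cancel' k h4
    unfold Nat.ModEq at h5
    rw [Nat.mod_eq_of_lt (by omega), Nat.zero_mod] at h5
    omega
  exact h2 this

/-- Orientation of three vertices. -/
theorem orient_pos (hs : 3 ≤ H.size) {a b c : ℕ} (hab : a < b) (hbc : b < c) (hc : c < H.size) :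
    0 < cross (H.pt b - H.pt a) (H.pt c - H.pt a) := by
  have hmod : ∀ j < H.size, j % H.size = j := fun j hj => Nat.mod_eq_of_lt hj
  have h1 : ∀ j, a + 2 ≤ j → j < H.size →
      0 < cross (H.pt (a + 1) - H.pt a) (H.pt j - H.pt a) := by
    intro j hj hj'
    have := pos_pt (H := H) (j := j) (k := a) (by omega)
      (by rw [hmod _ hj', hmod _ (by omega)]; omega)
      (by rw [hmod _ hj', hmod _ (by omega)]; omega)
    exact this
  have h2 : ∀ j, a + 1 ≤ j → j + 1 < H.size →
      0 < cross (H.pt j - H.pt a) (H.pt (j + 1) - H.pt a) := by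
    intro j hj hj'
    have := pos_pt (H := H) (j := a) (k := j) (by omega)
      (by rw [hmod _ (by omega), hmod _ (by omega)]; omega)
      (by rw [hmod _ (by omega), hmod _ (by omega)]; omega)
    have h : cross (H.pt j - H.pt a) (H.pt (j + 1) - H.pt a) = H.pos j (H.pt a) := by
      simp [pos, ed, cross]; ring
    rwa [h]
  rcases Nat.eq_or_lt_of_le (Nat.succ_le_of_lt hab) with rfl | hab'
  · exact h1 c hbc hc
  · rcases Nat.eq_or_lt_of_le (Nat.succ_le_of_lt hbc) with rfl | hbc'
    · exact h2 b hab (by omega)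
    · refine cross_trans_lt (h1 b hab' (by omega)) (h1 (b + 1) (by omega) (by omega))
        (h1 c (by omega) hc) (h2 b (by omega) (by omega)) ?_
      exact cross_sorted (u := H.pt (a + 1) - H.pt a) (w := fun j => H.pt j - H.pt a)
        (M := a + 2) (N := c) (fun j hj hj' => h1 j hj (by omega))
        (fun j hj hj' => (h2 j (by omega) (by omega)).le) (by omega) hbc'.le le_rfl

theorem orient_nonneg (hs : 3 ≤ H.size) {a b c : ℕ} (hab : a ≤ b) (hbc : b ≤ c)
    (hc : c ≤ H.size) : 0 ≤ cross (H.pt b - H.pt a) (H.pt c - H.pt a) := by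
  rcases hab.eq_or_lt with rfl | hab
  · simp [cross]
  rcases hbc.eq_or_lt with rfl | hbc
  · rw [cross_eq_zero_self]
  rcases hc.eq_or_lt with rfl | hc
  · have h0 : H.pt H.size = H.pt 0 := by simpa using pt_add_size (H := H) 0
    rw [h0]
    rcases Nat.eq_zero_or_pos a with rfl | ha
    · simp [cross]
    · have := orient_pos hs ha hab hbc
      have h : cross (H.pt b - H.pt a) (H.pt 0 - H.pt a) =
        cross (H.pt a - H.pt 0) (H.pt b - H.pt 0) := by simp [cross]; ring
      rw [h]; exact this.le
  · exact (orient_pos hs hab hbc hc).le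

/-- The hull is the intersection of half-planes. -/
theorem mem_hull_iff (hs : 3 ≤ H.size) {x : Plane} :
    x ∈ queryHull Q ↔ ∀ k < H.size, 0 ≤ H.pos k x := by
  refine ⟨fun h k _ => pos_nonneg (by omega) k h, fun h => ?_⟩
  obtain ⟨j, hj1, hj2, hj3, hj4⟩ : ∃ j, 1 ≤ j ∧ j + 1 < H.size ∧
      0 ≤ cross (H.pt j - H.pt 0) (x - H.pt 0) ∧
      cross (H.pt (j + 1) - H.pt 0) (x - H.pt 0) ≤ 0 := by
    by_contra hcon
    push Not at hcon
    have hall : ∀ j, 1 ≤ j → j < H.size → 0 ≤ cross (H.pt j - H.pt 0) (x - H.pt 0) := by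
      intro j hj
      induction j, hj using Nat.le_induction with
      | base => intro _; exact h 0 (by omega)
      | succ j hj ih => intro hj'; exact (hcon j hj hj' (ih (by omega))).le
    have h1 := hcon (H.size - 2) (by omega) (by omega) (hall _ (by omega) (by omega))
    have h2 := h (H.size - 1) (by omega)
    have h0 : H.pt (H.size - 1 + 1) = H.pt 0 := by
      rw [Nat.sub_add_cancel (by omega)]; simpa using pt_add_size (H := H) 0
    rw [show H.size - 2 + 1 = H.size - 1 by omega] at h1
    have h3 : H.pos (H.size - 1) x = - cross (H.pt (H.size - 1) - H.pt 0) (x - H.pt 0) := by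
      rw [pos, ed, h0]; simp [cross]; ring
    linarith
  set w := H.pt j - H.pt 0 with hw
  set w' := H.pt (j + 1) - H.pt 0 with hw'
  set y := x - H.pt 0 with hy
  have hD : 0 < cross w w' := orient_pos hs (by omega) (by omega) hj2
  have hL := h j (by omega)
  have hL' : H.pos j x = cross w w' - cross y w' - cross w y := by
    simp [pos, ed, cross, w, w', y]; ring
  have hcomb := eq_comb_of_cross (y := y) hD.ne'
  set α := cross y w' / cross w w' with hα
  set β := cross w y / cross w w' with hβ
  have hα0 : 0 ≤ α := div_nonneg (by rw [cross_swap]; linarith) hD.le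
  have hβ0 : 0 ≤ β := div_nonneg hj3 hD.le
  have hsum : α + β ≤ 1 := by
    rw [hα, hβ, ← add_div, div_le_one hD]; linarith
  have hc := convex_hull' Q
  have m0 := pt_mem (H := H) (by omega) 0
  have m1 := pt_mem (H := H) (by omega) j
  have m2 := pt_mem (H := H) (by omega) (j + 1)
  rcases (add_nonneg hα0 hβ0).eq_or_lt with h0 | h0
  · have a0 : α = 0 := by linarith
    have b0 : β = 0 := by linarith
    rw [a0, b0] at hcomb
    have : x = H.pt 0 := by rw [hy] at hcomb; simpa [sub_eq_zero] using hcomb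
    rw [this]; exact m0
  · have hz := hc m1 m2 (a := α / (α + β)) (b := β / (α + β)) (by positivity) (by positivity)
      (by field_simp)
    have hx := hc m0 hz (a := 1 - (α + β)) (b := α + β) (by linarith) h0.le (by ring)
    convert hx using 1
    have hx' : x = H.pt 0 + y := by simp [hy]
    rw [hx', hcomb, hw, hw']
    apply plane_ext <;> simp <;> field_simp <;> ring

theorem continuous_pos (k : ℕ) : Continuous (H.pos k) := continuous_cross_sub _ _

theorem mem_interior_iff (hs : 3 ≤ H.size) {x : Plane} :
    x ∈ interior (queryHull Q) ↔ ∀ k < H.size, 0 < H.pos k x := by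
  constructor
  · intro hx k hk
    refine lt_of_le_of_ne (pos_nonneg (by omega) k (interior_subset hx)) fun h0 => ?_
    obtain ⟨τ, hτ, h1⟩ := enters_of_mem_interior hx (-rot90 (H.ed k))
    have h2 := pos_nonneg (H := H) (by omega) k (h1 τ hτ le_rfl)
    rw [pos_add_smul, ← h0, cross_neg_right] at h2
    have h3 : cross (H.ed k) (rot90 (H.ed k)) = dot (H.ed k) (H.ed k) := by simp [cross, dot]
    rw [h3] at h2
    have := mul_pos hτ (dot_self_pos (ed_ne_zero (H := H) (by omega) k))
    linarith
  · intro h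
    have ho : IsOpen (⋂ k ∈ Finset.range H.size, {x | 0 < H.pos k x}) :=
      isOpen_biInter_finset fun k _ => isOpen_lt continuous_const (continuous_pos k)
    refine interior_maximal (fun y hy => ?_) ho (by simpa using h)
    rw [mem_hull_iff hs]
    simp only [Finset.mem_range, Set.mem_iInter, Set.mem_ofPred_eq] at hy
    exact fun k hk => (hy k hk).le

variable (H) in
/-- The point of the `i`-th edge with parameter `t`. -/
def at' (i : ℕ) (t : ℝ) : Plane := H.pt i + t • H.ed i

theorem at_zero (i : ℕ) : H.at' i 0 = H.pt i := by simp [at']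

theorem at_one (i : ℕ) : H.at' i 1 = H.pt (i + 1) := by simp [at', ed]

theorem at_eq_comb (i : ℕ) (t : ℝ) : H.at' i t = (1 - t) • H.pt i + t • H.pt (i + 1) := by
  simp only [at', ed]; module

theorem at_add (i : ℕ) (t r : ℝ) : H.at' i t + r • H.ed i = H.at' i (t + r) := by
  simp only [at']; module

theorem mem_edge_iff {k : ℕ} (hk : k < H.size) {x : Plane} :
    x ∈ H.edge ⟨k, hk⟩ ↔ ∃ t, 0 ≤ t ∧ t ≤ 1 ∧ x = H.at' k t := by
  rw [edge_eq hk, segment_eq_image]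
  constructor
  · rintro ⟨t, ⟨h0, h1⟩, rfl⟩; exact ⟨t, h0, h1, (at_eq_comb k t).symm⟩
  · rintro ⟨t, h0, h1, rfl⟩; exact ⟨t, ⟨h0, h1⟩, (at_eq_comb k t).symm⟩

theorem at_mem (hs : 0 < H.size) {i : ℕ} {t : ℝ} (h0 : 0 ≤ t) (h1 : t ≤ 1) :
    H.at' i t ∈ queryHull Q := by
  rw [at_eq_comb]
  exact convex_hull' Q (pt_mem hs i) (pt_mem hs (i + 1)) (by linarith) h0 (by ring)

theorem pos_at (i : ℕ) (t : ℝ) : H.pos i (H.at' i t) = 0 := by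
  rw [at_eq_comb, pos_comb _ _ _ _ _ (by ring), pos_self, pos_succ]; simp

/-- Successive edges turn left. -/
theorem cross_ed_pos (hs : 3 ≤ H.size) (k : ℕ) : 0 < cross (H.ed k) (H.ed (k + 1)) := by
  have h1 : cross (H.ed k) (H.ed (k + 1)) = H.pos k (H.pt (k + 2)) := by
    simp [pos, ed, cross]; ring
  rw [h1]
  have hne : ∀ i j, i < j → j ≤ i + 2 → j % H.size ≠ i % H.size := by
    intro i j h1 h2 h3
    obtain ⟨r, rfl⟩ := Nat.exists_eq_add_of_lt h1
    have h4 : i + (r + 1) ≡ i + 0 [MOD H.size] := by simpa [Nat.ModEq, add_assoc] using h3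
    have h5 := Nat.ModEq.add_left_cancel' i h4
    unfold Nat.ModEq at h5
    rw [Nat.mod_eq_of_lt (by omega), Nat.zero_mod] at h5
    omega
  exact pos_pt (by omega) (hne k (k + 2) (by omega) (by omega)) (hne (k + 1) (k + 2) (by omega) (by omega))

theorem mem_edge_of_pos_eq_zero (hs : 3 ≤ H.size) {i : ℕ} {x : Plane}
    (hx : x ∈ queryHull Q) (h : H.pos (i + 1) x = 0) : ∃ t, 0 ≤ t ∧ t ≤ 1 ∧ x = H.at' (i + 1) t := by
  have h1 := cross_ed_pos hs i
  have h2 := cross_ed_pos hs (i + 1)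
  have hd := dot_self_pos (ed_ne_zero (H := H) (by omega) (i + 1))
  have hx1 := pos_nonneg (H := H) (by omega) i hx
  have hx2 := pos_nonneg (H := H) (by omega) (i + 1 + 1) hx
  set d := H.ed (i + 1) with hdd
  set t := dot d (x - H.pt (i + 1)) / dot d d with ht
  have hxt : x = H.at' (i + 1) t := by
    rw [pos, ← hdd] at h
    unfold at'
    rw [← hdd]
    apply plane_ext
    · simp [ht]; field_simp; simp [dot, cross] at *; linear_combination (-d 1) * h
    · simp [ht]; field_simp; simp [dot, cross] at *; linear_combination (d 0) * h
  refine ⟨t, ?_, ?_, hxt⟩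
  · rw [hxt, at', pos_add_smul, pos_succ, ← hdd] at hx1
    by_contra hneg
    have := mul_neg_of_neg_of_pos (not_le.1 hneg) h1
    linarith
  · have h3 : H.at' (i + 1) t = H.pt (i + 1 + 1) + (t - 1) • H.ed (i + 1) := by
      simp only [at', ed]; module
    rw [hxt, h3, pos_add_smul, pos_self, cross_swap] at hx2
    nlinarith

theorem exists_edge_of_pos (hs : 3 ≤ H.size) {i : ℕ} {x : Plane}
    (hx : x ∈ queryHull Q) (h : H.pos i x = 0) : ∃ t, 0 ≤ t ∧ t ≤ 1 ∧ x = H.at' i t := by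
  have h1 : i + H.size = (i + H.size - 1) + 1 := by omega
  have h2 : H.pos (i + H.size - 1 + 1) x = 0 := by
    rw [← h1, ← pos_mod (by omega), Nat.add_mod_right, pos_mod (by omega), h]
  obtain ⟨t, h3, h4, h5⟩ := mem_edge_of_pos_eq_zero hs hx h2
  refine ⟨t, h3, h4, ?_⟩
  rw [h5, ← h1]
  unfold at'
  rw [pt_add_size, ← ed_mod (by omega), Nat.add_mod_right, ed_mod (by omega)]

theorem frontier_hull : frontier (queryHull Q) = queryHull Q \ interior (queryHull Q) :=
  (isCompact_hull Q).isClosed.frontier_eq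

theorem mem_frontier_iff (hs : 3 ≤ H.size) {x : Plane} : x ∈ frontier (queryHull Q) ↔
    ∃ i < H.size, ∃ t, 0 ≤ t ∧ t ≤ 1 ∧ x = H.at' i t := by
  rw [frontier_hull, Set.mem_sdiff, mem_interior_iff hs]
  constructor
  · rintro ⟨h1, h2⟩
    push Not at h2
    obtain ⟨i, hi, h3⟩ := h2
    exact ⟨i, hi, exists_edge_of_pos hs h1 (le_antisymm h3 (pos_nonneg (by omega) i h1))⟩
  · rintro ⟨i, hi, t, h0, h1, rfl⟩
    refine ⟨at_mem (by omega) h0 h1, fun h => ?_⟩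
    have := h i hi
    rw [pos_at] at this
    exact lt_irrefl _ this

theorem at_one_eq (i : ℕ) : H.at' i 1 = H.at' (i + 1) 0 := by rw [at_one, at_zero]

theorem at_mod (hs : 0 < H.size) (i : ℕ) (t : ℝ) : H.at' (i % H.size) t = H.at' i t := by
  unfold at'; rw [pt_mod, ed_mod hs]

/-- Boundary points in the half-open parametrization of the edges. -/
theorem mem_frontier_iff' (hs : 3 ≤ H.size) {x : Plane} : x ∈ frontier (queryHull Q) ↔
    ∃ i < H.size, ∃ t, 0 ≤ t ∧ t < 1 ∧ x = H.at' i t := by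
  rw [mem_frontier_iff hs]
  constructor
  · rintro ⟨i, hi, t, h0, h1, rfl⟩
    rcases h1.eq_or_lt with rfl | h1
    · refine ⟨(i + 1) % H.size, Nat.mod_lt _ (by omega), 0, le_rfl, one_pos, ?_⟩
      rw [at_mod (by omega), at_one_eq]
    · exact ⟨i, hi, t, h0, h1, rfl⟩
  · rintro ⟨i, hi, t, h0, h1, rfl⟩
    exact ⟨i, hi, t, h0, h1.le, rfl⟩

variable (H) in
/-- The clockwise boundary direction at the point of the `i`-th edge with parameter `t < 1`. -/
def back (i : ℕ) (t : ℝ) : Plane := if t = 0 then -H.ed (i + H.size - 1) else -H.ed i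

theorem corner (hs : 3 ≤ H.size) {i : ℕ} (hi : i < H.size) {t : ℝ} (h0 : 0 ≤ t) (h1 : t < 1) :
    Corner (queryHull Q) (H.at' i t) (H.ed i) (H.back i t) := by
  have hleft : ∀ x, cross (H.ed i) (x - H.at' i t) = H.pos i x := by
    intro x; simp [at', pos, cross]; ring
  set p := (i + H.size - 1) % H.size with hp
  have hpl : p < H.size := Nat.mod_lt _ (by omega)
  have hp1 : H.pt (i + H.size - 1 + 1) = H.pt i := by
    rw [show i + H.size - 1 + 1 = i + H.size by omega, pt_add_size]
  obtain ⟨r, hr, hright⟩ : ∃ r < H.size, ∀ x, cross (x - H.at' i t) (H.back i t) = H.pos r x := by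
    unfold back
    split_ifs with h
    · refine ⟨p, hpl, fun x => ?_⟩
      rw [h, at_zero, pos_mod (by omega), pos, ← hp1]
      simp [ed, cross]; ring
    · refine ⟨i, hi, fun x => ?_⟩
      rw [← hleft, cross_neg_right, ← cross_swap]
  have hrightw : ∀ w, cross (H.ed r) w = cross w (H.back i t) := by
    intro w
    have h1 := hright (H.at' i t + w)
    have h2 := hright (H.at' i t)
    have h3 := pos_add_smul (H := H) r (H.at' i t) w 1
    rw [one_smul, one_mul] at h3
    rw [sub_self] at h2
    rw [add_sub_cancel_left] at h1
    simp [cross] at h2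
    simp only [cross] at *
    linarith
  refine ⟨fun x hx => ?_, fun x hx => ?_, fun x hx => ?_, fun x hx => ?_, fun w hw1 hw2 => ?_⟩
  · rw [hleft]; exact pos_nonneg (by omega) _ hx
  · rw [hright]; exact pos_nonneg (by omega) _ hx
  · rw [hleft]; exact (mem_interior_iff hs).1 hx i hi
  · rw [hright]; exact (mem_interior_iff hs).1 hx r hr
  · apply enters_of_eventually
    have h : ∀ᶠ τ in 𝓝[>] (0 : ℝ), ∀ k ∈ Finset.range H.size, 0 < H.pos k (H.at' i t + τ • w) := by
      rw [Filter.eventually_all_finset]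
      intro k hk
      rw [Finset.mem_range] at hk
      rcases (pos_nonneg (H := H) (by omega) k (at_mem (H := H) (i := i) (by omega) h0 h1.le)).eq_or_lt
        with hz | hz
      · have hcr : 0 < cross (H.ed k) w := by
          by_cases hki : k = i
          · rw [hki]; exact hw1
          · rw [at_eq_comb, pos_comb _ _ _ _ _ (by ring)] at hz
            have g1 := pos_pt_nonneg (H := H) (by omega) i k
            have g2 := pos_pt_nonneg (H := H) (by omega) (i + 1) k
            have g3 : H.pos k (H.pt i) = 0 := by
              have k1 : 0 ≤ (1 - t) * H.pos k (H.pt i) := mul_nonneg (by linarith) g1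
              have k2 := mul_nonneg h0 g2
              have k3 : (1 - t) * H.pos k (H.pt i) = 0 := by linarith
              exact (mul_eq_zero.1 k3).resolve_left (by linarith)
            have g4 : i % H.size = (k + 1) % H.size := by
              by_contra hne
              have := pos_pt (H := H) (j := i) (k := k) (by omega)
                (by rw [Nat.mod_eq_of_lt hi, Nat.mod_eq_of_lt hk]; omega) hne
              linarith
            have hkp : k = p := by
              have : k ≡ i + H.size - 1 [MOD H.size] := by
                have h5 : k + 1 ≡ (i + H.size - 1) + 1 [MOD H.size] := by
                  rw [show i + H.size - 1 + 1 = i + H.size by omega]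
                  unfold Nat.ModEq
                  rw [Nat.add_mod_right, g4]
                exact Nat.ModEq.add_right_cancel' 1 h5
              rw [hp, ← this, Nat.mod_eq_of_lt hk]
            have ht : t = 0 := by
              by_contra htne
              have htpos : 0 < t := lt_of_le_of_ne h0 (Ne.symm htne)
              rw [g3, mul_zero, zero_add] at hz
              have g5 : H.pos k (H.pt (i + 1)) = 0 :=
                (mul_eq_zero.1 hz.symm).resolve_left htne
              have h6 := cross_ed_pos (H := H) hs (i + H.size - 1)
              rw [← ed_mod (by omega) (i + H.size - 1 + 1),
                show i + H.size - 1 + 1 = i + H.size by omega, Nat.add_mod_right,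
                ed_mod (by omega), ← ed_mod (by omega) (i + H.size - 1), ← hp, ← hkp] at h6
              have h7 : H.pt (i + 1) = H.pt i + (1 : ℝ) • H.ed i := by simp [ed]
              rw [h7, pos_add_smul, g3] at g5
              linarith
            have hb : H.back i t = -H.ed k := by
              unfold back; rw [if_pos ht, ← ed_mod (by omega), ← hp, hkp]
            rw [hb, cross_neg_right, ← cross_swap] at hw2
            exact hw2
        filter_upwards [self_mem_nhdsWithin] with τ hτ
        rw [pos_add_smul, ← hz, zero_add]
        exact mul_pos hτ hcr
      · have : Continuous fun τ : ℝ => H.pos k (H.at' i t + τ • w) :=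
          (continuous_pos k).comp (by fun_prop)
        have h1 := this.tendsto 0
        simp only [zero_smul, add_zero] at h1
        exact (h1.eventually (lt_mem_nhds hz)).filter_mono nhdsWithin_le_nhds
    exact h.mono fun τ hτ => (mem_interior_iff hs).2 fun k hk => hτ k (Finset.mem_range.2 hk)

theorem interior_nonempty (hs : 3 ≤ H.size) : (interior (queryHull Q)).Nonempty := by
  refine ⟨(1/2 : ℝ) • ((1/2 : ℝ) • H.pt 0 + (1/2 : ℝ) • H.pt 1) + (1/2 : ℝ) • H.pt 2, ?_⟩
  rw [mem_interior_iff hs]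
  intro k hk
  rw [pos_comb _ _ _ _ _ (by norm_num), pos_comb _ _ _ _ _ (by norm_num)]
  have h0 := pos_pt_nonneg (H := H) (by omega) 0 k
  have h1 := pos_pt_nonneg (H := H) (by omega) 1 k
  have h2 := pos_pt_nonneg (H := H) (by omega) 2 k
  have : 0 < H.pos k (H.pt 0) ∨ 0 < H.pos k (H.pt 1) ∨ 0 < H.pos k (H.pt 2) := by
    have hk1 : (k + 1) % H.size = if k + 1 = H.size then 0 else k + 1 := by
      split_ifs with h
      · rw [h, Nat.mod_self]
      · exact Nat.mod_eq_of_lt (by omega)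
    have key : ∀ j < 3, j ≠ k → j ≠ (k + 1) % H.size → 0 < H.pos k (H.pt j) := by
      intro j hj h1 h2
      exact pos_pt (by omega) (by rw [Nat.mod_eq_of_lt (by omega), Nat.mod_eq_of_lt hk]; exact h1)
        (by rw [Nat.mod_eq_of_lt (by omega)]; exact h2)
    by_cases c0 : 0 ≠ k ∧ 0 ≠ (k + 1) % H.size
    · exact Or.inl (key 0 (by omega) c0.1 c0.2)
    · by_cases c1 : 1 ≠ k ∧ 1 ≠ (k + 1) % H.size
      · exact Or.inr (Or.inl (key 1 (by omega) c1.1 c1.2))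
      · refine Or.inr (Or.inr (key 2 (by omega) ?_ ?_)) <;>
        · rw [hk1] at *; split_ifs at * <;> omega
  rcases this with h | h | h <;> linarith

/-- A hull with at most two vertices lies on a line. -/
theorem interior_eq_empty (hs : 0 < H.size) (hs2 : H.size ≤ 2) :
    interior (queryHull Q) = ∅ := by
  obtain ⟨w, hw, h⟩ : ∃ w : Plane, w ≠ 0 ∧ ∀ k, cross w (H.pt k - H.pt 0) = 0 := by
    rcases Nat.lt_or_ge H.size 2 with h1 | h1
    · refine ⟨!₂[1, 0], fun h => by simpa using congrArg (· 0) h, fun k => ?_⟩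
      rw [← pt_mod k, show k % H.size = 0 by
        have := Nat.mod_lt k hs; omega]
      simp [cross]
    · refine ⟨H.ed 0, ed_ne_zero h1 0, fun k => ?_⟩
      have hk : k % H.size < 2 := (Nat.mod_lt k hs).trans_le hs2
      rw [← pt_mod k]
      interval_cases k % H.size
      · simp [cross]
      · exact pos_succ 0
  apply interior_eq_empty_of_line hw (a := H.pt 0)
  intro x hx
  rw [H.hull_eq] at hx
  have hconv : Convex ℝ {x : Plane | cross w (x - H.pt 0) = 0} := by
    intro x hx y hy a b ha hb hab
    obtain rfl : b = 1 - a := by linarith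
    simp only [Set.mem_ofPred_eq] at *
    have : cross w (a • x + (1 - a) • y - H.pt 0) =
      a * cross w (x - H.pt 0) + (1 - a) * cross w (y - H.pt 0) := by simp [cross]; ring
    rw [this, hx, hy]; ring
  refine convexHull_min ?_ hconv hx
  rintro _ ⟨i, rfl⟩
  rw [← pt_of_lt i.isLt]
  exact h i.val

/-- The boundary of the hull consists of its edges. -/
theorem frontier_eq (hs : 0 < H.size) {x : Plane} : x ∈ frontier (queryHull Q) ↔
    ∃ i : Fin H.size, x ∈ H.edge i := by
  have conv : (∃ i : Fin H.size, x ∈ H.edge i) ↔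
      ∃ i < H.size, ∃ t, 0 ≤ t ∧ t ≤ 1 ∧ x = H.at' i t :=
    ⟨fun ⟨i, hi⟩ => ⟨i, i.isLt, (mem_edge_iff i.isLt).1 hi⟩,
      fun ⟨i, hi, h⟩ => ⟨⟨i, hi⟩, (mem_edge_iff hi).2 h⟩⟩
  rw [conv]
  rcases Nat.lt_or_ge 2 H.size with h3 | h3
  · exact mem_frontier_iff h3
  · rw [frontier_hull, interior_eq_empty hs h3, Set.sdiff_empty]
    constructor
    · intro hx
      have : Set.range H.vertex = {H.pt 0, H.pt 1} := by
        ext y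
        constructor
        · rintro ⟨i, rfl⟩
          rw [← pt_of_lt i.isLt]
          have := i.isLt
          have : i.val = 0 ∨ i.val = 1 := by omega
          rcases this with h | h <;> rw [h] <;> simp
        · have : ∀ k, H.pt k ∈ Set.range H.vertex := fun k => by
            unfold pt; rw [dif_pos hs]; exact ⟨_, rfl⟩
          rintro (rfl | rfl) <;> exact this _
      rw [H.hull_eq, this, convexHull_pair, segment_eq_image] at hx
      obtain ⟨t, ⟨h0, h1⟩, rfl⟩ := hx
      exact ⟨0, hs, t, h0, h1, (at_eq_comb 0 t).symm⟩
    · rintro ⟨i, hi, t, h0, h1, rfl⟩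
      exact at_mem hs h0 h1

end HullRep

/-- The open cell of `p` meets the interior of the hull. -/
def MeetsInt (P Q : Finset Plane) (p : Plane) : Prop :=
  (voronoiCell P p ∩ interior (queryHull Q)).Nonempty

/-- The open cell of `p` meets the boundary of the hull. -/
def MeetsBd (P Q : Finset Plane) (p : Plane) : Prop :=
  (voronoiCell P p ∩ frontier (queryHull Q)).Nonempty

theorem continuous_ray (z w : Plane) : Continuous fun t : ℝ => z + t • w := by fun_prop

theorem IsOpen.enters {U : Set Plane} (hU : IsOpen U) {z : Plane} (hz : z ∈ U) (w : Plane) :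
    Enters U z w := by
  rw [← hU.interior_eq] at hz
  exact (enters_of_mem_interior hz w).imp fun τ h => ⟨h.1, fun t h1 h2 => h.2 t h1 h2⟩

theorem Enters.inter {U K : Set Plane} {z w : Plane} (hU : Enters U z w) (hK : Enters K z w) :
    Enters (U ∩ K) z w := by
  obtain ⟨τ, h1, h2⟩ := hU
  obtain ⟨τ', h1', h2'⟩ := hK
  exact ⟨min τ τ', lt_min h1 h1', fun t h3 h4 =>
    ⟨h2 t h3 (h4.trans (min_le_left _ _)), h2' t h3 (h4.trans (min_le_right _ _))⟩⟩

theorem Enters.nonempty {U : Set Plane} {z w : Plane} (hU : Enters U z w) : U.Nonempty := by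
  obtain ⟨τ, h1, h2⟩ := hU
  exact ⟨_, h2 τ h1 le_rfl⟩

theorem Convex.enters_interior {K : Set Plane} (hK : Convex ℝ K) {z x : Plane} (hz : z ∈ K)
    (hx : x ∈ interior K) : Enters (interior K) z (x - z) := by
  refine ⟨1, one_pos, fun t h0 h1 => ?_⟩
  have := hK.combo_interior_self_mem_interior hx hz h0 (b := 1 - t) (by linarith) (by ring)
  convert this using 1
  module

theorem inter_interior_nonempty {U K : Set Plane} (hK : Convex ℝ K) (hU : IsOpen U)
    (hi : (interior K).Nonempty) (h : (U ∩ K).Nonempty) : (U ∩ interior K).Nonempty := by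
  obtain ⟨z, hz, hzK⟩ := h
  obtain ⟨x, hx⟩ := hi
  exact ((hU.enters hz _).inter (hK.enters_interior hzK hx)).nonempty

/-- A segment from a point of a closed set to a point outside passes its boundary. -/
theorem exists_frontier_point {K : Set Plane} (hK : IsClosed K) {x y : Plane} (hx : x ∈ K)
    (hy : y ∉ K) : ∃ t : ℝ, 0 ≤ t ∧ t < 1 ∧ x + t • (y - x) ∈ frontier K := by
  set f : ℝ → Plane := fun t => x + t • (y - x) with hf
  have hfc : Continuous f := continuous_ray _ _
  set S := Set.Icc (0 : ℝ) 1 ∩ f ⁻¹' K with hS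
  have hSc : IsCompact S := isCompact_Icc.inter_right (hK.preimage hfc)
  have h0 : (0 : ℝ) ∈ S := ⟨⟨le_rfl, zero_le_one⟩, by simp [hf, hx]⟩
  obtain ⟨t, ht, hmax⟩ := hSc.exists_isMaxOn ⟨0, h0⟩ continuousOn_id
  have ht1 : t ≠ 1 := by
    rintro rfl
    exact hy (by simpa [hf] using ht.2)
  have htlt : t < 1 := lt_of_le_of_ne ht.1.2 ht1
  refine ⟨t, ht.1.1, htlt, ?_⟩
  rw [hK.frontier_eq]
  refine ⟨ht.2, fun hint => ?_⟩
  obtain ⟨τ, hτ, h⟩ := enters_of_mem_interior hint (y - x)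
  set r := min τ (1 - t) with hr
  have hr0 : 0 < r := lt_min hτ (by linarith)
  have h1 := h r hr0 (min_le_left _ _)
  have h2 : t + r ∈ S := by
    refine ⟨⟨by linarith [ht.1.1], by linarith [min_le_right τ (1 - t)]⟩, ?_⟩
    have : f (t + r) = x + t • (y - x) + r • (y - x) := by simp only [hf]; module
    rw [Set.mem_preimage, this]; exact h1
  have := hmax h2
  simp at this
  linarith

variable {P Q : Finset Plane} {V : VoronoiRep P} {H : HullRep Q}

theorem isClosed_hull (Q : Finset Plane) : IsClosed (queryHull Q) :=
  (HullRep.isCompact_hull Q).isClosed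

theorem inner_of_meets_hull (hs : 3 ≤ H.size) {p : Plane}
    (h : (voronoiCell P p ∩ queryHull Q).Nonempty) : MeetsInt P Q p :=
  inter_interior_nonempty (HullRep.convex_hull' Q) (isOpen_voronoiCell P p)
    (HullRep.interior_nonempty hs) h

theorem inner_of_meetsBd (hs : 3 ≤ H.size) {p : Plane} (h : MeetsBd P Q p) : MeetsInt P Q p := by
  obtain ⟨x, hx, hx'⟩ := h
  exact inner_of_meets_hull hs ⟨x, hx, (isClosed_hull Q).frontier_subset hx'⟩

/-- A cell that meets the interior but not the boundary of the hull lies inside. -/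
theorem cell_subset_of_not_meetsBd {p : Plane} (h : MeetsInt P Q p) (h' : ¬ MeetsBd P Q p) :
    voronoiCell P p ⊆ interior (queryHull Q) := by
  obtain ⟨x, hx, hxi⟩ := h
  intro y hy
  by_contra hyi
  apply h'
  by_cases hyK : y ∈ queryHull Q
  · exact ⟨y, hy, by rw [HullRep.frontier_hull]; exact ⟨hyK, hyi⟩⟩
  · obtain ⟨t, h0, h1, h2⟩ := exists_frontier_point (isClosed_hull Q) (interior_subset hxi) hyK
    refine ⟨_, ?_, h2⟩
    have := convex_voronoiCell P p hx hy (a := 1 - t) (b := t) (by linarith) h0 (by ring)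
    convert this using 1
    module

theorem mem_seedPoints_iff (hs : 3 ≤ H.size) {p : Plane} :
    p ∈ seedPoints P Q ↔ p ∈ P ∧ MeetsInt P Q p := by
  unfold seedPoints
  simp only [Set.mem_ofPred_eq]
  refine and_congr_right fun hp => ⟨?_, fun h => ?_⟩
  · rintro (h | h)
    · exact inner_of_meetsBd hs h
    · exact inner_of_meets_hull hs ⟨p, self_mem_voronoiCell P p, h (self_mem_voronoiCell P p)⟩
  · by_cases h' : MeetsBd P Q p
    · exact Or.inl h'
    · exact Or.inr ((cell_subset_of_not_meetsBd h h').trans interior_subset)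

theorem mem_seedPoints_iff_of_le (hs : 0 < H.size) (hs2 : H.size ≤ 2) {p : Plane} :
    p ∈ seedPoints P Q ↔ p ∈ P ∧ MeetsBd P Q p := by
  unfold seedPoints
  simp only [Set.mem_ofPred_eq]
  refine and_congr_right fun hp => ⟨?_, fun h => Or.inl h⟩
  rintro (h | h)
  · exact h
  · exfalso
    have := (isOpen_voronoiCell P p).subset_interior_iff.2 h (self_mem_voronoiCell P p)
    rw [HullRep.interior_eq_empty hs hs2] at this
    exact this

/-! ## Skyline points -/

theorem gap_nonpos_of_dominates {p p' : Plane} (h : SpatiallyDominates Q p' p) {x : Plane}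
    (hx : x ∈ queryHull Q) : gap p p' x ≤ 0 := by
  have hconv : Convex ℝ {x | gap p p' x ≤ 0} := by
    intro x hx y hy a b ha hb hab
    simp only [Set.mem_ofPred_eq] at *
    rw [gap_comb _ _ _ _ _ _ hab]
    have := mul_nonpos_of_nonneg_of_nonpos ha hx
    have := mul_nonpos_of_nonneg_of_nonpos hb hy
    linarith
  refine convexHull_min ?_ hconv hx
  intro q hq
  have h1 := (dist_le_dist_iff _ _ _ _).1 (h.1 q hq)
  have h2 : ∀ a b : Plane, sqd a b = sqd b a := fun a b => by simp [sqd]; ring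
  rw [h2, h2 p q] at h1
  simp only [Set.mem_ofPred_eq, gap]
  linarith

theorem exists_gap_neg_of_dominates {p p' : Plane} (h : SpatiallyDominates Q p' p) :
    ∃ x ∈ queryHull Q, gap p p' x < 0 := by
  obtain ⟨q, hq, hlt⟩ := h.2
  refine ⟨q, subset_convexHull ℝ _ hq, ?_⟩
  have h1 := (dist_lt_dist_iff _ _ _ _).1 hlt
  have h2 : ∀ a b : Plane, sqd a b = sqd b a := fun a b => by simp [sqd]; ring
  rw [h2, h2 p q] at h1
  simp only [gap]
  linarith

theorem mem_skyline_of_meets {p : Plane} (hp : p ∈ P)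
    (h : (voronoiCell P p ∩ queryHull Q).Nonempty) : p ∈ skyline P Q := by
  refine ⟨hp, fun p' hp' hne hdom => ?_⟩
  obtain ⟨x, hx, hxQ⟩ := h
  have h1 := gap_nonpos_of_dominates hdom hxQ
  have h2 := mem_open_iff_gap.1 hx p' hp' hne
  linarith

theorem skyline_finite (P Q : Finset Plane) : (skyline P Q).Finite :=
  P.finite_toSet.subset fun _ h => h.1

theorem card_le_skyline {A : Finset Plane} (h : ∀ p ∈ A, p ∈ skyline P Q) :
    A.card ≤ (skyline P Q).ncard := by
  rw [← Set.ncard_coe_finset]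
  exact Set.ncard_le_ncard h (skyline_finite P Q)

theorem gap_at (i : ℕ) (c s : Plane) (t : ℝ) :
    gap c s (H.at' i t) = gap c s (H.pt i) - 2 * t * dot (s - c) (H.ed i) := by
  rw [HullRep.at', gap_add_smul]

theorem gap_at_eq_zero {i : ℕ} {c s : Plane} {t₀ t₁ : ℝ} (hne : t₀ ≠ t₁)
    (h0 : gap c s (H.at' i t₀) = 0) (h1 : gap c s (H.at' i t₁) = 0) :
    dot (s - c) (H.ed i) = 0 ∧ ∀ t, gap c s (H.at' i t) = 0 := by
  rw [gap_at] at h0 h1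
  have h2 : (t₀ - t₁) * dot (s - c) (H.ed i) = 0 := by linarith
  have h3 := (mul_eq_zero.1 h2).resolve_left (sub_ne_zero.2 hne)
  refine ⟨h3, fun t => ?_⟩
  rw [gap_at, h3]
  rw [h3] at h0
  linarith

/-- If the hull is a segment, a cell that contains a part of it belongs to a skyline point. -/
theorem mem_skyline_of_segment (hs : H.size = 2) {i : ℕ} {p : Plane} (hp : p ∈ P) {t₀ t₁ : ℝ}
    (h0 : 0 ≤ t₀) (h01 : t₀ < t₁) (h1 : t₁ ≤ 1) (hz0 : H.at' i t₀ ∈ closedVoronoiCell P p)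
    (hz1 : H.at' i t₁ ∈ closedVoronoiCell P p) : p ∈ skyline P Q := by
  refine ⟨hp, fun p' hp' hne hdom => ?_⟩
  have hle : ∀ t, 0 ≤ t → t ≤ 1 → gap p p' (H.at' i t) ≤ 0 := fun t h h' =>
    gap_nonpos_of_dominates hdom (HullRep.at_mem (by omega) h h')
  have e0 := le_antisymm (hle _ h0 (by linarith)) (mem_closed_iff_gap.1 hz0 p' hp')
  have e1 := le_antisymm (hle _ (by linarith) h1) (mem_closed_iff_gap.1 hz1 p' hp')
  have hall := (gap_at_eq_zero h01.ne e0 e1).2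
  have hpt : ∀ k, gap p p' (H.pt k) = 0 := by
    intro k
    have g0 := hall 0
    have g1 := hall 1
    rw [HullRep.at_zero, ← HullRep.pt_mod] at g0
    rw [HullRep.at_one, ← HullRep.pt_mod] at g1
    rw [← HullRep.pt_mod]
    rw [hs] at *
    rcases Nat.mod_two_eq_zero_or_one k with h | h <;>
      rcases Nat.mod_two_eq_zero_or_one i with h' | h' <;> rw [h]
    · rwa [h'] at g0
    · rwa [show (i + 1) % 2 = 0 by omega] at g1
    · rwa [show (i + 1) % 2 = 1 by omega] at g1
    · rwa [h'] at g0
  obtain ⟨x, hx, hxneg⟩ := exists_gap_neg_of_dominates hdom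
  have hconv : Convex ℝ {x | gap p p' x = 0} := by
    intro x hx y hy a b ha hb hab
    simp only [Set.mem_ofPred_eq] at *
    rw [gap_comb _ _ _ _ _ _ hab, hx, hy]; simp
  rw [H.hull_eq] at hx
  have := convexHull_min (by
    rintro _ ⟨j, rfl⟩
    have := hpt j.val
    rwa [HullRep.pt_of_lt j.isLt] at this) hconv hx
  simp only [Set.mem_ofPred_eq] at this
  linarith

/-! ## Cells along a hull edge -/

variable (H) in
/-- The mirror image of a point at the line through the `i`-th hull edge. -/
def mirror (i : ℕ) (p : Plane) : Plane :=
  p - (2 * H.pos i p / dot (H.ed i) (H.ed i)) • rot90 (H.ed i)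

theorem gap_of_perp {i : ℕ} {p : Plane} {l : ℝ} (t : ℝ) :
    gap p (p + l • rot90 (H.ed i)) (H.at' i t) =
      l * (l * dot (H.ed i) (H.ed i) + 2 * H.pos i p) := by
  simp [gap, sqd, HullRep.at', HullRep.pos, dot, cross]; ring

theorem gap_mirror (hs : 2 ≤ H.size) (i : ℕ) (p : Plane) (t : ℝ) :
    gap p (mirror H i p) (H.at' i t) = 0 := by
  have h : mirror H i p = p + (-(2 * H.pos i p / dot (H.ed i) (H.ed i))) • rot90 (H.ed i) := by
    unfold mirror; module
  have := (dot_self_pos (HullRep.ed_ne_zero (H := H) hs i)).ne'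
  rw [h, gap_of_perp]
  field_simp
  ring

theorem pos_mirror (hs : 2 ≤ H.size) (i : ℕ) (p : Plane) : H.pos i (mirror H i p) = - H.pos i p := by
  have h : mirror H i p = p + (-(2 * H.pos i p / dot (H.ed i) (H.ed i))) • rot90 (H.ed i) := by
    unfold mirror; module
  have h2 := (dot_self_pos (HullRep.ed_ne_zero (H := H) hs i)).ne'
  have h3 : cross (H.ed i) (rot90 (H.ed i)) = dot (H.ed i) (H.ed i) := by simp [cross, dot]
  rw [h, HullRep.pos_add_smul, h3]
  field_simp
  ring

theorem eq_mirror_of_ties (hs : 2 ≤ H.size) {i : ℕ} {p s : Plane} {t₀ t₁ : ℝ} (hne : t₀ ≠ t₁)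
    (h0 : gap p s (H.at' i t₀) = 0) (h1 : gap p s (H.at' i t₁) = 0) : s = p ∨ s = mirror H i p := by
  have hd := (dot_self_pos (HullRep.ed_ne_zero (H := H) hs i)).ne'
  obtain ⟨hperp, hall⟩ := gap_at_eq_zero hne h0 h1
  set l := dot (s - p) (rot90 (H.ed i)) / dot (H.ed i) (H.ed i) with hl
  have hsl : s = p + l • rot90 (H.ed i) := by
    apply plane_ext
    · simp [hl]; field_simp; simp [dot] at *; linear_combination (H.ed i 0) * hperp
    · simp [hl]; field_simp; simp [dot] at *; linear_combination (H.ed i 1) * hperp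
  have h2 := hall 0
  rw [hsl, gap_of_perp] at h2
  rcases mul_eq_zero.1 h2 with h | h
  · left; rw [hsl, h]; simp
  · right
    have : l = -(2 * H.pos i p / dot (H.ed i) (H.ed i)) := by field_simp; linarith
    rw [hsl, this, mirror]; module

/-- If the mirror image of `p` is a site, the cell of `p` lies on its side of the line. -/
theorem pos_of_mem_cell (hs : 2 ≤ H.size) {i : ℕ} {p x : Plane} (hr : mirror H i p ∈ P)
    (hne : mirror H i p ≠ p) (hx : x ∈ voronoiCell P p) : 0 < H.pos i p * H.pos i x := by
  have h1 := mem_open_iff_gap.1 hx _ hr hne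
  have hd := dot_self_pos (HullRep.ed_ne_zero (H := H) hs i)
  have h2 : gap p (mirror H i p) x * dot (H.ed i) (H.ed i) = 4 * (H.pos i p * H.pos i x) := by
    have e : gap p (mirror H i p) x = 4 * (H.pos i p * H.pos i x) / dot (H.ed i) (H.ed i) := by
      simp only [gap, sqd, mirror, HullRep.pos, cross, PiLp.sub_apply, PiLp.smul_apply, rot90_zero,
        rot90_one, smul_eq_mul]
      field_simp
      simp only [dot]
      ring
    rw [e]; field_simp
  have := mul_pos h1 hd
  linarith

theorem mirror_mirror (hs : 2 ≤ H.size) (i : ℕ) (p : Plane) : mirror H i (mirror H i p) = p := by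
  have h : mirror H i (mirror H i p) =
    mirror H i p - (2 * H.pos i (mirror H i p) / dot (H.ed i) (H.ed i)) • rot90 (H.ed i) := rfl
  rw [h, pos_mirror hs, mirror]
  module

theorem pos_self_ne_zero {i : ℕ} {p : Plane} (hne : mirror H i p ≠ p) : H.pos i p ≠ 0 := by
  intro h; apply hne; simp [mirror, h]

/-- The open cell meets every interior point of a part of the edge, unless the mirror image is a
site. -/
theorem mem_cell_of_between (hs : 2 ≤ H.size) {i : ℕ} {p : Plane} {t₀ t₁ : ℝ}
    (hz0 : H.at' i t₀ ∈ closedVoronoiCell P p) (hz1 : H.at' i t₁ ∈ closedVoronoiCell P p)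
    (hr : mirror H i p ∈ P → mirror H i p = p) {t : ℝ} (h0 : t₀ < t) (h1 : t < t₁) :
    H.at' i t ∈ voronoiCell P p := by
  rw [mem_open_iff_gap]
  intro s hsP hsp
  have g0 := mem_closed_iff_gap.1 hz0 s hsP
  have g1 := mem_closed_iff_gap.1 hz1 s hsP
  by_contra hneg
  have e0 : gap p s (H.at' i t₀) = 0 ∧ gap p s (H.at' i t₁) = 0 := by
    rw [gap_at] at g0 g1 hneg
    rw [gap_at, gap_at]
    have a0 := mul_nonneg (sub_pos.2 h1).le g0
    have a1 := mul_nonneg (sub_pos.2 h0).le g1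
    have a2 := mul_nonneg (sub_pos.2 (h0.trans h1)).le (not_lt.1 hneg |> sub_nonneg.2)
    constructor
    · have : (t₁ - t) * (gap p s (H.pt i) - 2 * t₀ * dot (s - p) (H.ed i)) = 0 := by linarith
      exact (mul_eq_zero.1 this).resolve_left (sub_pos.2 h1).ne'
    · have : (t - t₀) * (gap p s (H.pt i) - 2 * t₁ * dot (s - p) (H.ed i)) = 0 := by linarith
      exact (mul_eq_zero.1 this).resolve_left (sub_pos.2 h0).ne'
  rcases eq_mirror_of_ties hs (by linarith) e0.1 e0.2 with h | h
  · exact hsp h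
  · rw [h] at hsP hsp; exact hsp (hr hsP)

theorem not_mem_cell_of_mirror (hs : 2 ≤ H.size) {i : ℕ} {p : Plane} (hr : mirror H i p ∈ P)
    (hne : mirror H i p ≠ p) (t : ℝ) : H.at' i t ∉ voronoiCell P p := by
  intro h
  have := pos_of_mem_cell hs hr hne h
  rw [HullRep.pos_at, mul_zero] at this
  exact lt_irrefl _ this

/-- The site to the right of a hull edge of a pair of mirror images is not a seed. -/
theorem disjoint_of_right (hs : 2 ≤ H.size) {i : ℕ} {p : Plane} (hr : mirror H i p ∈ P)
    (hneg : H.pos i p < 0) {x : Plane} (hx : x ∈ voronoiCell P p) : x ∉ queryHull Q := by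
  intro hxQ
  have hne : mirror H i p ≠ p := by
    intro h
    have := pos_mirror (H := H) hs i p
    rw [h] at this; linarith
  have h1 := pos_of_mem_cell hs hr hne hx
  have h2 := HullRep.pos_nonneg (H := H) (by omega) i hxQ
  have := mul_nonpos_of_nonpos_of_nonneg hneg.le h2
  linarith

theorem inner_of_left (hs : 3 ≤ H.size) {i : ℕ} (hi : i < H.size) {p : Plane} {t₀ t₁ : ℝ}
    (h0 : 0 ≤ t₀) (h01 : t₀ < t₁) (h1 : t₁ ≤ 1)
    (hz0 : H.at' i t₀ ∈ closedVoronoiCell P p) (hz1 : H.at' i t₁ ∈ closedVoronoiCell P p)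
    (hpos : 0 < H.pos i p) : MeetsInt P Q p := by
  set t := (t₀ + t₁) / 2 with ht
  have hz : H.at' i t ∈ closedVoronoiCell P p := by
    have := convex_closedVoronoiCell P p hz0 hz1 (a := 1/2) (b := 1/2) (by norm_num)
      (by norm_num) (by norm_num)
    convert this using 1
    simp only [HullRep.at', ht]; module
  have hc := HullRep.corner (H := H) hs hi (t := t) (by linarith) (by linarith)
  have hcr : cross (H.ed i) (p - H.at' i t) = H.pos i p := by
    simp [HullRep.at', HullRep.pos, cross]; ring
  have hb : H.back i t = -H.ed i := by
    unfold HullRep.back; rw [if_neg (by linarith)]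
  obtain ⟨τ, hτ, h⟩ := hc.enter (p - H.at' i t) (by rw [hcr]; exact hpos)
    (by rw [hb, cross_neg_right, ← cross_swap, hcr]; exact hpos)
  have hr0 : 0 < min τ 1 := lt_min hτ one_pos
  refine ⟨_, ?_, h _ hr0 (min_le_left _ _)⟩
  have := comb_mem_voronoiCell (self_mem_voronoiCell P p) hz hr0
    (b := 1 - min τ 1) (by linarith [min_le_right τ 1]) (by ring)
  convert this using 1
  module

theorem inner_of_edge (hs : 3 ≤ H.size) {i : ℕ} {p : Plane} {t₀ t₁ : ℝ}
    (h0 : 0 ≤ t₀) (h01 : t₀ < t₁) (h1 : t₁ ≤ 1)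
    (hz0 : H.at' i t₀ ∈ closedVoronoiCell P p) (hz1 : H.at' i t₁ ∈ closedVoronoiCell P p)
    (hr : mirror H i p ∈ P → mirror H i p = p) : MeetsInt P Q p :=
  inner_of_meets_hull hs ⟨H.at' i ((t₀ + t₁) / 2),
    mem_cell_of_between (by omega) hz0 hz1 hr (by linarith) (by linarith),
    HullRep.at_mem (by omega) (by linarith) (by linarith)⟩

/-- A part of a hull edge belongs to at most one cell inside. -/
theorem eq_of_inner (hs : 3 ≤ H.size) {i : ℕ} {p p' : Plane} (hp : p ∈ P)
    (hp' : p' ∈ P) (hI : MeetsInt P Q p) (hI' : MeetsInt P Q p') {t₀ t₁ : ℝ} (h01 : t₀ ≠ t₁)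
    (hz0 : H.at' i t₀ ∈ closedVoronoiCell P p) (hz1 : H.at' i t₁ ∈ closedVoronoiCell P p)
    (hz0' : H.at' i t₀ ∈ closedVoronoiCell P p') (hz1' : H.at' i t₁ ∈ closedVoronoiCell P p') :
    p = p' := by
  have key : ∀ t, H.at' i t ∈ closedVoronoiCell P p → H.at' i t ∈ closedVoronoiCell P p' →
      gap p p' (H.at' i t) = 0 := fun t h h' => by
    have h1 := mem_closed_iff_gap.1 h p' hp'
    have h2 := mem_closed_iff_gap.1 h' p hp
    rw [gap_swap] at h2
    linarith
  rcases eq_mirror_of_ties (by omega) h01 (key _ hz0 hz0') (key _ hz1 hz1') with h | h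
  · exact h.symm
  · by_contra hne
    rw [h] at hne
    have hr' : mirror H i p' = p := by rw [h, mirror_mirror (by omega)]
    have hnz := pos_self_ne_zero (Ne.symm hne)
    rcases lt_or_gt_of_ne hnz with hneg | hpos
    · obtain ⟨x, hx, hxi⟩ := hI
      exact disjoint_of_right (by omega) (h ▸ hp') hneg hx (interior_subset hxi)
    · obtain ⟨x, hx, hxi⟩ := hI'
      refine disjoint_of_right (by omega) (hr'.symm ▸ hp) ?_ hx (interior_subset hxi)
      rw [h, pos_mirror (by omega)]
      linarith

/-! ## The number of corners of Voronoi cells inside the hull -/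

/-- The vector points upwards, or horizontally to the right. -/
def Up (w : Plane) : Prop := 0 < w 1 ∨ (w 1 = 0 ∧ 0 < w 0)

theorem Up.add {v w : Plane} (hv : Up v) (hw : Up w) : Up (v + w) := by
  rcases hv with h | ⟨h, h'⟩ <;> rcases hw with g | ⟨g, g'⟩ <;> simp only [Up, PiLp.add_apply]
  · left; linarith
  · left; linarith
  · left; linarith
  · right; constructor <;> linarith

theorem Up.smul {w : Plane} (hw : Up w) {t : ℝ} (ht : 0 < t) : Up (t • w) := by
  rcases hw with h | ⟨h, h'⟩ <;> simp only [Up, PiLp.smul_apply, smul_eq_mul]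
  · left; positivity
  · right; exact ⟨by rw [h, mul_zero], by positivity⟩

theorem Up.comb {v w : Plane} (hv : Up v) (hw : Up w) {s t : ℝ} (hs : 0 ≤ s) (ht : 0 ≤ t)
    (h : s • v + t • w ≠ 0) : Up (s • v + t • w) := by
  rcases hs.eq_or_lt with rfl | hs
  · rcases ht.eq_or_lt with rfl | ht
    · simp at h
    · simpa using hw.smul ht
  · rcases ht.eq_or_lt with rfl | ht
    · simpa using hv.smul hs
    · exact (hv.smul hs).add (hw.smul ht)

theorem Up.not_neg {w : Plane} (hw : Up w) : ¬ Up (-w) := by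
  rcases hw with h | ⟨h, h'⟩ <;> rintro (g | ⟨g, g'⟩) <;> simp only [PiLp.neg_apply] at * <;> linarith

theorem up_or_neg {w : Plane} (h : w ≠ 0) : Up w ∨ Up (-w) := by
  simp only [Up, PiLp.neg_apply]
  rcases lt_trichotomy (w 1) 0 with h1 | h1 | h1
  · right; left; linarith
  · rcases lt_trichotomy (w 0) 0 with h0 | h0 | h0
    · right; right; constructor <;> linarith
    · exact absurd (plane_ext h0 h1) h
    · left; right; exact ⟨h1, h0⟩
  · left; left; exact h1

/-- A cell whose directions are restricted by two upward vectors has an extreme point. -/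
theorem up_rot_of_dot {p q d : Plane} (hp : Up p) (hq : Up q) (hc : 0 < cross p q) (hd : d ≠ 0)
    (h1 : 0 ≤ dot p d) (h2 : dot q d ≤ 0) : Up (rot90 d) := by
  have e : rot90 d = (-dot q d / cross p q) • p + (dot p d / cross p q) • q := by
    rw [eq_comb_of_cross (y := rot90 d) hc.ne']
    congr 3
    · simp [cross, rot90, dot]; ring
    · simp [cross, rot90, dot]
  rw [e]
  apply Up.comb hp hq (div_nonneg (by linarith) hc.le) (div_nonneg h1 hc.le)
  rw [← e]
  exact VoronoiRep.rot90_ne_zero hd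

namespace VoronoiRep

variable {P Q : Finset Plane} {V : VoronoiRep P}

/-- The end of the half-edge is the extreme point (with sign `σ`) of the cell of `m`, and the owner
is the lowest (`k = 0`) or the highest (`k = 1`) site at that point, or `m` itself. -/
structure CornerOf (e : Fin V.numEdges) (k : Fin 3) (σ : Bool) (m : Plane) : Prop where
  hasTgt : V.hasTgt e = true
  mem : V.tgt e ∈ closedVoronoiCell P m
  extreme : ∀ x ∈ closedVoronoiCell P m, x ≠ V.tgt e →
    Up (rot90 (if σ then x - V.tgt e else V.tgt e - x))
  lowest : k = 0 → ∀ u ∈ P, V.tgt e ∈ closedVoronoiCell P u → u ≠ V.so e → Up (u - V.so e)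
  highest : k = 1 → ∀ u ∈ P, V.tgt e ∈ closedVoronoiCell P u → u ≠ V.so e → Up (V.so e - u)
  middle : k = 2 → V.so e = m

theorem tgt_mem_owner {e : Fin V.numEdges} (h : V.hasTgt e = true) :
    V.tgt e ∈ closedVoronoiCell P (V.so e) := V.edge_subset_owner e (V.tgt_mem_edge h)

theorem rot90_neg' (d : Plane) : rot90 (-d) = -rot90 d := by
  apply plane_ext <;> simp [rot90]

theorem owner_eq_of_so {e f : Fin V.numEdges} (h : V.so e = V.so f) : V.owner e = V.owner f :=
  V.site_injective h

theorem CornerOf.unique {e f : Fin V.numEdges} {k : Fin 3} {σ : Bool} {m : Plane}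
    (he : V.CornerOf e k σ m) (hf : V.CornerOf f k σ m) : e = f := by
  have hv : V.tgt e = V.tgt f := by
    by_contra hne
    have h1 := he.extreme _ hf.mem (Ne.symm hne)
    have h2 := hf.extreme _ he.mem hne
    apply h1.not_neg
    rw [← rot90_neg']
    convert h2 using 2
    split_ifs <;> abel
  have ho : V.so e = V.so f := by
    by_contra hne
    have e1 := tgt_mem_owner he.hasTgt
    have e2 := tgt_mem_owner hf.hasTgt
    have hk : k = 0 ∨ k = 1 ∨ k = 2 := by omega
    rcases hk with h | h | h
    · have h1 := he.lowest h _ (V.so_mem f) (hv ▸ e2) (Ne.symm hne)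
      have h2 := hf.lowest h _ (V.so_mem e) (hv ▸ e1) hne
      apply h1.not_neg; rwa [neg_sub]
    · have h1 := he.highest h _ (V.so_mem f) (hv ▸ e2) (Ne.symm hne)
      have h2 := hf.highest h _ (V.so_mem e) (hv ▸ e1) hne
      apply h1.not_neg; rwa [neg_sub]
    · exact hne ((he.middle h).trans (hf.middle h).symm)
  have b1 := (next_nxt he.hasTgt).bwd
  have b2 := (next_nxt hf.hasTgt).bwd
  exact Bwd.unique (owner_eq_of_so ho) b1 (hv ▸ b2)

/-- The directions of a cell at a point, restricted by a tie. -/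
theorem dot_le_of_tie {m u v x : Plane} (hu : u ∈ P) (hv : v ∈ closedVoronoiCell P u)
    (hm : m ∈ P) (hv' : v ∈ closedVoronoiCell P m) (hx : x ∈ closedVoronoiCell P m) :
    dot (u - m) (x - v) ≤ 0 := by
  have h0 : gap m u v = 0 := by
    have h1 := mem_closed_iff_gap.1 hv' u hu
    have h2 := mem_closed_iff_gap.1 hv m hm
    rw [gap_swap] at h2; linarith
  have h1 := mem_closed_iff_gap.1 hx u hu
  have : x = v + (1 : ℝ) • (x - v) := by module
  rw [this, gap_add_smul, h0] at h1
  linarith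

/-- A site `m` between two others in the vertical order, all three tied at `v`. -/
theorem extreme_of_between {l m u v : Plane} (hl : l ∈ P) (hm : m ∈ P) (hu : u ∈ P)
    (hvl : v ∈ closedVoronoiCell P l) (hvm : v ∈ closedVoronoiCell P m)
    (hvu : v ∈ closedVoronoiCell P u) (h1 : Up (m - l)) (h2 : Up (u - m))
    (hc : cross (m - l) (u - m) ≠ 0) :
    ∃ σ : Bool, ∀ x ∈ closedVoronoiCell P m, x ≠ v →
      Up (rot90 (if σ then x - v else v - x)) := by
  rcases lt_or_gt_of_ne hc with hc | hc
  · refine ⟨false, fun x hx hne => ?_⟩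
    have d1 := dot_le_of_tie hl hvl hm hvm hx
    have d2 := dot_le_of_tie hu hvu hm hvm hx
    simp only [Bool.false_eq_true, if_false]
    have e1 : dot (m - l) (v - x) = dot (l - m) (x - v) := by simp [dot]; ring
    have e2 : dot (u - m) (v - x) = - dot (u - m) (x - v) := by simp [dot]; ring
    exact up_rot_of_dot h2 h1 (by rw [cross_swap]; linarith) (sub_ne_zero.2 (Ne.symm hne))
      (by linarith) (by linarith)
  · refine ⟨true, fun x hx hne => ?_⟩
    have d1 := dot_le_of_tie hl hvl hm hvm hx
    have d2 := dot_le_of_tie hu hvu hm hvm hx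
    simp only [if_true]
    have e1 : dot (m - l) (x - v) = - dot (l - m) (x - v) := by simp [dot]; ring
    exact up_rot_of_dot h1 h2 hc (sub_ne_zero.2 hne) (by linarith) d2

theorem exists_cornerOf {e : Fin V.numEdges} (h : V.hasTgt e = true) :
    ∃ k σ m, V.CornerOf e k σ m ∧ (m = V.so e ∨ m = V.sn e ∨ m = V.sn (V.nxt e)) := by
  have hn := next_nxt h
  set f := V.nxt e with hf
  have hof : V.so f = V.so e := (so_congr hn.owner_eq).symm
  have hve := V.tgt_mem_edge h
  have hvf : V.tgt e ∈ V.edge f := hn.fwd.1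
  have mc := V.edge_subset_owner e hve
  have ma := V.edge_subset_nbr e hve
  have mb := V.edge_subset_nbr f hvf
  have hcross := hn.cross_pos
  have ca := V.sn_mem e
  have cb := V.sn_mem f
  have cc := V.so_mem e
  have na := V.nrm_ne_zero e
  have nb := V.nrm_ne_zero f
  have hw : ∀ u ∈ P, V.tgt e ∈ closedVoronoiCell P u → u ≠ V.so e →
      ∃ s t : ℝ, 0 ≤ s ∧ 0 ≤ t ∧ u - V.so e = s • V.nrm e + t • V.nrm f := by
    intro u hu hm hne
    have h0 : gap (V.so e) u (V.tgt e) = 0 := by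
      have h1 := mem_closed_iff_gap.1 mc u hu
      have h2 := mem_closed_iff_gap.1 hm _ cc
      rw [gap_swap] at h2; linarith
    have h1 := hn.bwd.le_cross hu h0
    have h2 := hn.fwd.cross_le hu (by rwa [hof])
    rw [hof, cross_swap] at h2
    exact ⟨_, _, div_nonneg (by linarith) hcross.le, div_nonneg h1 hcross.le,
      eq_comb_of_cross hcross.ne'⟩
  unfold nrm at hcross hw na nb
  rw [hof] at hcross hw nb
  set a := V.sn e
  set b := V.sn f
  set c := V.so e
  have c1 : cross (a - c) (b - a) = cross (a - c) (b - c) := by simp [cross]; ring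
  have c2 : cross (b - c) (a - b) = - cross (a - c) (b - c) := by simp [cross]; ring
  have c3 : cross (c - a) (b - c) = - cross (a - c) (b - c) := by simp [cross]; ring
  have c4 : cross (c - b) (a - c) = cross (a - c) (b - c) := by simp [cross]; ring
  have c5 : cross (a - b) (c - a) = - cross (a - c) (b - c) := by simp [cross]; ring
  have c6 : cross (b - a) (c - b) = cross (a - c) (b - c) := by simp [cross]; ring
  have nab : b - a ≠ 0 := by
    intro h0; rw [h0] at c1; simp [cross] at c1; simp [cross] at hcross; linarith
  rcases up_or_neg na with ua | ua <;> rcases up_or_neg nb with ub | ub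
  · have low : ∀ u ∈ P, V.tgt e ∈ closedVoronoiCell P u → u ≠ c → Up (u - c) := by
      intro u hu hm hne
      obtain ⟨s, t, hs, ht, he⟩ := hw u hu hm hne
      rw [he]; apply ua.comb ub hs ht; rw [← he]; exact sub_ne_zero.2 hne
    rcases up_or_neg nab with u1 | u1
    · obtain ⟨σ, hσ⟩ := extreme_of_between cc ca cb mc ma mb ua u1 (by rw [c1]; exact hcross.ne')
      exact ⟨0, σ, a, ⟨h, ma, hσ, fun _ => low, by simp, by simp⟩, by tauto⟩
    · rw [neg_sub] at u1
      obtain ⟨σ, hσ⟩ := extreme_of_between cc cb ca mc mb ma ub u1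
        (by rw [c2]; exact neg_ne_zero.2 hcross.ne')
      exact ⟨0, σ, b, ⟨h, mb, hσ, fun _ => low, by simp, by simp⟩, by tauto⟩
  · rw [neg_sub] at ub
    obtain ⟨σ, hσ⟩ := extreme_of_between cb cc ca mb mc ma ub ua (by rw [c4]; exact hcross.ne')
    exact ⟨2, σ, c, ⟨h, mc, hσ, by simp, by simp, fun _ => rfl⟩, by tauto⟩
  · rw [neg_sub] at ua
    obtain ⟨σ, hσ⟩ := extreme_of_between ca cc cb ma mc mb ua ub
      (by rw [c3]; exact neg_ne_zero.2 hcross.ne')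
    exact ⟨2, σ, c, ⟨h, mc, hσ, by simp, by simp, fun _ => rfl⟩, by tauto⟩
  · have high : ∀ u ∈ P, V.tgt e ∈ closedVoronoiCell P u → u ≠ c → Up (c - u) := by
      intro u hu hm hne
      obtain ⟨s, t, hs, ht, he⟩ := hw u hu hm hne
      have e2 : c - u = s • (-(a - c)) + t • (-(b - c)) := by
        rw [← neg_sub, he]; module
      rw [e2]; apply ua.comb ub hs ht; rw [← e2]; exact sub_ne_zero.2 (Ne.symm hne)
    rw [neg_sub] at ua ub
    rcases up_or_neg nab with u1 | u1
    · obtain ⟨σ, hσ⟩ := extreme_of_between ca cb cc ma mb mc u1 ub (by rw [c6]; exact hcross.ne')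
      exact ⟨1, σ, b, ⟨h, mb, hσ, by simp, fun _ => high, by simp⟩, by tauto⟩
    · rw [neg_sub] at u1
      obtain ⟨σ, hσ⟩ := extreme_of_between cb ca cc mb ma mc u1 ua
        (by rw [c5]; exact neg_ne_zero.2 hcross.ne')
      exact ⟨1, σ, a, ⟨h, ma, hσ, by simp, fun _ => high, by simp⟩, by tauto⟩

/-- There are at most six times as many half-edges with an end whose cells belong to a set of sites
as there are sites in the set. -/
theorem card_corners_le (A : Finset (Fin V.numEdges)) (F : Finset Plane)
    (hA : ∀ e ∈ A, V.hasTgt e = true ∧ V.so e ∈ F ∧ V.sn e ∈ F ∧ V.sn (V.nxt e) ∈ F) :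
    A.card ≤ 6 * F.card := by
  classical
  have hex : ∀ e : Fin V.numEdges, ∃ x : (Fin 3 × Bool) × Plane, e ∈ A →
      V.CornerOf e x.1.1 x.1.2 x.2 ∧ x.2 ∈ F := by
    intro e
    by_cases he : e ∈ A
    · obtain ⟨h1, h2, h3, h4⟩ := hA e he
      obtain ⟨k, σ, m, h, hm⟩ := exists_cornerOf h1
      refine ⟨((k, σ), m), fun _ => ⟨h, ?_⟩⟩
      rcases hm with rfl | rfl | rfl <;> assumption
    · exact ⟨((0, true), 0), fun h => absurd h he⟩
  choose g hg using hex
  have h := Finset.card_le_card_of_injOn (s := A) (t := Finset.univ ×ˢ F) g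
    (fun e he => by simp [(hg e he).2])
    (fun e he f hf hef => by
      have h1 := (hg e he).1
      have h2 := (hg f hf).1
      rw [hef] at h1
      exact h1.unique h2)
  rw [Finset.card_product] at h
  simpa using h

end VoronoiRep

/-! ## The number of pieces into which the cells cut the boundary of the hull -/

variable (P H) in
/-- The closed cell of `p` contains a part of the `i`-th hull edge. -/
def Piece (i : ℕ) (p : Plane) : Prop :=
  ∃ t₀ t₁ : ℝ, 0 ≤ t₀ ∧ t₀ < t₁ ∧ t₁ ≤ 1 ∧ H.at' i t₀ ∈ closedVoronoiCell P p ∧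
    H.at' i t₁ ∈ closedVoronoiCell P p

/-- The orientation of a triangle. -/
def orient (a b c : Plane) : ℝ := cross (b - a) (c - a)

theorem orient_rot (a b c : Plane) : orient b c a = orient a b c := by
  simp [orient, cross]; ring

theorem orient_comb_right (a b c d : Plane) (s : ℝ) :
    orient a b ((1 - s) • c + s • d) = (1 - s) * orient a b c + s * orient a b d := by
  simp [orient, cross]; ring

theorem orient_comb_mid (a b c d : Plane) (s : ℝ) :
    orient a ((1 - s) • c + s • d) b = (1 - s) * orient a c b + s * orient a d b := by
  simp [orient, cross]; ring

theorem orient_comb_left (a b c d : Plane) (s : ℝ) :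
    orient ((1 - s) • c + s • d) a b = (1 - s) * orient c a b + s * orient d a b := by
  simp [orient, cross]; ring

/-- Four points with an affine function. -/
theorem orient_gap (a b c d p s : Plane) :
    orient b c d * gap p s a + orient d a b * gap p s c =
      orient c d a * gap p s b + orient a b c * gap p s d := by
  simp [orient, cross, gap, sqd]; ring

theorem orient_at_pos (hs : 3 ≤ H.size) {i j k : ℕ} (hij : i < j) (hjk : j < k) (hk : k < H.size)
    {s t r : ℝ} (hs0 : 0 ≤ s) (hs1 : s < 1) (ht0 : 0 ≤ t) (ht1 : t < 1) (hr0 : 0 ≤ r)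
    (hr1 : r < 1) : 0 < orient (H.at' i s) (H.at' j t) (H.at' k r) := by
  have key : ∀ a b : ℕ, (a = i ∨ a = i + 1) → (b = j ∨ b = j + 1) →
      0 ≤ orient (H.pt a) (H.pt b) (H.at' k r) := by
    intro a b ha hb
    rw [HullRep.at_eq_comb, orient_comb_right]
    have h1 : 0 ≤ orient (H.pt a) (H.pt b) (H.pt k) :=
      HullRep.orient_nonneg hs (by omega) (by omega) (by omega)
    have h2 : 0 ≤ orient (H.pt a) (H.pt b) (H.pt (k + 1)) :=
      HullRep.orient_nonneg hs (by omega) (by omega) (by omega)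
    have := mul_nonneg (sub_nonneg.2 hr1.le) h1
    have := mul_nonneg hr0 h2
    linarith
  have key1 : 0 < orient (H.pt i) (H.pt j) (H.at' k r) := by
    rw [HullRep.at_eq_comb, orient_comb_right]
    have h1 : 0 < orient (H.pt i) (H.pt j) (H.pt k) := HullRep.orient_pos hs hij hjk hk
    have h2 : 0 ≤ orient (H.pt i) (H.pt j) (H.pt (k + 1)) :=
      HullRep.orient_nonneg hs (by omega) (by omega) (by omega)
    have := mul_pos (sub_pos.2 hr1) h1
    have := mul_nonneg hr0 h2
    linarith
  rw [HullRep.at_eq_comb i, orient_comb_left, HullRep.at_eq_comb j, orient_comb_mid, orient_comb_mid]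
  have g1 := mul_pos (sub_pos.2 ht1) key1
  have g2 := mul_nonneg ht0 (key i (j + 1) (Or.inl rfl) (Or.inr rfl))
  have g3 := mul_nonneg (sub_pos.2 ht1).le (key (i + 1) j (Or.inr rfl) (Or.inl rfl))
  have g4 := mul_nonneg ht0 (key (i + 1) (j + 1) (Or.inr rfl) (Or.inr rfl))
  have g5 := mul_pos (sub_pos.2 hs1) (add_pos_of_pos_of_nonneg g1 g2)
  have g6 := mul_nonneg hs0 (add_nonneg g3 g4)
  linarith

theorem orient_at_same (j : ℕ) (s t : ℝ) (x : Plane) :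
    orient (H.at' j s) (H.at' j t) x = (t - s) * H.pos j x := by
  simp [orient, HullRep.at', HullRep.pos, cross]; ring

theorem mem_closed_of_tie {p p' x : Plane} (h : x ∈ closedVoronoiCell P p) (h0 : gap p p' x = 0) :
    x ∈ closedVoronoiCell P p' := by
  rw [mem_closedVoronoiCell] at h ⊢
  intro s hs
  have := h s hs
  unfold gap at h0; linarith

theorem mem_closed_between {p : Plane} {i : ℕ} {t₀ t₁ t : ℝ}
    (h₀ : H.at' i t₀ ∈ closedVoronoiCell P p) (h₁ : H.at' i t₁ ∈ closedVoronoiCell P p)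
    (ht₀ : t₀ ≤ t) (ht₁ : t ≤ t₁) : H.at' i t ∈ closedVoronoiCell P p := by
  rw [mem_closed_iff_gap] at h₀ h₁ ⊢
  intro s hs
  have g0 := h₀ s hs
  have g1 := h₁ s hs
  rw [gap_at] at g0 g1 ⊢
  rcases le_total 0 (dot (s - p) (H.ed i)) with h | h <;> nlinarith

/-- Two different cells that meet the interior of the hull do not share a part of an edge. -/
theorem gap_pos_of_piece (hs : 3 ≤ H.size) {i : ℕ} {p p' : Plane} (hp : p ∈ P) (hp' : p' ∈ P)
    (hI : MeetsInt P Q p) (hI' : MeetsInt P Q p') (hne : p ≠ p') {t₀ t₁ : ℝ} (h01 : t₀ < t₁)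
    (h0 : H.at' i t₀ ∈ closedVoronoiCell P p) (h1 : H.at' i t₁ ∈ closedVoronoiCell P p) :
    0 < gap p p' (H.at' i ((t₀ + t₁) / 2)) := by
  by_contra hn
  have g0 := mem_closed_iff_gap.1 h0 p' hp'
  have g1 := mem_closed_iff_gap.1 h1 p' hp'
  have e0 : gap p p' (H.at' i t₀) = 0 := by rw [gap_at] at *; linarith
  have e1 : gap p p' (H.at' i t₁) = 0 := by rw [gap_at] at *; linarith
  exact hne (eq_of_inner hs hp hp' hI hI' h01.ne h0 h1 (mem_closed_of_tie h0 e0)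
    (mem_closed_of_tie h1 e1))

theorem no_crossing (hs : 3 ≤ H.size) {i j k : ℕ} (hij : i < j) (hjk : j < k) (hk : k < H.size)
    {p p' : Plane} (hp : p ∈ P) (hp' : p' ∈ P) (hI : MeetsInt P Q p) (hI' : MeetsInt P Q p')
    (hne : p ≠ p') {t₀ t₁ s₀ s₁ : ℝ} (h0 : 0 ≤ t₀) (h01 : t₀ < t₁) (hts : t₁ ≤ s₀)
    (hs01 : s₀ < s₁) (hs1 : s₁ ≤ 1)
    (ht0 : H.at' j t₀ ∈ closedVoronoiCell P p) (ht1 : H.at' j t₁ ∈ closedVoronoiCell P p)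
    (hs0 : H.at' j s₀ ∈ closedVoronoiCell P p') (hs1' : H.at' j s₁ ∈ closedVoronoiCell P p')
    (hpk : Piece P H k p) (hpi : Piece P H i p') : False := by
  obtain ⟨a₀, a₁, ha0, ha01, ha1, hA0, hA1⟩ := hpk
  obtain ⟨b₀, b₁, hb0, hb01, hb1, hB0, hB1⟩ := hpi
  have id := orient_gap (H.at' i ((b₀ + b₁) / 2)) (H.at' j ((t₀ + t₁) / 2))
    (H.at' j ((s₀ + s₁) / 2)) (H.at' k ((a₀ + a₁) / 2)) p p'
  have f1 := gap_pos_of_piece hs hp hp' hI hI' hne h01 ht0 ht1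
  have f2 := mem_closed_iff_gap.1
    (mem_closed_between hA0 hA1 (t := (a₀ + a₁) / 2) (by linarith) (by linarith)) p' hp'
  have f3 := mem_closed_iff_gap.1
    (mem_closed_between hs0 hs1' (t := (s₀ + s₁) / 2) (by linarith) (by linarith)) p hp
  have f4 := mem_closed_iff_gap.1
    (mem_closed_between hB0 hB1 (t := (b₀ + b₁) / 2) (by linarith) (by linarith)) p hp
  rw [gap_swap] at f3 f4
  have hm : 0 < H.size := by omega
  rw [orient_at_same, ← orient_rot (H.at' i _) (H.at' j _) (H.at' j _), orient_at_same] at id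
  have q1 := HullRep.pos_nonneg hm j
    (HullRep.at_mem hm (i := k) (t := (a₀ + a₁) / 2) (by linarith) (by linarith))
  have q2 := HullRep.pos_nonneg hm j
    (HullRep.at_mem hm (i := i) (t := (b₀ + b₁) / 2) (by linarith) (by linarith))
  have o1 := orient_at_pos hs hij hjk hk (s := (b₀ + b₁) / 2) (t := (t₀ + t₁) / 2)
    (r := (a₀ + a₁) / 2) (by linarith) (by linarith) (by linarith) (by linarith) (by linarith)
    (by linarith)
  have o2 := orient_at_pos hs hij hjk hk (s := (b₀ + b₁) / 2) (t := (s₀ + s₁) / 2)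
    (r := (a₀ + a₁) / 2) (by linarith) (by linarith) (by linarith) (by linarith) (by linarith)
    (by linarith)
  have hd : 0 ≤ (s₀ + s₁) / 2 - (t₀ + t₁) / 2 := by linarith
  have m1 := mul_nonneg (mul_nonneg hd q1) (by linarith : 0 ≤ -gap p p' (H.at' i ((b₀ + b₁) / 2)))
  have m2 := mul_nonneg o1.le (by linarith : 0 ≤ -gap p p' (H.at' j ((s₀ + s₁) / 2)))
  have m3 := mul_pos o2 f1
  have m4 := mul_nonneg (mul_nonneg hd q2) f2
  have r1 := orient_rot (H.at' i ((b₀ + b₁) / 2)) (H.at' j ((t₀ + t₁) / 2)) (H.at' k ((a₀ + a₁) / 2))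
  have r2 := orient_rot (H.at' j ((t₀ + t₁) / 2)) (H.at' k ((a₀ + a₁) / 2)) (H.at' i ((b₀ + b₁) / 2))
  have r3 := orient_rot (H.at' i ((b₀ + b₁) / 2)) (H.at' j ((s₀ + s₁) / 2)) (H.at' k ((a₀ + a₁) / 2))
  simp only [r1, r2, r3] at id
  linarith

/-- At most one cell has an inner piece on a given edge. -/
theorem inner_piece_unique (hs : 3 ≤ H.size) {i i' j k k' : ℕ} (hij : i < j) (hjk : j < k)
    (hk : k < H.size) (hij' : i' < j) (hjk' : j < k') (hk' : k' < H.size)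
    {p p' : Plane} (hp : p ∈ P) (hp' : p' ∈ P) (hI : MeetsInt P Q p) (hI' : MeetsInt P Q p')
    (h1 : Piece P H i p) (h2 : Piece P H j p) (h3 : Piece P H k p)
    (h1' : Piece P H i' p') (h2' : Piece P H j p') (h3' : Piece P H k' p') : p = p' := by
  by_contra hne
  obtain ⟨t₀, t₁, ht0, ht01, ht1, hA0, hA1⟩ := h2
  obtain ⟨s₀, s₁, hs0, hs01, hs1, hB0, hB1⟩ := h2'
  rcases le_or_gt t₁ s₀ with h | h
  · exact no_crossing hs hij' hjk hk hp hp' hI hI' hne ht0 ht01 h hs01 hs1 hA0 hA1 hB0 hB1 h3 h1'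
  rcases le_or_gt s₁ t₀ with h' | h'
  · exact no_crossing hs hij hjk' hk' hp' hp hI' hI (Ne.symm hne) hs0 hs01 h' ht01 ht1 hB0 hB1 hA0
      hA1 h3' h1
  have hm : max t₀ s₀ < min t₁ s₁ := by
    rw [max_lt_iff, lt_min_iff, lt_min_iff]; exact ⟨⟨ht01, h'⟩, h, hs01⟩
  refine hne (eq_of_inner hs hp hp' hI hI' hm.ne
    (mem_closed_between hA0 hA1 (le_max_left _ _) (hm.le.trans (min_le_left _ _)))
    (mem_closed_between hA0 hA1 ((le_max_left _ _).trans hm.le) (min_le_left _ _))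
    (mem_closed_between hB0 hB1 (le_max_right _ _) (hm.le.trans (min_le_right _ _)))
    (mem_closed_between hB0 hB1 ((le_max_right _ _).trans hm.le) (min_le_right _ _)))

theorem card_pieces_le (hs : 3 ≤ H.size) (R : Finset (ℕ × Plane)) (F : Finset Plane)
    (hR : ∀ x ∈ R, x.1 < H.size ∧ x.2 ∈ F ∧ Piece P H x.1 x.2)
    (hF : ∀ p ∈ F, p ∈ P ∧ MeetsInt P Q p) : R.card ≤ 2 * F.card + H.size := by
  classical
  set R₀ := R.filter fun x => ∀ y ∈ R, y.2 = x.2 → x.1 ≤ y.1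
  set R₁ := R.filter fun x => ∀ y ∈ R, y.2 = x.2 → y.1 ≤ x.1
  set R₂ := R.filter fun x => (∃ y ∈ R, y.2 = x.2 ∧ y.1 < x.1) ∧ ∃ y ∈ R, y.2 = x.2 ∧ x.1 < y.1
  have hsub : R ⊆ R₀ ∪ R₁ ∪ R₂ := by
    intro x hx
    simp only [R₀, R₁, R₂, Finset.mem_union, Finset.mem_filter, hx, true_and]
    by_contra hn
    push Not at hn
    obtain ⟨⟨⟨y, hy, e, hl⟩, z, hz, e', hl'⟩, h⟩ := hn
    exact absurd (h ⟨y, hy, e, hl⟩ z hz e') (not_le.2 hl')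
  have c0 : R₀.card ≤ F.card := by
    apply Finset.card_le_card_of_injOn Prod.snd
    · intro x hx; exact (hR x (Finset.mem_filter.1 hx).1).2.1
    · intro x hx y hy hxy
      have hx' := Finset.mem_filter.1 hx
      have hy' := Finset.mem_filter.1 hy
      exact Prod.ext (le_antisymm (hx'.2 y hy'.1 hxy.symm) (hy'.2 x hx'.1 hxy)) hxy
  have c1 : R₁.card ≤ F.card := by
    apply Finset.card_le_card_of_injOn Prod.snd
    · intro x hx; exact (hR x (Finset.mem_filter.1 hx).1).2.1
    · intro x hx y hy hxy
      have hx' := Finset.mem_filter.1 hx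
      have hy' := Finset.mem_filter.1 hy
      exact Prod.ext (le_antisymm (hy'.2 x hx'.1 hxy) (hx'.2 y hy'.1 hxy.symm)) hxy
  have c2 : R₂.card ≤ (Finset.range H.size).card := by
    apply Finset.card_le_card_of_injOn Prod.fst
    · intro x hx; simpa using (hR x (Finset.mem_filter.1 hx).1).1
    · intro x hx y hy hxy
      obtain ⟨hx1, ⟨a, ha, ea, la⟩, b, hb, eb, lb⟩ := Finset.mem_filter.1 hx
      obtain ⟨hy1, ⟨c, hc, ec, lc⟩, d, hd, ed, ld⟩ := Finset.mem_filter.1 hy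
      have ax := hR a ha; have bx := hR b hb; have cx := hR c hc; have dx := hR d hd
      have xx := hR x hx1; have yx := hR y hy1
      refine Prod.ext hxy (inner_piece_unique hs la lb bx.1 (hxy ▸ lc) (hxy ▸ ld) dx.1
        (hF _ xx.2.1).1 (hF _ yx.2.1).1 (hF _ xx.2.1).2 (hF _ yx.2.1).2 (ea ▸ ax.2.2) xx.2.2
        (eb ▸ bx.2.2) (ec ▸ cx.2.2) (hxy ▸ yx.2.2) (ed ▸ dx.2.2))
  have h1 := Finset.card_le_card hsub
  have h2 := Finset.card_union_le (R₀ ∪ R₁) R₂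
  have h3 := Finset.card_union_le R₀ R₁
  rw [Finset.card_range] at c2
  omega

/-! ## The edges of a Voronoi cell at the boundary of the hull -/

theorem gap_eq_zero_of_closed {p s z : Plane} (hp : p ∈ P) (hs : s ∈ P)
    (h : z ∈ closedVoronoiCell P p) (h' : z ∈ closedVoronoiCell P s) : gap p s z = 0 := by
  have h1 := mem_closed_iff_gap.1 h s hs
  have h2 := mem_closed_iff_gap.1 h' p hp
  rw [gap_swap] at h2; linarith

theorem dot_nonpos_of_enters {p s z a : Plane} (hs : s ∈ P) (h0 : gap p s z = 0)
    (h : Enters (closedVoronoiCell P p) z a) : dot (s - p) a ≤ 0 := by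
  obtain ⟨τ, hτ, h⟩ := h
  have := mem_closed_iff_gap.1 (h τ hτ le_rfl) s hs
  rw [gap_add_smul, h0] at this
  by_contra hn
  have := mul_pos hτ (not_le.1 hn)
  linarith

theorem enters_of_dot_eq_zero {p s z a : Plane} (h0 : gap p s z = 0)
    (h : Enters (closedVoronoiCell P p) z a) (hd : dot (s - p) a = 0) :
    Enters (closedVoronoiCell P s) z a := by
  obtain ⟨τ, hτ, h⟩ := h
  refine ⟨τ, hτ, fun t ht ht' => mem_closed_of_tie (h t ht ht') ?_⟩
  rw [gap_add_smul, h0, hd]; ring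

theorem dot_mul_cross (w a d x : Plane) :
    dot w a * cross d x = dot w d * cross a x + dot w x * cross d a := by
  simp [dot, cross]; ring

theorem dot_sub_left_neg (p s a : Plane) : dot (p - s) a = - dot (s - p) a := by
  simp [dot]; ring

variable (H) in
/-- A boundary point of the hull with the directions of the boundary there. -/
def BdPt (z u v : Plane) : Prop :=
  ∃ i t, i < H.size ∧ 0 ≤ t ∧ t < 1 ∧ z = H.at' i t ∧ u = H.ed i ∧ v = H.back i t

theorem BdPt.corner (hs : 3 ≤ H.size) {z u v : Plane} (h : BdPt H z u v) :
    Corner (queryHull Q) z u v := by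
  obtain ⟨i, t, hi, h0, h1, rfl, rfl, rfl⟩ := h
  exact HullRep.corner hs hi h0 h1

theorem BdPt.cross_nonneg (hs : 3 ≤ H.size) {z u v : Plane} (h : BdPt H z u v) :
    0 ≤ cross u v := by
  obtain ⟨i, t, hi, h0, h1, rfl, rfl, rfl⟩ := h
  unfold HullRep.back
  split_ifs
  · have := HullRep.cross_ed_pos hs (i + H.size - 1)
    rw [show i + H.size - 1 + 1 = i + H.size by omega,
      show H.ed (i + H.size) = H.ed i by
        rw [← HullRep.ed_mod (by omega) (i + H.size), Nat.add_mod_right,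
          HullRep.ed_mod (by omega)]] at this
    rw [cross_neg_right, ← cross_swap]; exact this.le
  · rw [cross_neg_right, cross_eq_zero_self]; simp

theorem at_back (hs : 0 < H.size) (i : ℕ) (t : ℝ) :
    ∃ i' t', H.at' i t = H.at' i' t' ∧ ∀ r, H.at' i t + r • H.back i t = H.at' i' (t' - r) := by
  unfold HullRep.back
  split_ifs with h
  · refine ⟨i + H.size - 1, 1, ?_, fun r => ?_⟩
    · rw [h, HullRep.at_one, HullRep.at_zero, show i + H.size - 1 + 1 = i + H.size by omega,
        HullRep.pt_add_size]
    · rw [smul_neg, ← sub_eq_add_neg, h, HullRep.at_zero]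
      have : H.pt i = H.at' (i + H.size - 1) 1 := by
        rw [HullRep.at_one, show i + H.size - 1 + 1 = i + H.size by omega, HullRep.pt_add_size]
      rw [this, sub_eq_add_neg, ← neg_smul, HullRep.at_add, sub_eq_add_neg]
  · exact ⟨i, t, rfl, fun r => by
      rw [smul_neg, ← neg_smul, HullRep.at_add, sub_eq_add_neg]⟩

theorem BdPt.eq_left (hs : 3 ≤ H.size) {z u v p p' : Plane} (h : BdPt H z u v)
    (hp : p ∈ P) (hp' : p' ∈ P) (hI : MeetsInt P Q p) (hI' : MeetsInt P Q p')
    (hz : z ∈ closedVoronoiCell P p) (hz' : z ∈ closedVoronoiCell P p')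
    (he : Enters (closedVoronoiCell P p) z u) (he' : Enters (closedVoronoiCell P p') z u) :
    p = p' := by
  obtain ⟨i, t, hi, h0, h1, rfl, rfl, rfl⟩ := h
  obtain ⟨τ, hτ, he⟩ := he
  obtain ⟨τ', hτ', he'⟩ := he'
  have hm : 0 < min τ τ' := lt_min hτ hτ'
  have e1 := he _ hm (min_le_left _ _)
  have e2 := he' _ hm (min_le_right _ _)
  rw [HullRep.at_add] at e1 e2
  exact eq_of_inner hs hp hp' hI hI' (lt_add_of_pos_right t hm).ne hz e1 hz' e2

theorem BdPt.eq_right (hs : 3 ≤ H.size) {z u v p p' : Plane} (h : BdPt H z u v)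
    (hp : p ∈ P) (hp' : p' ∈ P) (hI : MeetsInt P Q p) (hI' : MeetsInt P Q p')
    (hz : z ∈ closedVoronoiCell P p) (hz' : z ∈ closedVoronoiCell P p')
    (he : Enters (closedVoronoiCell P p) z v) (he' : Enters (closedVoronoiCell P p') z v) :
    p = p' := by
  obtain ⟨i, t, hi, h0, h1, rfl, rfl, rfl⟩ := h
  obtain ⟨τ, hτ, he⟩ := he
  obtain ⟨τ', hτ', he'⟩ := he'
  obtain ⟨i', t', e, hr⟩ := at_back (H := H) (by omega) i t
  have hm : 0 < min τ τ' := lt_min hτ hτ'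
  have e1 := he _ hm (min_le_left _ _)
  have e2 := he' _ hm (min_le_right _ _)
  rw [hr] at e1 e2
  rw [e] at hz hz'
  exact eq_of_inner hs hp hp' hI hI' (sub_lt_self t' hm).ne' hz e1 hz' e2

namespace VoronoiRep

variable (V Q) in
/-- The half-edge meets the interior of the hull. -/
def Inside (e : Fin V.numEdges) : Prop := (V.edge e ∩ interior (queryHull Q)).Nonempty

theorem dot_dir (w : Plane) (e : Fin V.numEdges) : dot w (V.dir e) = cross (V.nrm e) w := by
  simp [dot, dir, rot90, cross]; ring

theorem cross_dir_dir (e f : Fin V.numEdges) :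
    cross (V.dir e) (V.dir f) = cross (V.nrm e) (V.nrm f) := by
  simp [dir, rot90, cross]; ring

/-- An inner point of the open cell lies strictly to the left of the boundary of the cell. -/
theorem cross_dir_pos_of_open {e : Fin V.numEdges} {x z : Plane} (hx : x ∈ voronoiCell P (V.so e))
    (hz : z ∈ V.edge e) : 0 < cross (V.dir e) (x - z) :=
  cross_dir_pos (voronoiCell_subset_closed hx)
    (fun h => V.sn_ne_so e (eq_of_mem_open_of_mem_closed (V.so_mem e) (V.sn_mem e) hx
      (V.edge_subset_nbr e h))) hz

theorem dot_neg_of_open {p s x z : Plane} (hs : s ∈ P) (hne : s ≠ p) (hx : x ∈ voronoiCell P p)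
    (h0 : gap p s z = 0) : dot (s - p) (x - z) < 0 := by
  have h1 := mem_open_iff_gap.1 hx s hs hne
  rw [show x = z + (1 : ℝ) • (x - z) by module, gap_add_smul, h0] at h1
  linarith

theorem cross_dir_nonneg_of_enters {e : Fin V.numEdges} {z a : Plane} (hz : z ∈ V.edge e)
    (h : Enters (closedVoronoiCell P (V.so e)) z a) : 0 ≤ cross (V.dir e) a := by
  obtain ⟨τ, hτ, h⟩ := h
  have := cross_dir_nonneg (h τ hτ le_rfl) hz
  rw [add_sub_cancel_left, cross_smul_right] at this
  exact nonneg_of_mul_nonneg_right this hτ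

theorem fwd_left (hs : 3 ≤ H.size) {z u v : Plane} (hB : BdPt H z u v) {h : Fin V.numEdges}
    (hF : V.Fwd h z) (hI : MeetsInt P Q (V.so h)) {s : Plane} (hsP : s ∈ P) (hne : s ≠ V.so h)
    (hI' : MeetsInt P Q s) (hz : z ∈ closedVoronoiCell P s)
    (hv : Enters (closedVoronoiCell P (V.so h)) z v) : 0 < cross (V.dir h) v := by
  have hzp := V.edge_subset_owner h hF.1
  have h0 := gap_eq_zero_of_closed (V.so_mem h) hsP hzp hz
  refine lt_of_le_of_ne (cross_dir_nonneg_of_enters hF.1 hv) fun hc => hne ?_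
  obtain ⟨x, hx, hxi⟩ := hI
  have hdx := cross_dir_pos_of_open hx hF.1
  have hxv := (hB.corner hs).right_int x hxi
  have hd := hF.cross_le hsP h0
  rw [← dot_dir] at hd
  have hdv := dot_nonpos_of_enters hsP h0 hv
  have id := dot_mul_cross (s - V.so h) v (V.dir h) (x - z)
  rw [← hc, mul_zero, add_zero, cross_swap (x - z) v] at id
  have : 0 ≤ dot (s - V.so h) v := by
    by_contra hn
    have h1 := mul_neg_of_neg_of_pos (not_le.1 hn) hdx
    have h2 := mul_nonneg (neg_nonneg.2 hd) hxv.le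
    linarith
  exact (hB.eq_right hs (V.so_mem h) hsP ⟨x, hx, hxi⟩ hI' hzp hz hv
    (enters_of_dot_eq_zero h0 hv (le_antisymm hdv this))).symm

theorem fwd_right (hs : 3 ≤ H.size) {z u v : Plane} (hB : BdPt H z u v) {h : Fin V.numEdges}
    (hF : V.Fwd h z) (hI : MeetsInt P Q (V.so h)) {s : Plane} (hsP : s ∈ P) (hne : s ≠ V.so h)
    (hI' : MeetsInt P Q s) (hz : z ∈ closedVoronoiCell P s)
    (hu : Enters (closedVoronoiCell P s) z u) : 0 < cross u (V.dir h) := by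
  by_contra hn
  have hzp := V.edge_subset_owner h hF.1
  have h0 := gap_eq_zero_of_closed (V.so_mem h) hsP hzp hz
  have h0' := gap_eq_zero_of_closed hsP (V.so_mem h) hz hzp
  obtain ⟨x, hx, hxi⟩ := hI
  have hdx := cross_dir_pos_of_open hx hF.1
  have hux := (hB.corner hs).left_int x hxi
  have hd := hF.cross_le hsP h0
  rw [← dot_dir] at hd
  have hdu := dot_nonpos_of_enters (V.so_mem h) h0' hu
  rw [dot_sub_left_neg] at hdu
  have hwx := dot_neg_of_open hsP hne hx h0
  have id := dot_mul_cross (s - V.so h) u (V.dir h) (x - z)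
  rw [cross_swap u (V.dir h)] at id
  have : dot (s - V.so h) u ≤ 0 := by
    by_contra hn'
    have h1 := mul_pos (not_le.1 hn') hdx
    have h2 := mul_nonneg (neg_nonneg.2 hd) hux.le
    have h3 := mul_nonneg (neg_nonneg.2 hwx.le) (neg_nonneg.2 (not_lt.1 hn))
    linarith
  refine hne (hB.eq_left hs (V.so_mem h) hsP ⟨x, hx, hxi⟩ hI' hzp hz
    (enters_of_dot_eq_zero h0' hu ?_) hu).symm
  rw [dot_sub_left_neg]; linarith

theorem bwd_right (hs : 3 ≤ H.size) {z u v : Plane} (hB : BdPt H z u v) {h : Fin V.numEdges}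
    (hF : V.Bwd h z) (hI : MeetsInt P Q (V.so h)) {s : Plane} (hsP : s ∈ P) (hne : s ≠ V.so h)
    (hI' : MeetsInt P Q s) (hz : z ∈ closedVoronoiCell P s)
    (hu : Enters (closedVoronoiCell P (V.so h)) z u) : 0 < cross (V.dir h) u := by
  have hzp := V.edge_subset_owner h hF.1
  have h0 := gap_eq_zero_of_closed (V.so_mem h) hsP hzp hz
  refine lt_of_le_of_ne (cross_dir_nonneg_of_enters hF.1 hu) fun hc => hne ?_
  obtain ⟨x, hx, hxi⟩ := hI
  have hdx := cross_dir_pos_of_open hx hF.1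
  have hux := (hB.corner hs).left_int x hxi
  have hd := hF.le_cross hsP h0
  rw [← dot_dir] at hd
  have hdu := dot_nonpos_of_enters hsP h0 hu
  have id := dot_mul_cross (s - V.so h) u (V.dir h) (x - z)
  rw [← hc, mul_zero, add_zero] at id
  have : 0 ≤ dot (s - V.so h) u := by
    by_contra hn
    have h1 := mul_neg_of_neg_of_pos (not_le.1 hn) hdx
    have h2 := mul_nonneg hd hux.le
    linarith
  exact (hB.eq_left hs (V.so_mem h) hsP ⟨x, hx, hxi⟩ hI' hzp hz hu
    (enters_of_dot_eq_zero h0 hu (le_antisymm hdu this))).symm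

theorem bwd_left (hs : 3 ≤ H.size) {z u v : Plane} (hB : BdPt H z u v) {h : Fin V.numEdges}
    (hF : V.Bwd h z) (hI : MeetsInt P Q (V.so h)) {s : Plane} (hsP : s ∈ P) (hne : s ≠ V.so h)
    (hI' : MeetsInt P Q s) (hz : z ∈ closedVoronoiCell P s)
    (hv : Enters (closedVoronoiCell P s) z v) : 0 < cross v (V.dir h) := by
  by_contra hn
  have hzp := V.edge_subset_owner h hF.1
  have h0 := gap_eq_zero_of_closed (V.so_mem h) hsP hzp hz
  have h0' := gap_eq_zero_of_closed hsP (V.so_mem h) hz hzp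
  obtain ⟨x, hx, hxi⟩ := hI
  have hdx := cross_dir_pos_of_open hx hF.1
  have hxv := (hB.corner hs).right_int x hxi
  have hd := hF.le_cross hsP h0
  rw [← dot_dir] at hd
  have hdv := dot_nonpos_of_enters (V.so_mem h) h0' hv
  rw [dot_sub_left_neg] at hdv
  have hwx := dot_neg_of_open hsP hne hx h0
  have id := dot_mul_cross (s - V.so h) v (V.dir h) (x - z)
  rw [cross_swap v (V.dir h), cross_swap (x - z) v] at id
  have : dot (s - V.so h) v ≤ 0 := by
    by_contra hn'
    have h1 := mul_pos (not_le.1 hn') hdx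
    have h2 := mul_nonneg hd hxv.le
    have h3 := mul_nonneg (neg_nonneg.2 hwx.le) (neg_nonneg.2 (not_lt.1 hn))
    linarith
  refine hne (hB.eq_right hs (V.so_mem h) hsP ⟨x, hx, hxi⟩ hI' hzp hz
    (enters_of_dot_eq_zero h0' hv ?_) hv).symm
  rw [dot_sub_left_neg]; linarith

theorem Fwd.inside {K : Set Plane} {h : Fin V.numEdges} {z u v : Plane} (hF : V.Fwd h z)
    (hK : Corner K z u v) (h1 : 0 < cross u (V.dir h)) (h2 : 0 < cross (V.dir h) v) :
    (V.edge h ∩ interior K).Nonempty := by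
  obtain ⟨τ, hτ, he⟩ := hK.enter _ h1 h2
  obtain ⟨τ', hτ', he'⟩ := hF.exists_smul
  have hm : 0 < min τ τ' := lt_min hτ hτ'
  refine ⟨z + min τ τ' • V.dir h, ?_, he _ hm (min_le_left _ _)⟩
  have := (V.convex_edge h).add_smul_sub_mem hF.1 he' (t := min τ τ' / τ')
    ⟨by positivity, (div_le_one hτ').2 (min_le_right _ _)⟩
  rwa [add_sub_cancel_left, smul_smul, div_mul_cancel₀ _ hτ'.ne'] at this

theorem Bwd.inside {K : Set Plane} {h : Fin V.numEdges} {z u v : Plane} (hF : V.Bwd h z)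
    (hK : Corner K z u v) (h1 : 0 < cross (V.dir h) u) (h2 : 0 < cross v (V.dir h)) :
    (V.edge h ∩ interior K).Nonempty := by
  obtain ⟨τ, hτ, he⟩ := hK.enter (-V.dir h) (by rw [cross_neg_right, ← cross_swap]; exact h1)
    (by rw [cross_neg_left, ← cross_swap]; exact h2)
  obtain ⟨τ', hτ', he'⟩ := hF.exists_smul
  have hm : 0 < min τ τ' := lt_min hτ hτ'
  refine ⟨z + min τ τ' • -V.dir h, ?_, he _ hm (min_le_left _ _)⟩
  have := (V.convex_edge h).add_smul_sub_mem hF.1 he' (t := min τ τ' / τ')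
    ⟨by positivity, (div_le_one hτ').2 (min_le_right _ _)⟩
  rwa [show z - τ' • V.dir h - z = τ' • -V.dir h by module, smul_smul,
    div_mul_cancel₀ _ hτ'.ne'] at this

theorem Bwd.not_mem_hull {K : Set Plane} {h : Fin V.numEdges} {z u v : Plane}
    (hK : Corner K z u v) (h1 : 0 < cross (V.dir h) u) {τ : ℝ} (hτ : 0 < τ) :
    z + τ • V.dir h ∉ K := by
  intro hm
  have := hK.left _ hm
  rw [add_sub_cancel_left, cross_smul_right, cross_swap] at this
  have := mul_pos hτ h1
  linarith

theorem meetsInt_of_closed {p x : Plane} (hx : x ∈ closedVoronoiCell P p)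
    (hxi : x ∈ interior (queryHull Q)) : MeetsInt P Q p := by
  by_cases h : p = x
  · exact ⟨x, h ▸ self_mem_voronoiCell P p, hxi⟩
  · obtain ⟨τ, hτ, he⟩ := isOpen_interior.enters hxi (p - x)
    have hm : 0 < min τ 1 := lt_min hτ one_pos
    refine ⟨x + min τ 1 • (p - x), ?_, he _ hm (min_le_left _ _)⟩
    rw [show x + min τ 1 • (p - x) = min τ 1 • p + (1 - min τ 1) • x by module]
    exact comb_mem_voronoiCell (self_mem_voronoiCell P p) hx hm
      (sub_nonneg.2 (min_le_right _ _)) (by ring)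

theorem Inside.owner {e : Fin V.numEdges} (h : V.Inside Q e) : MeetsInt P Q (V.so e) := by
  obtain ⟨x, hx, hi⟩ := h
  exact meetsInt_of_closed (V.edge_subset_owner e hx) hi

theorem Inside.nbr {e : Fin V.numEdges} (h : V.Inside Q e) : MeetsInt P Q (V.sn e) := by
  obtain ⟨x, hx, hi⟩ := h
  exact meetsInt_of_closed (V.edge_subset_nbr e hx) hi

end VoronoiRep

/-! ## Walking along the boundary of a cell inside the hull -/

/-- The cyclic successor of a record. -/
def nextRec (N j : ℕ) : ℕ := if j + 1 < N then j + 1 else 0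

/-- The cyclic predecessor of a record. -/
def prevRec (N j : ℕ) : ℕ := if 0 < j then j - 1 else N - 1

theorem nextRec_lt {N j : ℕ} (h : j < N) : nextRec N j < N := by unfold nextRec; split_ifs <;> omega
theorem prevRec_lt {N j : ℕ} (h : j < N) : prevRec N j < N := by unfold prevRec; split_ifs <;> omega
theorem nextRec_prevRec {N j : ℕ} (h : j < N) : nextRec N (prevRec N j) = j := by
  unfold nextRec prevRec; split_ifs <;> omega
theorem prevRec_nextRec {N j : ℕ} (h : j < N) : prevRec N (nextRec N j) = j := by
  unfold nextRec prevRec; split_ifs <;> omega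

/-- The division of the boundary of the hull into pieces that belong to cells. -/
structure Records (V : VoronoiRep P) (H : HullRep Q) (N : ℕ) (cell : ℕ → Fin P.card)
    (edge : ℕ → ℕ) (lo hi : ℕ → ℝ) : Prop where
  edge_lt : ∀ j < N, edge j < H.size
  lo_nonneg : ∀ j < N, 0 ≤ lo j
  lo_lt_hi : ∀ j < N, lo j < hi j
  hi_le : ∀ j < N, hi j ≤ 1
  lo_mem : ∀ j < N, H.at' (edge j) (lo j) ∈ closedVoronoiCell P (V.site (cell j))
  hi_mem : ∀ j < N, H.at' (edge j) (hi j) ∈ closedVoronoiCell P (V.site (cell j))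
  meets : 3 ≤ H.size → ∀ j < N, MeetsInt P Q (V.site (cell j))
  next : ∀ j < N, (edge (nextRec N j) = edge j ∧ lo (nextRec N j) = hi j) ∨
    (hi j = 1 ∧ lo (nextRec N j) = 0 ∧ edge (nextRec N j) = (edge j + 1) % H.size)
  cover : ∀ i < H.size, ∀ t, 0 ≤ t → t ≤ 1 → ∃ j < N, edge j = i ∧ lo j ≤ t ∧ t ≤ hi j

namespace Records

variable {N : ℕ} {cell : ℕ → Fin P.card} {edge : ℕ → ℕ} {lo hi : ℕ → ℝ}

theorem mem (R : Records V H N cell edge lo hi) {j : ℕ} (hj : j < N) {t : ℝ} (h0 : lo j ≤ t)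
    (h1 : t ≤ hi j) : H.at' (edge j) t ∈ closedVoronoiCell P (V.site (cell j)) :=
  mem_closed_between (R.lo_mem j hj) (R.hi_mem j hj) h0 h1

/-- The record `j` ends at `z`, where the next one starts. -/
structure Junction (R : Records V H N cell edge lo hi) (j : ℕ) (z u v : Plane) : Prop where
  lt : j < N
  bd : BdPt H z u v
  eq_hi : z = H.at' (edge j) (hi j)
  eq_lo : z = H.at' (edge (nextRec N j)) (lo (nextRec N j))
  mem : z ∈ closedVoronoiCell P (V.site (cell j))
  mem_next : z ∈ closedVoronoiCell P (V.site (cell (nextRec N j)))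
  left : Enters (closedVoronoiCell P (V.site (cell j))) z v
  right : Enters (closedVoronoiCell P (V.site (cell (nextRec N j)))) z u

theorem enters_right (R : Records V H N cell edge lo hi) {j : ℕ} (hj : j < N) {t : ℝ}
    (h0 : lo j ≤ t) (h1 : t < hi j) :
    Enters (closedVoronoiCell P (V.site (cell j))) (H.at' (edge j) t) (H.ed (edge j)) := by
  refine ⟨hi j - t, by linarith, fun r hr hr' => ?_⟩
  rw [HullRep.at_add]
  exact R.mem hj (by linarith) (by linarith)

theorem enters_left (R : Records V H N cell edge lo hi) {j : ℕ} (hj : j < N) {t : ℝ}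
    (h0 : lo j < t) (h1 : t ≤ hi j) :
    Enters (closedVoronoiCell P (V.site (cell j))) (H.at' (edge j) t) (-H.ed (edge j)) := by
  refine ⟨t - lo j, by linarith, fun r hr hr' => ?_⟩
  rw [smul_neg, ← neg_smul, HullRep.at_add]
  exact R.mem hj (by linarith) (by linarith)

theorem junction (R : Records V H N cell edge lo hi) {j : ℕ} (hj : j < N) :
    R.Junction j (H.at' (edge j) (hi j)) (H.ed (edge (nextRec N j)))
      (H.back (edge (nextRec N j)) (lo (nextRec N j))) := by
  have hj' := nextRec_lt hj
  have hlt := R.lo_lt_hi _ hj'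
  have hle := R.hi_le _ hj'
  have hm : 0 < H.size := lt_of_le_of_lt (Nat.zero_le _) (R.edge_lt j hj)
  have hz : H.at' (edge j) (hi j) = H.at' (edge (nextRec N j)) (lo (nextRec N j)) := by
    rcases R.next j hj with ⟨h1, h2⟩ | ⟨h1, h2, h3⟩
    · rw [h1, h2]
    · rw [h1, h2, h3, HullRep.at_mod hm, HullRep.at_one_eq]
  refine ⟨hj, ⟨_, _, R.edge_lt _ hj', R.lo_nonneg _ hj', by linarith, hz, rfl, rfl⟩, rfl, hz,
    R.hi_mem j hj, hz ▸ R.lo_mem _ hj', ?_, ?_⟩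
  · have hl := R.enters_left hj (R.lo_lt_hi j hj) le_rfl
    have e : H.back (edge (nextRec N j)) (lo (nextRec N j)) = -H.ed (edge j) := by
      unfold HullRep.back
      rcases R.next j hj with ⟨h1, h2⟩ | ⟨h1, h2, h3⟩
      · have := R.lo_nonneg j hj
        have := R.lo_lt_hi j hj
        rw [if_neg (by linarith), h1]
      · rw [if_pos h2, h3, ← HullRep.ed_mod hm]
        congr 2
        have e1 : (edge j + 1) % H.size + H.size - 1 = (edge j + 1) % H.size + (H.size - 1) := by
          omega
        have e2 : edge j + 1 + (H.size - 1) = edge j + H.size := by omega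
        rw [e1, Nat.mod_add_mod, e2, Nat.add_mod_right, Nat.mod_eq_of_lt (R.edge_lt j hj)]
    rwa [e]
  · rw [hz]; exact R.enters_right hj' le_rfl hlt

/-- The records at a boundary point. -/
theorem at_boundary (R : Records V H N cell edge lo hi) (hs : 3 ≤ H.size) {z : Plane}
    (hz : z ∈ frontier (queryHull Q)) :
    ∃ u v, BdPt H z u v ∧ ((∃ j, R.Junction j z u v) ∨
      ∃ j < N, z ∈ closedVoronoiCell P (V.site (cell j)) ∧
        Enters (closedVoronoiCell P (V.site (cell j))) z u ∧
        Enters (closedVoronoiCell P (V.site (cell j))) z v) := by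
  obtain ⟨i, hi', t, h0, h1, rfl⟩ := (HullRep.mem_frontier_iff' hs).1 hz
  obtain ⟨j, hj, rfl, hl, hh⟩ := R.cover i hi' t h0 h1.le
  rcases hh.eq_or_lt with rfl | hh
  · exact ⟨_, _, (R.junction hj).bd, Or.inl ⟨j, R.junction hj⟩⟩
  · rcases hl.eq_or_lt with rfl | hl
    · have hJ := R.junction (prevRec_lt hj)
      have e := hJ.eq_lo
      rw [nextRec_prevRec hj] at e
      exact ⟨_, _, e ▸ hJ.bd, Or.inl ⟨_, e ▸ hJ⟩⟩
    · refine ⟨_, _, ⟨_, _, hi', h0, h1, rfl, rfl, rfl⟩, Or.inr ⟨j, hj, R.mem hj hl.le hh.le,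
        R.enters_right hj hl.le hh, ?_⟩⟩
      have := R.lo_nonneg j hj
      rw [HullRep.back, if_neg (by linarith)]
      exact R.enters_left hj hl hh.le

/-- The half-edge with which the boundary of a cell enters the hull at the end of a record. -/
def Begin (_ : Records V H N cell edge lo hi) (h : Fin V.numEdges) : Prop :=
  ∃ j < N, cell (nextRec N j) ≠ cell j ∧ V.owner h = cell j ∧ V.Fwd h (H.at' (edge j) (hi j))

/-- The half-edge with which the boundary of a cell leaves the hull at the start of a record. -/
def Finish (_ : Records V H N cell edge lo hi) (h : Fin V.numEdges) : Prop :=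
  ∃ j < N, cell (nextRec N j) ≠ cell j ∧ V.owner h = cell (nextRec N j) ∧
    V.Bwd h (H.at' (edge j) (hi j))

theorem so_of_owner {h : Fin V.numEdges} {c : Fin P.card} (ho : V.owner h = c) :
    V.so h = V.site c := by rw [← ho]; rfl

theorem site_ne {c c' : Fin P.card} (h : c ≠ c') : V.site c ≠ V.site c' :=
  fun e => h (V.site_injective e)

theorem Begin.inside {R : Records V H N cell edge lo hi} (hs : 3 ≤ H.size) {h : Fin V.numEdges}
    (hb : R.Begin h) : V.Inside Q h := by
  obtain ⟨j, hj, hne, ho, hF⟩ := hb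
  have hJ := R.junction hj
  have e := so_of_owner ho
  have hI : MeetsInt P Q (V.so h) := e ▸ R.meets hs j hj
  have hI' := R.meets hs _ (nextRec_lt hj)
  have hne' : V.site (cell (nextRec N j)) ≠ V.so h := e ▸ site_ne hne
  exact hF.inside (hJ.bd.corner hs)
    (VoronoiRep.fwd_right hs hJ.bd hF hI (V.site_mem _) hne' hI' hJ.mem_next hJ.right)
    (VoronoiRep.fwd_left hs hJ.bd hF hI (V.site_mem _) hne' hI' hJ.mem_next (e ▸ hJ.left))

theorem finish_directions {R : Records V H N cell edge lo hi} (hs : 3 ≤ H.size)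
    {h : Fin V.numEdges} {j : ℕ} {z u v : Plane} (hJ : R.Junction j z u v)
    (hne : cell (nextRec N j) ≠ cell j) (ho : V.owner h = cell (nextRec N j)) (hF : V.Bwd h z) :
    0 < cross (V.dir h) u ∧ 0 < cross v (V.dir h) := by
  have e := so_of_owner ho
  have hI : MeetsInt P Q (V.so h) := e ▸ R.meets hs _ (nextRec_lt hJ.lt)
  have hI' := R.meets hs _ hJ.lt
  have hne' : V.site (cell j) ≠ V.so h := e ▸ site_ne hne.symm
  exact ⟨VoronoiRep.bwd_right hs hJ.bd hF hI (V.site_mem _) hne' hI' hJ.mem (e ▸ hJ.right),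
    VoronoiRep.bwd_left hs hJ.bd hF hI (V.site_mem _) hne' hI' hJ.mem hJ.left⟩

end Records

namespace VoronoiRep

theorem mem_edge_add {e : Fin V.numEdges} {y : Plane} (hy : y ∈ V.edge e)
    (ht : V.hasTgt e = false) {t : ℝ} (h : 0 ≤ t) : y + t • V.dir e ∈ V.edge e := by
  rw [mem_edge] at hy ⊢
  refine ⟨by rw [V.gap_add_dir]; exact hy.1, fun hs => ?_, fun h' => by simp [ht] at h'⟩
  have h1 := hy.2.1 hs
  have h2 := mul_nonneg h (V.dot_nrm_pos e).le
  rw [← V.cross_nrm_dir] at h2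
  rw [show y + t • V.dir e - V.src e = (y - V.src e) + t • V.dir e by module, cross_add_right]
  linarith

theorem mem_edge_sub {e : Fin V.numEdges} {y : Plane} (hy : y ∈ V.edge e)
    (ht : V.hasSrc e = false) {t : ℝ} (h : 0 ≤ t) : y - t • V.dir e ∈ V.edge e := by
  rw [mem_edge] at hy ⊢
  refine ⟨by rw [sub_eq_add_neg, ← neg_smul, V.gap_add_dir]; exact hy.1,
    fun h' => by simp [ht] at h', fun hs => ?_⟩
  have h1 := hy.2.2 hs
  have h2 := mul_nonneg h (V.dot_nrm_pos e).le
  rw [← V.cross_nrm_dir] at h2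
  rw [show y - t • V.dir e - V.tgt e = (y - V.tgt e) - t • V.dir e by module, sub_eq_add_neg,
    cross_add_right, cross_neg_right]
  linarith

theorem dir_ne_zero (e : Fin V.numEdges) : V.dir e ≠ 0 := rot90_ne_zero (V.nrm_ne_zero e)

theorem exists_not_mem_hull (Q : Finset Plane) (y : Plane) {d : Plane} (hd : d ≠ 0) :
    ∃ t : ℝ, 0 < t ∧ y + t • d ∉ queryHull Q := by
  obtain ⟨R, hR⟩ := (HullRep.isCompact_hull Q).isBounded.exists_norm_le
  have hd' : 0 < ‖d‖ := norm_pos_iff.2 hd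
  refine ⟨(|R| + ‖y‖ + 1) / ‖d‖, by positivity, fun h => ?_⟩
  have h1 := hR _ h
  have h2 : ‖((|R| + ‖y‖ + 1) / ‖d‖) • d‖ = |R| + ‖y‖ + 1 := by
    rw [norm_smul, Real.norm_of_nonneg (by positivity), div_mul_cancel₀ _ hd'.ne']
  have h3 := norm_sub_norm_le (((|R| + ‖y‖ + 1) / ‖d‖) • d) (-y)
  rw [sub_neg_eq_add, add_comm _ y, norm_neg, h2] at h3
  have := le_abs_self R
  linarith

/-- Going from an interior point of the hull in some direction, one reaches the boundary. -/
theorem exists_frontier_of_interior {y d : Plane} {l : ℝ} (hy : y ∈ interior (queryHull Q))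
    (hl : 0 < l) (h : y + l • d ∉ interior (queryHull Q)) :
    ∃ τ, 0 < τ ∧ τ ≤ l ∧ y + τ • d ∈ frontier (queryHull Q) := by
  by_cases hm : y + l • d ∈ queryHull Q
  · exact ⟨l, hl, le_rfl, subset_closure hm, h⟩
  · obtain ⟨t, h0, h1, ht⟩ := exists_frontier_point (isClosed_hull Q) (interior_subset hy) hm
    rw [add_sub_cancel_left, smul_smul] at ht
    refine ⟨t * l, ?_, by nlinarith, ht⟩
    rcases h0.eq_or_lt with rfl | h0
    · rw [zero_mul, zero_smul, add_zero] at ht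
      exact absurd hy ht.2
    · positivity

theorem exit_point {e : Fin V.numEdges} {y : Plane} (he : y ∈ V.edge e)
    (hy : y ∈ interior (queryHull Q)) :
    (V.hasTgt e = true ∧ V.tgt e ∈ interior (queryHull Q)) ∨
      ∃ τ : ℝ, 0 < τ ∧ y + τ • V.dir e ∈ V.edge e ∧ y + τ • V.dir e ∈ frontier (queryHull Q) := by
  by_cases ht : V.hasTgt e = true
  · by_cases hi : V.tgt e ∈ interior (queryHull Q)
    · exact Or.inl ⟨ht, hi⟩
    · right
      have hF : V.Fwd e y := ⟨he, fun h => hi (h.2 ▸ hy)⟩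
      obtain ⟨l, hl, e1⟩ := hF.eq_tgt_sub ht
      obtain ⟨τ, h0, h1, h2⟩ := exists_frontier_of_interior hy hl (e1 ▸ hi)
      refine ⟨τ, h0, ?_, h2⟩
      have := (V.convex_edge e).add_smul_sub_mem he (V.tgt_mem_edge ht) (t := τ / l)
        ⟨by positivity, (div_le_one hl).2 h1⟩
      rwa [e1, add_sub_cancel_left, smul_smul, div_mul_cancel₀ _ hl.ne'] at this
  · right
    obtain ⟨l, hl, e1⟩ := exists_not_mem_hull Q y (V.dir_ne_zero e)
    obtain ⟨τ, h0, h1, h2⟩ := exists_frontier_of_interior hy hl fun h => e1 (interior_subset h)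
    exact ⟨τ, h0, V.mem_edge_add he (by simpa using ht) h0.le, h2⟩

theorem Bwd.eq_src_add' {e : Fin V.numEdges} {z : Plane} (ht : V.hasSrc e = true)
    (hz : V.Bwd e z) : ∃ l : ℝ, 0 < l ∧ V.src e = z - l • V.dir e := by
  obtain ⟨l, hl, h⟩ := eq_src_add ht hz.1
  refine ⟨l, lt_of_le_of_ne hl fun h0 => hz.2 ⟨ht, ?_⟩, by rw [h]; module⟩
  rw [h, ← h0]; module

theorem entry_point {e : Fin V.numEdges} {y : Plane} (he : y ∈ V.edge e)
    (hy : y ∈ interior (queryHull Q)) :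
    (V.hasSrc e = true ∧ V.src e ∈ interior (queryHull Q)) ∨
      ∃ τ : ℝ, 0 < τ ∧ y - τ • V.dir e ∈ V.edge e ∧ y - τ • V.dir e ∈ frontier (queryHull Q) := by
  by_cases ht : V.hasSrc e = true
  · by_cases hi : V.src e ∈ interior (queryHull Q)
    · exact Or.inl ⟨ht, hi⟩
    · right
      have hF : V.Bwd e y := ⟨he, fun h => hi (h.2 ▸ hy)⟩
      obtain ⟨l, hl, e1⟩ := hF.eq_src_add' ht
      rw [sub_eq_add_neg, ← smul_neg] at e1
      obtain ⟨τ, h0, h1, h2⟩ := exists_frontier_of_interior hy hl (e1 ▸ hi)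
      rw [smul_neg, ← sub_eq_add_neg] at h2
      refine ⟨τ, h0, ?_, h2⟩
      have := (V.convex_edge e).add_smul_sub_mem he (V.src_mem_edge ht) (t := τ / l)
        ⟨by positivity, (div_le_one hl).2 h1⟩
      rwa [e1, add_sub_cancel_left, smul_smul, div_mul_cancel₀ _ hl.ne', smul_neg,
        ← sub_eq_add_neg] at this
  · right
    obtain ⟨l, hl, e1⟩ := exists_not_mem_hull Q y (neg_ne_zero.2 (V.dir_ne_zero e))
    obtain ⟨τ, h0, h1, h2⟩ := exists_frontier_of_interior hy hl fun h => e1 (interior_subset h)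
    rw [smul_neg, ← sub_eq_add_neg] at h2
    exact ⟨τ, h0, V.mem_edge_sub he (by simpa using ht) h0.le, h2⟩

/-- Where the boundary of a cell leaves the interior of the hull, and the cell behind the point on
the boundary of the hull is another one, the next half-edge enters the hull again. -/
theorem reenter (hs : 3 ≤ H.size) {h : Fin V.numEdges} {y z u v : Plane} {τ : ℝ}
    (hB : BdPt H z u v) (hy : y ∈ V.edge h) (hyi : y ∈ interior (queryHull Q)) (hτ : 0 < τ)
    (hz : z = y + τ • V.dir h) (hzh : z ∈ V.edge h) {s : Plane} (hsP : s ∈ P) (hne : s ≠ V.so h)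
    (hI' : MeetsInt P Q s) (hzs : z ∈ closedVoronoiCell P s)
    (hu : Enters (closedVoronoiCell P s) z u) :
    V.hasTgt h = true ∧ z = V.tgt h ∧ V.Inside Q (V.nxt h) := by
  have hc := hB.corner hs
  have hl := hc.left_int y hyi
  have hr := hc.right_int y hyi
  have hyz : y - z = (-τ) • V.dir h := by rw [hz]; module
  rw [hyz, cross_smul_right] at hl
  rw [hyz, cross_smul_left] at hr
  have hI : MeetsInt P Q (V.so h) := meetsInt_of_closed (V.edge_subset_owner h hy) hyi
  have hzp := V.edge_subset_owner h hzh
  have h0 := gap_eq_zero_of_closed (V.so_mem h) hsP hzp hzs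
  have h0' := gap_eq_zero_of_closed hsP (V.so_mem h) hzs hzp
  have hdu := dot_nonpos_of_enters (V.so_mem h) h0' hu
  rw [dot_sub_left_neg] at hdu
  have hcu : 0 < cross (V.dir h) u := by rw [cross_swap u]; nlinarith
  have hcv : 0 < cross v (V.dir h) := by rw [cross_swap (V.dir h)]; nlinarith
  have hnF : ¬ V.Fwd h z := by
    intro hF
    obtain ⟨x, hx, hxi⟩ := hI
    have hdx := cross_dir_pos_of_open hx hzh
    have hwx := dot_neg_of_open hsP hne hx h0
    have hd := hF.cross_le hsP h0
    have hd' := (bwd_of_smul hτ hzh (by rw [hz, add_sub_cancel_right]; exact hy)).le_cross hsP h0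
    have hd0 : dot (s - V.so h) (V.dir h) = 0 := by rw [dot_dir]; exact le_antisymm hd hd'
    have id := dot_mul_cross (s - V.so h) u (V.dir h) (x - z)
    rw [hd0, zero_mul, zero_add] at id
    have h1 := mul_neg_of_neg_of_pos hwx hcu
    have h2 := mul_nonneg (by linarith : 0 ≤ dot (s - V.so h) u) hdx.le
    linarith
  have ht : V.hasTgt h = true ∧ z = V.tgt h := by
    by_contra hn; exact hnF ⟨hzh, hn⟩
  refine ⟨ht.1, ht.2, ?_⟩
  have hN := next_nxt ht.1
  have hF := hN.fwd
  rw [← ht.2] at hF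
  have e : V.so (V.nxt h) = V.so h := (so_congr hN.owner_eq).symm
  have hur := fwd_right hs hB hF (e ▸ hI) hsP (e ▸ hne) hI' hzs hu
  have hdd := hN.cross_pos
  rw [← cross_dir_dir] at hdd
  refine hF.inside hc hur ?_
  have huv := hB.cross_nonneg hs
  have id : cross (V.dir (V.nxt h)) v * cross (V.dir h) u =
      cross (V.dir h) (V.dir (V.nxt h)) * cross u v +
        cross u (V.dir (V.nxt h)) * cross v (V.dir h) := by simp [cross]; ring
  have h1 := mul_nonneg hdd.le huv
  have h2 := mul_pos hur hcv
  exact (mul_pos_iff_of_pos_right hcu).1 (by rw [id]; linarith)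

theorem reenter_prv (hs : 3 ≤ H.size) {h : Fin V.numEdges} {y z u v : Plane} {τ : ℝ}
    (hB : BdPt H z u v) (hy : y ∈ V.edge h) (hyi : y ∈ interior (queryHull Q)) (hτ : 0 < τ)
    (hz : z = y - τ • V.dir h) (hzh : z ∈ V.edge h) {s : Plane} (hsP : s ∈ P) (hne : s ≠ V.so h)
    (hI' : MeetsInt P Q s) (hzs : z ∈ closedVoronoiCell P s)
    (hv : Enters (closedVoronoiCell P s) z v) :
    V.hasSrc h = true ∧ z = V.src h ∧ V.Inside Q (V.prv h) := by
  have hc := hB.corner hs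
  have hl := hc.left_int y hyi
  have hr := hc.right_int y hyi
  have hyz : y - z = τ • V.dir h := by rw [hz]; module
  rw [hyz, cross_smul_right] at hl
  rw [hyz, cross_smul_left] at hr
  have hI : MeetsInt P Q (V.so h) := meetsInt_of_closed (V.edge_subset_owner h hy) hyi
  have hzp := V.edge_subset_owner h hzh
  have h0 := gap_eq_zero_of_closed (V.so_mem h) hsP hzp hzs
  have h0' := gap_eq_zero_of_closed hsP (V.so_mem h) hzs hzp
  have hdv := dot_nonpos_of_enters (V.so_mem h) h0' hv
  rw [dot_sub_left_neg] at hdv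
  have hcu : 0 < cross u (V.dir h) := (mul_pos_iff_of_pos_left hτ).1 hl
  have hcv : 0 < cross (V.dir h) v := (mul_pos_iff_of_pos_left hτ).1 hr
  have hnF : ¬ V.Bwd h z := by
    intro hF
    obtain ⟨x, hx, hxi⟩ := hI
    have hdx := cross_dir_pos_of_open hx hzh
    have hwx := dot_neg_of_open hsP hne hx h0
    have hd := hF.le_cross hsP h0
    have hd' := (fwd_of_smul hτ hzh (by rw [hz, sub_add_cancel]; exact hy)).cross_le hsP h0
    have hd0 : dot (s - V.so h) (V.dir h) = 0 := by rw [dot_dir]; exact le_antisymm hd' hd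
    have id := dot_mul_cross (s - V.so h) v (V.dir h) (x - z)
    rw [hd0, zero_mul, zero_add] at id
    have h1 := mul_neg_of_neg_of_pos hwx hcv
    have h2 := mul_nonneg (by linarith : 0 ≤ dot (s - V.so h) v) hdx.le
    linarith
  have ht : V.hasSrc h = true ∧ z = V.src h := by
    by_contra hn; exact hnF ⟨hzh, hn⟩
  refine ⟨ht.1, ht.2, ?_⟩
  have hN := next_prv ht.1
  have hF := hN.bwd
  rw [hN.tgt_eq, ← ht.2] at hF
  have e : V.so (V.prv h) = V.so h := so_congr hN.owner_eq
  have hvr := bwd_left hs hB hF (e ▸ hI) hsP (e ▸ hne) hI' hzs hv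
  have hdd := hN.cross_pos
  rw [← cross_dir_dir] at hdd
  refine hF.inside hc ?_ hvr
  have huv := hB.cross_nonneg hs
  have id : cross (V.dir (V.prv h)) u * cross (V.dir h) v =
      cross (V.dir (V.prv h)) (V.dir h) * cross u v +
        cross u (V.dir h) * cross v (V.dir (V.prv h)) := by simp [cross]; ring
  have h1 := mul_nonneg hdd.le huv
  have h2 := mul_pos hcu hvr
  exact (mul_pos_iff_of_pos_right hcv).1 (by rw [id]; linarith)

end VoronoiRep

/-! ## The traversal reaches all the cells -/

namespace Records

variable {N : ℕ} {cell : ℕ → Fin P.card} {edge : ℕ → ℕ} {lo hi : ℕ → ℝ}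
  {R : Records V H N cell edge lo hi}

theorem inside_nxt (hs : 3 ≤ H.size) {h : Fin V.numEdges} (hi' : V.Inside Q h)
    (hF : ¬ R.Finish h) : V.hasTgt h = true ∧ V.Inside Q (V.nxt h) := by
  obtain ⟨y, hy, hyi⟩ := hi'
  rcases VoronoiRep.exit_point hy hyi with ⟨h1, h2⟩ | ⟨τ, hτ, hz, hzf⟩
  · exact ⟨h1, V.tgt h, (VoronoiRep.next_nxt h1).fwd.1, h2⟩
  set z := y + τ • V.dir h with hzd
  obtain ⟨u, v, hB, hJ⟩ := R.at_boundary hs hzf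
  have hb : V.Bwd h z :=
    VoronoiRep.bwd_of_smul hτ hz (by rw [hzd, add_sub_cancel_right]; exact hy)
  have hnot : ¬ Enters (closedVoronoiCell P (V.so h)) z v := by
    intro he
    have h1 := VoronoiRep.cross_dir_nonneg_of_enters hz he
    have h2 := (hB.corner hs).right_int y hyi
    rw [show y - z = (-τ) • V.dir h by rw [hzd]; module, cross_smul_left] at h2
    have := mul_nonneg hτ.le h1
    linarith
  have key : ∃ s ∈ P, s ≠ V.so h ∧ MeetsInt P Q s ∧ z ∈ closedVoronoiCell P s ∧
      Enters (closedVoronoiCell P s) z u := by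
    rcases hJ with ⟨j, hJ⟩ | ⟨j, hj, hm, hu, hv⟩
    · have h1 : V.owner h ≠ cell j := fun e => hnot (so_of_owner e ▸ hJ.left)
      have h2 : V.owner h ≠ cell (nextRec N j) := by
        intro e
        exact hF ⟨j, hJ.lt, fun e' => h1 (e.trans e'), e, hJ.eq_hi ▸ hb⟩
      exact ⟨_, V.site_mem _, site_ne h2.symm, R.meets hs _ (nextRec_lt hJ.lt), hJ.mem_next,
        hJ.right⟩
    · have h1 : V.owner h ≠ cell j := fun e => hnot (so_of_owner e ▸ hv)
      exact ⟨_, V.site_mem _, site_ne h1.symm, R.meets hs _ hj, hm, hu⟩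
  obtain ⟨s, hsP, hne, hI, hzs, hu⟩ := key
  obtain ⟨h1, -, h2⟩ := VoronoiRep.reenter hs hB hy hyi hτ hzd hz hsP hne hI hzs hu
  exact ⟨h1, h2⟩

/-- A vertex of a cell on the boundary of the hull lies in the hull only at the finish. -/
theorem Finish.tgt_eq (hs : 3 ≤ H.size) {h : Fin V.numEdges} {j : ℕ} {z u v : Plane}
    (hJ : R.Junction j z u v) (hne : cell (nextRec N j) ≠ cell j)
    (ho : V.owner h = cell (nextRec N j)) (hb : V.Bwd h z) (ht : V.hasTgt h = true)
    (hm : V.tgt h ∈ queryHull Q) : z = V.tgt h := by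
  by_contra hn
  have hF : V.Fwd h z := ⟨hb.1, fun h => hn h.2⟩
  obtain ⟨l, hl, e⟩ := hF.eq_tgt_sub ht
  exact VoronoiRep.Bwd.not_mem_hull (hJ.bd.corner hs) (finish_directions hs hJ hne ho hb).1 hl
    (e ▸ hm)

theorem inside_prv (hs : 3 ≤ H.size) {h : Fin V.numEdges} (hi' : V.Inside Q h) :
    R.Begin h ∨ (V.hasSrc h = true ∧ V.src h ∈ queryHull Q ∧ V.Inside Q (V.prv h) ∧
      ¬ R.Finish (V.prv h)) := by
  obtain ⟨y, hy, hyi⟩ := hi'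
  rcases VoronoiRep.entry_point hy hyi with ⟨h1, h2⟩ | ⟨τ, hτ, hz, hzf⟩
  · have hN := VoronoiRep.next_prv h1
    refine Or.inr ⟨h1, interior_subset h2, ⟨V.src h, hN.tgt_eq ▸ hN.bwd.1, h2⟩, ?_⟩
    rintro ⟨j, hj, hne, ho, hb⟩
    have hJ := R.junction hj
    have e := Finish.tgt_eq hs hJ hne ho hb hN.hasTgt (hN.tgt_eq ▸ interior_subset h2)
    have hfr := (HullRep.mem_frontier_iff (H := H) hs).2
      ⟨_, R.edge_lt j hj, hi j, (R.lo_nonneg j hj).trans (R.lo_lt_hi j hj).le, R.hi_le j hj, rfl⟩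
    rw [e, hN.tgt_eq] at hfr
    exact hfr.2 h2
  set z := y - τ • V.dir h with hzd
  obtain ⟨u, v, hB, hJ⟩ := R.at_boundary hs hzf
  have hyz : y - z = τ • V.dir h := by rw [hzd]; module
  have hb : V.Fwd h z :=
    VoronoiRep.fwd_of_smul hτ hz (by rw [hzd, sub_add_cancel]; exact hy)
  have hnot : ∀ {u' v'}, BdPt H z u' v' →
      ¬ Enters (closedVoronoiCell P (V.so h)) z u' := by
    intro u' v' hB' he
    have h1 := VoronoiRep.cross_dir_nonneg_of_enters hz he
    have h2 := (hB'.corner hs).left_int y hyi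
    rw [hyz, cross_smul_right, cross_swap] at h2
    have := mul_nonneg hτ.le h1
    linarith
  have key : R.Begin h ∨ ∃ s ∈ P, s ≠ V.so h ∧ MeetsInt P Q s ∧ z ∈ closedVoronoiCell P s ∧
      Enters (closedVoronoiCell P s) z v := by
    rcases hJ with ⟨j, hJ⟩ | ⟨j, hj, hm, hu, hv⟩
    · have h1 : V.owner h ≠ cell (nextRec N j) := fun e => hnot hB (so_of_owner e ▸ hJ.right)
      by_cases h2 : V.owner h = cell j
      · exact Or.inl ⟨j, hJ.lt, fun e => h1 (h2.trans e.symm), h2, hJ.eq_hi ▸ hb⟩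
      · exact Or.inr ⟨_, V.site_mem _, site_ne (Ne.symm h2), R.meets hs _ hJ.lt, hJ.mem, hJ.left⟩
    · have h1 : V.owner h ≠ cell j := fun e => hnot hB (so_of_owner e ▸ hu)
      exact Or.inr ⟨_, V.site_mem _, site_ne h1.symm, R.meets hs _ hj, hm, hv⟩
  rcases key with h | ⟨s, hsP, hne, hI, hzs, hv⟩
  · exact Or.inl h
  obtain ⟨h1, h2, h3⟩ := VoronoiRep.reenter_prv hs hB hy hyi hτ hzd hz hsP hne hI hzs hv
  have hN := VoronoiRep.next_prv h1
  have hzH : z ∈ queryHull Q := (isClosed_hull Q).frontier_subset hzf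
  refine Or.inr ⟨h1, h2 ▸ hzH, h3, ?_⟩
  rintro ⟨j, hj, hne', ho, hb'⟩
  have hJ' := R.junction hj
  have e := Finish.tgt_eq hs hJ' hne' ho hb' hN.hasTgt (hN.tgt_eq ▸ h2 ▸ hzH)
  rw [hN.tgt_eq, ← h2] at e
  have hr := hJ'.right
  have hbd := hJ'.bd
  rw [e] at hr hbd
  exact hnot hbd (so_of_owner (hN.owner_eq ▸ ho) ▸ hr)

end Records

theorem dot_eq_zero_of_line {p s z d : Plane} (h : ∀ t : ℝ, z + t • d ∈ closedVoronoiCell P p)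
    (hs : s ∈ P) : dot (s - p) d = 0 := by
  by_contra hn
  have := mem_closed_iff_gap.1 (h ((gap p s z + 1) / (2 * dot (s - p) d))) s hs
  rw [gap_add_smul] at this
  have e : 2 * ((gap p s z + 1) / (2 * dot (s - p) d)) * dot (s - p) d = gap p s z + 1 := by
    field_simp
  linarith

namespace VoronoiRep

/-- A bounded half-edge with ends in the hull lies in the hull. -/
theorem edge_subset_hull {e : Fin V.numEdges} (h1 : V.hasSrc e = true) (h2 : V.hasTgt e = true)
    (h1' : V.src e ∈ queryHull Q) (h2' : V.tgt e ∈ queryHull Q) : V.edge e ⊆ queryHull Q := by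
  intro y hy
  obtain ⟨l, hl, he⟩ := eq_src_add h1 hy
  by_cases hF : V.Fwd e y
  · obtain ⟨l', hl', he'⟩ := hF.eq_tgt_sub h2
    have := (HullRep.convex_hull' Q).add_smul_sub_mem h1' h2' (t := l / (l + l'))
      ⟨by positivity, (div_le_one (by positivity)).2 (by linarith)⟩
    rwa [he', he, show V.src e + l • V.dir e + l' • V.dir e - V.src e = (l + l') • V.dir e by module,
      smul_smul, div_mul_cancel₀ _ (by positivity), ← he] at this
  · have : y = V.tgt e := by
      by_contra hn; exact hF ⟨hy, fun h => hn h.2⟩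
    exact this ▸ h2'

/-- The closed cell is not bounded by half-edges inside the hull alone, if the cell contains a part
of the boundary of the hull. -/
theorem not_all_inside (hs : 3 ≤ H.size) {i : ℕ} (hi : i < H.size) {c : Fin P.card}
    (hp : Piece P H i (V.site c)) {e₀ : Fin V.numEdges} (he₀ : V.owner e₀ = c)
    (hall : ∀ e, V.owner e = c → V.Inside Q e ∧ V.hasSrc e = true ∧ V.src e ∈ queryHull Q) :
    False := by
  obtain ⟨t₀, t₁, h0, h01, h1, hz0, hz1⟩ := hp
  have hsub : ∀ e, V.owner e = c → V.edge e ⊆ queryHull Q := by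
    intro e he
    obtain ⟨-, h1, h2⟩ := hall e he
    obtain ⟨-, h3, h4⟩ := hall (V.nxt e) (by rw [owner_nxt, he])
    have hN := next_prv h3
    rw [prv_nxt] at hN
    exact edge_subset_hull h1 hN.hasTgt h2 (hN.tgt_eq ▸ h4)
  by_cases hr : mirror H i (V.site c) ∈ P → mirror H i (V.site c) = V.site c
  · have hz := mem_cell_of_between (by omega) hz0 hz1 hr (t := (t₀ + t₁) / 2) (by linarith)
      (by linarith)
    obtain ⟨τ, hτ, hE⟩ := (isOpen_voronoiCell P (V.site c)).enters hz (-rot90 (H.ed i))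
    have hz' := hE τ hτ le_rfl
    set z := H.at' i ((t₀ + t₁) / 2) + τ • -rot90 (H.ed i) with hzd
    have hdp := dot_self_pos (HullRep.ed_ne_zero (H := H) (by omega) i)
    have hpos : ∀ t : ℝ, H.pos i (z + t • H.ed i) < 0 := by
      intro t
      rw [hzd, HullRep.pos_add_smul, HullRep.pos_add_smul, HullRep.pos_at]
      have h1 : cross (H.ed i) (-rot90 (H.ed i)) = - dot (H.ed i) (H.ed i) := by
        simp [cross, rot90, dot]; ring
      rw [h1, cross_eq_zero_self]
      have := mul_pos hτ hdp
      linarith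
    have hline : ∀ t : ℝ, z + t • H.ed i ∈ closedVoronoiCell P (V.site c) := by
      intro t
      by_contra hn
      obtain ⟨r, hr0, hr1, hfr⟩ := exists_frontier_point
        (isClosed_closedVoronoiCell P (V.site c)) (voronoiCell_subset_closed hz') hn
      rw [add_sub_cancel_left, smul_smul] at hfr
      have hcl := (isClosed_closedVoronoiCell P (V.site c)).frontier_subset hfr
      have hno : z + (r * t) • H.ed i ∉ voronoiCell P (V.site c) := fun h =>
        hfr.2 (interior_maximal voronoiCell_subset_closed (isOpen_voronoiCell P _) h)
      have : ∃ s ∈ P, s ≠ V.site c ∧ gap (V.site c) s (z + (r * t) • H.ed i) = 0 := by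
        by_contra hn'
        push Not at hn'
        exact hno (mem_open_of_closed_no_tie hcl hn')
      obtain ⟨s, hsP, hne, hg⟩ := this
      obtain ⟨e, he, hF⟩ := exists_fwd hcl hsP hne hg
      have h2 := HullRep.pos_nonneg (H := H) (by omega) i (hsub e he hF.1)
      exact absurd (hpos (r * t)) (not_lt.2 h2)
    have hd := dot_eq_zero_of_line hline (V.sn_mem e₀)
    obtain ⟨y, hy, -⟩ := (hall e₀ he₀).1
    have hdd : dot (V.sn e₀ - V.site c) (V.dir e₀) = 0 := by
      rw [dot_dir, ← he₀]; exact cross_eq_zero_self _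
    -- translate an edge point along the line
    obtain ⟨l, hl, hnot⟩ := exists_not_mem_hull Q y (HullRep.ed_ne_zero (H := H) (by omega) i)
    apply hnot
    apply hsub e₀ he₀
    have hso : V.so e₀ = V.site c := Records.so_of_owner he₀
    apply V.mem_edge_of_tie
    · rw [hso, mem_closed_iff_gap]
      intro s hsP
      rw [gap_add_smul, dot_eq_zero_of_line hline hsP]
      have := mem_closed_iff_gap.1 (V.edge_subset_owner e₀ hy) s hsP
      rw [hso] at this
      linarith
    · rw [gap_add_smul, hso, hd, ← hso, (V.mem_edge.1 hy).1]; ring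
  · push Not at hr
    have hg := fun t => gap_mirror (H := H) (by omega) i (V.site c) t
    obtain ⟨e, he, -, hze, hze'⟩ := exists_edge_of_step (c := c) (V := V) (d := (t₁ - t₀) • H.ed i)
      hr.1 hr.2 hz0 (hg _) (smul_ne_zero (sub_ne_zero.2 h01.ne')
        (HullRep.ed_ne_zero (H := H) (by omega) i))
      (by rw [HullRep.at_add]; convert hz1 using 2; ring) (by rw [HullRep.at_add]; exact hg _)
    rw [HullRep.at_add, add_sub_cancel] at hze'
    obtain ⟨y, hy, hyi⟩ := (hall e he).1
    have hypos := (HullRep.mem_interior_iff hs).1 hyi i hi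
    have e1 := V.eq_add_smul_dir (V.mem_edge.1 hze).1 (V.mem_edge.1 hze').1
    have e2 := V.eq_add_smul_dir (V.mem_edge.1 hze).1 (V.mem_edge.1 hy).1
    set a := cross (V.nrm e) (H.at' i t₁ - H.at' i t₀) / dot (V.nrm e) (V.nrm e)
    set b := cross (V.nrm e) (y - H.at' i t₀) / dot (V.nrm e) (V.nrm e)
    have p1 : H.pos i (H.at' i t₁) = 0 := HullRep.pos_at _ _
    rw [e1, HullRep.pos_add_smul, HullRep.pos_at, zero_add] at p1
    rw [e2, HullRep.pos_add_smul, HullRep.pos_at, zero_add] at hypos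
    rcases mul_eq_zero.1 p1 with h | h
    · rw [h, zero_smul, add_zero] at e1
      have : (t₁ - t₀) • H.ed i = 0 := by
        have e3 : H.at' i t₁ - H.at' i t₀ = (t₁ - t₀) • H.ed i := by
          simp only [HullRep.at']; module
        rw [← e3, e1, sub_self]
      exact smul_ne_zero (sub_ne_zero.2 h01.ne') (HullRep.ed_ne_zero (H := H) (by omega) i) this
    · rw [h, mul_zero] at hypos; exact lt_irrefl _ hypos

end VoronoiRep

namespace Records

variable {N : ℕ} {cell : ℕ → Fin P.card} {edge : ℕ → ℕ} {lo hi : ℕ → ℝ}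

theorem piece (R : Records V H N cell edge lo hi) {j : ℕ} (hj : j < N) :
    Piece P H (edge j) (V.site (cell j)) :=
  ⟨lo j, hi j, R.lo_nonneg j hj, R.lo_lt_hi j hj, R.hi_le j hj, R.lo_mem j hj, R.hi_mem j hj⟩

/-- Walking along the boundary of a cell at the boundary of the hull, one meets all its edges inside
the hull. -/
theorem scan_complete (R : Records V H N cell edge lo hi) (hs : 3 ≤ H.size)
    {S : Fin V.numEdges → Prop} (hb : ∀ h, R.Begin h → S h)
    (hn : ∀ h, S h → ¬ R.Finish h → S (V.nxt h)) {j : ℕ} (hj : j < N) {h : Fin V.numEdges}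
    (ho : V.owner h = cell j) (hi' : V.Inside Q h) : S h := by
  by_contra hS
  have step : ∀ h, V.Inside Q h → ¬ S h → (V.hasSrc h = true ∧ V.src h ∈ queryHull Q ∧
      V.Inside Q (V.prv h) ∧ ¬ S (V.prv h)) := by
    intro h h1 h2
    rcases inside_prv (R := R) hs h1 with h | ⟨a, b, c, d⟩
    · exact absurd (hb _ h) h2
    · refine ⟨a, b, c, fun h' => h2 ?_⟩
      have := hn _ h' d
      rwa [VoronoiRep.nxt_prv] at this
  have hall := VoronoiRep.prv_induction (V := V) (c := cell j)
    (S := fun h => V.Inside Q h ∧ ¬ S h)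
    (fun e _ h => ⟨(step e h.1 h.2).2.2.1, (step e h.1 h.2).2.2.2⟩) ho ⟨hi', hS⟩
  exact VoronoiRep.not_all_inside hs (R.edge_lt j hj) (R.piece hj) ho fun e he =>
    ⟨(hall e he).1, (step e (hall e he).1 (hall e he).2).1,
      (step e (hall e he).1 (hall e he).2).2.1⟩

end Records

/-! ## Connectivity of the Delaunay graph inside the hull, and the number of edges -/

/-- Three different sites tie in only finitely many points. -/
theorem finite_triples (P : Finset Plane) :
    {x : Plane | ∃ a ∈ P, ∃ b ∈ P, ∃ c ∈ P, a ≠ b ∧ b ≠ c ∧ a ≠ c ∧ gap a b x = 0 ∧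
      gap a c x = 0}.Finite := by
  have h1 : ∀ a b c : Plane, a ≠ b → b ≠ c → a ≠ c →
      {x : Plane | gap a b x = 0 ∧ gap a c x = 0}.Subsingleton := by
    intro a b c hab hbc hac x hx y hy
    have e1 : dot (b - a) (y - x) = 0 := by
      have := hy.1
      rw [show y = x + (1 : ℝ) • (y - x) by module, gap_add_smul, hx.1] at this
      linarith
    have e2 : dot (c - a) (y - x) = 0 := by
      have := hy.2
      rw [show y = x + (1 : ℝ) • (y - x) by module, gap_add_smul, hx.2] at this
      linarith
    by_cases hc : cross (b - a) (c - a) = 0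
    · exfalso
      have p1 := VoronoiRep.tie_dot_pos hab.symm hx.1
      have p2 := VoronoiRep.tie_dot_pos hac.symm hx.2
      have g1 := hx.1
      have g2 := hx.2
      rw [gap_eq] at g1 g2
      have q1 := dot_self_pos (sub_ne_zero.2 hab.symm)
      -- both differences are multiples of one vector
      set v := b - a with hv
      set w := c - a with hw
      set k := x - a
      have e3 : w = (dot v w / dot v v) • v := by
        have h0 : dot v v * w 0 = dot v w * v 0 := by simp only [dot, cross] at *; linear_combination (-(v 1)) * hc
        have h1 : dot v v * w 1 = dot v w * v 1 := by simp only [dot, cross] at *; linear_combination v 0 * hc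
        apply plane_ext
        · simp only [PiLp.smul_apply, smul_eq_mul]; field_simp; linarith
        · simp only [PiLp.smul_apply, smul_eq_mul]; field_simp; linarith
      set l := dot v w / dot v v
      have f1 : dot w w = l * l * dot v v := by rw [e3]; simp [dot]; ring
      have f2 : dot w k = l * dot v k := by rw [e3]; simp [dot]; ring
      have f3 : dot k w = l * dot k v := by rw [e3]; simp [dot]; ring
      have hl : l ≠ 0 := by
        intro h0; rw [f3, h0] at p2; simp at p2
      have : l * (l - 1) * dot v v = 0 := by
        rw [f1, f2] at g2; linear_combination g2 - l * g1
      have hl1 : l = 1 := by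
        rcases mul_eq_zero.1 this with h | h
        · rcases mul_eq_zero.1 h with h | h
          · exact absurd h hl
          · linarith
        · exact absurd h q1.ne'
      rw [hl1, one_smul, hv, hw] at e3
      exact hbc (sub_left_injective e3).symm
    · have h0 : cross (b - a) (c - a) * (y - x) 0 = 0 := by
        simp only [cross, dot] at *; linear_combination (c - a) 1 * e1 - (b - a) 1 * e2
      have h1 : cross (b - a) (c - a) * (y - x) 1 = 0 := by
        simp only [cross, dot] at *; linear_combination (b - a) 0 * e2 - (c - a) 0 * e1
      have : y - x = 0 := plane_ext (by simpa [hc] using h0) (by simpa [hc] using h1)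
      exact (sub_eq_zero.1 this).symm
  have : {x : Plane | ∃ a ∈ P, ∃ b ∈ P, ∃ c ∈ P, a ≠ b ∧ b ≠ c ∧ a ≠ c ∧ gap a b x = 0 ∧
      gap a c x = 0} ⊆ ⋃ a ∈ P, ⋃ b ∈ P, ⋃ c ∈ P,
        {x : Plane | (a ≠ b ∧ b ≠ c ∧ a ≠ c) ∧ gap a b x = 0 ∧ gap a c x = 0} := by
    rintro x ⟨a, ha, b, hb, c, hc, h1, h2, h3, h4⟩
    simp only [Set.mem_iUnion]
    exact ⟨a, ha, b, hb, c, hc, ⟨h1, h2, h3⟩, h4⟩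
  refine Set.Finite.subset ?_ this
  refine P.finite_toSet.biUnion fun a _ => P.finite_toSet.biUnion fun b _ =>
    P.finite_toSet.biUnion fun c _ => ?_
  by_cases hd : a ≠ b ∧ b ≠ c ∧ a ≠ c
  · exact ((h1 a b c hd.1 hd.2.1 hd.2.2).anti fun x hx => hx.2).finite
  · convert Set.finite_empty
    ext x; simp only [Set.mem_ofPred_eq, Set.mem_empty_iff_false, iff_false]
    exact fun h => hd h.1

/-- One can see a point of an open set past finitely many obstacles. -/
theorem exists_avoiding {T : Set Plane} (hT : T.Finite) {z₀ : Plane} (h0 : z₀ ∉ T) {U : Set Plane}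
    (hU : IsOpen U) (hne : U.Nonempty) :
    ∃ z₁ ∈ U, ∀ t : ℝ, z₀ + t • (z₁ - z₀) ∉ T := by
  obtain ⟨y, hy⟩ := hne
  obtain ⟨y, hy, hy0⟩ : ∃ y ∈ U, y ≠ z₀ := by
    by_cases h : y = z₀
    · obtain ⟨τ, hτ, he⟩ := hU.enters hy !₂[1, 0]
      refine ⟨_, he τ hτ le_rfl, fun h' => ?_⟩
      rw [h] at h'
      have := congrArg (fun p : Plane => p 0) h'
      simp at this
      linarith
    · exact ⟨y, hy, h⟩
  set w := rot90 (y - z₀) with hw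
  obtain ⟨τ, hτ, he⟩ := hU.enters hy w
  have hdp := dot_self_pos (sub_ne_zero.2 hy0)
  have hbad : ∀ p ∈ T, {s : ℝ | cross (p - z₀) (y + s • w - z₀) = 0}.Subsingleton := by
    intro p hp s hs r hr
    have e : ∀ s : ℝ, cross (p - z₀) (y + s • w - z₀) =
        cross (p - z₀) (y - z₀) + s * dot (p - z₀) (y - z₀) := by
      intro s; rw [hw]; simp [cross, rot90, dot]; ring
    simp only [Set.mem_ofPred_eq, e] at hs hr
    have h1 : (s - r) * dot (p - z₀) (y - z₀) = 0 := by linarith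
    rcases mul_eq_zero.1 h1 with h | h
    · linarith
    · exfalso
      rw [h, mul_zero, add_zero] at hs
      apply h0
      have : p - z₀ = 0 := by
        have h2 : dot (y - z₀) (y - z₀) * (p - z₀) 0 = 0 := by
          simp only [cross, dot] at *; linear_combination (y - z₀) 0 * h + (y - z₀) 1 * hs
        have h3 : dot (y - z₀) (y - z₀) * (p - z₀) 1 = 0 := by
          simp only [cross, dot] at *; linear_combination (y - z₀) 1 * h - (y - z₀) 0 * hs
        exact plane_ext (by simpa [hdp.ne'] using h2) (by simpa [hdp.ne'] using h3)
      rwa [sub_eq_zero.1 this] at hp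
  have hfin : (⋃ p ∈ T, {s : ℝ | cross (p - z₀) (y + s • w - z₀) = 0}).Finite :=
    hT.biUnion fun p hp => (hbad p hp).finite
  obtain ⟨s, hs, hs'⟩ := (Set.Ioo_infinite hτ).exists_notMem_finite hfin
  refine ⟨y + s • w, he s hs.1 hs.2.le, fun t ht => hs' ?_⟩
  simp only [Set.mem_iUnion]
  refine ⟨_, ht, ?_⟩
  simp only [Set.mem_ofPred_eq, add_sub_cancel_left, cross_smul_left, cross_eq_zero_self, mul_zero]

theorem segment_mem_interior {z₀ z₁ : Plane} (h0 : z₀ ∈ interior (queryHull Q))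
    (h1 : z₁ ∈ interior (queryHull Q)) {t : ℝ} (ht0 : 0 ≤ t) (ht1 : t ≤ 1) :
    z₀ + t • (z₁ - z₀) ∈ interior (queryHull Q) :=
  (HullRep.convex_hull' Q).interior.add_smul_sub_mem h0 h1 ⟨ht0, ht1⟩

/-- A set of cells that contains with a cell all its neighbours across edges inside the hull
contains all the cells that meet the interior of the hull. -/
theorem connected_inside (M : Fin P.card → Prop) {c₀ : Fin P.card} (hM : M c₀)
    (hI : MeetsInt P Q (V.site c₀)) (hc : ∀ h, M (V.owner h) → V.Inside Q h → M (V.nbr h))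
    {c₁ : Fin P.card} (hI1 : MeetsInt P Q (V.site c₁)) : M c₁ := by
  classical
  obtain ⟨z₀, hz0, hz0i⟩ := hI
  set T := {x : Plane | ∃ a ∈ P, ∃ b ∈ P, ∃ c ∈ P, a ≠ b ∧ b ≠ c ∧ a ≠ c ∧
    x ∈ closedVoronoiCell P a ∧ x ∈ closedVoronoiCell P b ∧ x ∈ closedVoronoiCell P c} with hT
  have hTf : T.Finite := by
    refine (finite_triples P).subset ?_
    rintro x ⟨a, ha, b, hb, c, hc, h1, h2, h3, h4, h5, h6⟩
    exact ⟨a, ha, b, hb, c, hc, h1, h2, h3, gap_eq_zero_of_closed ha hb h4 h5,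
      gap_eq_zero_of_closed ha hc h4 h6⟩
  have hz0T : z₀ ∉ T := by
    rintro ⟨a, ha, b, hb, c, hc, h1, h2, h3, h4, h5, h6⟩
    have e1 := eq_of_mem_open_of_mem_closed (V.site_mem c₀) ha hz0 h4
    have e2 := eq_of_mem_open_of_mem_closed (V.site_mem c₀) hb hz0 h5
    exact h1 (e1.trans e2.symm)
  obtain ⟨z₁, ⟨hz1, hz1i⟩, hav⟩ := exists_avoiding hTf hz0T
    ((isOpen_voronoiCell P (V.site c₁)).inter isOpen_interior) hI1
  set γ : ℝ → Plane := fun t => z₀ + t • (z₁ - z₀) with hγ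
  have hγc : Continuous γ := by fun_prop
  -- the last parameter in a cell of `M`
  set S := {t : ℝ | t ∈ Set.Icc (0 : ℝ) 1 ∧ ∃ c, M c ∧ γ t ∈ closedVoronoiCell P (V.site c)}
  have hSc : IsClosed S := by
    have e : S = Set.Icc (0 : ℝ) 1 ∩ ⋃ c ∈ {c | M c}, γ ⁻¹' closedVoronoiCell P (V.site c) := by
      ext t; simp [S]
    rw [e]
    exact isClosed_Icc.inter ((Set.toFinite _).isClosed_biUnion fun c _ =>
      (isClosed_closedVoronoiCell P _).preimage hγc)
  have h0S : (0 : ℝ) ∈ S := ⟨by simp, c₀, hM, by simpa [hγ] using voronoiCell_subset_closed hz0⟩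
  have hbdd : BddAbove S := ⟨1, fun t ht => ht.1.2⟩
  have hsup := hSc.csSup_mem ⟨0, h0S⟩ hbdd
  set t := sSup S with ht
  obtain ⟨⟨ht0, ht1⟩, c, hMc, hcm⟩ := hsup
  rcases ht1.eq_or_lt with h1 | h1
  · have : γ t = z₁ := by rw [hγ, h1]; simp
    rw [this] at hcm
    have := V.site_injective (eq_of_mem_open_of_mem_closed (V.site_mem c₁) (V.site_mem c) hz1 hcm)
    exact this ▸ hMc
  exfalso
  -- a cell outside `M` that contains the point
  have hs : ∃ s, ¬ M s ∧ γ t ∈ closedVoronoiCell P (V.site s) := by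
    by_contra hn
    push Not at hn
    have hcl : IsClosed (⋃ s ∈ {s | ¬ M s}, γ ⁻¹' closedVoronoiCell P (V.site s)) :=
      (Set.toFinite _).isClosed_biUnion fun s _ =>
        (isClosed_closedVoronoiCell P _).preimage hγc
    have hmem : t ∈ (⋃ s ∈ {s | ¬ M s}, γ ⁻¹' closedVoronoiCell P (V.site s))ᶜ := by
      simp only [Set.mem_compl_iff, Set.mem_iUnion, not_exists]
      exact fun s hs h => hn s hs h
    obtain ⟨ε, hε, hball⟩ := Metric.isOpen_iff.1 hcl.isOpen_compl t hmem
    have hlt : t < min (t + ε / 2) 1 := lt_min (by linarith) h1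
    have hb := hball (show min (t + ε / 2) 1 ∈ Metric.ball t ε by
      rw [Metric.mem_ball, Real.dist_eq, abs_of_pos (by linarith)]
      have := min_le_left (t + ε / 2) 1
      linarith)
    obtain ⟨p, hp, hpm⟩ := exists_mem_closedVoronoiCell ⟨_, V.site_mem c₀⟩
      (γ (min (t + ε / 2) 1))
    obtain ⟨s, rfl⟩ := V.exists_site hp
    have hMs : M s := by
      by_contra hMs
      exact hb (Set.mem_iUnion₂.2 ⟨s, hMs, hpm⟩)
    have := le_csSup hbdd (show min (t + ε / 2) 1 ∈ S from
      ⟨⟨by linarith, min_le_right _ _⟩, s, hMs, hpm⟩)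
    linarith
  obtain ⟨s, hMs, hsm⟩ := hs
  have hne : V.site s ≠ V.site c := fun h => hMs (V.site_injective h ▸ hMc)
  obtain ⟨e, he, hF⟩ := VoronoiRep.exists_fwd hcm (V.site_mem s) hne
    (gap_eq_zero_of_closed (V.site_mem c) (V.site_mem s) hcm hsm)
  have hin : V.Inside Q e := ⟨γ t, hF.1, segment_mem_interior hz0i hz1i ht0 ht1⟩
  have hnb : V.sn e = V.site s := by
    by_contra hn
    refine hav t ⟨_, V.site_mem c, _, V.site_mem s, _, V.sn_mem e, hne.symm, Ne.symm hn, ?_, hcm,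
      hsm, V.edge_subset_nbr e hF.1⟩
    rw [← he]
    exact (V.sn_ne_so e).symm
  have := hc e (he ▸ hMc) hin
  rw [V.site_injective hnb] at this
  exact hMs this

/-! ### Counting -/

open Classical in
variable (P Q) in
/-- The sites whose cells meet the interior of the hull. -/
def innerSites : Finset Plane := P.filter fun p => MeetsInt P Q p

theorem mem_innerSites {p : Plane} : p ∈ innerSites P Q ↔ p ∈ P ∧ MeetsInt P Q p := by
  simp [innerSites]

theorem card_innerSites_le : (innerSites P Q).card ≤ (skyline P Q).ncard :=
  card_le_skyline fun p hp => by
    obtain ⟨h1, x, hx, hxi⟩ := mem_innerSites.1 hp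
    exact mem_skyline_of_meets h1 ⟨x, hx, interior_subset hxi⟩

namespace VoronoiRep

/-- The number of pairs of successive half-edges that meet the interior of the hull. -/
theorem card_inside_pairs_le (A : Finset (Fin V.numEdges))
    (hA : ∀ e ∈ A, V.Inside Q e ∧ V.hasTgt e = true ∧ V.Inside Q (V.nxt e)) :
    A.card ≤ 6 * (innerSites P Q).card := by
  apply card_corners_le
  intro e he
  obtain ⟨h1, h2, h3⟩ := hA e he
  exact ⟨h2, mem_innerSites.2 ⟨V.so_mem e, h1.owner⟩, mem_innerSites.2 ⟨V.sn_mem e, h1.nbr⟩,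
    mem_innerSites.2 ⟨V.sn_mem _, h3.nbr⟩⟩

theorem closed_subset_closure (p : Plane) :
    closedVoronoiCell P p ⊆ closure (voronoiCell P p) := by
  intro x hx
  rw [Metric.mem_closure_iff]
  intro ε hε
  by_cases h : p = x
  · exact ⟨x, h ▸ self_mem_voronoiCell P p, by simpa using hε⟩
  have hd : 0 < ‖p - x‖ := norm_pos_iff.2 (sub_ne_zero.2 h)
  have hm : 0 < min (ε / (2 * ‖p - x‖)) 1 := lt_min (by positivity) one_pos
  refine ⟨min (ε / (2 * ‖p - x‖)) 1 • p + (1 - min (ε / (2 * ‖p - x‖)) 1) • x,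
    comb_mem_voronoiCell (self_mem_voronoiCell P p) hx hm
      (sub_nonneg.2 (min_le_right _ _)) (by ring), ?_⟩
  rw [dist_comm, dist_eq_norm, show min (ε / (2 * ‖p - x‖)) 1 • p +
    (1 - min (ε / (2 * ‖p - x‖)) 1) • x - x = min (ε / (2 * ‖p - x‖)) 1 • (p - x) by module,
    norm_smul, Real.norm_of_nonneg hm.le]
  calc _ ≤ ε / (2 * ‖p - x‖) * ‖p - x‖ := by gcongr; exact min_le_left _ _
    _ = ε / 2 := by field_simp
    _ < ε := by linarith

/-- A cell that meets the interior of the hull but not its boundary lies in the hull. -/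
theorem closed_subset_hull {p : Plane} (h : MeetsInt P Q p) (h' : ¬ MeetsBd P Q p) :
    closedVoronoiCell P p ⊆ queryHull Q :=
  (closed_subset_closure p).trans (closure_minimal
    ((cell_subset_of_not_meetsBd h h').trans interior_subset) (isClosed_hull Q))

theorem bounded_of_subset {e : Fin V.numEdges} (h : V.edge e ⊆ queryHull Q) :
    V.hasTgt e = true ∧ V.hasSrc e = true := by
  obtain ⟨y, hy⟩ := (V.edge_nontrivial e).nonempty
  constructor
  · by_contra hn
    obtain ⟨t, ht, hm⟩ := exists_not_mem_hull Q y (V.dir_ne_zero e)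
    exact hm (h (V.mem_edge_add hy (by simpa using hn) ht.le))
  · by_contra hn
    obtain ⟨t, ht, hm⟩ := exists_not_mem_hull Q y (neg_ne_zero.2 (V.dir_ne_zero e))
    rw [smul_neg, ← sub_eq_add_neg] at hm
    exact hm (h (V.mem_edge_sub hy (by simpa using hn) ht.le))

/-- A half-edge in the hull that does not meet its interior lies on a hull edge. -/
theorem exists_hull_edge (hs : 3 ≤ H.size) {e : Fin V.numEdges} (h : V.edge e ⊆ queryHull Q)
    (hn : ¬ V.Inside Q e) : ∃ i < H.size, ∃ t₀ t₁ : ℝ, 0 ≤ t₀ ∧ t₀ < t₁ ∧ t₁ ≤ 1 ∧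
      H.at' i t₀ ∈ V.edge e ∧ H.at' i t₁ ∈ V.edge e := by
  obtain ⟨x, hx, y, hy, hxy⟩ := V.edge_nontrivial e
  set z := (1 / 2 : ℝ) • x + (1 / 2 : ℝ) • y with hz
  have hze : z ∈ V.edge e := V.convex_edge e hx hy (by norm_num) (by norm_num) (by norm_num)
  have hzf : z ∈ frontier (queryHull Q) := by
    rw [HullRep.frontier_hull]
    exact ⟨h hze, fun hi => hn ⟨z, hze, hi⟩⟩
  obtain ⟨i, hi, t, -, -, hzt⟩ := (HullRep.mem_frontier_iff hs).1 hzf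
  have h1 := HullRep.pos_nonneg (H := H) (by omega) i (h hx)
  have h2 := HullRep.pos_nonneg (H := H) (by omega) i (h hy)
  have h3 : H.pos i z = 0 := by rw [hzt, HullRep.pos_at]
  rw [hz, HullRep.pos_comb _ _ _ _ _ (by norm_num)] at h3
  obtain ⟨a, ha0, ha1, hxa⟩ := HullRep.exists_edge_of_pos hs (h hx) (i := i) (by linarith)
  obtain ⟨b, hb0, hb1, hyb⟩ := HullRep.exists_edge_of_pos hs (h hy) (i := i) (by linarith)
  rcases lt_trichotomy a b with hab | hab | hab
  · exact ⟨i, hi, a, b, ha0, hab, hb1, hxa ▸ hx, hyb ▸ hy⟩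
  · rw [hab, ← hyb] at hxa; exact absurd hxa hxy
  · exact ⟨i, hi, b, a, hb0, hab, ha1, hyb ▸ hy, hxa ▸ hx⟩

theorem nxt_injective : Function.Injective V.nxt :=
  fun a b h => by rw [← prv_nxt a, h, prv_nxt]

/-- The total number of half-edges of cells inside the hull. -/
theorem card_edges_le (hs : 3 ≤ H.size) (A : Finset (Fin V.numEdges))
    (hA : ∀ e ∈ A, MeetsInt P Q (V.so e) ∧ ¬ MeetsBd P Q (V.so e))
    (hnxt : ∀ e ∈ A, V.nxt e ∈ A) :
    A.card ≤ 10 * (innerSites P Q).card + 2 * H.size := by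
  classical
  have hsub : ∀ e ∈ A, V.edge e ⊆ queryHull Q := fun e he =>
    (V.edge_subset_owner e).trans (closed_subset_hull (hA e he).1 (hA e he).2)
  set A₀ := A.filter fun e => V.Inside Q e ∧ V.Inside Q (V.nxt e)
  set A₁ := A.filter fun e => ¬ V.Inside Q e
  set A₂ := A.filter fun e => ¬ V.Inside Q (V.nxt e)
  have c0 : A₀.card ≤ 6 * (innerSites P Q).card := card_inside_pairs_le A₀ fun e he => by
    obtain ⟨h1, h2, h3⟩ := Finset.mem_filter.1 he
    exact ⟨h2, (bounded_of_subset (hsub e h1)).1, h3⟩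
  have c2 : A₂.card ≤ A₁.card := by
    apply Finset.card_le_card_of_injOn V.nxt
    · intro e he
      obtain ⟨h1, h2⟩ := Finset.mem_filter.1 he
      exact Finset.mem_coe.2 (Finset.mem_filter.2 ⟨hnxt e h1, h2⟩)
    · exact nxt_injective.injOn
  have hex : ∀ e : Fin V.numEdges, ∃ i : ℕ, e ∈ A₁ → i < H.size ∧ ∃ t₀ t₁ : ℝ, 0 ≤ t₀ ∧ t₀ < t₁ ∧
      t₁ ≤ 1 ∧ H.at' i t₀ ∈ V.edge e ∧ H.at' i t₁ ∈ V.edge e := by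
    intro e
    by_cases he : e ∈ A₁
    · obtain ⟨h1, h2⟩ := Finset.mem_filter.1 he
      obtain ⟨i, hi⟩ := exists_hull_edge hs (hsub e h1) h2
      exact ⟨i, fun _ => hi⟩
    · exact ⟨0, fun h => absurd h he⟩
  choose g hg using hex
  have c1 : A₁.card ≤ 2 * (innerSites P Q).card + H.size := by
    have hinj : Set.InjOn (fun e => (g e, V.so e)) (A₁ : Set (Fin V.numEdges)) := by
      intro e he f hf hef
      obtain ⟨-, t₀, t₁, -, h01, -, a0, a1⟩ := hg e he
      obtain ⟨-, s₀, s₁, -, s01, -, b0, b1⟩ := hg f hf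
      have e1 : g e = g f := congrArg Prod.fst hef
      have e2 : V.so e = V.so f := congrArg Prod.snd hef
      have k1 := eq_mirror_of_ties (by omega) h01.ne (V.mem_edge.1 a0).1 (V.mem_edge.1 a1).1
      have k2 := eq_mirror_of_ties (by omega) s01.ne (V.mem_edge.1 b0).1 (V.mem_edge.1 b1).1
      have k1 := k1.resolve_left (V.sn_ne_so e)
      have k2 := k2.resolve_left (V.sn_ne_so f)
      refine eq_of_nbr (V.site_injective e2) (V.site_injective ?_)
      change V.sn e = V.sn f
      rw [k1, k2, e1, e2]
    rw [← Finset.card_image_of_injOn hinj]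
    apply card_pieces_le hs
    · intro x hx
      obtain ⟨e, he, rfl⟩ := Finset.mem_image.1 hx
      obtain ⟨h1, t₀, t₁, h0, h01, h1', a0, a1⟩ := hg e he
      exact ⟨h1, mem_innerSites.2 ⟨V.so_mem e, (hA e (Finset.mem_filter.1 he).1).1⟩,
        t₀, t₁, h0, h01, h1', V.edge_subset_owner e a0, V.edge_subset_owner e a1⟩
    · exact fun p hp => mem_innerSites.1 hp
  have hsubs : A ⊆ A₀ ∪ A₁ ∪ A₂ := by
    intro e he
    simp only [A₀, A₁, A₂, Finset.mem_union, Finset.mem_filter, he, true_and]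
    tauto
  have h1 := Finset.card_le_card hsubs
  have h2 := Finset.card_union_le (A₀ ∪ A₁) A₂
  have h3 := Finset.card_union_le A₀ A₁
  omega

end VoronoiRep

/-! ## The input in memory, and point location -/

variable {L : PointLocator V}

/-- The input is still in memory. -/
structure Input (V : VoronoiRep P) (L : PointLocator V) (H : HullRep Q) (s : RamState) : Prop where
  nvar : ∀ x < 4, s.nvar x = (inputState V L H).nvar x
  narr : ∀ a < 11, s.narr a = (inputState V L H).narr a
  rarr : ∀ a < 11, s.rarr a = (inputState V L H).rarr a

theorem input_inputState : Input V L H (inputState V L H) :=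
  ⟨fun _ _ => rfl, fun _ _ => rfl, fun _ _ => rfl⟩

/-- The program does not change the input. -/
def Cmd.safe (c : Cmd) : Bool :=
  c.nvars.all (4 ≤ ·) && c.narrs.all (11 ≤ ·) && c.rarrs.all (11 ≤ ·)

theorem Input.frame {s s' : RamState} {c : Cmd} (h : Input V L H s) (hF : Frame c s s')
    (hc : c.safe = true := by rfl) : Input V L H s' := by
  simp only [Cmd.safe, Bool.and_eq_true, List.all_eq_true, decide_eq_true_eq] at hc
  refine ⟨fun x hx => ?_, fun x hx => ?_, fun x hx => ?_⟩
  · rw [hF.nvar x fun hm => absurd (hc.1.1 x hm) (by omega), h.nvar x hx]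
  · rw [hF.narr x fun hm => absurd (hc.1.2 x hm) (by omega), h.narr x hx]
  · rw [hF.rarr x fun hm => absurd (hc.2 x hm) (by omega), h.rarr x hx]

theorem tableArray_fin {α : Type} [Zero α] {n : ℕ} (f : Fin n → α) (i : Fin n) :
    tableArray f i.val = f i := by simp [tableArray]

namespace Input

variable {s : RamState} (h : Input V L H s)
include h

theorem root : s.nvar 2 = L.root.val := h.nvar 2 (by norm_num)
theorem hullSize : s.nvar 3 = H.size := h.nvar 3 (by norm_num)
theorem first (i : Fin P.card) : s.narr 0 i.val = V.first i := by
  rw [h.narr 0 (by norm_num)]; exact tableArray_fin _ i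
theorem deg (i : Fin P.card) : s.narr 1 i.val = V.deg i := by
  rw [h.narr 1 (by norm_num)]; exact tableArray_fin _ i
theorem nbr (e : Fin V.numEdges) : s.narr 3 e.val = (V.nbr e).val := by
  rw [h.narr 3 (by norm_num)]; exact tableArray_fin (fun e => (V.nbr e).val) e
theorem hasSrc (e : Fin V.numEdges) : s.narr 5 e.val = (V.hasSrc e).toNat := by
  rw [h.narr 5 (by norm_num)]; exact tableArray_fin (fun e => (V.hasSrc e).toNat) e
theorem hasTgt (e : Fin V.numEdges) : s.narr 6 e.val = (V.hasTgt e).toNat := by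
  rw [h.narr 6 (by norm_num)]; exact tableArray_fin (fun e => (V.hasTgt e).toNat) e
theorem isLeaf (v : Fin L.size) : s.narr 7 v.val = (L.isLeaf v).toNat := by
  rw [h.narr 7 (by norm_num)]; exact tableArray_fin (fun v => (L.isLeaf v).toNat) v
theorem lo (v : Fin L.size) : s.narr 8 v.val = (L.lo v).val := by
  rw [h.narr 8 (by norm_num)]; exact tableArray_fin (fun v => (L.lo v).val) v
theorem hi (v : Fin L.size) : s.narr 9 v.val = (L.hi v).val := by
  rw [h.narr 9 (by norm_num)]; exact tableArray_fin (fun v => (L.hi v).val) v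
theorem label (v : Fin L.size) : s.narr 10 v.val = (L.label v).val := by
  rw [h.narr 10 (by norm_num)]; exact tableArray_fin (fun v => (L.label v).val) v
theorem site_zero (i : Fin P.card) : s.rarr 0 i.val = V.site i 0 := by
  rw [h.rarr 0 (by norm_num)]; exact tableArray_fin (fun i => V.site i 0) i
theorem site_one (i : Fin P.card) : s.rarr 1 i.val = V.site i 1 := by
  rw [h.rarr 1 (by norm_num)]; exact tableArray_fin (fun i => V.site i 1) i
theorem src_zero (e : Fin V.numEdges) : s.rarr 2 e.val = V.src e 0 := by
  rw [h.rarr 2 (by norm_num)]; exact tableArray_fin (fun i => V.src i 0) e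
theorem src_one (e : Fin V.numEdges) : s.rarr 3 e.val = V.src e 1 := by
  rw [h.rarr 3 (by norm_num)]; exact tableArray_fin (fun i => V.src i 1) e
theorem tgt_zero (e : Fin V.numEdges) : s.rarr 4 e.val = V.tgt e 0 := by
  rw [h.rarr 4 (by norm_num)]; exact tableArray_fin (fun i => V.tgt i 0) e
theorem tgt_one (e : Fin V.numEdges) : s.rarr 5 e.val = V.tgt e 1 := by
  rw [h.rarr 5 (by norm_num)]; exact tableArray_fin (fun i => V.tgt i 1) e
theorem la (v : Fin L.size) : s.rarr 6 v.val = L.a v := by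
  rw [h.rarr 6 (by norm_num)]; exact tableArray_fin L.a v
theorem lb (v : Fin L.size) : s.rarr 7 v.val = L.b v := by
  rw [h.rarr 7 (by norm_num)]; exact tableArray_fin L.b v
theorem lc (v : Fin L.size) : s.rarr 8 v.val = L.c v := by
  rw [h.rarr 8 (by norm_num)]; exact tableArray_fin L.c v
theorem vertex_zero {i : ℕ} (hi : i < H.size) : s.rarr 9 i = H.pt i 0 := by
  rw [h.rarr 9 (by norm_num), HullRep.pt_of_lt hi]
  exact tableArray_fin (fun i => H.vertex i 0) ⟨i, hi⟩
theorem vertex_one {i : ℕ} (hi : i < H.size) : s.rarr 10 i = H.pt i 1 := by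
  rw [h.rarr 10 (by norm_num), HullRep.pt_of_lt hi]
  exact tableArray_fin (fun i => H.vertex i 1) ⟨i, hi⟩

end Input

namespace PointLocator

variable (L) in
/-- One step of the descent. -/
def step (x : Plane) (v : Fin L.size) : Fin L.size :=
  if L.isLeaf v = true then v else if L.a v * x 0 + L.b v * x 1 ≤ L.c v then L.lo v else L.hi v

theorem step_iterate_leaf (x : Plane) {v : Fin L.size} (hv : L.isLeaf v = true) (k : ℕ) :
    (L.step x)^[k] v = v := by
  induction k with
  | zero => rfl
  | succ k ih => rw [Function.iterate_succ_apply, step, if_pos hv, ih]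

theorem step_inner (x : Plane) {v : Fin L.size} (hv : L.isLeaf v = false) :
    L.step x v = if L.a v * x 0 + L.b v * x 1 ≤ L.c v then L.lo v else L.hi v := by
  rw [step, if_neg (by simp [hv])]

theorem locates' (x : Plane) : L.isLeaf ((L.step x)^[L.depth] L.root) = true ∧
    x ∈ closedVoronoiCell P (V.site (L.label ((L.step x)^[L.depth] L.root))) := L.locates x

end PointLocator

theorem locAt_spec {s : RamState} (hI : Input V L H s) (x : Plane) (h0 : s.rvar 0 = x 0)
    (h1 : s.rvar 1 = x 1) : Runs locAt s (22 * L.depth + 10) fun s' =>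
      Frame locAt s s' ∧ ∃ r : Fin P.card, s'.nvar 11 = r.val ∧
        x ∈ closedVoronoiCell P (V.site r) := by
  suffices h : Runs locAt s (22 * L.depth + 10) fun s' =>
      ∃ r : Fin P.card, s'.nvar 11 = r.val ∧ x ∈ closedVoronoiCell P (V.site r) from
    h.frame.mono le_rfl fun s' h => ⟨h.2, h.1⟩
  let node : ℕ → RamState → Prop := fun j s' => Input V L H s' ∧ s'.rvar = s.rvar ∧
    s'.nvar 10 = ((L.step x)^[j] L.root).val ∧ j ≤ L.depth
  let I : ℕ → RamState → Prop := fun k s' => ∃ j, node j s' ∧ 22 * (L.depth - j) + 4 = k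
  have hloop : ∀ s', node 0 s' → Runs _ s' (22 * L.depth + 4) fun s' =>
      ∃ v : Fin L.size, Input V L H s' ∧ s'.nvar 10 = v.val ∧
        x ∈ closedVoronoiCell P (V.site (L.label v)) := fun s' h => by
    refine Runs.loop (b := .neq (.load 7 (.var 10)) (.const 0))
      (c := .ite (.rlt (.load 8 (.var 10))
        (.add (.mul (.load 6 (.var 10)) (.var 0)) (.mul (.load 7 (.var 10)) (.var 1))))
      (.nset 10 (.load 9 (.var 10))) (.nset 10 (.load 8 (.var 10)))) I ?_ ?_ _ s'
      ⟨0, h, by simp⟩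
    · rintro k s' ⟨j, ⟨hI', hr, hn, hj⟩, rfl⟩ hb
      simp only [BExp.eval, NExp.eval, hn, hI'.isLeaf] at hb
      have hleaf : L.isLeaf ((L.step x)^[j] L.root) = false :=
        Bool.toNat_eq_zero.1 hb
      have hlt : j < L.depth := by
        rcases hj.eq_or_lt with rfl | h
        · have := (L.locates' x).1
          rw [hleaf] at this; simp at this
        · exact h
      have hstep : (L.step x)^[j + 1] L.root = if L.a ((L.step x)^[j] L.root) * x 0 +
          L.b ((L.step x)^[j] L.root) * x 1 ≤ L.c ((L.step x)^[j] L.root) then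
          L.lo ((L.step x)^[j] L.root) else L.hi ((L.step x)^[j] L.root) := by
        rw [Function.iterate_succ_apply']; exact PointLocator.step_inner x hleaf
      refine ⟨18, (Runs.straight rfl (by simp [Cmd.cost, BExp.cost, RExp.cost, NExp.cost])
        (p := fun s' => node (j + 1) s') ?_).mono le_rfl fun s' h' => ⟨22 * (L.depth - (j + 1)) + 4,
          by simp only [BExp.cost, NExp.cost]; omega, j + 1, h', rfl⟩⟩
      have hR := Cmd.exec_run (.ite (.rlt (.load 8 (.var 10))
        (.add (.mul (.load 6 (.var 10)) (.var 0)) (.mul (.load 7 (.var 10)) (.var 1))))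
        (.nset 10 (.load 9 (.var 10))) (.nset 10 (.load 8 (.var 10)))) s' rfl
      obtain ⟨t, -, hex⟩ := hR
      refine ⟨hI'.frame hex.frame rfl, ?_, ?_, hlt⟩
      · rw [← hr]; funext y; exact hex.frame.rvar y (by simp [Cmd.rvars])
      · rw [hstep]
        simp only [Cmd.run, BExp.eval, RExp.eval, NExp.eval, hn, hI'.la, hI'.lb, hI'.lc, hr, h0, h1]
        by_cases hc : L.a ((L.step x)^[j] L.root) * x 0 +
          L.b ((L.step x)^[j] L.root) * x 1 ≤ L.c ((L.step x)^[j] L.root)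
        · rw [if_pos hc, if_neg (not_lt.2 hc)]
          simp [hI'.lo]
        · rw [if_neg hc, if_pos (not_le.1 hc)]
          simp [hI'.hi]
    · rintro k s' ⟨j, ⟨hI', hr, hn, hj⟩, rfl⟩ hb
      simp only [BExp.eval, NExp.eval, hn, hI'.isLeaf] at hb
      have hleaf : L.isLeaf ((L.step x)^[j] L.root) = true := by
        by_contra hc; exact hb (Bool.toNat_eq_zero.2 (by rwa [Bool.not_eq_true] at hc))
      refine ⟨by simp only [BExp.cost, NExp.cost]; omega, _, hI', hn, ?_⟩
      have := (L.locates' x).2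
      rwa [show L.depth = (L.depth - j) + j by omega, Function.iterate_add_apply,
        L.step_iterate_leaf x hleaf] at this
  refine Runs.mono (B := 2 + ((22 * L.depth + 4) + 3)) (Runs.seq (p := node 0) ?_ fun s' h' =>
    Runs.seq (hloop s' h') fun s'' ⟨v, h1, h2, h3⟩ => ?_) (by omega) fun _ h => h
  · refine Runs.straight rfl (by simp [Cmd.cost, NExp.cost]) ⟨?_, rfl, ?_, by omega⟩
    · obtain ⟨t, -, hex⟩ := Cmd.exec_run (.nset 10 (.var 2)) s rfl
      exact hI.frame hex.frame rfl
    · simp [Cmd.run, NExp.eval, hI.root]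
  · refine Runs.straight rfl (by simp [block, Cmd.cost, NExp.cost]) ⟨L.label v, ?_, h3⟩
    simp [block, Cmd.run, NExp.eval, h2, h1.label]

theorem locateCmd_spec (hm : 0 < H.size) {s : RamState} (hI : Input V L H s) :
    Runs locateCmd s (22 * L.depth + 18) fun s' =>
      Frame locateCmd s s' ∧ ∃ r : Fin P.card, s'.nvar 5 = r.val ∧
        H.at' 0 0 ∈ closedVoronoiCell P (V.site r) := by
  suffices h : Runs locateCmd s (22 * L.depth + 18) fun s' =>
      ∃ r : Fin P.card, s'.nvar 5 = r.val ∧ H.at' 0 0 ∈ closedVoronoiCell P (V.site r) from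
    h.frame.mono le_rfl fun s' h => ⟨h.2, h.1⟩
  have h1 : Runs (.rset 0 (.load 9 (.const 0))) s 3 fun s' =>
      Input V L H s' ∧ s'.rvar 0 = H.pt 0 0 := by
    refine (Runs.straight rfl (by simp [Cmd.cost, RExp.cost, NExp.cost])
      (p := fun s' => s'.rvar 0 = H.pt 0 0) ?_).frame.mono le_rfl
      fun s' h => ⟨hI.frame h.2 rfl, h.1⟩
    simp [Cmd.run, RExp.eval, NExp.eval, hI.vertex_zero hm]
  have h2 : ∀ s', (Input V L H s' ∧ s'.rvar 0 = H.pt 0 0) →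
      Runs (.rset 1 (.load 10 (.const 0))) s' 3 fun s' =>
      Input V L H s' ∧ s'.rvar 0 = H.pt 0 0 ∧ s'.rvar 1 = H.pt 0 1 := fun s' h => by
    refine (Runs.straight rfl (by simp [Cmd.cost, RExp.cost, NExp.cost])
      (p := fun s' => s'.rvar 0 = H.pt 0 0 ∧ s'.rvar 1 = H.pt 0 1) ?_).frame.mono le_rfl
      fun s' h' => ⟨h.1.frame h'.2 rfl, h'.1⟩
    simp [Cmd.run, RExp.eval, NExp.eval, h.1.vertex_one hm, h.2]
  refine Runs.mono (B := 3 + (3 + ((22 * L.depth + 10) + 2))) (h1.seq fun s' h => (h2 s' h).seq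
    fun s' h => (locAt_spec h.1 (H.pt 0) h.2.1 h.2.2).seq (fun s' h => ?_)) (by omega) fun _ h => h
  obtain ⟨-, r, h1, h2⟩ := h
  refine Runs.straight rfl (by simp [block, Cmd.cost, NExp.cost]) ⟨r, ?_, by rwa [HullRep.at_zero]⟩
  simp [block, Cmd.run, NExp.eval, h1]

/-! ## Searching the boundary of a cell -/

theorem Runs.run {c : Cmd} {s : RamState} {B : ℕ} (h : c.straight = true := by rfl)
    (hB : c.cost ≤ B := by simp [block, Cmd.cost, BExp.cost, RExp.cost, NExp.cost]) :
    Runs c s B fun s' => s' = c.run s ∧ Frame c s s' :=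
  (Runs.straight h hB (p := fun s' => s' = c.run s) rfl).frame

theorem Runs.conseq {c : Cmd} {s : RamState} {B : ℕ} {p q : RamState → Prop}
    (h : Runs c s B p) (hpq : ∀ s', p s' → q s') : Runs c s B q := h.mono le_rfl hpq

theorem Runs.ite' {b : BExp} {c₁ c₂ : Cmd} {s : RamState} {B₁ B₂ B : ℕ} {q : RamState → Prop}
    (h₁ : b.eval s → Runs c₁ s B₁ q) (h₂ : ¬ b.eval s → Runs c₂ s B₂ q)
    (hB : b.cost + max B₁ B₂ ≤ B := by simp [onEdgeTest, tieTest, slopeExp, baseExp, RExp.sq,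
      BExp.cost, RExp.cost, NExp.cost]; try omega) : Runs (.ite b c₁ c₂) s B q :=
  (Runs.ite (fun h => (h₁ h).mono (le_max_left _ _) fun _ h => h)
    fun h => (h₂ h).mono (le_max_right _ _) fun _ h => h).mono hB fun _ h => h

/-- The state in which the boundary of the cell `c` is searched for the point `z`. -/
structure Searching (V : VoronoiRep P) (L : PointLocator V) (H : HullRep Q) (c : Fin P.card)
    (z : Plane) (s : RamState) : Prop where
  input : Input V L H s
  cell : s.nvar 20 = c.val
  first : s.nvar 26 = V.first c
  deg : s.nvar 27 = V.deg c
  z0 : s.rvar 20 = z 0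
  z1 : s.rvar 21 = z 1

theorem Searching.frame {c : Fin P.card} {z : Plane} {s s' : RamState} {cmd : Cmd}
    (h : Searching V L H c z s) (hF : Frame cmd s s') (hc : cmd.safe = true := by rfl)
    (hn : (cmd.nvars.all fun x => x != 20 && x != 26 && x != 27) = true := by rfl)
    (hr : (cmd.rvars.all fun x => x != 20 && x != 21) = true := by rfl) : Searching V L H c z s' := by
  simp only [List.all_eq_true, Bool.and_eq_true, bne_iff_ne] at hn hr
  exact ⟨h.input.frame hF hc, by rw [hF.nvar _ fun hm => (hn _ hm).1.1 rfl, h.cell],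
    by rw [hF.nvar _ fun hm => (hn _ hm).1.2 rfl, h.first],
    by rw [hF.nvar _ fun hm => (hn _ hm).2 rfl, h.deg],
    by rw [hF.rvar _ fun hm => (hr _ hm).1 rfl, h.z0],
    by rw [hF.rvar _ fun hm => (hr _ hm).2 rfl, h.z1]⟩

theorem eval_onEdgeTest {c : Fin P.card} {z : Plane} {s : RamState} (h : Searching V L H c z s)
    (hz : z ∈ closedVoronoiCell P (V.site c)) {e : Fin V.numEdges} (ho : V.owner e = c)
    (he : s.nvar 21 = e.val) : onEdgeTest.eval s ↔ V.Fwd e z := by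
  have hso : V.so e = V.site c := by rw [← ho]; rfl
  have h1 : (tieTest (.var 20) (.load 3 (.var 21))).eval s ↔ z ∈ V.edge e := by
    simp only [tieTest, RExp.sq, BExp.eval, RExp.eval, NExp.eval, he, h.cell, h.z0, h.z1,
      h.input.nbr, h.input.site_zero, h.input.site_one]
    constructor
    · intro h
      apply V.mem_edge_of_tie (hso ▸ hz)
      rw [hso]; simp only [gap, sqd, VoronoiRep.sn]; linarith
    · intro h
      have := (V.mem_edge.1 h).1
      rw [hso] at this; simp only [gap, sqd, VoronoiRep.sn] at this; linarith
  have h2 : (V.hasTgt e).toNat = 1 ↔ V.hasTgt e = true := Bool.toNat_eq_one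
  have h3 : (z 0 = V.tgt e 0 ∧ z 1 = V.tgt e 1) ↔ z = V.tgt e :=
    ⟨fun h => plane_ext h.1 h.2, fun h => by rw [h]; exact ⟨rfl, rfl⟩⟩
  change (_ ∧ ¬ _) ↔ _
  rw [h1]
  simp only [BExp.eval, RExp.eval, NExp.eval, he, h.z0, h.z1, h.input.hasTgt, h.input.tgt_zero,
    h.input.tgt_one, h2, h3]
  rfl

/-- The half-edge with a given position in the block of a cell. -/
def blockEdge (V : VoronoiRep P) (c : Fin P.card) (h : 0 < V.deg c) (j : ℕ) : Fin V.numEdges :=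
  if hj : j < V.deg c then ⟨V.first c + j, by have := V.block_le c; omega⟩
  else ⟨V.first c, by have := V.block_le c; omega⟩

theorem isBlock_blockEdge (c : Fin P.card) (h : 0 < V.deg c) :
    V.IsBlock c (blockEdge V c h) := by
  intro j hj; simp [blockEdge, hj]

theorem VoronoiRep.IsBlock.exists_eq {c : Fin P.card} {E : ℕ → Fin V.numEdges}
    (hE : V.IsBlock c E) {e : Fin V.numEdges} (ho : V.owner e = c) :
    ∃ j < V.deg c, e = E j := by
  obtain ⟨h1, h2⟩ := (V.mem_block e c).1 ho
  refine ⟨e.val - V.first c, by omega, Fin.ext ?_⟩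
  rw [hE _ (by omega)]; omega

theorem searchLoop_spec {c : Fin P.card} {z : Plane} {E : ℕ → Fin V.numEdges}
    (hE : V.IsBlock c E) (h2 : 2 < V.deg c) {s : RamState} (hS : Searching V L H c z s)
    (ha0 : s.rvar 22 = V.tgt (E 0) 0) (ha1 : s.rvar 23 = V.tgt (E 0) 1) (hlo : s.nvar 23 = 1)
    (hhi : s.nvar 24 = V.deg c - 1) :
    Runs searchLoop s (46 * Nat.clog 2 (V.deg c) + 5) fun s' => Searching V L H c z s' ∧
      1 < s'.nvar 24 ∧ s'.nvar 24 < V.deg c ∧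
      ∀ J < V.deg c, 2 ≤ J → V.Fwd (E J) z → J = s'.nvar 24 := by
  let I : ℕ → RamState → Prop := fun k s' => Searching V L H c z s' ∧
    s'.rvar 22 = V.tgt (E 0) 0 ∧ s'.rvar 23 = V.tgt (E 0) 1 ∧ 1 ≤ s'.nvar 23 ∧
    s'.nvar 23 < s'.nvar 24 ∧ s'.nvar 24 < V.deg c ∧
    (∀ J < V.deg c, 2 ≤ J → V.Fwd (E J) z → s'.nvar 23 < J ∧ J ≤ s'.nvar 24) ∧
    k = 46 * Nat.clog 2 (s'.nvar 24 - s'.nvar 23) + 5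
  have hle : 46 * Nat.clog 2 (V.deg c - 1 - 1) + 5 ≤ 46 * Nat.clog 2 (V.deg c) + 5 := by
    have := Nat.clog_mono_right 2 (show V.deg c - 1 - 1 ≤ V.deg c by omega)
    omega
  refine Runs.mono (Runs.loop I ?_ ?_ _ s ⟨hS, ha0, ha1, by omega, by omega, by omega,
    fun J hJ h hF => ⟨by omega, by omega⟩, by rw [hlo, hhi]⟩) hle fun _ h => h
  · rintro k s' ⟨hS', h22, h23, hl1, hlh, hhd, hJ, rfl⟩ hb
    simp only [BExp.eval, NExp.eval] at hb
    set l := s'.nvar 23 with hl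
    set h := s'.nvar 24 with hh
    set m := (l + h) / 2 with hm
    have hlm : l < m := by omega
    have hmh : m < h := by omega
    have hfm : V.first c + m = (E m).val := (hE m (by omega)).symm
    have hsearch := fun (J : ℕ) (hJd : J < V.deg c) (hJ2 : 2 ≤ J) (hF : V.Fwd (E J) z) =>
      hE.search hJd hJ2 hF (i := m) (by omega) (by omega)
    have hclog : Nat.clog 2 (h - l) = Nat.clog 2 ((h - l + 1) / 2) + 1 := by
      rw [Nat.clog_of_two_le (by norm_num) (by omega),
        show h - l + 2 - 1 = h - l + 1 by omega]
    refine ⟨41, (Runs.run rfl).mono le_rfl fun s'' ⟨hr, hF⟩ => ?_⟩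
    have hS'' := hS'.frame hF
    have e22 : s''.rvar 22 = V.tgt (E 0) 0 := by rw [hF.rvar 22, h22]
    have e23 : s''.rvar 23 = V.tgt (E 0) 1 := by rw [hF.rvar 23, h23]
    have hcr : cross (V.tgt (E m) - V.tgt (E 0)) (z - V.tgt (E 0)) =
        (V.tgt (E m) 0 - V.tgt (E 0) 0) * (z 1 - V.tgt (E 0) 1) -
        (V.tgt (E m) 1 - V.tgt (E 0) 1) * (z 0 - V.tgt (E 0) 0) := by simp [cross]
    simp only [block, Cmd.run, BExp.eval, RExp.eval, NExp.eval, Function.update_self,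
      Function.update_of_ne (show (26 : ℕ) ≠ 25 by decide), hS'.first, ← hl, ← hh, ← hm, hfm,
      hS'.input.tgt_zero, hS'.input.tgt_one, h22, h23, hS'.z0, hS'.z1, Int.cast_zero, ← hcr] at hr
    by_cases hc : cross (V.tgt (E m) - V.tgt (E 0)) (z - V.tgt (E 0)) < 0
    · rw [if_pos hc] at hr
      have g24 : s''.nvar 24 = m := by rw [hr]; simp
      have g23 : s''.nvar 23 = l := by rw [hr]; simp [hl]
      refine ⟨46 * Nat.clog 2 (m - l) + 5, ?_, hS'', e22, e23, by omega, by omega, by omega,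
        fun J hJd hJ2 hF => ?_, by rw [g24, g23]⟩
      · simp only [BExp.cost, NExp.cost]
        have := Nat.clog_mono_right 2 (show m - l ≤ (h - l + 1) / 2 by omega)
        omega
      · have h1 := hJ J hJd hJ2 hF
        have h2 := (hsearch J hJd hJ2 hF).1
        rw [g23, g24]
        refine ⟨h1.1, ?_⟩
        by_contra hn
        exact absurd hc (not_lt.2 (h2 (by omega)))
    · rw [if_neg hc] at hr
      have g24 : s''.nvar 24 = h := by rw [hr]; simp [hh]
      have g23 : s''.nvar 23 = m := by rw [hr]; simp
      refine ⟨46 * Nat.clog 2 (h - m) + 5, ?_, hS'', e22, e23, by omega, by omega, by omega,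
        fun J hJd hJ2 hF => ?_, by rw [g24, g23]⟩
      · simp only [BExp.cost, NExp.cost]
        have := Nat.clog_mono_right 2 (show h - m ≤ (h - l + 1) / 2 by omega)
        omega
      · have h1 := hJ J hJd hJ2 hF
        have h2 := (hsearch J hJd hJ2 hF).2
        rw [g23, g24]
        refine ⟨?_, h1.2⟩
        by_contra hn
        exact hc (h2 (by omega))
  · rintro k s' ⟨hS', h22, h23, hl1, hlh, hhd, hJ, rfl⟩ hb
    simp only [BExp.eval, NExp.eval] at hb
    refine ⟨by simp only [BExp.cost, NExp.cost]; omega, hS', by omega, hhd, fun J h1 h2 h3 => ?_⟩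
    have := hJ J h1 h2 h3
    omega

theorem search_spec {c : Fin P.card} {z : Plane} {s : RamState} (hI : Input V L H s)
    (hc : s.nvar 20 = c.val) (h0 : s.rvar 20 = z 0) (h1 : s.rvar 21 = z 1)
    (hz : z ∈ closedVoronoiCell P (V.site c)) :
    Runs search s (46 * Nat.clog 2 (V.deg c) + 240) fun s' => Searching V L H c z s' ∧
      ((s'.nvar 22 = 1 ∧ ∃ e, s'.nvar 21 = e.val ∧ V.owner e = c ∧ V.Fwd e z) ∨
        (s'.nvar 22 = 0 ∧ ∀ e, V.owner e = c → ¬ V.Fwd e z)) ∧ Frame search s s' := by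
  suffices h : Runs search s (46 * Nat.clog 2 (V.deg c) + 240) fun s' => Searching V L H c z s' ∧
      ((s'.nvar 22 = 1 ∧ ∃ e, s'.nvar 21 = e.val ∧ V.owner e = c ∧ V.Fwd e z) ∨
        (s'.nvar 22 = 0 ∧ ∀ e, V.owner e = c → ¬ V.Fwd e z)) from
    h.frame.conseq fun s' h => ⟨h.1.1, h.1.2, h.2⟩
  let Found : RamState → Prop := fun s' =>
    (s'.nvar 22 = 1 ∧ ∃ e, s'.nvar 21 = e.val ∧ V.owner e = c ∧ V.Fwd e z) ∨
        (s'.nvar 22 = 0 ∧ ∀ e, V.owner e = c → ¬ V.Fwd e z)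
  have hskip : ∀ s', Searching V L H c z s' → s'.nvar 22 = 0 →
      (∀ e, V.owner e = c → ¬ V.Fwd e z) →
      Runs .skip s' 1 fun s' => Searching V L H c z s' ∧ Found s' := fun s' hS hn hf =>
    Runs.straight rfl le_rfl ⟨hS, Or.inr ⟨hn, hf⟩⟩
  have hfound : ∀ s', Searching V L H c z s' → ∀ e : Fin V.numEdges, s'.nvar 21 = e.val →
      V.owner e = c → V.Fwd e z → Runs (.nset 22 (.const 1)) s' 2 fun s' =>
        Searching V L H c z s' ∧ Found s' := fun s' hS e he ho hF => by
    refine (Runs.run rfl le_rfl).conseq fun s'' ⟨hr, hF'⟩ => ⟨hS.frame hF',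
      Or.inl ⟨by rw [hr]; simp [Cmd.run, NExp.eval], e, ?_, ho, hF⟩⟩
    rw [hF'.nvar 21, he]
  refine Runs.mono (B := 4 + (4 + (2 + (2 + (4 + (46 * Nat.clog 2 (V.deg c) + 214))))))
    (Runs.seq (Runs.run rfl) fun s₁ ⟨r₁, f₁⟩ =>
      Runs.seq (Runs.run rfl) fun s₂ ⟨r₂, f₂⟩ =>
      Runs.seq (Runs.run rfl) fun s₃ ⟨r₃, f₃⟩ =>
      Runs.seq (Runs.run rfl) fun s₄ ⟨r₄, f₄⟩ => ?_) (by omega)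
    fun _ h => h
  have hI₁ := hI.frame f₁
  have hI₄ := ((hI₁.frame f₂).frame f₃).frame f₄
  have hc₁ : s₁.nvar 20 = c.val := by rw [f₁.nvar 20, hc]
  have hS : Searching V L H c z s₄ := by
    refine ⟨hI₄, ?_, ?_, ?_, ?_, ?_⟩
    · rw [f₄.nvar 20, f₃.nvar 20, f₂.nvar 20, hc₁]
    · rw [f₄.nvar 26, f₃.nvar 26, f₂.nvar 26, r₁]
      simp [Cmd.run, NExp.eval, hc, hI.first]
    · rw [f₄.nvar 27, f₃.nvar 27, r₂]
      simp [Cmd.run, NExp.eval, hc₁, hI₁.deg]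
    · rw [f₄.rvar 20, f₃.rvar 20, f₂.rvar 20, f₁.rvar 20, h0]
    · rw [f₄.rvar 21, f₃.rvar 21, f₂.rvar 21, f₁.rvar 21, h1]
  have h22 : s₄.nvar 22 = 0 := by
    rw [f₄.nvar 22, r₃]; simp [Cmd.run, NExp.eval]
  have h21 : s₄.nvar 21 = V.first c := by
    rw [r₄]; simp only [Cmd.run, NExp.eval, Function.update_self]
    rw [← f₄.nvar 26, hS.first]
  refine Runs.ite' (B₁ := 46 * Nat.clog 2 (V.deg c) + 210) (B₂ := 1) (fun hb => ?_) fun hb => ?_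
  swap
  · simp only [BExp.eval, NExp.eval, hS.deg] at hb
    refine hskip s₄ hS h22 fun e he _ => ?_
    have := (V.mem_block e c).1 he
    omega
  simp only [BExp.eval, NExp.eval, hS.deg] at hb
  have hE := isBlock_blockEdge (V := V) c hb
  set E := blockEdge V c hb with hEdef
  have he0 : s₄.nvar 21 = (E 0).val := by rw [h21, hE 0 hb, add_zero]
  have ho := fun j (hj : j < V.deg c) => hE.owner hj
  refine Runs.ite' (B₁ := 2) (B₂ := 46 * Nat.clog 2 (V.deg c) + 151) (fun hb' => ?_)
    fun hb0 => ?_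
  · exact hfound s₄ hS _ he0 (ho 0 hb) ((eval_onEdgeTest hS hz (ho 0 hb) he0).1 hb')
  rw [eval_onEdgeTest hS hz (ho 0 hb) he0] at hb0
  refine Runs.ite' (B₁ := 46 * Nat.clog 2 (V.deg c) + 148) (B₂ := 1) (fun hd1 => ?_)
    fun hd1 => ?_
  swap
  · simp only [BExp.eval, NExp.eval, hS.deg] at hd1
    refine hskip s₄ hS h22 fun e he => ?_
    obtain ⟨j, hj, rfl⟩ := hE.exists_eq he
    rwa [show j = 0 by omega]
  simp only [BExp.eval, NExp.eval, hS.deg] at hd1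
  refine (Runs.seq (B₁ := 4) (B₂ := 46 * Nat.clog 2 (V.deg c) + 144)
    (Runs.run rfl) fun s₅ ⟨r₅, f₅⟩ => ?_).mono (by omega)
    fun _ h => h
  have hS₅ := hS.frame f₅
  have h22₅ : s₅.nvar 22 = 0 := by rw [f₅.nvar 22, h22]
  have he1 : s₅.nvar 21 = (E 1).val := by
    rw [r₅, hE 1 hd1]; simp [Cmd.run, NExp.eval, hS.first]
  refine Runs.ite' (B₁ := 2) (B₂ := 46 * Nat.clog 2 (V.deg c) + 85) (fun hb' => ?_)
    fun hb1 => ?_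
  · exact hfound s₅ hS₅ _ he1 (ho 1 hd1) ((eval_onEdgeTest hS₅ hz (ho 1 hd1) he1).1 hb')
  rw [eval_onEdgeTest hS₅ hz (ho 1 hd1) he1] at hb1
  refine Runs.ite' (B₁ := 46 * Nat.clog 2 (V.deg c) + 82) (B₂ := 1) (fun hd2 => ?_)
    fun hd2 => ?_
  swap
  · simp only [BExp.eval, NExp.eval, hS₅.deg] at hd2
    refine hskip s₅ hS₅ h22₅ fun e he => ?_
    obtain ⟨j, hj, rfl⟩ := hE.exists_eq he
    rcases (by omega : j = 0 ∨ j = 1) with rfl | rfl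
    · exact hb0
    · exact hb1
  simp only [BExp.eval, NExp.eval, hS₅.deg] at hd2
  refine Runs.mono (B := 3 + (3 + (2 + (4 + ((46 * Nat.clog 2 (V.deg c) + 5) + (4 + 61))))))
    (Runs.seq (Runs.run rfl) fun t₁ ⟨q₁, g₁⟩ =>
      Runs.seq (Runs.run rfl) fun t₂ ⟨q₂, g₂⟩ =>
      Runs.seq (Runs.run rfl) fun t₃ ⟨q₃, g₃⟩ =>
      Runs.seq (Runs.run rfl) fun t₄ ⟨q₄, g₄⟩ => ?_)
    (by omega) fun _ h => h
  have hT₁ := hS₅.frame g₁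
  have hT₃ := (hT₁.frame g₂).frame g₃
  have hT₄ := hT₃.frame g₄
  have hf0 : V.first c = (E 0).val := by rw [hE 0 hb, add_zero]
  have k22 : t₄.nvar 22 = 0 := by
    rw [g₄.nvar 22, g₃.nvar 22, g₂.nvar 22, g₁.nvar 22, h22₅]
  refine (searchLoop_spec hE hd2 hT₄ ?_ ?_ ?_ ?_).frame.seq fun t₅ ⟨⟨hT₅, hl, hh, hJ⟩, g₅⟩ => ?_
  · rw [g₄.rvar 22, g₃.rvar 22, g₂.rvar 22, q₁]
    simp only [Cmd.run, RExp.eval, NExp.eval, hS₅.first, hf0, hS₅.input.tgt_zero,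
      Function.update_self]
  · rw [g₄.rvar 23, g₃.rvar 23, q₂]
    simp only [Cmd.run, RExp.eval, NExp.eval, hT₁.first, hf0, hT₁.input.tgt_one,
      Function.update_self]
  · rw [g₄.nvar 23, q₃]; simp [Cmd.run, NExp.eval]
  · rw [q₄]; simp [Cmd.run, NExp.eval, hT₃.deg]
  · refine Runs.seq (Runs.run rfl) fun t₆ ⟨q₆, g₆⟩ => ?_
    have hT₆ := hT₅.frame g₆
    have m22 : t₆.nvar 22 = 0 := by rw [g₆.nvar 22, g₅.nvar 22, k22]
    have he : t₆.nvar 21 = (E (t₅.nvar 24)).val := by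
      rw [q₆, hE _ hh]; simp [Cmd.run, NExp.eval, hT₅.first]
    refine Runs.ite' (B₁ := 2) (B₂ := 1) (fun hb' => ?_) fun hb2 => ?_
    · exact hfound t₆ hT₆ _ he (ho _ hh) ((eval_onEdgeTest hT₆ hz (ho _ hh) he).1 hb')
    · rw [eval_onEdgeTest hT₆ hz (ho _ hh) he] at hb2
      refine hskip t₆ hT₆ m22 fun e he => ?_
      obtain ⟨j, hj, rfl⟩ := hE.exists_eq he
      intro hF
      rcases (by omega : j = 0 ∨ j = 1 ∨ 2 ≤ j) with rfl | rfl | h2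
      · exact hb0 hF
      · exact hb1 hF
      · rw [hJ j hj h2 hF] at hF; exact hb2 hF

/-! ## The output list and the list of records in memory -/

/-- Started in `s`, the program halts, and the running time and the final state satisfy `post`. -/
def Halts (c : Cmd) (s : RamState) (post : ℕ → RamState → Prop) : Prop :=
  ∃ t s', Exec c s t s' ∧ post t s'

theorem Runs.halts {c : Cmd} {s : RamState} {B : ℕ} {p : RamState → Prop} (h : Runs c s B p) :
    Halts c s fun t s' => t ≤ B ∧ p s' := h

theorem Halts.mono {c : Cmd} {s : RamState} {p q : ℕ → RamState → Prop} (h : Halts c s p)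
    (hpq : ∀ t s', p t s' → q t s') : Halts c s q := by
  obtain ⟨t, s', h1, h2⟩ := h
  exact ⟨t, s', h1, hpq _ _ h2⟩

theorem Halts.seq {c₁ c₂ : Cmd} {s : RamState} {p q : ℕ → RamState → Prop} (h₁ : Halts c₁ s p)
    (h₂ : ∀ t s', p t s' → Halts c₂ s' fun t' s'' => q (t + t') s'') :
    Halts (.seq c₁ c₂) s q := by
  obtain ⟨t, s', h1, h2⟩ := h₁
  obtain ⟨t', s'', h1', h2'⟩ := h₂ t s' h2
  exact ⟨_, _, .seq h1 h1', h2'⟩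

theorem Halts.frame {c : Cmd} {s : RamState} {p : ℕ → RamState → Prop} (h : Halts c s p) :
    Halts c s fun t s' => p t s' ∧ Frame c s s' := by
  obtain ⟨t, s', h1, h2⟩ := h
  exact ⟨t, s', h1, h2, h1.frame⟩

/-- A loop rule with an invariant that knows the time used so far, and a measure for termination. -/
theorem Halts.loop {b : BExp} {c : Cmd} {q : ℕ → RamState → Prop} (I : ℕ → ℕ → RamState → Prop)
    (hstep : ∀ k t s, I k t s → b.eval s →
      Halts c s fun t' s' => ∃ k' < k, I k' (t + b.cost + t') s')
    (hexit : ∀ k t s, I k t s → ¬ b.eval s → q (t + b.cost) s) :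
    ∀ k t s, I k t s → Halts (.loop b c) s fun t' s' => q (t + t') s' := by
  intro k
  induction k using Nat.strong_induction_on with
  | _ k ih =>
    intro t s hI
    by_cases hb : b.eval s
    · obtain ⟨t', s', h1, k', h2, h3⟩ := hstep k t s hI hb
      obtain ⟨t'', s'', g1, g2⟩ := ih k' h2 _ s' h3
      exact ⟨_, _, .loopTrue hb h1 g1, by simpa only [add_assoc] using g2⟩
    · exact ⟨_, _, .loopFalse hb, hexit k t s hI hb⟩

/-- The output list and the marks in memory. -/
structure OutList (V : VoronoiRep P) (Q : Finset Plane) (l : List (Fin P.card)) (s : RamState) :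
    Prop where
  nodup : l.Nodup
  len : s.nvar 6 = l.length
  get : ∀ k (h : k < l.length), s.narr 11 k = (l[k]'h).val
  marked : ∀ c ∈ l, s.narr 14 c.val ≠ 0
  of_marked : ∀ c : Fin P.card, s.narr 14 c.val ≠ 0 →
    c ∈ l ∨ ∀ x ∈ voronoiCell P (V.site c), x ∉ queryHull Q

theorem OutList.frame {l : List (Fin P.card)} {s s' : RamState} {c : Cmd}
    (h : OutList V Q l s) (hF : Frame c s s') (h6 : 6 ∉ c.nvars := by decide) (h11 : 11 ∉ c.narrs := by decide)
    (h14 : 14 ∉ c.narrs := by decide) : OutList V Q l s' := by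
  refine ⟨h.nodup, ?_, ?_, ?_, ?_⟩
  · rw [hF.nvar 6 h6]; exact h.len
  · rw [hF.narr 11 h11]; exact h.get
  · rw [hF.narr 14 h14]; exact h.marked
  · rw [hF.narr 14 h14]; exact h.of_marked

theorem OutList.outputs {l : List (Fin P.card)} {s : RamState} (h : OutList V Q l s)
    {A : Set Plane} (hA : ∀ c, c ∈ l ↔ V.site c ∈ A) (hP : A ⊆ P) : Outputs V s A := by
  have hk : ∀ k, k < s.nvar outLenVar ↔ k < l.length := fun k => by
    rw [show s.nvar outLenVar = l.length from h.len]
  refine ⟨fun k hk' => ?_, fun k hk' k' hk'' e => ?_, ?_⟩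
  · have := h.get k ((hk k).1 hk')
    rw [show s.narr outArr k = _ from this]; exact Fin.isLt _
  · have e1 := h.get k ((hk k).1 hk')
    have e2 := h.get k' ((hk k').1 hk'')
    have : l[k]'((hk k).1 hk') = l[k']'((hk k').1 hk'') := by
      apply Fin.ext; rw [← e1, ← e2]; exact e
    exact (h.nodup.getElem_inj_iff).1 this
  · ext p
    constructor
    · rintro ⟨k, hk', i, hi, rfl⟩
      have e1 := h.get k ((hk k).1 hk')
      rw [← hA]
      have : i = l[k]'((hk k).1 hk') := by
        apply Fin.ext; rw [← e1, ← hi]; rfl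
      rw [this]; exact List.getElem_mem _
    · intro hp
      obtain ⟨c, rfl⟩ := V.exists_site (hP hp)
      obtain ⟨k, hk', e⟩ := List.getElem_of_mem ((hA c).2 hp)
      exact ⟨k, (hk k).2 hk', c, by rw [← e]; exact h.get k hk', rfl⟩

theorem output_spec {l : List (Fin P.card)} {s : RamState} (h : OutList V Q l s)
    {e : NExp} {c : Fin P.card} (he : e.eval s = c.val)
    (he' : ∀ s' : RamState, s'.nvar 5 = s.nvar 5 → s'.nvar 30 = s.nvar 30 →
      s'.nvar 20 = s.nvar 20 → e.eval s' = e.eval s) (hn : s.narr 14 c.val = 0) :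
    Runs (output e) s (2 * e.cost + 8) fun s' => OutList V Q (l ++ [c]) s' ∧
      ∀ z, s.narr 14 z ≠ 0 → s'.narr 14 z ≠ 0 := by
  refine Runs.straight rfl (by simp only [output, block, Cmd.cost, NExp.cost]; omega) ?_
  have hc : c ∉ l := fun hm => h.marked c hm hn
  have hs : ∀ s' : RamState, s'.nvar 5 = s.nvar 5 → s'.nvar 30 = s.nvar 30 →
      s'.nvar 20 = s.nvar 20 → e.eval s' = c.val := fun s' h1 h2 h3 => (he' s' h1 h2 h3).trans he
  have h14 : ((output e).run s).narr 14 = Function.update (s.narr 14) c.val 1 := by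
    simp only [output, block, Cmd.run, NExp.eval, Function.update_self]
    rw [Function.update_of_ne (by decide), hs _ (by simp) (by simp) (by simp)]
  have h11 : ((output e).run s).narr 11 = Function.update (s.narr 11) (s.nvar 6) c.val := by
    simp [output, block, Cmd.run, NExp.eval, he]
  have h6 : ((output e).run s).nvar 6 = s.nvar 6 + 1 := by
    simp [output, block, Cmd.run, NExp.eval]
  refine ⟨⟨?_, ?_, ?_, ?_, ?_⟩, fun z hz => ?_⟩
  · rw [List.nodup_append]
    exact ⟨h.nodup, List.nodup_singleton _, fun a ha b hb => by
      rw [List.mem_singleton] at hb; rintro rfl; exact hc (hb ▸ ha)⟩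
  · rw [h6, h.len]; simp
  · intro k hk
    rw [h11, h.len]
    by_cases hkl : k < l.length
    · rw [Function.update_of_ne (by omega), h.get k hkl, List.getElem_append_left hkl]
    · have : k = l.length := by simp at hk; omega
      subst this
      simp
  · intro c' hc'
    rw [h14]
    rcases List.mem_append.1 hc' with h' | h'
    · by_cases e : c'.val = c.val
      · rw [e]; simp
      · rw [Function.update_of_ne e]; exact h.marked c' h'
    · rw [List.mem_singleton.1 h']; simp
  · intro c' hc'
    rw [h14] at hc'
    by_cases e : c'.val = c.val
    · left; rw [Fin.ext e]; simp
    · rw [Function.update_of_ne e] at hc'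
      rcases h.of_marked c' hc' with h' | h'
      · left; exact List.mem_append_left _ h'
      · right; exact h'
  · rw [h14]
    by_cases e : z = c.val
    · rw [e]; simp
    · rwa [Function.update_of_ne e]

/-- A piece of a hull edge in a cell. -/
structure Rec (n : ℕ) where
  cell : Fin n
  edge : ℕ
  lo : ℝ
  hi : ℝ

/-- The list of records in memory. -/
structure RecList (H : HullRep Q) (l : List (Rec P.card)) (s : RamState) : Prop where
  len : s.nvar 16 = l.length
  get : ∀ k (h : k < l.length), s.narr 13 k = (l[k]'h).cell.val ∧
    s.rarr 13 k = H.at' (l[k]'h).edge (l[k]'h).lo 0 ∧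
    s.rarr 14 k = H.at' (l[k]'h).edge (l[k]'h).lo 1 ∧
    s.rarr 15 k = H.at' (l[k]'h).edge (l[k]'h).hi 0 ∧
    s.rarr 16 k = H.at' (l[k]'h).edge (l[k]'h).hi 1

theorem RecList.frame {l : List (Rec P.card)} {s s' : RamState} {c : Cmd}
    (h : RecList H l s) (hF : Frame c s s') (h16 : 16 ∉ c.nvars := by decide) (h13 : 13 ∉ c.narrs := by decide)
    (hr : c.rarrs = [] := by rfl) : RecList H l s' := by
  have hr' : ∀ a, a ∉ c.rarrs := by rw [hr]; simp
  refine ⟨?_, ?_⟩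
  · rw [hF.nvar 16 h16]; exact h.len
  · rw [hF.narr 13 h13, hF.rarr _ (hr' 13), hF.rarr _ (hr' 14), hF.rarr _ (hr' 15),
      hF.rarr _ (hr' 16)]
    exact h.get

variable (V H) in
/-- The piece lies in the closed cell of the record. -/
structure Rec.Valid (r : Rec P.card) : Prop where
  edge_lt : r.edge < H.size
  lo_nonneg : 0 ≤ r.lo
  lo_lt_hi : r.lo < r.hi
  hi_le : r.hi ≤ 1
  lo_mem : H.at' r.edge r.lo ∈ closedVoronoiCell P (V.site r.cell)
  hi_mem : H.at' r.edge r.hi ∈ closedVoronoiCell P (V.site r.cell)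
  meets : 3 ≤ H.size → MeetsInt P Q (V.site r.cell)

variable (V H) in
/-- The mirror images of the recorded cells are marked. -/
def Outer (l : List (Rec P.card)) (s : RamState) : Prop :=
  ∀ r ∈ l, ∀ c, V.site c = mirror H r.edge (V.site r.cell) → c ≠ r.cell → s.narr 14 c.val ≠ 0

theorem Outer.mono {l : List (Rec P.card)} {s s' : RamState} (h : Outer V H l s)
    (hs : ∀ z, s.narr 14 z ≠ 0 → s'.narr 14 z ≠ 0) : Outer V H l s' :=
  fun r hr c hc hne => hs _ (h r hr c hc hne)

theorem Outer.frame {l : List (Rec P.card)} {s s' : RamState} {c : Cmd} (h : Outer V H l s)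
    (hF : Frame c s s') (h14 : 14 ∉ c.narrs := by decide) : Outer V H l s' :=
  h.mono fun z => by rw [hF.narr 14 h14]; exact id

variable (V H) in
/-- The records divide the boundary of the hull up to the point `t` of the edge `i`. -/
inductive Walked : List (Rec P.card) → ℕ → ℝ → Prop
  | nil : Walked [] 0 0
  | emit {l : List (Rec P.card)} {r : Rec P.card} : Walked l r.edge r.lo → r.Valid V H →
      Walked (l ++ [r]) r.edge r.hi
  | corner {l : List (Rec P.card)} {i : ℕ} : Walked l i 1 → Walked l (i + 1) 0

theorem Walked.valid {l : List (Rec P.card)} {i : ℕ} {t : ℝ} (h : Walked V H l i t) :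
    ∀ r ∈ l, r.Valid V H := by
  induction h with
  | nil => simp
  | emit _ hr ih =>
    intro r' hr'
    rcases List.mem_append.1 hr' with h | h
    · exact ih _ h
    · rw [List.mem_singleton.1 h]; exact hr
  | corner _ ih => exact ih

theorem Walked.edge_le {l : List (Rec P.card)} {i : ℕ} {t : ℝ} (h : Walked V H l i t) :
    ∀ r ∈ l, r.edge < i ∨ (r.edge = i ∧ r.hi ≤ t) := by
  induction h with
  | nil => simp
  | emit _ hr ih =>
    intro r' hr'
    rcases List.mem_append.1 hr' with h | h
    · rcases ih _ h with h | ⟨h, h'⟩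
      · exact Or.inl h
      · exact Or.inr ⟨h, h'.trans hr.lo_lt_hi.le⟩
    · rw [List.mem_singleton.1 h]; exact Or.inr ⟨rfl, le_rfl⟩
  | corner _ ih =>
    intro r hr
    rcases ih r hr with h | ⟨h, -⟩ <;> left <;> omega

theorem Walked.cover {l : List (Rec P.card)} {i : ℕ} {a : ℝ} (h : Walked V H l i a) :
    ∀ i' t, 0 ≤ t → (i' < i ∧ t ≤ 1) ∨ (i' = i ∧ t ≤ a ∧ 0 < a) →
      ∃ r ∈ l, r.edge = i' ∧ r.lo ≤ t ∧ t ≤ r.hi := by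
  induction h with
  | nil => rintro i' t h0 (⟨h, -⟩ | ⟨-, -, h⟩); omega; exact absurd h (lt_irrefl _)
  | @emit l r hl hr ih =>
    intro i' t h0 h
    by_cases hnew : i' = r.edge ∧ r.lo ≤ t
    · refine ⟨r, by simp, hnew.1.symm, hnew.2, ?_⟩
      rcases h with ⟨h, -⟩ | ⟨-, h, -⟩
      · omega
      · exact h
    · obtain ⟨r', h1, h2⟩ := ih i' t h0 (by
        rcases h with h | ⟨h, -, -⟩
        · exact Or.inl h
        · right
          have : t < r.lo := by
            by_contra hn; exact hnew ⟨h, not_lt.1 hn⟩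
          exact ⟨h, this.le, by linarith⟩)
      exact ⟨r', List.mem_append_left _ h1, h2⟩
  | @corner l i hl ih =>
    rintro i' t h0 (⟨h, h'⟩ | ⟨-, -, h⟩)
    · exact ih i' t h0 (by
        rcases (by omega : i' < i ∨ i' = i) with h | h
        · exact Or.inl ⟨h, h'⟩
        · exact Or.inr ⟨h, h', one_pos⟩)
    · exact absurd h (lt_irrefl _)

/-- One record follows another along the boundary. -/
def Rec.Link {n : ℕ} (r : Rec n) (i : ℕ) (t : ℝ) : Prop :=
  (i = r.edge ∧ t = r.hi) ∨ (r.hi = 1 ∧ t = 0 ∧ i = r.edge + 1)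

theorem Walked.chain {l : List (Rec P.card)} {i : ℕ} {t : ℝ} (h : Walked V H l i t) :
    (∀ j (hj : j + 1 < l.length), (l[j]).Link (l[j + 1]).edge (l[j + 1]).lo) ∧
    (∀ h : 0 < l.length, (l[l.length - 1]).Link i t ∧ (l[0]).edge = 0 ∧ (l[0]).lo = 0) ∧
    (l.length = 0 → i = 0 ∧ t = 0) := by
  induction h with
  | nil => simp
  | @emit l r hl hr ih =>
    obtain ⟨h1, h2, h3⟩ := ih
    refine ⟨fun j hj => ?_, fun h => ⟨?_, ?_⟩, fun h => by simp at h⟩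
    · simp only [List.length_append, List.length_singleton] at hj
      rcases (by omega : j + 1 < l.length ∨ j + 1 = l.length) with hlt | heq
      · rw [List.getElem_append_left hlt, List.getElem_append_left (by omega)]
        exact h1 j hlt
      · have hpos : 0 < l.length := by omega
        rw [List.getElem_append_left (by omega : j < l.length)]
        have e : (l ++ [r])[j + 1]'(by simp; omega) = r := by
          rw [List.getElem_append_right (by omega)]; simp
        rw [e]
        have := (h2 hpos).1
        simp only [← heq, Nat.add_sub_cancel] at this
        exact this
    · left
      have e : (l ++ [r])[(l ++ [r]).length - 1]'(by simp) = r := by simp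
      rw [e]; exact ⟨rfl, rfl⟩
    · rcases Nat.eq_zero_or_pos l.length with h0 | h0
      · have : l = [] := List.length_eq_zero_iff.1 h0
        subst this
        obtain ⟨e1, e2⟩ := h3 rfl
        exact ⟨by simpa using e1, by simpa using e2⟩
      · rw [List.getElem_append_left h0]; exact (h2 h0).2
  | @corner l i hl ih =>
    obtain ⟨h1, h2, h3⟩ := ih
    refine ⟨h1, fun h => ⟨?_, (h2 h).2⟩, fun h => ?_⟩
    · rcases (h2 h).1 with ⟨e1, e2⟩ | ⟨-, e2, -⟩
      · exact Or.inr ⟨e2.symm, rfl, by omega⟩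
      · exact absurd e2 one_ne_zero
    · exact absurd (h3 h).2 one_ne_zero

/-- The complete list of records. -/
theorem Walked.records {l : List (Rec P.card)} (h : Walked V H l H.size 0)
    (d : Rec P.card) : Records V H l.length (fun j => (l.getD j d).cell)
      (fun j => (l.getD j d).edge) (fun j => (l.getD j d).lo) (fun j => (l.getD j d).hi) := by
  have hg : ∀ j (hj : j < l.length), l.getD j d = l[j] := fun j hj => by simp [hj]
  have hv := h.valid
  have hv' : ∀ j (hj : j < l.length), (l[j]).Valid V H := fun j hj => hv _ (List.getElem_mem hj)
  obtain ⟨h1, h2, -⟩ := h.chain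
  refine ⟨fun j hj => ?_, fun j hj => ?_, fun j hj => ?_, fun j hj => ?_, fun j hj => ?_,
    fun j hj => ?_, fun hs j hj => ?_, fun j hj => ?_, fun i hi t h0 h1 => ?_⟩
  · rw [hg j hj]; exact (hv' j hj).edge_lt
  · rw [hg j hj]; exact (hv' j hj).lo_nonneg
  · rw [hg j hj]; exact (hv' j hj).lo_lt_hi
  · rw [hg j hj]; exact (hv' j hj).hi_le
  · rw [hg j hj]; exact (hv' j hj).lo_mem
  · rw [hg j hj]; exact (hv' j hj).hi_mem
  · rw [hg j hj]; exact (hv' j hj).meets hs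
  · unfold nextRec
    split_ifs with hlt
    · rw [hg j hj, hg _ hlt]
      rcases h1 j hlt with h | ⟨e1, e2, e3⟩
      · exact Or.inl h
      · exact Or.inr ⟨e1, e2, by rw [← e3, Nat.mod_eq_of_lt (hv' _ hlt).edge_lt]⟩
    · have hj' : j = l.length - 1 := by omega
      rw [hg j hj, hg 0 (by omega)]
      obtain ⟨e0, e1, e2⟩ := h2 (by omega)
      subst hj'
      right
      rcases e0 with ⟨e3, e4⟩ | ⟨e3, e4, e5⟩
      · have := (hv' _ hj).edge_lt
        omega
      · refine ⟨e3, e2, ?_⟩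
        rw [e1, ← e5, Nat.mod_self]
  · obtain ⟨r, hr, e1, e2, e3⟩ := h.cover i t h0 (Or.inl ⟨hi, h1⟩)
    obtain ⟨j, hj, rfl⟩ := List.getElem_of_mem hr
    exact ⟨j, hj, by rw [hg j hj]; exact ⟨e1, e2, e3⟩⟩

/-! ## Recording a piece of a hull edge -/

/-- The `i`-th hull edge is in the real variables 2 to 5. -/
structure OnEdge (V : VoronoiRep P) (L : PointLocator V) (H : HullRep Q) (i : ℕ) (s : RamState) :
    Prop where
  input : Input V L H s
  r2 : s.rvar 2 = H.pt i 0
  r3 : s.rvar 3 = H.pt i 1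
  r4 : s.rvar 4 = H.ed i 0
  r5 : s.rvar 5 = H.ed i 1

theorem OnEdge.frame {i : ℕ} {s s' : RamState} {cmd : Cmd} (h : OnEdge V L H i s)
    (hF : Frame cmd s s') (hc : cmd.safe = true := by rfl)
    (hr : (cmd.rvars.all fun x => !(2 ≤ x && x ≤ 5)) = true := by rfl) : OnEdge V L H i s' := by
  simp only [List.all_eq_true] at hr
  have h' : ∀ x, 2 ≤ x → x ≤ 5 → x ∉ cmd.rvars := fun x h1 h2 hm => by
    have := hr x hm; simp [h1, h2] at this
  exact ⟨h.input.frame hF hc, by rw [hF.rvar _ (h' 2 (by decide) (by decide)), h.r2],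
    by rw [hF.rvar _ (h' 3 (by decide) (by decide)), h.r3],
    by rw [hF.rvar _ (h' 4 (by decide) (by decide)), h.r4],
    by rw [hF.rvar _ (h' 5 (by decide) (by decide)), h.r5]⟩

/-- The part from `a` to `b` of the edge `i` in the cell `p` is recorded as part of `c`, and the
output list is extended from `l` to `l'`. -/
structure Emitted (V : VoronoiRep P) (H : HullRep Q) (i : ℕ) (a b : ℝ) (p c : Fin P.card)
    (l l' : List (Fin P.card)) : Prop where
  slope : dot (V.site c - V.site p) (H.ed i) = 0
  valid : Rec.Valid V H ⟨c, i, a, b⟩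
  sub : ∀ x ∈ l, x ∈ l'
  new : ∀ x ∈ l', x ∈ l ∨ ∃ t, 0 ≤ t ∧ t ≤ 1 ∧ H.at' i t ∈ voronoiCell P (V.site x)
  cover : ∀ x t, a ≤ t → t ≤ b → H.at' i t ∈ voronoiCell P (V.site x) → x ∈ l'

theorem record_spec {i : ℕ} {s : RamState} (hE : OnEdge V L H i s) {c : Fin P.card}
    (hc : s.nvar 15 = c.val) {a b : ℝ} (ha : s.rvar 6 = a) (hb : s.rvar 14 = b)
    {recs : List (Rec P.card)} (hR : RecList H recs s) :
    Runs (block [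
      .nstore 13 (.var 16) (.var 15),
      .rstore 13 (.var 16) (edgeX (.var 6)),
      .rstore 14 (.var 16) (edgeY (.var 6)),
      .rstore 15 (.var 16) (edgeX (.var 14)),
      .rstore 16 (.var 16) (edgeY (.var 14)),
      .nset 16 (.add (.var 16) (.const 1))]) s 35 fun s' =>
        RecList H (recs ++ [⟨c, i, a, b⟩]) s' := by
  refine Runs.straight rfl (by simp [block, edgeX, edgeY, Cmd.cost, RExp.cost, NExp.cost])
    ⟨?_, fun k hk => ?_⟩
  · simp [block, Cmd.run, NExp.eval, hR.len]
  · simp only [block, Cmd.run, NExp.eval, RExp.eval, edgeX, edgeY, hE.r2, hE.r3, hE.r4, hE.r5, ha, hb,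
      hc, hR.len]
    by_cases hkl : k < recs.length
    · have := hR.get k hkl
      simp only [List.getElem_append_left hkl]
      simpa [hkl.ne] using this
    · have hk' : k = recs.length := by simp at hk; omega
      subst hk'
      simp [HullRep.at']

theorem site_eq_of_closed {p : Plane} {r : Fin P.card} (hp : p ∈ P)
    (h : p ∈ closedVoronoiCell P (V.site r)) : V.site r = p :=
  eq_of_mem_open_of_mem_closed hp (V.site_mem r) (self_mem_voronoiCell P p) h

theorem dot_mirror (i : ℕ) (p : Plane) : dot (mirror H i p - p) (H.ed i) = 0 := by
  simp [mirror, dot]; ring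

theorem emitted_of_pair (hs : 2 ≤ H.size) {i : ℕ} (hi : i < H.size) {a b : ℝ} (h0 : 0 ≤ a)
    (hab : a < b) (h1 : b ≤ 1) {p r c : Fin P.card} {l : List (Fin P.card)}
    (ha : H.at' i a ∈ closedVoronoiCell P (V.site p)) (hb : H.at' i b ∈ closedVoronoiCell P (V.site p))
    (hr : V.site r = mirror H i (V.site p)) (hne : r ≠ p) (hc : c = p ∨ c = r)
    (hpos : 0 < H.pos i (V.site c)) : Emitted V H i a b p c l l := by
  have hmem : ∀ t, H.at' i t ∈ closedVoronoiCell P (V.site p) →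
      H.at' i t ∈ closedVoronoiCell P (V.site c) := fun t ht => by
    rcases hc with rfl | rfl
    · exact ht
    · exact mem_closed_of_tie ht (by rw [hr]; exact gap_mirror hs i _ t)
  refine ⟨?_, ⟨hi, h0, hab, h1, hmem _ ha, hmem _ hb, fun h3 =>
    inner_of_left h3 hi h0 hab h1 (hmem _ ha) (hmem _ hb) hpos⟩, fun _ h => h, fun _ h => Or.inl h,
    fun x t hat htb hx => ?_⟩
  · rcases hc with rfl | rfl
    · simp [dot]
    · rw [hr]; exact dot_mirror i _
  · exfalso
    have := eq_of_mem_open_of_mem_closed (V.site_mem x) (V.site_mem p) hx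
      (mem_closed_between ha hb hat htb)
    rw [← this] at hx
    refine not_mem_cell_of_mirror hs (hr ▸ V.site_mem r) ?_ t hx
    rw [← hr]
    exact fun h => hne (V.site_injective h)

theorem emitted_of_single (hs : 2 ≤ H.size) {i : ℕ} (hi : i < H.size) {a b : ℝ} (h0 : 0 ≤ a)
    (hab : a < b) (h1 : b ≤ 1) {p : Fin P.card} {l l' : List (Fin P.card)}
    (ha : H.at' i a ∈ closedVoronoiCell P (V.site p)) (hb : H.at' i b ∈ closedVoronoiCell P (V.site p))
    (hr : mirror H i (V.site p) ∈ P → mirror H i (V.site p) = V.site p)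
    (hp : p ∈ l') (hl : l' = l ∨ l' = l ++ [p]) : Emitted V H i a b p p l l' := by
  refine ⟨by simp [dot], ⟨hi, h0, hab, h1, ha, hb, fun h3 => inner_of_edge h3 h0 hab h1 ha hb hr⟩,
    fun x hx => ?_, fun x hx => ?_, fun x t hat htb hx => ?_⟩
  · rcases hl with rfl | rfl
    · exact hx
    · exact List.mem_append_left _ hx
  · rcases hl with rfl | rfl
    · exact Or.inl hx
    · rcases List.mem_append.1 hx with h | h
      · exact Or.inl h
      · rw [List.mem_singleton.1 h]
        exact Or.inr ⟨(a + b) / 2, by linarith, by linarith,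
          mem_cell_of_between hs ha hb hr (by linarith) (by linarith)⟩
  · have := eq_of_mem_open_of_mem_closed (V.site_mem x) (V.site_mem p) hx
      (mem_closed_between ha hb hat htb)
    rwa [← V.site_injective this]

theorem mark_spec {s : RamState} {l : List (Fin P.card)} (hl : OutList V Q l s) {c p : Fin P.card}
    {x y : ℕ} (hx : s.nvar x = c.val) (hy : s.nvar y = p.val) (hy' : y ≠ 15)
    (hc : ∀ z ∈ voronoiCell P (V.site p), z ∉ queryHull Q) :
    Runs (block [.nset 15 (.var x), .nstore 14 (.var y) (.const 1)]) s 5 fun s' =>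
      s'.nvar 15 = c.val ∧ OutList V Q l s' ∧ s'.narr 14 p.val ≠ 0 ∧
        ∀ z, s.narr 14 z ≠ 0 → s'.narr 14 z ≠ 0 := by
  have h14 : ((block [.nset 15 (.var x), .nstore 14 (.var y) (.const 1)]).run s).narr 14 =
      Function.update (s.narr 14) p.val 1 := by
    simp [block, Cmd.run, NExp.eval, Function.update_of_ne hy', hy]
  refine Runs.straight rfl (by simp [block, Cmd.cost, NExp.cost])
    ⟨?_, ⟨hl.nodup, ?_, ?_, ?_, ?_⟩, by rw [h14]; simp, fun z hz => ?_⟩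
  · simp [block, Cmd.run, NExp.eval, hx]
  · simp [block, Cmd.run, NExp.eval, hl.len]
  · simpa [block, Cmd.run, NExp.eval] using hl.get
  · intro c' hc'
    rw [h14]
    by_cases e : c'.val = p.val
    · rw [e]; simp
    · rw [Function.update_of_ne e]; exact hl.marked c' hc'
  · intro c' hc'
    rw [h14] at hc'
    by_cases e : c'.val = p.val
    · rw [Fin.ext e]; exact Or.inr hc
    · rw [Function.update_of_ne e] at hc'; exact hl.of_marked c' hc'
  · rw [h14]
    by_cases e : z = p.val
    · rw [e]; simp
    · rwa [Function.update_of_ne e]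

theorem emit_spec (hs : 2 ≤ H.size) {i : ℕ} (hi : i < H.size) {s : RamState}
    (hE : OnEdge V L H i s) {p : Fin P.card} (hp : s.nvar 5 = p.val) {a b : ℝ} (ha : s.rvar 6 = a)
    (hb : s.rvar 14 = b) (h0 : 0 ≤ a) (hab : a < b) (h1 : b ≤ 1)
    (hza : H.at' i a ∈ closedVoronoiCell P (V.site p))
    (hzb : H.at' i b ∈ closedVoronoiCell P (V.site p)) {l : List (Fin P.card)}
    (hl : OutList V Q l s) {recs : List (Rec P.card)} (hR : RecList H recs s)
    (hO : Outer V H recs s) : Runs emitCmd s (22 * L.depth + 130) fun s' => (∃ c l', Emitted V H i a b p c l l' ∧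
      RecList H (recs ++ [⟨c, i, a, b⟩]) s' ∧ OutList V Q l' s' ∧
      Outer V H (recs ++ [⟨c, i, a, b⟩]) s') ∧ Frame emitCmd s s' := by
  refine Runs.frame ?_
  set μ := 2 * H.pos i (V.site p) / dot (H.ed i) (H.ed i) with hμ
  refine Runs.mono (B := 27 + (8 + (8 + ((22 * L.depth + 10) + (40 + 35)))))
    (Runs.seq (Runs.run rfl (by simp [RExp.sq, Cmd.cost, RExp.cost, NExp.cost])) fun s₁ ⟨r₁, f₁⟩ =>
      Runs.seq (Runs.run rfl) fun s₂ ⟨r₂, f₂⟩ =>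
      Runs.seq (Runs.run rfl) fun s₃ ⟨r₃, f₃⟩ => ?_)
    (by omega) fun _ h => h
  have hE₁ := hE.frame f₁
  have hE₂ := hE₁.frame f₂
  have hE₃ := hE₂.frame f₃
  have p₁ : s₁.nvar 5 = p.val := by rw [f₁.nvar 5, hp]
  have p₂ : s₂.nvar 5 = p.val := by rw [f₂.nvar 5, p₁]
  have p₃ : s₃.nvar 5 = p.val := by rw [f₃.nvar 5, p₂]
  have m₁ : s₁.rvar 15 = μ := by
    rw [r₁, hμ]
    simp only [Cmd.run, RExp.sq, RExp.eval, NExp.eval, Function.update_self, hE.r2, hE.r3, hE.r4,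
      hE.r5, hp, hE.input.site_zero, hE.input.site_one, HullRep.pos, cross, dot, PiLp.sub_apply]
    norm_num
  have m₂ : s₂.rvar 15 = μ := by rw [f₂.rvar 15, m₁]
  have m₃ : s₃.rvar 15 = μ := by rw [f₃.rvar 15, m₂]
  have x₃ : s₃.rvar 0 = mirror H i (V.site p) 0 := by
    rw [f₃.rvar 0, r₂]
    simp [Cmd.run, RExp.eval, NExp.eval, hE₁.r5, p₁, hE₁.input.site_zero, m₁, mirror, hμ]
  have y₃ : s₃.rvar 1 = mirror H i (V.site p) 1 := by
    rw [r₃]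
    simp [Cmd.run, RExp.eval, NExp.eval, hE₂.r4, p₂, hE₂.input.site_one, m₂, mirror, hμ]
  refine Runs.seq (locAt_spec hE₃.input _ x₃ y₃) fun s₄ ⟨f₄, r, hr, hrm⟩ => ?_
  have hE₄ := hE₃.frame f₄
  have p₄ : s₄.nvar 5 = p.val := by rw [f₄.nvar 5, p₃]
  have m₄ : s₄.rvar 15 = μ := by rw [f₄.rvar 15, m₃]
  have x₄ : s₄.rvar 0 = mirror H i (V.site p) 0 := by rw [f₄.rvar 0, x₃]
  have y₄ : s₄.rvar 1 = mirror H i (V.site p) 1 := by rw [f₄.rvar 1, y₃]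
  have a₄ : s₄.rvar 6 = a := by
    rw [f₄.rvar 6, f₃.rvar 6, f₂.rvar 6, f₁.rvar 6, ha]
  have b₄ : s₄.rvar 14 = b := by
    rw [f₄.rvar 14, f₃.rvar 14, f₂.rvar 14, f₁.rvar 14, hb]
  have hl₄ : OutList V Q l s₄ := (((hl.frame f₁).frame f₂).frame f₃).frame f₄
  have hR₄ : RecList H recs s₄ := (((hR.frame f₁).frame f₂).frame f₃).frame f₄
  have hO₄ : Outer V H recs s₄ := (((hO.frame f₁).frame f₂).frame f₃).frame f₄
  have houter : ∀ (s' : RamState) (c : Fin P.card), (∀ z, s₄.narr 14 z ≠ 0 → s'.narr 14 z ≠ 0) →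
      (∀ r', V.site r' = mirror H i (V.site c) → r' ≠ c → s'.narr 14 r'.val ≠ 0) →
      Outer V H (recs ++ [⟨c, i, a, b⟩]) s' := fun s' c h1 h2 rec hrec => by
    rcases List.mem_append.1 hrec with h | h
    · exact hO₄.mono h1 rec h
    · rw [List.mem_singleton.1 h]; exact h2
  refine (Runs.seq (B₁ := 40) (Runs.frame (p := fun s' => ∃ c l', s'.nvar 15 = c.val ∧ Emitted V H i a b p c l l' ∧
    OutList V Q l' s' ∧ Outer V H (recs ++ [⟨c, i, a, b⟩]) s') ?_)
    fun s₅ ⟨⟨c, l', hc, hem, hl', hO'⟩, f₅⟩ => ?_)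
  · have hμpos : 0 < H.pos i (V.site p) ↔ 0 < μ := by
      rw [hμ]
      have := dot_self_pos (HullRep.ed_ne_zero (H := H) hs i)
      constructor
      · intro h; positivity
      · intro h
        have := (div_pos_iff_of_pos_right this).1 h
        linarith
    refine Runs.ite' (B₁ := 9) (B₂ := 18) (fun hb => ?_) fun hb => ?_
    · simp only [BExp.eval, RExp.eval, NExp.eval, hr, x₄, y₄, p₄, hE₄.input.site_zero,
        hE₄.input.site_one] at hb
      have hrm' : V.site r = mirror H i (V.site p) := plane_ext hb.1.1 hb.1.2
      have hne : r ≠ p := fun h => hb.2 (by rw [h])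
      have hmne : mirror H i (V.site p) ≠ V.site p := fun h => hne (V.site_injective (hrm'.trans h))
      have hpos0 := pos_self_ne_zero hmne
      refine Runs.ite' (B₁ := 5) (B₂ := 5) (fun hb' => ?_) fun hb' => ?_
      · simp only [BExp.eval, RExp.eval, m₄, Int.cast_zero] at hb'
        have hpos := hμpos.2 hb'
        refine (mark_spec hl₄ p₄ hr (by decide) fun z hz => ?_).conseq fun s' h => ⟨p, l, h.1,
          emitted_of_pair hs hi h0 hab h1 hza hzb hrm' hne (Or.inl rfl) hpos, h.2.1,
          houter _ _ h.2.2.2 fun r' hr' _ => by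
            rw [V.site_injective (hr'.trans hrm'.symm)]; exact h.2.2.1⟩
        refine disjoint_of_right (i := i) hs ?_ ?_ hz
        · rw [hrm', mirror_mirror hs]; exact V.site_mem p
        · rw [hrm', pos_mirror hs]; linarith
      · simp only [BExp.eval, RExp.eval, m₄, Int.cast_zero] at hb'
        have hneg : H.pos i (V.site p) < 0 := lt_of_le_of_ne (not_lt.1 fun h => hb' (hμpos.1 h)) hpos0
        refine (mark_spec hl₄ hr p₄ (by decide) fun z hz => ?_).conseq fun s' h => ⟨r, l, h.1,
          emitted_of_pair hs hi h0 hab h1 hza hzb hrm' hne (Or.inr rfl)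
            (by rw [hrm', pos_mirror hs]; linarith), h.2.1,
          houter _ _ h.2.2.2 fun r' hr' _ => by
            rw [hrm', mirror_mirror hs] at hr'
            rw [V.site_injective hr']; exact h.2.2.1⟩
        refine disjoint_of_right (i := i) hs ?_ hneg hz
        rw [← hrm']; exact V.site_mem r
    · simp only [BExp.eval, RExp.eval, NExp.eval, hr, x₄, y₄, p₄, hE₄.input.site_zero,
        hE₄.input.site_one] at hb
      have hrp : mirror H i (V.site p) ∈ P → mirror H i (V.site p) = V.site p := fun h => by
        have e := site_eq_of_closed h hrm
        by_contra hne
        refine hb ⟨⟨by rw [e], by rw [e]⟩, fun h' => hne ?_⟩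
        rw [← e, Fin.ext h']
      have hsing : ∀ (r' : Fin P.card), V.site r' = mirror H i (V.site p) → r' ≠ p → False :=
        fun r' h h' => h' (V.site_injective (h.trans (hrp (h ▸ V.site_mem r'))))
      refine Runs.mono (B := 2 + 16) (Runs.seq (Runs.run rfl) fun s' ⟨q, f⟩ =>
        Runs.ite' (B₁ := 10) (B₂ := 1) (fun hm => ?_) fun hm => ?_) (by omega) fun _ h => h
      · have p' : s'.nvar 5 = p.val := by rw [f.nvar 5, p₄]
        simp only [BExp.eval, NExp.eval, p'] at hm
        have hl' := hl₄.frame f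
        refine (output_spec hl' (e := .var 5) p' (fun s'' h _ _ => h) hm).frame.conseq
          fun s'' ⟨⟨h, hmono⟩, f''⟩ => ⟨p, l ++ [p], ?_,
            emitted_of_single hs hi h0 hab h1 hza hzb hrp (by simp) (Or.inr rfl), h,
            houter _ _ (fun z hz => hmono z (by rwa [f.narr 14]))
              fun r' hr' h' => (hsing r' hr' h').elim⟩
        rw [f''.nvar 15, q]
        simp [Cmd.run, NExp.eval, p₄]
      · have p' : s'.nvar 5 = p.val := by rw [f.nvar 5, p₄]
        simp only [BExp.eval, NExp.eval, p'] at hm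
        have hl' := hl₄.frame f
        refine Runs.straight rfl le_rfl ⟨p, l, ?_,
            emitted_of_single hs hi h0 hab h1 hza hzb hrp ?_ (Or.inl rfl), hl',
            houter _ _ (fun z hz => show s'.narr 14 z ≠ 0 by rwa [f.narr 14])
              fun r' hr' h' => (hsing r' hr' h').elim⟩
        · change s'.nvar 15 = _
          rw [q]; simp [Cmd.run, NExp.eval, p₄]
        · refine (hl'.of_marked p hm).resolve_right fun h => h (H.at' i ((a + b) / 2)) ?_ ?_
          · exact mem_cell_of_between hs hza hzb hrp (by linarith) (by linarith)
          · exact HullRep.at_mem (by omega) (by linarith) (by linarith)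
  · refine (record_spec (hE₄.frame f₅) hc (a := a) (b := b) ?_ ?_
      (hR₄.frame f₅)).frame.conseq
      fun s₆ ⟨hR', f₆⟩ => ⟨c, l', hem, hR', hl'.frame f₆, hO'.frame f₆⟩
    · rw [f₅.rvar 6, a₄]
    · rw [f₅.rvar 14, b₄]

/-! ## Walking along a hull edge -/

variable (H) in
/-- Up to a term that does not depend on the site, the squared distance from the points of a hull edge
to a site is an affine function. This is its slope. -/
def edgeSlope (i : ℕ) (x : Plane) : ℝ := 2 * dot (H.ed i) (H.pt i - x)

variable (H) in
/-- The affine function of a site. -/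
def lin (i : ℕ) (x : Plane) (t : ℝ) : ℝ := sqd (H.pt i) x + edgeSlope H i x * t

theorem gap_eq_lin (i : ℕ) (c s : Plane) (t : ℝ) :
    gap c s (H.at' i t) = lin H i s t - lin H i c t := by
  rw [gap_at]; simp [lin, edgeSlope, gap, dot]; ring

theorem mem_closed_iff_lin {i : ℕ} {c : Plane} {t : ℝ} :
    H.at' i t ∈ closedVoronoiCell P c ↔ ∀ s ∈ P, lin H i c t ≤ lin H i s t := by
  rw [mem_closed_iff_gap]; simp only [gap_eq_lin, sub_nonneg]

theorem crossing {a a' s s' b b' : ℝ} (hs : s' < s) (hb : a + s * b ≤ a' + s' * b)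
    (hb' : a' + s' * b' ≤ a + s * b') :
    b ≤ (a' - a) / (s - s') ∧ (a' - a) / (s - s') ≤ b' ∧
      a + s * ((a' - a) / (s - s')) = a' + s' * ((a' - a) / (s - s')) := by
  have h := sub_pos.2 hs
  refine ⟨?_, ?_, ?_⟩
  · rw [le_div_iff₀ h]; linarith
  · rw [div_le_iff₀ h]; linarith
  · field_simp; ring

variable (V H) in
/-- A stack of cells with points of the edge that they contain. -/
def WalkStack (i : ℕ) : Fin P.card → ℝ → List (Fin P.card × ℝ) → Prop
  | p, b, [] => H.at' i b ∈ closedVoronoiCell P (V.site p) ∧ b = 1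
  | p, b, (p', b') :: st => H.at' i b ∈ closedVoronoiCell P (V.site p) ∧
      edgeSlope H i (V.site p') < edgeSlope H i (V.site p) ∧ b < b' ∧ WalkStack i p' b' st

theorem WalkStack.mem {i : ℕ} {p : Fin P.card} {b : ℝ} {st : List (Fin P.card × ℝ)}
    (h : WalkStack V H i p b st) : H.at' i b ∈ closedVoronoiCell P (V.site p) := by
  cases st with
  | nil => exact h.1
  | cons _ _ => exact h.1

theorem WalkStack.le_one {i : ℕ} {p : Fin P.card} {b : ℝ} {st : List (Fin P.card × ℝ)}
    (h : WalkStack V H i p b st) : b ≤ 1 := by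
  induction st generalizing p b with
  | nil => exact h.2.le
  | cons x st ih => exact h.2.2.1.le.trans (ih h.2.2.2)

variable (V H) in
/-- The number of sites with a smaller slope. -/
def below (i : ℕ) (p : Fin P.card) : ℕ :=
  (Finset.univ.filter fun s : Fin P.card => edgeSlope H i (V.site s) < edgeSlope H i (V.site p)).card

theorem below_lt {i : ℕ} {p p' : Fin P.card} (h : edgeSlope H i (V.site p') < edgeSlope H i (V.site p)) :
    below V H i p' < below V H i p := by
  apply Finset.card_lt_card
  refine ⟨fun x hx => ?_, fun hsub => ?_⟩
  · simp only [Finset.mem_filter, Finset.mem_univ, true_and] at hx ⊢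
    exact hx.trans h
  · have := hsub (show p' ∈ _ by simpa using h)
    simp at this

theorem WalkStack.length_le {i : ℕ} {p : Fin P.card} {b : ℝ} {st : List (Fin P.card × ℝ)}
    (h : WalkStack V H i p b st) : st.length ≤ below V H i p := by
  induction st generalizing p b with
  | nil => simp
  | cons x st ih =>
    have := ih h.2.2.2
    have := below_lt h.2.1
    simp only [List.length_cons]; omega

/-- The stack in memory. -/
def StackMem {n : ℕ} : List (Fin n × ℝ) → (ℕ → ℕ) → Prop
  | [], _ => True
  | x :: st, f => f st.length = x.1.val ∧ StackMem st f

theorem StackMem.update {n : ℕ} {st : List (Fin n × ℝ)} {f : ℕ → ℕ} (h : StackMem st f) {k : ℕ}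
    (hk : st.length ≤ k) (v : ℕ) : StackMem st (Function.update f k v) := by
  induction st with
  | nil => trivial
  | cons x st ih =>
    simp only [List.length_cons] at hk
    exact ⟨by rw [Function.update_of_ne (by omega)]; exact h.1, ih h.2 (by omega)⟩

/-- The state while a hull edge is processed, up to the parameter `a`. -/
structure Walking (V : VoronoiRep P) (L : PointLocator V) (H : HullRep Q) (i : ℕ)
    (l₀ : List (Fin P.card)) (a : ℝ) (p : Fin P.card) (recs : List (Rec P.card))
    (l : List (Fin P.card)) (s : RamState) : Prop where
  edge : OnEdge V L H i s
  out : OutList V Q l s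
  list : RecList H recs s
  outer : Outer V H recs s
  walked : Walked V H recs i a
  nonneg : 0 ≤ a
  mem : H.at' i a ∈ closedVoronoiCell P (V.site p)
  distinct : (recs.map fun r => (r.edge, r.cell)).Nodup
  slope : ∀ r ∈ recs, r.edge = i → edgeSlope H i (V.site p) < edgeSlope H i (V.site r.cell)
  sub : ∀ x ∈ l₀, x ∈ l
  new : ∀ x ∈ l, x ∈ l₀ ∨ ∃ t, 0 ≤ t ∧ t ≤ 1 ∧ H.at' i t ∈ voronoiCell P (V.site x)
  cover : ∀ x t, 0 ≤ t → t ≤ a → 0 < a → H.at' i t ∈ voronoiCell P (V.site x) → x ∈ l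

theorem Walking.frame {i : ℕ} {l₀ : List (Fin P.card)} {a : ℝ} {p : Fin P.card}
    {recs : List (Rec P.card)} {l : List (Fin P.card)} {s s' : RamState} {cmd : Cmd}
    (h : Walking V L H i l₀ a p recs l s) (hF : Frame cmd s s') (hc : cmd.safe = true := by rfl)
    (hr : (cmd.rvars.all fun x => !(2 ≤ x && x ≤ 5)) = true := by rfl)
    (hn : (cmd.nvars.all fun x => x != 6 && x != 16) = true := by rfl)
    (ha : (cmd.narrs.all fun x => x != 11 && x != 13 && x != 14) = true := by rfl) (hra : cmd.rarrs = [] := by rfl) :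
    Walking V L H i l₀ a p recs l s' := by
  simp only [List.all_eq_true, Bool.and_eq_true, bne_iff_ne] at hn ha
  exact ⟨h.edge.frame hF hc hr,
    h.out.frame hF (fun hm => (hn _ hm).1 rfl) (fun hm => (ha _ hm).1.1 rfl)
      (fun hm => (ha _ hm).2 rfl),
    h.list.frame hF (fun hm => (hn _ hm).2 rfl) (fun hm => (ha _ hm).1.2 rfl) hra,
    h.outer.frame hF (fun hm => (ha _ hm).2 rfl), h.walked,
    h.nonneg, h.mem, h.distinct, h.slope, h.sub, h.new, h.cover⟩

theorem Walking.change {i : ℕ} {l₀ : List (Fin P.card)} {a : ℝ} {p p' : Fin P.card}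
    {recs : List (Rec P.card)} {l : List (Fin P.card)} {s : RamState}
    (h : Walking V L H i l₀ a p recs l s) (hmem : H.at' i a ∈ closedVoronoiCell P (V.site p'))
    (hsl : edgeSlope H i (V.site p') < edgeSlope H i (V.site p)) :
    Walking V L H i l₀ a p' recs l s :=
  ⟨h.edge, h.out, h.list, h.outer, h.walked, h.nonneg, hmem, h.distinct,
    fun r hr hri => hsl.trans (h.slope r hr hri), h.sub, h.new, h.cover⟩

theorem Walking.emit (hs : 2 ≤ H.size) {i : ℕ} (hi : i < H.size) {l₀ : List (Fin P.card)} {a b : ℝ}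
    {p : Fin P.card} {recs : List (Rec P.card)} {l : List (Fin P.card)} {s : RamState}
    (h : Walking V L H i l₀ a p recs l s) (h5 : s.nvar 5 = p.val) (h6 : s.rvar 6 = a) (hab : a < b) (hb1 : b ≤ 1)
    (hb : H.at' i b ∈ closedVoronoiCell P (V.site p)) (h14 : s.rvar 14 = b) :
    Runs emitCmd s (22 * L.depth + 130) fun s' => (∃ r l', r.edge = i ∧
      Walked V H (recs ++ [r]) i b ∧ dot (V.site r.cell - V.site p) (H.ed i) = 0 ∧
      ((recs ++ [r]).map fun r => (r.edge, r.cell)).Nodup ∧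
      RecList H (recs ++ [r]) s' ∧ Outer V H (recs ++ [r]) s' ∧ OutList V Q l' s' ∧ (∀ x ∈ l₀, x ∈ l') ∧
      (∀ x ∈ l', x ∈ l₀ ∨ ∃ t, 0 ≤ t ∧ t ≤ 1 ∧ H.at' i t ∈ voronoiCell P (V.site x)) ∧
      (∀ x t, 0 ≤ t → t ≤ b → H.at' i t ∈ voronoiCell P (V.site x) → x ∈ l')) ∧
      Frame emitCmd s s' := by
  refine (emit_spec hs hi h.edge h5 h6 h14 h.nonneg hab hb1 h.mem hb h.out h.list h.outer).conseq
    fun s' ⟨⟨c, l', hem, hR, hO, hOut⟩, hF⟩ => ⟨⟨⟨c, i, a, b⟩, l', rfl, ?_, hem.slope, ?_, hR, hOut, hO,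
      fun x hx => hem.sub x (h.sub x hx), fun x hx => (hem.new x hx).elim (h.new x) Or.inr,
      fun x t h0 h1 hx => ?_⟩, hF⟩
  · exact Walked.emit (r := ⟨c, i, a, b⟩) h.walked hem.valid
  · rw [List.map_append, List.nodup_append]
    refine ⟨h.distinct, List.nodup_singleton _, fun x hx y hy e => ?_⟩
    simp only [List.map_cons, List.map_nil, List.mem_singleton] at hy
    obtain ⟨r, hr, rfl⟩ := List.mem_map.1 hx
    rw [hy] at e
    simp only [Prod.mk.injEq] at e
    have := h.slope r hr e.1
    rw [e.2] at this
    have h2 := hem.slope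
    simp only [edgeSlope, dot, PiLp.sub_apply] at this h2
    linarith
  · rcases le_or_gt a t with hat | hat
    · exact hem.cover x t hat h1 hx
    · exact hem.sub x (h.cover x t h0 hat.le (by linarith) hx)

theorem eval_slopeExp {i : ℕ} {s : RamState} (h : OnEdge V L H i s) {e : NExp} {c : Fin P.card}
    (he : e.eval s = c.val) : (slopeExp e).eval s = edgeSlope H i (V.site c) := by
  simp [slopeExp, RExp.eval, he, h.r2, h.r3, h.r4, h.r5, h.input.site_zero, h.input.site_one,
    edgeSlope, dot]

theorem eval_baseExp {i : ℕ} {s : RamState} (h : OnEdge V L H i s) {e : NExp} {c : Fin P.card}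
    (he : e.eval s = c.val) : (baseExp e).eval s = sqd (H.pt i) (V.site c) := by
  simp [baseExp, RExp.sq, RExp.eval, he, h.r2, h.r3, h.input.site_zero, h.input.site_one, sqd]
  ring

/-- The possible effects of one step on an edge: a cell is put on the stack, or the walk proceeds to the
cell on top of the stack. -/
inductive Stepped (V : VoronoiRep P) (L : PointLocator V) (H : HullRep Q) (i : ℕ)
    (l₀ : List (Fin P.card)) (a b : ℝ) (p p' : Fin P.card) (b' : ℝ) (st : List (Fin P.card × ℝ))
    (recs : List (Rec P.card)) (l : List (Fin P.card)) (s : RamState) : Prop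
  | push (r : Fin P.card) (x : ℝ) : Walking V L H i l₀ a p recs l s →
      s.nvar 5 = p.val → s.rvar 6 = a → s.nvar 13 = st.length + 2 → StackMem ((r, x) :: (p', b') :: st) (s.narr 12) →
      WalkStack V H i p b ((r, x) :: (p', b') :: st) →
      Stepped V L H i l₀ a b p p' b' st recs l s
  | pop (x : ℝ) (recs' : List (Rec P.card)) (l' : List (Fin P.card)) :
      Walking V L H i l₀ x p' recs' l' s → s.nvar 5 = p'.val → s.rvar 6 = x → s.nvar 13 = st.length → StackMem st (s.narr 12) →
      b ≤ x → x ≤ b' → (a < x ∧ recs'.length = recs.length + 1) ∨ (a = x ∧ recs' = recs) →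
      Stepped V L H i l₀ a b p p' b' st recs l s

theorem push_geometry {i : ℕ} {p p' r : Fin P.card} {b b' x : ℝ} {st : List (Fin P.card × ℝ)}
    (h : WalkStack V H i p b ((p', b') :: st)) (hbx : b ≤ x) (hxb : x ≤ b')
    (hx : lin H i (V.site p) x = lin H i (V.site p') x)
    (hr : H.at' i x ∈ closedVoronoiCell P (V.site r))
    (hlt : lin H i (V.site r) x < lin H i (V.site p) x) :
    WalkStack V H i p b ((r, x) :: (p', b') :: st) := by
  obtain ⟨h1, h2, h3, h4⟩ := h
  have g1 := mem_closed_iff_lin.1 h1 _ (V.site_mem r)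
  have g2 := mem_closed_iff_lin.1 h4.mem _ (V.site_mem r)
  have hb : b < x := lt_of_le_of_ne hbx fun e => by rw [e] at g1; linarith
  have hb' : x < b' := lt_of_le_of_ne hxb fun e => by rw [← e] at g2; linarith
  refine ⟨h1, ?_, hb, hr, ?_, hb', h4⟩
  · simp only [lin] at *
    by_contra hn
    nlinarith
  · simp only [lin] at *
    by_contra hn
    nlinarith

theorem pop_geometry {i : ℕ} {p p' r : Fin P.card} {x : ℝ}
    (hx : lin H i (V.site p) x = lin H i (V.site p') x)
    (hr : H.at' i x ∈ closedVoronoiCell P (V.site r))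
    (hle : lin H i (V.site p) x ≤ lin H i (V.site r) x) :
    H.at' i x ∈ closedVoronoiCell P (V.site p) ∧ H.at' i x ∈ closedVoronoiCell P (V.site p') := by
  simp only [mem_closed_iff_lin] at *
  rw [← hx]
  exact ⟨fun s hs => hle.trans (hr s hs), fun s hs => hle.trans (hr s hs)⟩

theorem walkStep_spec (hs : 2 ≤ H.size) {i : ℕ} (hi : i < H.size) {l₀ : List (Fin P.card)}
    {a b : ℝ} {p p' : Fin P.card} {b' : ℝ} {st : List (Fin P.card × ℝ)} {recs : List (Rec P.card)}
    {l : List (Fin P.card)} {s : RamState} (hW : Walking V L H i l₀ a p recs l s)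
    (h5 : s.nvar 5 = p.val) (h6 : s.rvar 6 = a) (h13 : s.nvar 13 = st.length + 1) (hM : StackMem ((p', b') :: st) (s.narr 12))
    (hS : WalkStack V H i p b ((p', b') :: st)) (hab : a ≤ b) :
    Runs walkStep s (44 * L.depth + 320) fun s' => Stepped V L H i l₀ a b p p' b' st recs l s' := by
  obtain ⟨h1, h2, h3, h4⟩ := hS
  refine Runs.mono (B := 10 + (16 + (20 + (40 + (8 + (8 + ((22 * L.depth + 10) + (22 * L.depth + 200))))))))
    (Runs.seq (Runs.run rfl) fun s₁ ⟨r₁, f₁⟩ =>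
      Runs.seq (Runs.run rfl (by simp [slopeExp, Cmd.cost, RExp.cost, NExp.cost])) fun s₂ ⟨r₂, f₂⟩ =>
      Runs.seq (Runs.run rfl (by simp [baseExp, RExp.sq, Cmd.cost, RExp.cost, NExp.cost])) fun s₃ ⟨r₃, f₃⟩ =>
      Runs.seq (Runs.run rfl (by simp [slopeExp, baseExp, RExp.sq, Cmd.cost, RExp.cost, NExp.cost])) fun s₄ ⟨r₄, f₄⟩ =>
      Runs.seq (Runs.run rfl (by simp [edgeX, Cmd.cost, RExp.cost])) fun s₅ ⟨r₅, f₅⟩ =>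
      Runs.seq (Runs.run rfl (by simp [edgeY, Cmd.cost, RExp.cost])) fun s₆ ⟨r₆, f₆⟩ => ?_)
    (by omega) fun _ h => h
  have W₁ := hW.frame f₁
  have W₂ := W₁.frame f₂
  have W₃ := W₂.frame f₃
  have W₄ := W₃.frame f₄
  have W₅ := W₄.frame f₅
  have W₆ := W₅.frame f₆
  have k₁ : s₁.nvar 5 = p.val := by rw [f₁.nvar 5, h5]
  have k₂ : s₂.nvar 5 = p.val := by rw [f₂.nvar 5, k₁]
  have n₁ : s₁.nvar 14 = p'.val := by
    rw [r₁]; simp [Cmd.run, NExp.eval, h13, hM.1]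
  have n₂ : s₂.nvar 14 = p'.val := by rw [f₂.nvar 14, n₁]
  have n₃ : s₃.nvar 14 = p'.val := by rw [f₃.nvar 14, n₂]
  have x7 : s₂.rvar 7 = edgeSlope H i (V.site p) := by
    rw [r₂, ← eval_slopeExp W₁.edge (e := .var 5) k₁]; simp [Cmd.run]
  have x7' : s₃.rvar 7 = edgeSlope H i (V.site p) := by rw [f₃.rvar 7, x7]
  have x8 : s₃.rvar 8 = sqd (H.pt i) (V.site p) := by
    rw [r₃, ← eval_baseExp W₂.edge (e := .var 5) k₂]; simp [Cmd.run]
  set x := (sqd (H.pt i) (V.site p') - sqd (H.pt i) (V.site p)) /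
    (edgeSlope H i (V.site p) - edgeSlope H i (V.site p')) with hx
  have x11 : s₄.rvar 11 = x := by
    rw [r₄, hx, ← eval_slopeExp W₃.edge (e := .var 14) n₃, ← eval_baseExp W₃.edge (e := .var 14) n₃,
      ← x7', ← x8]
    simp [Cmd.run, RExp.eval]
  have y11 : s₅.rvar 11 = x := by rw [f₅.rvar 11, x11]
  have z11 : s₆.rvar 11 = x := by rw [f₆.rvar 11, y11]
  have z0 : s₆.rvar 0 = H.at' i x 0 := by
    rw [f₆.rvar 0, r₅]
    simp [Cmd.run, RExp.eval, edgeX, W₄.edge.r2, W₄.edge.r4, x11, HullRep.at']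
  have z1 : s₆.rvar 1 = H.at' i x 1 := by
    rw [r₆]
    simp [Cmd.run, RExp.eval, edgeY, W₅.edge.r3, W₅.edge.r5, y11, HullRep.at']
  obtain ⟨c1, c2, c3⟩ := crossing h2 (mem_closed_iff_lin.1 h1 _ (V.site_mem p'))
    (mem_closed_iff_lin.1 h4.mem _ (V.site_mem p))
  rw [← hx] at c1 c2 c3
  refine Runs.seq (locAt_spec W₆.edge.input _ z0 z1) fun s₇ ⟨f₇, r, hr, hrm⟩ => ?_
  have W₇ := W₆.frame f₇
  have e7 : s₇.rvar 7 = edgeSlope H i (V.site p) := by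
    rw [f₇.rvar 7, f₆.rvar 7, f₅.rvar 7, f₄.rvar 7, x7']
  have e8 : s₇.rvar 8 = sqd (H.pt i) (V.site p) := by
    rw [f₇.rvar 8, f₆.rvar 8, f₅.rvar 8, f₄.rvar 8, x8]
  have e11 : s₇.rvar 11 = x := by rw [f₇.rvar 11, z11]
  have e14 : s₇.nvar 14 = p'.val := by
    rw [f₇.nvar 14, f₆.nvar 14, f₅.nvar 14, f₄.nvar 14, n₃]
  have e13 : s₇.nvar 13 = st.length + 1 := by
    rw [f₇.nvar 13, f₆.nvar 13, f₅.nvar 13, f₄.nvar 13, f₃.nvar 13, f₂.nvar 13, f₁.nvar 13, h13]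
  have e12 : s₇.narr 12 = s.narr 12 := by
    rw [f₇.narr 12, f₆.narr 12, f₅.narr 12, f₄.narr 12, f₃.narr 12, f₂.narr 12, f₁.narr 12]
  have e5 : s₇.nvar 5 = p.val := by
    rw [f₇.nvar 5, f₆.nvar 5, f₅.nvar 5, f₄.nvar 5, f₃.nvar 5, k₂]
  have e6 : s₇.rvar 6 = a := by
    rw [f₇.rvar 6, f₆.rvar 6, f₅.rvar 6, f₄.rvar 6, f₃.rvar 6, f₂.rvar 6, f₁.rvar 6, h6]
  refine Runs.ite' (B₁ := 7) (B₂ := 22 * L.depth + 150) (fun hb => ?_) fun hb => ?_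
  · rw [BExp.eval, RExp.eval, RExp.eval, RExp.eval, RExp.eval, eval_baseExp W₇.edge (e := .var 11) hr,
      eval_slopeExp W₇.edge (e := .var 11) hr] at hb
    simp only [RExp.eval, e7, e8, e11] at hb
    refine (Runs.run rfl).conseq fun s₈ ⟨q, f₈⟩ =>
      .push r x (W₇.frame f₈)
        (by rw [f₈.nvar 5, e5]) (by rw [f₈.rvar 6, e6]) ?_ ?_ (push_geometry ⟨h1, h2, h3, h4⟩ c1 c2 c3 hrm hb)
    · rw [q]; simp [block, Cmd.run, NExp.eval, e13]
    · have : s₈.narr 12 = Function.update (s.narr 12) (st.length + 1) r.val := by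
        rw [q]; simp [block, Cmd.run, NExp.eval, e13, e12, hr]
      rw [this]
      exact ⟨by simp, hM.update (by simp) _⟩
  · rw [BExp.eval, RExp.eval, RExp.eval, RExp.eval, RExp.eval, eval_baseExp W₇.edge (e := .var 11) hr,
      eval_slopeExp W₇.edge (e := .var 11) hr] at hb
    simp only [RExp.eval, e7, e8, e11, not_lt] at hb
    obtain ⟨hp, hp'⟩ := pop_geometry c3 hrm hb
    have hax := hab.trans c1
    have hx1 : x ≤ 1 := c2.trans h4.le_one
    refine Runs.mono (B := (22 * L.depth + 136) + 8) (Runs.seq (p := fun s' => (∃ recs' l',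
        Walking V L H i l₀ x p' recs' l' s' ∧
        ((a < x ∧ recs'.length = recs.length + 1) ∨ (a = x ∧ recs' = recs))) ∧
        s'.rvar 11 = x ∧ s'.nvar 14 = p'.val ∧ s'.nvar 13 = st.length + 1 ∧ s'.narr 12 = s.narr 12)
      ?_ ?_) (by omega) fun _ h => h
    · refine Runs.ite' (B₁ := 22 * L.depth + 132) (B₂ := 1) (fun hb' => ?_) fun hb' => ?_
      · simp only [BExp.eval, RExp.eval, e6, e11] at hb'
        refine Runs.mono (B := 2 + (22 * L.depth + 130)) (Runs.seq (Runs.run rfl le_rfl)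
          fun s₈ ⟨q, f₈⟩ => ?_) (by omega) fun _ h => h
        have W₈ := W₇.frame f₈
        refine (W₈.emit hs hi (by rw [f₈.nvar 5, e5]) (by rw [f₈.rvar 6, e6])
          hb' hx1 hp (by rw [q]; simp [Cmd.run, RExp.eval, e11])).conseq
          fun s₉ ⟨⟨rec, l', g1, g2, g3, g4, g5, g10, g6, g7, g8, g9⟩, f₉⟩ => ⟨⟨recs ++ [rec], l',
            ⟨W₈.edge.frame f₉, g6, g5, g10, g2, W₇.nonneg.trans hax, hp', g4, ?_, g7, g8,
              fun y t h0 h1 _ => g9 y t h0 h1⟩, Or.inl ⟨hb', by simp⟩⟩, ?_, ?_, ?_, ?_⟩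
        · intro r' hr' hri
          rcases List.mem_append.1 hr' with h | h
          · exact h2.trans (W₇.slope r' h hri)
          · rw [List.mem_singleton.1 h]
            refine h2.trans_eq ?_
            simp only [edgeSlope, dot, PiLp.sub_apply] at g3 ⊢
            linarith
        · rw [f₉.rvar 11, f₈.rvar 11, e11]
        · rw [f₉.nvar 14, f₈.nvar 14, e14]
        · rw [f₉.nvar 13, f₈.nvar 13, e13]
        · rw [f₉.narr 12, f₈.narr 12, e12]
      · simp only [BExp.eval, RExp.eval, e6, e11] at hb'
        have : a = x := le_antisymm hax (not_lt.1 hb')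
        refine Runs.straight rfl le_rfl ⟨⟨recs, l, ?_, Or.inr ⟨this, rfl⟩⟩, e11, e14, e13, e12⟩
        rw [← this] at hp' ⊢
        exact W₇.change hp' h2
    · rintro s₈ ⟨⟨recs', l', hW₈, hcase⟩, k11, k14, k13, k12⟩
      refine (Runs.run rfl).conseq
        fun s₉ ⟨q, f₉⟩ => .pop x recs' l' (hW₈.frame f₉) ?_ ?_ ?_ ?_ c1 c2 hcase
      · rw [q]; simp [block, Cmd.run, NExp.eval, k14]
      · rw [q]; simp [block, Cmd.run, RExp.eval, k11]
      · rw [q]; simp [block, Cmd.run, NExp.eval, k13]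
      · rw [f₉.narr 12, k12]; exact hM.2

/-- The walk along an edge, started at the cell `p`. -/
theorem walkLoop_spec (hs : 2 ≤ H.size) {i : ℕ} (hi : i < H.size) {l₀ : List (Fin P.card)} {b₀ : ℝ}
    {p₀ : Fin P.card} {st₀ : List (Fin P.card × ℝ)} {recs₀ : List (Rec P.card)} {s : RamState}
    (hW : Walking V L H i l₀ 0 p₀ recs₀ l₀ s) (h5 : s.nvar 5 = p₀.val) (h6 : s.rvar 6 = 0)
    (h13 : s.nvar 13 = st₀.length) (hM : StackMem st₀ (s.narr 12)) (hS : WalkStack V H i p₀ b₀ st₀)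
    (hb : 0 ≤ b₀) (hst : st₀.length ≤ 1) :
    Halts (.loop (.nlt (.const 0) (.var 13)) walkStep) s fun t s' =>
      ∃ (a : ℝ) (p : Fin P.card) (recs : List (Rec P.card)) (l : List (Fin P.card)) (pops : ℕ),
        Walking V L H i l₀ a p recs l s' ∧ s'.nvar 5 = p.val ∧ s'.rvar 6 = a ∧ a ≤ 1 ∧
        H.at' i 1 ∈ closedVoronoiCell P (V.site p) ∧
        recs₀.length ≤ recs.length ∧ t ≤ (44 * L.depth + 323) * (2 * pops + 1) + 3 ∧
        pops ≤ 2 * (recs.length - recs₀.length) + (if a < 1 then 1 else 0) := by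
  let I : ℕ → ℕ → RamState → Prop := fun k t s' =>
    ∃ (a b : ℝ) (p : Fin P.card) (st : List (Fin P.card × ℝ)) (recs : List (Rec P.card))
      (l : List (Fin P.card)) (pops : ℕ), Walking V L H i l₀ a p recs l s' ∧ s'.nvar 5 = p.val ∧
        s'.rvar 6 = a ∧ s'.nvar 13 = st.length ∧ StackMem st (s'.narr 12) ∧ WalkStack V H i p b st ∧
        a ≤ b ∧ recs₀.length ≤ recs.length ∧
        t ≤ (44 * L.depth + 323) * (2 * pops + st.length + 1 - st₀.length) ∧
        pops ≤ 2 * (recs.length - recs₀.length) + (if a < b then 1 else 0) ∧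
        k = 2 * below V H i p - st.length
  have key := Halts.loop (b := .nlt (.const 0) (.var 13)) (c := walkStep)
    (q := fun t s' => ∃ (a : ℝ) (p : Fin P.card) (recs : List (Rec P.card))
      (l : List (Fin P.card)) (pops : ℕ),
        Walking V L H i l₀ a p recs l s' ∧ s'.nvar 5 = p.val ∧ s'.rvar 6 = a ∧ a ≤ 1 ∧
        H.at' i 1 ∈ closedVoronoiCell P (V.site p) ∧
        recs₀.length ≤ recs.length ∧ t ≤ (44 * L.depth + 323) * (2 * pops + 1) + 3 ∧
        pops ≤ 2 * (recs.length - recs₀.length) + (if a < 1 then 1 else 0)) I ?_ ?_ _ 0 s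
    ⟨0, b₀, p₀, st₀, recs₀, l₀, 0, hW, h5, h6, h13, hM, hS, hb, le_rfl, Nat.zero_le _, Nat.zero_le _, rfl⟩
  · exact key.mono fun t s' h => by rwa [zero_add] at h
  · rintro k t s' ⟨a, b, p, st, recs, l, pops, W, g5, g6, g13, gM, gS, gab, gr, gt, gp, rfl⟩ hb'
    simp only [BExp.eval, NExp.eval, g13] at hb'
    match st, g13, gM, gS, gt, hb' with
    | (p', b') :: st, g13, gM, gS, gt, _ =>
    have hlen := gS.length_le
    have hbel := below_lt gS.2.1
    simp only [List.length_cons] at g13 gt hlen ⊢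
    have harith : ∀ t' j j' : ℕ, t ≤ (44 * L.depth + 323) * j → j + 1 ≤ j' →
        t' ≤ 44 * L.depth + 320 →
        t + (BExp.nlt (.const 0) (.var 13)).cost + t' ≤ (44 * L.depth + 323) * j' :=
      fun t' j j' h1 h2 h3 => by
        have : (44 * L.depth + 323) * (j + 1) ≤ (44 * L.depth + 323) * j' :=
          Nat.mul_le_mul_left _ h2
        simp only [BExp.cost, NExp.cost]
        rw [Nat.mul_add] at this
        omega
    refine (walkStep_spec hs hi W g5 g6 g13 gM gS gab).halts.mono fun t' s'' ⟨ht', hstep⟩ => ?_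
    rcases hstep with ⟨r, x, W', k5, k6, k13, kM, kS⟩ | ⟨x, recs', l', W', k5, k6, k13, kM, kb, kb', kc⟩
    · refine ⟨_, ?_, a, b, p, (r, x) :: (p', b') :: st, recs, l, pops, W', k5, k6, by simpa using k13,
        kM, kS, gab, gr, harith _ _ _ gt ?_ ht', gp, rfl⟩
      · have := kS.length_le
        simp only [List.length_cons] at this ⊢
        omega
      · simp only [List.length_cons]; omega
    · have hr : recs.length ≤ recs'.length := by
        rcases kc with ⟨-, h⟩ | ⟨-, h⟩
        · omega
        · rw [h]
      refine ⟨_, ?_, x, b', p', st, recs', l', pops + 1, W', k5, k6, k13, kM, gS.2.2.2, kb',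
        gr.trans hr, harith _ _ _ gt ?_ ht', ?_, rfl⟩
      · omega
      · omega
      · rcases kc with ⟨h1, h⟩ | ⟨h1, h⟩
        · have : (if a < b then 1 else 0) ≤ 1 := by split_ifs <;> omega
          omega
        · have hxb : ¬ a < b := by rw [h1]; exact not_lt.2 kb
          rw [if_neg hxb] at gp
          have : x < b' := by
            have := gS.2.2.1
            linarith
          rw [if_pos this, h]
          omega
  · rintro k t s' ⟨a, b, p, st, recs, l, pops, W, g5, g6, g13, gM, gS, gab, gr, gt, gp, rfl⟩ hb'
    simp only [BExp.eval, NExp.eval, g13, not_lt] at hb'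
    have hst0 : st = [] := List.length_eq_zero_iff.1 (by omega)
    subst hst0
    obtain ⟨gm, rfl⟩ := gS
    refine ⟨a, p, recs, l, pops, W, g5, g6, gab, gm, gr, ?_, gp⟩
    simp only [BExp.cost, NExp.cost]
    have : (44 * L.depth + 323) * (2 * pops + List.length ([] : List (Fin P.card × ℝ)) + 1 - st₀.length) ≤
      (44 * L.depth + 323) * (2 * pops + 1) := Nat.mul_le_mul_left _ (by simp)
    omega

theorem edgeSetup_spec {i : ℕ} (hi : i < H.size) {s : RamState} (hI : Input V L H s)
    (h4 : s.nvar 4 = i) : Runs edgeSetup s 40 fun s' => (OnEdge V L H i s' ∧ s'.rvar 6 = 0 ∧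
      s'.nvar 12 = (i + 1) % H.size) ∧ Frame edgeSetup s s' := by
  refine Runs.frame ?_
  refine Runs.mono (B := 9 + 30) (Runs.seq (p := fun s' => Input V L H s' ∧ s'.nvar 4 = i ∧
    s'.nvar 12 = (i + 1) % H.size) ?_ fun s₁ ⟨hI₁, k4, k12⟩ => ?_) (by omega) fun _ h => h
  · refine Runs.ite' (B₁ := 4) (B₂ := 2) (fun hb => ?_) fun hb => ?_
    · simp only [BExp.eval, NExp.eval, h4, hI.hullSize] at hb
      refine (Runs.run rfl).conseq fun s' ⟨q, f⟩ =>
        ⟨hI.frame f, by rw [f.nvar 4, h4], ?_⟩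
      rw [q, Nat.mod_eq_of_lt hb]; simp [Cmd.run, NExp.eval, h4]
    · simp only [BExp.eval, NExp.eval, h4, hI.hullSize] at hb
      refine (Runs.run rfl).conseq fun s' ⟨q, f⟩ =>
        ⟨hI.frame f, by rw [f.nvar 4, h4], ?_⟩
      rw [q, show i + 1 = H.size by omega, Nat.mod_self]; simp [Cmd.run, NExp.eval]
  · have hj : (i + 1) % H.size < H.size := Nat.mod_lt _ (by omega)
    refine (Runs.run rfl).conseq fun s' ⟨q, f⟩ =>
      ⟨⟨hI₁.frame f, ?_, ?_, ?_, ?_⟩, ?_, by rw [f.nvar 12, k12]⟩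
    · rw [q]; simp [block, Cmd.run, RExp.eval, NExp.eval, k4, hI₁.vertex_zero hi]
    · rw [q]; simp [block, Cmd.run, RExp.eval, NExp.eval, k4, hI₁.vertex_one hi]
    · rw [q]; simp [block, Cmd.run, RExp.eval, NExp.eval, k4, k12, hI₁.vertex_zero hi,
        hI₁.vertex_zero hj, HullRep.pt_mod, HullRep.ed]
    · rw [q]; simp [block, Cmd.run, RExp.eval, NExp.eval, k4, k12, hI₁.vertex_one hi,
        hI₁.vertex_one hj, HullRep.pt_mod, HullRep.ed]
    · rw [q]; simp [block, Cmd.run, RExp.eval]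

/-- The state after `i` edges of the hull have been processed. -/
structure WalkState (V : VoronoiRep P) (L : PointLocator V) (H : HullRep Q) (i : ℕ)
    (l : List (Fin P.card)) (recs : List (Rec P.card)) (s : RamState) : Prop where
  input : Input V L H s
  cell : ∃ p : Fin P.card, s.nvar 5 = p.val ∧ H.at' i 0 ∈ closedVoronoiCell P (V.site p)
  out : OutList V Q l s
  mem : ∀ c, c ∈ l ↔ ∃ i' < i, ∃ t, 0 ≤ t ∧ t ≤ 1 ∧ H.at' i' t ∈ voronoiCell P (V.site c)
  list : RecList H recs s
  outer : 2 ≤ H.size → Outer V H recs s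
  walked : 2 ≤ H.size → Walked V H recs i 0
  distinct : (recs.map fun r => (r.edge, r.cell)).Nodup
  endmark : ∀ k, s.narr 16 k = 0
  scanned : ∀ k, s.narr 17 k = 0

theorem Runs.seq_halts {c₁ c₂ : Cmd} {s : RamState} {B : ℕ} {p : RamState → Prop}
    {q : ℕ → RamState → Prop} (h₁ : Runs c₁ s B p)
    (h₂ : ∀ s', p s' → Halts c₂ s' fun t' s'' => ∀ t ≤ B, q (t + t') s'') :
    Halts (.seq c₁ c₂) s q :=
  Halts.seq h₁.halts fun _ s' ⟨ht, hp⟩ => (h₂ s' hp).mono fun _ _ h => h _ ht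

variable (L) in
/-- The factor in the running time of one edge. -/
def edgeTime : ℕ := 352 * L.depth + 46 * Nat.clog 2 P.card + 2650

theorem Halts.ite {b : BExp} {c₁ c₂ : Cmd} {s : RamState} {q : ℕ → RamState → Prop}
    (h₁ : b.eval s → Halts c₁ s fun t s' => q (b.cost + t) s')
    (h₂ : ¬ b.eval s → Halts c₂ s fun t s' => q (b.cost + t) s') : Halts (.ite b c₁ c₂) s q := by
  by_cases h : b.eval s
  · obtain ⟨t, s', h1, h2⟩ := h₁ h
    exact ⟨_, s', .iteTrue h h1, h2⟩
  · obtain ⟨t, s', h1, h2⟩ := h₂ h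
    exact ⟨_, s', .iteFalse h h1, h2⟩

theorem no_fwd_iff {c : Fin P.card} {z : Plane} (hz : z ∈ closedVoronoiCell P (V.site c)) :
    (∀ e, V.owner e = c → ¬ V.Fwd e z) ↔ z ∈ voronoiCell P (V.site c) := by
  constructor
  · intro h
    refine mem_open_of_closed_no_tie hz fun u hu hne hg => ?_
    obtain ⟨e, he, hf⟩ := V.exists_fwd hz hu hne hg
    exact h e he hf
  · intro h e he hf
    have h1 := (V.mem_edge.1 hf.1).1
    have h2 := mem_open_iff_gap.1 h _ (V.sn_mem e) (by rw [← he]; exact V.sn_ne_so e)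
    rw [VoronoiRep.so, he] at h1
    linarith

theorem point_spec (hm : H.size = 1) {l : List (Fin P.card)} {recs : List (Rec P.card)}
    {s : RamState} (hW : WalkState V L H 0 l recs s) (hE : OnEdge V L H 0 s) :
    Runs pointCmd s
      (46 * Nat.clog 2 P.card + 270) fun s' => ∃ l', WalkState V L H 1 l' recs s' := by
  have hat : ∀ i t, H.at' i t = H.pt 0 := fun i t => by
    have hp : ∀ k, H.pt k = H.pt 0 := fun k => by
      rw [← HullRep.pt_mod, hm, Nat.mod_one]
    simp [HullRep.at', HullRep.ed, hp]
  obtain ⟨c, hc, hzc⟩ := hW.cell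
  rw [hat] at hzc
  have hl : l = [] := List.eq_nil_iff_forall_not_mem.2 fun x hx => by
    obtain ⟨i', hi', -⟩ := (hW.mem x).1 hx
    omega
  have hmem : ∀ x, H.pt 0 ∈ voronoiCell P (V.site x) ↔
      ∃ i' < 1, ∃ t, 0 ≤ t ∧ t ≤ 1 ∧ H.at' i' t ∈ voronoiCell P (V.site x) := fun x => by
    simp only [hat]
    exact ⟨fun h => ⟨0, one_pos, 0, le_rfl, zero_le_one, h⟩, fun ⟨_, _, _, _, _, h⟩ => h⟩
  have hsame : ∀ x, H.pt 0 ∈ voronoiCell P (V.site x) → x = c := fun x hx =>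
    (V.site_injective (eq_of_mem_open_of_mem_closed (V.site_mem x) (V.site_mem c) hx hzc)).symm
  have hclog := Nat.clog_mono_right 2 (V.deg_le c)
  refine Runs.mono (B := 2 + (2 + (2 + ((46 * Nat.clog 2 (V.deg c) + 240) + 16))))
    (Runs.seq (Runs.run rfl) fun s₁ ⟨r₁, f₁⟩ =>
      Runs.seq (Runs.run rfl) fun s₂ ⟨r₂, f₂⟩ =>
      Runs.seq (Runs.run rfl) fun s₃ ⟨r₃, f₃⟩ =>
      Runs.seq (search_spec (c := c) (z := H.pt 0)
        (((hW.input.frame f₁).frame f₂).frame f₃) ?_ ?_ ?_ hzc)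
        fun s₄ ⟨_, hfound, f₄⟩ => ?_) (by omega) fun _ h => h
  · rw [f₃.nvar 20, f₂.nvar 20, r₁]; simp [Cmd.run, NExp.eval, hc]
  · rw [f₃.rvar 20, r₂]; simp [Cmd.run, RExp.eval, f₁.rvar 2, hE.r2]
  · rw [r₃]; simp [Cmd.run, RExp.eval, f₂.rvar 3, f₁.rvar 3, hE.r3]
  · have hI₄ := (((hW.input.frame f₁).frame f₂).frame f₃).frame f₄
    have hO₄ := (((hW.out.frame f₁).frame f₂).frame f₃).frame f₄
    have hR₄ := (((hW.list.frame f₁).frame f₂).frame f₃).frame f₄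
    have c₄ : s₄.nvar 5 = c.val := by
      rw [f₄.nvar 5, f₃.nvar 5, f₂.nvar 5, f₁.nvar 5, hc]
    have e₄ : ∀ k, s₄.narr 16 k = 0 := by
      rw [f₄.narr 16, f₃.narr 16, f₂.narr 16, f₁.narr 16]
      exact hW.endmark
    have g₄ : ∀ k, s₄.narr 17 k = 0 := by
      rw [f₄.narr 17, f₃.narr 17, f₂.narr 17, f₁.narr 17]
      exact hW.scanned
    refine Runs.ite' (B₁ := 10) (B₂ := 1) (fun hb => ?_) fun hb => ?_
    · simp only [BExp.eval, NExp.eval] at hb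
      have hopen : H.pt 0 ∈ voronoiCell P (V.site c) := by
        rcases hfound with ⟨h, -⟩ | ⟨-, h⟩
        · omega
        · exact (no_fwd_iff hzc).1 h
      have hunm : s₄.narr 14 c.val = 0 := by
        by_contra h
        rcases hO₄.of_marked c h with h | h
        · rw [hl] at h; simp at h
        · exact h _ hopen (HullRep.pt_mem (H := H) (by omega) 0)
      refine (output_spec hO₄ (e := .var 5) c₄ (fun s'' h _ _ => h) hunm).frame.conseq
        fun s₅ ⟨⟨hO, _⟩, f₅⟩ => ⟨l ++ [c], hI₄.frame f₅, ⟨c, ?_, by rwa [hat]⟩, hO, fun x => ?_,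
          hR₄.frame f₅, fun h => by omega, fun h => by omega, hW.distinct, ?_, ?_⟩
      · rw [f₅.nvar 5, c₄]
      · rw [← hmem, hl]
        simp only [List.nil_append, List.mem_singleton]
        exact ⟨fun h => h ▸ hopen, hsame x⟩
      · rwa [f₅.narr 16]
      · rwa [f₅.narr 17]
    · simp only [BExp.eval, NExp.eval] at hb
      refine Runs.straight rfl le_rfl ⟨l, hI₄, ⟨c, c₄, by rwa [hat]⟩, hO₄, fun x => ?_, hR₄,
        fun h => by omega, fun h => by omega, hW.distinct, e₄, g₄⟩
      rw [← hmem, hl]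
      refine ⟨fun h => by simp at h, fun h => ?_⟩
      exfalso
      rw [hsame x h] at h
      rcases hfound with ⟨-, e, -, he, hf⟩ | ⟨h', -⟩
      · exact (no_fwd_iff hzc).2 h e he hf
      · exact hb h'

/-- The state after the edge `i` has been processed. -/
structure EdgeDone (V : VoronoiRep P) (L : PointLocator V) (H : HullRep Q) (i : ℕ)
    (l₀ : List (Fin P.card)) (recs : List (Rec P.card)) (l : List (Fin P.card)) (s : RamState) :
    Prop where
  input : Input V L H s
  cell : ∃ p : Fin P.card, s.nvar 5 = p.val ∧ H.at' i 1 ∈ closedVoronoiCell P (V.site p)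
  out : OutList V Q l s
  list : RecList H recs s
  outer : Outer V H recs s
  walked : Walked V H recs i 1
  distinct : (recs.map fun r => (r.edge, r.cell)).Nodup
  sub : ∀ x ∈ l₀, x ∈ l
  new : ∀ x ∈ l, x ∈ l₀ ∨ ∃ t, 0 ≤ t ∧ t ≤ 1 ∧ H.at' i t ∈ voronoiCell P (V.site x)
  cover : ∀ x t, 0 ≤ t → t ≤ 1 → H.at' i t ∈ voronoiCell P (V.site x) → x ∈ l

theorem finishEdge_spec (hs : 2 ≤ H.size) {i : ℕ} (hi : i < H.size) {l₀ : List (Fin P.card)} {a : ℝ}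
    {p : Fin P.card} {recs : List (Rec P.card)} {l : List (Fin P.card)} {s : RamState}
    (h : Walking V L H i l₀ a p recs l s) (h5 : s.nvar 5 = p.val) (h6 : s.rvar 6 = a) (ha : a ≤ 1)
    (h1 : H.at' i 1 ∈ closedVoronoiCell P (V.site p)) :
    Runs (.ite (.rlt (.var 6) (.const 1)) (.seq (.rset 14 (.const 1)) emitCmd) .skip) s
      (22 * L.depth + 135) fun s' => ∃ recs' l', EdgeDone V L H i l₀ recs' l' s' ∧
        recs'.length = recs.length + (if a < 1 then 1 else 0) := by
  refine Runs.ite' (B₁ := 22 * L.depth + 132) (B₂ := 1) (fun hb => ?_) fun hb => ?_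
  · simp only [BExp.eval, RExp.eval, h6, Int.cast_one] at hb
    refine Runs.mono (B := 2 + (22 * L.depth + 130)) (Runs.seq (Runs.run rfl le_rfl)
      fun s₈ ⟨q, f₈⟩ => ?_) (by omega) fun _ h => h
    have W₈ := h.frame f₈
    have h58 : s₈.nvar 5 = p.val := by rw [f₈.nvar 5, h5]
    refine (W₈.emit hs hi h58 (by rw [f₈.rvar 6, h6])
      hb le_rfl h1 (by rw [q]; simp [Cmd.run, RExp.eval])).conseq
      fun s₉ ⟨⟨rec, l', g1, g2, g3, g4, g5, g10, g6, g7, g8, g9⟩, f₉⟩ => ⟨recs ++ [rec], l',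
        ⟨(W₈.edge.frame f₉).input, ⟨p, by rw [f₉.nvar 5, h58], h1⟩, g6, g5, g10, g2, g4,
          g7, g8, g9⟩, by simp [hb]⟩
  · simp only [BExp.eval, RExp.eval, h6, Int.cast_one] at hb
    obtain rfl : a = 1 := le_antisymm ha (not_lt.1 hb)
    exact Runs.straight rfl le_rfl ⟨recs, l, ⟨h.edge.input, ⟨p, h5, h1⟩, h.out, h.list, h.outer, h.walked,
      h.distinct, h.sub, h.new, fun x t h0 h1 => h.cover x t h0 h1 one_pos⟩, by simp⟩

theorem initStack {i : ℕ} {p r : Fin P.card} (hp : H.at' i 0 ∈ closedVoronoiCell P (V.site p))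
    (hr : H.at' i 1 ∈ closedVoronoiCell P (V.site r)) :
    (edgeSlope H i (V.site p) = edgeSlope H i (V.site r) → WalkStack V H i p 1 []) ∧
    (edgeSlope H i (V.site p) ≠ edgeSlope H i (V.site r) → WalkStack V H i p 0 [(r, 1)]) := by
  have h0 := mem_closed_iff_lin.1 hp _ (V.site_mem r)
  have h1 := mem_closed_iff_lin.1 hr _ (V.site_mem p)
  simp only [lin] at h0 h1
  refine ⟨fun h => ⟨?_, rfl⟩, fun h => ⟨hp, lt_of_le_of_ne (by linarith) (Ne.symm h), one_pos, hr, rfl⟩⟩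
  rw [mem_closed_iff_lin] at hr ⊢
  intro s hs
  refine le_trans ?_ (hr s hs)
  simp only [lin]
  linarith

theorem segment_spec (hs : 2 ≤ H.size) {i : ℕ} (hi : i < H.size) {l : List (Fin P.card)}
    {recs : List (Rec P.card)} {s : RamState} (hW : WalkState V L H i l recs s)
    (hE : OnEdge V L H i s) (h6 : s.rvar 6 = 0) (h12 : s.nvar 12 = (i + 1) % H.size) :
    Halts segmentCmd s fun t s' =>
      ∃ l' recs', recs.length ≤ recs'.length ∧
        t ≤ (352 * L.depth + 2592) * (recs'.length - recs.length + 1) ∧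
        WalkState V L H (i + 1) l' recs' s' := by
  have hj : (i + 1) % H.size < H.size := Nat.mod_lt _ (by omega)
  obtain ⟨p, hp, hpm⟩ := hW.cell
  refine Halts.mono (p := fun t s' => (∃ l' recs', recs.length ≤ recs'.length ∧
        t ≤ (352 * L.depth + 2592) * (recs'.length - recs.length + 1) ∧
        EdgeDone V L H i l recs' l' s') ∧ Frame _ s s') (Halts.frame ?_) ?_
  · have W : Walking V L H i l 0 p recs l s := ⟨hE, hW.out, hW.list, hW.outer hs, hW.walked hs, le_rfl, hpm,
      hW.distinct, fun r hr hri => by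
        have := (hW.walked hs).valid r hr
        rcases (hW.walked hs).edge_le r hr with h | ⟨-, h⟩
        · omega
        · have h1 := this.lo_nonneg
          have h2 := this.lo_lt_hi
          linarith, fun x hx => hx, fun x hx => Or.inl hx, fun x t _ _ h => absurd h (lt_irrefl _)⟩
    refine Runs.seq_halts (Runs.run (B := 3) rfl) fun s₁ ⟨r₁, f₁⟩ =>
      Runs.seq_halts (Runs.run (B := 3) rfl) fun s₂ ⟨r₂, f₂⟩ =>
      ?_
    have W₁ := W.frame f₁
    have W₂ := W₁.frame f₂
    refine Runs.seq_halts (locAt_spec W₂.edge.input (H.at' i 1) ?_ ?_) fun s₃ ⟨f₃, r, hr, hrm⟩ =>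
      Runs.seq_halts (Runs.run (B := 2) rfl) fun s₄ ⟨r₄, f₄⟩ => ?_
    · rw [f₂.rvar 0, r₁, HullRep.at_one]
      simp [Cmd.run, RExp.eval, NExp.eval, h12, hE.input.vertex_zero hj, HullRep.pt_mod]
    · rw [r₂, HullRep.at_one]
      simp [Cmd.run, RExp.eval, NExp.eval, f₁.nvar 12, h12, W₁.edge.input.vertex_one hj,
        HullRep.pt_mod]
    have W₄ := (W₂.frame f₃).frame f₄
    have k5 : s₄.nvar 5 = p.val := by
      rw [f₄.nvar 5, f₃.nvar 5, f₂.nvar 5, f₁.nvar 5, hp]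
    have k6 : s₄.rvar 6 = 0 := by
      rw [f₄.rvar 6, f₃.rvar 6, f₂.rvar 6, f₁.rvar 6, h6]
    have k11 : s₄.nvar 11 = r.val := by rw [f₄.nvar 11, hr]
    have k13 : s₄.nvar 13 = 0 := by rw [r₄]; simp [Cmd.run, NExp.eval]
    refine Runs.seq_halts (B := 50) (p := fun s' => Walking V L H i l 0 p recs l s' ∧
      s'.nvar 5 = p.val ∧ s'.rvar 6 = 0 ∧ ∃ st b, s'.nvar 13 = st.length ∧ StackMem st (s'.narr 12) ∧
        WalkStack V H i p b st ∧ 0 ≤ b ∧ st.length ≤ 1) ?_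
      fun s₅ ⟨W₅, m5, m6, st, b, m13, mM, mS, mb, mst⟩ => ?_
    · refine Runs.ite' (B₁ := 1) (B₂ := 6) (fun hb => ?_) fun hb => ?_
      · rw [BExp.eval, eval_slopeExp W₄.edge (e := .var 5) k5,
          eval_slopeExp W₄.edge (e := .var 11) k11] at hb
        exact Runs.straight rfl le_rfl ⟨W₄, k5, k6, [], 1, k13, trivial, (initStack hpm hrm).1 hb,
          zero_le_one, by simp⟩
      · rw [BExp.eval, eval_slopeExp W₄.edge (e := .var 5) k5,
          eval_slopeExp W₄.edge (e := .var 11) k11] at hb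
        refine (Runs.run rfl).conseq fun s₅ ⟨q, f₅⟩ =>
          ⟨W₄.frame f₅, by rw [f₅.nvar 5, k5],
            by rw [f₅.rvar 6, k6], [(r, 1)], 0, ?_, ⟨?_, trivial⟩,
            (initStack hpm hrm).2 hb, le_rfl, by simp⟩
        · rw [q]; simp [block, Cmd.run, NExp.eval]
        · rw [q]; simp [block, Cmd.run, NExp.eval, k11]
    · refine Halts.seq (walkLoop_spec hs hi W₅ m5 m6 m13 mM mS mb mst) fun t₆ s₆
        ⟨a, p', recs', l', pops, W₆, n5, n6, na, n1, nr, nt, np⟩ => ?_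
      refine (finishEdge_spec hs hi W₆ n5 n6 na n1).halts.mono fun t₇ s₇ ⟨ht₇, recs'', l'', hD, hlen⟩ =>
        fun t₅ ht₅ t₄ ht₄ t₃ ht₃ t₂ ht₂ t₁ ht₁ => ⟨l'', recs'', by omega, ?_, hD⟩
      obtain ⟨B, hB⟩ : ∃ B, B = 44 * L.depth + 323 := ⟨_, rfl⟩
      obtain ⟨e, he⟩ : ∃ e, recs''.length - recs.length = e := ⟨_, rfl⟩
      rw [he, show 352 * L.depth + 2592 = 8 * B + 8 by omega,
        show (8 * B + 8) * (e + 1) = 8 * (B * e) + 8 * B + 8 * e + 8 by ring]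
      rw [← hB] at nt
      have h2 : 2 * pops + 1 ≤ 4 * e + 1 := by
        split_ifs at np hlen <;> omega
      have h3 := Nat.mul_le_mul_left B h2
      rw [show B * (4 * e + 1) = 4 * (B * e) + B by ring] at h3
      omega
  · rintro t s' ⟨⟨l', recs', hlen, ht, hD⟩, hF⟩
    refine ⟨l', recs', hlen, ht, hD.input, ?_, hD.out, fun x => ?_, hD.list, fun _ => hD.outer, fun _ => hD.walked.corner,
      hD.distinct, ?_, ?_⟩
    · rw [← HullRep.at_one_eq]; exact hD.cell
    · constructor
      · intro hx
        rcases hD.new x hx with h | ⟨t, h⟩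
        · obtain ⟨i', hi', h⟩ := (hW.mem x).1 h
          exact ⟨i', by omega, h⟩
        · exact ⟨i, by omega, t, h⟩
      · rintro ⟨i', hi', t, h0, h1, h⟩
        rcases (by omega : i' < i ∨ i' = i) with h' | rfl
        · exact hD.sub x ((hW.mem x).2 ⟨i', h', t, h0, h1, h⟩)
        · exact hD.cover x t h0 h1 h
    · rw [hF.narr 16]; exact hW.endmark
    · rw [hF.narr 17]; exact hW.scanned

theorem edge_spec (hm : 0 < H.size) {i : ℕ} (hi : i < H.size) {l : List (Fin P.card)}
    {recs : List (Rec P.card)} {s : RamState} (hW : WalkState V L H i l recs s) (h4 : s.nvar 4 = i) :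
    Halts edgeCmd s fun t s' => ∃ l' recs', recs.length ≤ recs'.length ∧
      (H.size = 1 → recs' = recs) ∧ t ≤ edgeTime L * (recs'.length - recs.length + 1) ∧
      WalkState V L H (i + 1) l' recs' s' := by
  refine Runs.seq_halts (edgeSetup_spec hi hW.input h4) fun s₁ ⟨⟨hE, h6, h12⟩, f₁⟩ => ?_
  have hW₁ : WalkState V L H i l recs s₁ := by
    refine ⟨hE.input, ?_, hW.out.frame f₁, hW.mem,
      hW.list.frame f₁, fun h => (hW.outer h).frame f₁, hW.walked, hW.distinct, ?_, ?_⟩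
    · rw [f₁.nvar 5]; exact hW.cell
    · rw [f₁.narr 16]; exact hW.endmark
    · rw [f₁.narr 17]; exact hW.scanned
  refine Halts.ite (fun hb => ?_) fun hb => ?_
  · simp only [BExp.eval, NExp.eval, hE.input.hullSize] at hb
    obtain rfl : i = 0 := by omega
    refine (point_spec hb hW₁ hE).halts.mono fun t s' ⟨ht, l', h⟩ t' ht' =>
      ⟨l', recs, le_rfl, fun _ => rfl, ?_, h⟩
    simp only [BExp.cost, NExp.cost, edgeTime, Nat.sub_self, zero_add, mul_one]
    omega
  · simp only [BExp.eval, NExp.eval, hE.input.hullSize] at hb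
    refine (segment_spec (by omega) hi hW₁ hE h6 h12).mono fun t s' ⟨l', recs', h1, h2, h3⟩ t' ht' =>
      ⟨l', recs', h1, fun h => absurd h hb, ?_, h3⟩
    obtain ⟨e, he⟩ : ∃ e, recs'.length - recs.length = e := ⟨_, rfl⟩
    rw [he] at h2 ⊢
    have := Nat.mul_le_mul_right (e + 1) (show 352 * L.depth + 2592 + 58 ≤ edgeTime L by
      unfold edgeTime; omega)
    rw [Nat.add_mul _ 58] at this
    simp only [BExp.cost, NExp.cost]
    omega

/-! ## The walk along the whole hull -/

theorem Halts.edgeRound {c : Cmd} {s : RamState} {p : ℕ → RamState → Prop} (h : Halts c s p)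
    {q : ℕ → RamState → Prop} (hpq : ∀ t s', p t s' → Frame c s s' →
      q (t + 4) { s' with nvar := Function.update s'.nvar 4 (s'.nvar 4 + 1) }) :
    Halts (edgeRound c) s q := by
  obtain ⟨t, s', h1, h2⟩ := h
  exact ⟨_, _, .seq h1 (.nset _ _ _), hpq t s' h2 h1.frame⟩

theorem WalkState.of_eq {i : ℕ} {l : List (Fin P.card)} {recs : List (Rec P.card)} {s : RamState}
    (h : WalkState V L H i l recs s) (k : ℕ) :
    WalkState V L H i l recs { s with nvar := Function.update s.nvar 4 k } := by
  have hF : Frame (.nset 4 (.const k)) s { s with nvar := Function.update s.nvar 4 k } :=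
    (Exec.nset 4 (.const k) s).frame
  exact ⟨h.input.frame hF rfl, by simpa using h.cell,
    h.out.frame hF (by simp [Cmd.nvars]) (by simp [Cmd.narrs]) (by simp [Cmd.narrs]), h.mem,
    h.list.frame hF (by simp [Cmd.nvars]) (by simp [Cmd.narrs]) rfl, fun h2 => (h.outer h2).frame hF (by simp [Cmd.narrs]), h.walked, h.distinct,
    h.endmark, h.scanned⟩

theorem startWalk_spec (hm : 0 < H.size) :
    Runs (startWalk locateCmd) (inputState V L H) (22 * L.depth + 20) fun s' =>
      WalkState V L H 0 [] [] s' ∧ s'.nvar 4 = 0 := by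
  refine Runs.mono (B := (22 * L.depth + 18) + 2) (Runs.seq (locateCmd_spec hm input_inputState)
    fun s₁ ⟨f₁, r, hr, hrm⟩ => (Runs.run rfl le_rfl).conseq fun s₂ ⟨q, f₂⟩ => ⟨?_, ?_⟩) (by omega)
    fun _ h => h
  · have e14 : s₂.narr 14 = fun _ => 0 := by
      rw [f₂.narr 14, f₁.narr 14]; rfl
    have e16 : s₂.narr 16 = fun _ => 0 := by
      rw [f₂.narr 16, f₁.narr 16]; rfl
    have e17 : s₂.narr 17 = fun _ => 0 := by
      rw [f₂.narr 17, f₁.narr 17]; rfl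
    refine ⟨(input_inputState.frame f₁).frame f₂, ⟨r, ?_, hrm⟩,
      ⟨List.nodup_nil, ?_, by simp, by simp, fun c hc => absurd (congrFun e14 _) hc⟩, by simp,
      ⟨?_, by simp⟩, fun _ r hr => by simp at hr, fun _ => .nil, by simp, fun k => congrFun e16 k, fun k => congrFun e17 k⟩
    · rw [f₂.nvar 5, hr]
    · rw [f₂.nvar 6, f₁.nvar 6]; rfl
    · rw [f₂.nvar 16, f₁.nvar 16]; rfl
  · rw [q]; simp [Cmd.run, NExp.eval, edgeVar]

theorem walkEdges_spec (hm : 0 < H.size) {k : ℕ} (hk : k ≤ H.size) :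
    Halts (walkEdges locateCmd edgeCmd k) (inputState V L H) fun _ s' => ∃ l recs,
      WalkState V L H k l recs s' ∧ s'.nvar 4 = k := by
  induction k with
  | zero => exact (startWalk_spec hm).halts.mono fun _ s' h => ⟨[], [], h.2⟩
  | succ k ih =>
    refine Halts.seq (ih (by omega)) fun _ s₁ ⟨l, recs, h, h4⟩ => ?_
    refine (edge_spec hm (by omega) h h4).edgeRound fun _ s₂ ⟨l', recs', _, _, _, h'⟩ hF =>
      ⟨l', recs', h'.of_eq _, ?_⟩
    simp [hF.nvar 4, h4]

theorem walkLoop_all (hm : 0 < H.size) {s : RamState} (hW : WalkState V L H 0 [] [] s)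
    (h4 : s.nvar 4 = 0) :
    Halts (.loop (.nlt (.var edgeVar) (.var hullSizeVar)) (edgeRound edgeCmd)) s fun t s' =>
      ∃ l recs, WalkState V L H H.size l recs s' ∧ (H.size = 1 → recs = []) ∧
        t ≤ (edgeTime L + 7) * (recs.length + H.size) + 3 := by
  let I : ℕ → ℕ → RamState → Prop := fun k t s' => ∃ i l recs, WalkState V L H i l recs s' ∧
    s'.nvar 4 = i ∧ i ≤ H.size ∧ k = H.size - i ∧
    (H.size = 1 → recs = []) ∧ t ≤ (edgeTime L + 7) * (recs.length + i)
  have key := Halts.loop (b := .nlt (.var edgeVar) (.var hullSizeVar)) (c := edgeRound edgeCmd)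
    (q := fun t s' => ∃ l recs, WalkState V L H H.size l recs s' ∧ (H.size = 1 → recs = []) ∧
        t ≤ (edgeTime L + 7) * (recs.length + H.size) + 3) I ?_ ?_ _ 0 s
    ⟨0, [], [], hW, h4, Nat.zero_le _, rfl, fun _ => rfl, Nat.zero_le _⟩
  · exact key.mono fun t s' h => by rwa [zero_add] at h
  · rintro k t s' ⟨i, l, recs, h, h4, hi, rfl, h1, ht⟩ hb
    have h3 : s'.nvar hullSizeVar = H.size := h.input.hullSize
    simp only [BExp.eval, NExp.eval, h3, show s'.nvar edgeVar = i from h4] at hb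
    refine (edge_spec hm hb h h4).edgeRound fun t' s₂ ⟨l', recs', hl, hr, ht', h'⟩ hF =>
      ⟨_, ?_, i + 1, l', recs', h'.of_eq _, ?_, hb, rfl, fun e => (hr e).trans (h1 e), ?_⟩
    · omega
    · simp [hF.nvar 4, h4]
    · obtain ⟨e, he⟩ : ∃ e, recs'.length = recs.length + e := ⟨_, (Nat.add_sub_cancel' hl).symm⟩
      rw [he, Nat.add_sub_cancel_left] at ht'
      rw [he, show recs.length + e + (i + 1) = (recs.length + i) + (e + 1) by omega,
        Nat.mul_add, Nat.add_mul _ _ (e + 1)]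
      simp only [BExp.cost, NExp.cost]
      omega
  · rintro k t s' ⟨i, l, recs, h, h4, hi, rfl, h1, ht⟩ hb
    have h3 : s'.nvar hullSizeVar = H.size := h.input.hullSize
    simp only [BExp.eval, NExp.eval, h3, show s'.nvar edgeVar = i from h4] at hb
    obtain rfl : i = H.size := by omega
    refine ⟨l, recs, h, h1, ?_⟩
    simp only [BExp.cost, NExp.cost]
    omega

/-! ## The traversal: half-edges at the ends of the records -/

/-- The input and the records are in memory. -/
structure Tables (V : VoronoiRep P) (L : PointLocator V) (H : HullRep Q) (N : ℕ)
    (cell : ℕ → Fin P.card) (edge : ℕ → ℕ) (lo hi : ℕ → ℝ) (s : RamState) : Prop where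
  input : Input V L H s
  len : s.nvar 16 = N
  cell : ∀ j < N, s.narr 13 j = (cell j).val
  lo0 : ∀ j < N, s.rarr 13 j = H.at' (edge j) (lo j) 0
  lo1 : ∀ j < N, s.rarr 14 j = H.at' (edge j) (lo j) 1
  hi0 : ∀ j < N, s.rarr 15 j = H.at' (edge j) (hi j) 0
  hi1 : ∀ j < N, s.rarr 16 j = H.at' (edge j) (hi j) 1

variable {N : ℕ} {cell : ℕ → Fin P.card} {edge : ℕ → ℕ} {lo hi : ℕ → ℝ}

theorem Tables.frame {s s' : RamState} {c : Cmd} (h : Tables V L H N cell edge lo hi s)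
    (hF : Frame c s s') (hc : c.safe = true := by rfl) (h16 : 16 ∉ c.nvars := by decide) (h13 : 13 ∉ c.narrs := by decide)
    (hr : c.rarrs = [] := by rfl) : Tables V L H N cell edge lo hi s' := by
  have hr' : ∀ a, a ∉ c.rarrs := by rw [hr]; simp
  refine ⟨h.input.frame hF hc, ?_, ?_, ?_, ?_, ?_, ?_⟩
  · rw [hF.nvar 16 h16]; exact h.len
  · rw [hF.narr 13 h13]; exact h.cell
  · rw [hF.rarr _ (hr' 13)]; exact h.lo0
  · rw [hF.rarr _ (hr' 14)]; exact h.lo1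
  · rw [hF.rarr _ (hr' 15)]; exact h.hi0
  · rw [hF.rarr _ (hr' 16)]; exact h.hi1

theorem neighbours_spec {s : RamState} (hT : Tables V L H N cell edge lo hi s) {j : ℕ}
    (h18 : s.nvar 18 = j) : Runs neighbours s 20 fun s' => (s'.nvar 19 = nextRec N j ∧
      s'.nvar 33 = prevRec N j) ∧ Frame neighbours s s' := by
  refine Runs.frame ?_
  refine Runs.mono (B := 9 + 8) (Runs.seq (p := fun s' => s'.nvar 16 = N ∧ s'.nvar 18 = j ∧
    s'.nvar 19 = nextRec N j) ?_ fun s₁ ⟨k16, k18, k19⟩ => ?_) (by omega) fun _ h => h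
  · refine Runs.ite' (B₁ := 4) (B₂ := 2) (fun hb => ?_) fun hb => ?_
    all_goals
      simp only [BExp.eval, NExp.eval, h18, hT.len] at hb
      refine (Runs.run rfl).conseq fun s' ⟨q, f⟩ =>
        ⟨by rw [f.nvar 16, hT.len], by rw [f.nvar 18, h18], ?_⟩
      rw [q]; simp [Cmd.run, NExp.eval, h18, nextRec, hb]
  · refine Runs.ite' (B₁ := 4) (B₂ := 4) (fun hb => ?_) fun hb => ?_
    all_goals
      simp only [BExp.eval, NExp.eval, k18] at hb
      refine (Runs.run rfl).conseq fun s' ⟨q, f⟩ =>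
        ⟨by rw [f.nvar 19, k19], ?_⟩
      rw [q]; simp [Cmd.run, NExp.eval, k18, k16, prevRec, hb]

theorem search_tie {c c' : Fin P.card} {z : Plane} {s : RamState} (hI : Input V L H s)
    (hc : s.nvar 20 = c.val) (h0 : s.rvar 20 = z 0) (h1 : s.rvar 21 = z 1)
    (hz : z ∈ closedVoronoiCell P (V.site c)) (hz' : z ∈ closedVoronoiCell P (V.site c'))
    (hne : c' ≠ c) :
    Runs search s (46 * Nat.clog 2 P.card + 240) fun s' => Searching V L H c z s' ∧
      (∃ e, s'.nvar 21 = e.val ∧ V.owner e = c ∧ V.Fwd e z) ∧ Frame search s s' := by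
  have hclog := Nat.clog_mono_right 2 (V.deg_le c)
  refine (search_spec hI hc h0 h1 hz).mono (by omega) fun s' ⟨hS, hf, hF⟩ => ⟨hS, ?_, hF⟩
  rcases hf with ⟨-, h⟩ | ⟨-, h⟩
  · exact h
  · obtain ⟨e, he, hf⟩ := V.exists_fwd hz (V.site_mem c') (fun h => hne (V.site_injective h)) (by
      have g1 := mem_closed_iff_gap.1 hz _ (V.site_mem c')
      have g2 := mem_closed_iff_gap.1 hz' _ (V.site_mem c)
      rw [gap_swap] at g2
      linarith)
    exact absurd hf (h e he)

theorem prv_val (e : Fin V.numEdges) : (V.prv e).val = if e.val = V.first (V.owner e) then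
    V.first (V.owner e) + V.deg (V.owner e) - 1 else e.val - 1 := by
  unfold VoronoiRep.prv; split_ifs <;> rfl

theorem nxt_val (e : Fin V.numEdges) : (V.nxt e).val =
    if e.val + 1 < V.first (V.owner e) + V.deg (V.owner e) then e.val + 1
    else V.first (V.owner e) := by
  unfold VoronoiRep.nxt; split_ifs <;> rfl

/-- Replace the half-edge that starts at the given point by the one that ends there. -/
theorem stepBack_spec {c : Fin P.card} {z : Plane} {s : RamState} (hS : Searching V L H c z s)
    {e : Fin V.numEdges} (he : s.nvar 21 = e.val) (ho : V.owner e = c) (hf : V.Fwd e z) :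
    Runs stepBack s 30 fun s' =>
      ∃ e, s'.nvar 21 = e.val ∧ V.owner e = c ∧ V.Bwd e z := by
  refine Runs.ite' (B₁ := 9) (B₂ := 1) (fun hb => ?_) fun hb => ?_
  · simp only [BExp.eval, RExp.eval, NExp.eval, he, hS.z0, hS.z1, hS.input.hasSrc, hS.input.src_zero,
      hS.input.src_one, Bool.toNat_eq_one] at hb
    obtain ⟨h1, h2, h3⟩ := hb
    have hz : z = V.src e := plane_ext h2 h3
    have hnext := VoronoiRep.next_prv h1
    have hbwd : V.Bwd (V.prv e) z := by rw [hz, ← hnext.tgt_eq]; exact hnext.bwd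
    have hv := prv_val e
    refine Runs.ite' (B₁ := 6) (B₂ := 4) (fun hb => ?_) fun hb => ?_
    all_goals
      simp only [BExp.eval, NExp.eval, he, hS.first] at hb
      rw [ho] at hv
      refine (Runs.run rfl).conseq fun s' ⟨q, f⟩ =>
        ⟨V.prv e, ?_, by rw [VoronoiRep.owner_prv, ho], hbwd⟩
      rw [q, hv]
      simp [Cmd.run, NExp.eval, he, hS.first, hS.deg, hb]
  · simp only [BExp.eval, RExp.eval, NExp.eval, he, hS.z0, hS.z1, hS.input.hasSrc, hS.input.src_zero,
      hS.input.src_one, Bool.toNat_eq_one] at hb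
    exact Runs.straight rfl le_rfl ⟨e, he, ho, hf.1, fun h =>
      hb ⟨h.1, by rw [← h.2], by rw [← h.2]⟩⟩

/-- The half-edges at the ends of the first `k` records have been found. -/
structure Marked (V : VoronoiRep P) (H : HullRep Q) (N : ℕ) (cell : ℕ → Fin P.card) (edge : ℕ → ℕ)
    (lo hi : ℕ → ℝ) (k : ℕ) (s : RamState) : Prop where
  begins : ∀ j < k, cell (nextRec N j) ≠ cell j → ∃ h : Fin V.numEdges, s.narr 15 j = h.val ∧
    V.owner h = cell j ∧ V.Fwd h (H.at' (edge j) (hi j))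
  ends : ∀ h : Fin V.numEdges, s.narr 16 h.val = 1 ↔ ∃ j < k, cell (prevRec N j) ≠ cell j ∧
    V.owner h = cell j ∧ V.Bwd h (H.at' (edge j) (lo j))

theorem markBegin_spec (R : Records V H N cell edge lo hi) {k : ℕ} (hk : k < N) {s : RamState}
    (hT : Tables V L H N cell edge lo hi s) (h18 : s.nvar 18 = k) (h19 : s.nvar 19 = nextRec N k)
    (h20 : s.nvar 20 = (cell k).val)
    (hb : ∀ j < k, cell (nextRec N j) ≠ cell j → ∃ h : Fin V.numEdges, s.narr 15 j = h.val ∧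
      V.owner h = cell j ∧ V.Fwd h (H.at' (edge j) (hi j))) :
    Runs markBegin s (46 * Nat.clog 2 P.card + 260) fun s' =>
      ∀ j < k + 1, cell (nextRec N j) ≠ cell j → ∃ h : Fin V.numEdges, s'.narr 15 j = h.val ∧
        V.owner h = cell j ∧ V.Fwd h (H.at' (edge j) (hi j)) := by
  have hJ := R.junction hk
  refine Runs.ite' (B₁ := 1) (B₂ := 46 * Nat.clog 2 P.card + 252) (fun hc => ?_) fun hc => ?_
  · simp only [BExp.eval, NExp.eval, h19, h20, hT.cell _ (nextRec_lt hk)] at hc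
    refine Runs.straight rfl le_rfl fun j hj hne => ?_
    rcases (by omega : j < k ∨ j = k) with h | rfl
    · exact hb j h hne
    · exact absurd (Fin.ext hc) hne
  · simp only [BExp.eval, NExp.eval, h19, h20, hT.cell _ (nextRec_lt hk)] at hc
    refine Runs.mono (B := 3 + (3 + ((46 * Nat.clog 2 P.card + 240) + 3)))
      (Runs.seq (Runs.run rfl) fun s₁ ⟨r₁, f₁⟩ =>
        Runs.seq (Runs.run rfl) fun s₂ ⟨r₂, f₂⟩ =>
        Runs.seq (search_tie (c := cell k) (c' := cell (nextRec N k)) (z := H.at' (edge k) (hi k))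
          ((hT.input.frame f₁).frame f₂) ?_ ?_ ?_ hJ.mem hJ.mem_next
          fun e => hc (congrArg Fin.val e)) fun s₃ ⟨_, ⟨e, he, ho, hf⟩, f₃⟩ =>
        (Runs.run rfl le_rfl).conseq fun s₄ ⟨q, f₄⟩ j hj hne => ?_) (by omega) fun _ h => h
    · rw [f₂.nvar 20, f₁.nvar 20, h20]
    · rw [f₂.rvar 20, r₁]
      simp [Cmd.run, RExp.eval, NExp.eval, h18, hT.hi0 k hk]
    · rw [r₂]
      simp [Cmd.run, RExp.eval, NExp.eval, f₁.nvar 18, f₁.rarr 16, h18, hT.hi1 k hk]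
    · have e18 : s₃.nvar 18 = k := by
        rw [f₃.nvar 18, f₂.nvar 18, f₁.nvar 18, h18]
      have h15 : s₄.narr 15 = Function.update (s.narr 15) k e.val := by
        rw [q]
        simp [block, Cmd.run, NExp.eval, e18, he, f₃.narr 15, f₂.narr 15,
          f₁.narr 15]
      rw [h15]
      rcases (by omega : j < k ∨ j = k) with h | rfl
      · rw [Function.update_of_ne h.ne]; exact hb j h hne
      · exact ⟨e, by simp, ho, hf⟩

theorem markEnd_spec (R : Records V H N cell edge lo hi) {k : ℕ} (hk : k < N) {s : RamState}
    (hT : Tables V L H N cell edge lo hi s) (h18 : s.nvar 18 = k) (h33 : s.nvar 33 = prevRec N k)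
    (h20 : s.nvar 20 = (cell k).val)
    (hb : ∀ h : Fin V.numEdges, s.narr 16 h.val = 1 ↔ ∃ j < k, cell (prevRec N j) ≠ cell j ∧
      V.owner h = cell j ∧ V.Bwd h (H.at' (edge j) (lo j))) :
    Runs markEnd s (46 * Nat.clog 2 P.card + 290) fun s' =>
      ∀ h : Fin V.numEdges, s'.narr 16 h.val = 1 ↔ ∃ j < k + 1, cell (prevRec N j) ≠ cell j ∧
        V.owner h = cell j ∧ V.Bwd h (H.at' (edge j) (lo j)) := by
  have hJ := R.junction (prevRec_lt hk)
  rw [hJ.eq_lo, nextRec_prevRec hk] at hJ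
  have hm1 := hJ.mem
  have hm2 := hJ.mem_next
  rw [nextRec_prevRec hk] at hm2
  have hold : ∀ h : Fin V.numEdges, (∃ j < k + 1, cell (prevRec N j) ≠ cell j ∧
      V.owner h = cell j ∧ V.Bwd h (H.at' (edge j) (lo j))) ↔ (∃ j < k, cell (prevRec N j) ≠ cell j ∧
      V.owner h = cell j ∧ V.Bwd h (H.at' (edge j) (lo j))) ∨ (cell (prevRec N k) ≠ cell k ∧
      V.owner h = cell k ∧ V.Bwd h (H.at' (edge k) (lo k))) := by
    intro h
    constructor
    · rintro ⟨j, hj, h'⟩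
      rcases (by omega : j < k ∨ j = k) with hlt | rfl
      · exact Or.inl ⟨j, hlt, h'⟩
      · exact Or.inr h'
    · rintro (⟨j, hj, h'⟩ | h')
      · exact ⟨j, by omega, h'⟩
      · exact ⟨k, by omega, h'⟩
  refine Runs.ite' (B₁ := 1) (B₂ := 46 * Nat.clog 2 P.card + 282) (fun hc => ?_) fun hc => ?_
  · simp only [BExp.eval, NExp.eval, h33, h20, hT.cell _ (prevRec_lt hk)] at hc
    refine Runs.straight rfl le_rfl fun h => ?_
    rw [hold]
    refine (hb h).trans ⟨Or.inl, fun h' => h'.resolve_right fun h' => h'.1 (Fin.ext hc)⟩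
  · simp only [BExp.eval, NExp.eval, h33, h20, hT.cell _ (prevRec_lt hk)] at hc
    refine Runs.mono (B := 3 + (3 + ((46 * Nat.clog 2 P.card + 240) + (30 + 3))))
      (Runs.seq (Runs.run rfl) fun s₁ ⟨r₁, f₁⟩ =>
        Runs.seq (Runs.run rfl) fun s₂ ⟨r₂, f₂⟩ =>
        Runs.seq (search_tie (c := cell k) (c' := cell (prevRec N k)) (z := H.at' (edge k) (lo k))
          ((hT.input.frame f₁).frame f₂) ?_ ?_ ?_ hm2 hm1
          fun e => hc (congrArg Fin.val e)) fun s₃ ⟨hS, ⟨e, he, ho, hf⟩, f₃⟩ =>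
        Runs.seq (stepBack_spec hS he ho hf).frame fun s₄ ⟨⟨e', he', ho', hb'⟩, f₄⟩ =>
        (Runs.run rfl le_rfl).conseq fun s₅ ⟨q, f₅⟩ h => ?_) (by omega) fun _ h => h
    · rw [f₂.nvar 20, f₁.nvar 20, h20]
    · rw [f₂.rvar 20, r₁]
      simp [Cmd.run, RExp.eval, NExp.eval, h18, hT.lo0 k hk]
    · rw [r₂]
      simp [Cmd.run, RExp.eval, NExp.eval, f₁.nvar 18, f₁.rarr 14, h18, hT.lo1 k hk]
    · have h16 : s₅.narr 16 = Function.update (s.narr 16) e'.val 1 := by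
        rw [q]
        simp [block, Cmd.run, NExp.eval, he', f₄.narr 16, f₃.narr 16,
          f₂.narr 16, f₁.narr 16]
      rw [h16, hold]
      by_cases hhe : h = e'
      · subst hhe
        simp only [Function.update_self, true_iff]
        exact Or.inr ⟨fun e => hc (congrArg Fin.val e), ho', hb'⟩
      · rw [Function.update_of_ne fun e => hhe (Fin.ext e)]
        refine (hb h).trans ⟨Or.inl, fun h' => h'.resolve_right fun h' => hhe ?_⟩
        exact VoronoiRep.Bwd.unique (h'.2.1.trans ho'.symm) h'.2.2 hb'

theorem markStep_spec (R : Records V H N cell edge lo hi) {k : ℕ} (hk : k < N) {s : RamState}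
    (hT : Tables V L H N cell edge lo hi s) (h18 : s.nvar 18 = k)
    (hM : Marked V H N cell edge lo hi k s) :
    Runs markStep s (92 * Nat.clog 2 P.card + 580) fun s' => Tables V L H N cell edge lo hi s' ∧
      s'.nvar 18 = k + 1 ∧ Marked V H N cell edge lo hi (k + 1) s' := by
  refine Runs.mono (B := 20 + (3 + ((46 * Nat.clog 2 P.card + 260) +
      ((46 * Nat.clog 2 P.card + 290) + 4))))
    (Runs.seq (neighbours_spec hT h18) fun s₁ ⟨⟨k19, k33⟩, f₁⟩ =>
      Runs.seq (Runs.run rfl) fun s₂ ⟨r₂, f₂⟩ => ?_)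
    (by omega) fun _ h => h
  have T₁ := hT.frame f₁
  have T₂ := T₁.frame f₂
  have a18 : s₂.nvar 18 = k := by rw [f₂.nvar 18, f₁.nvar 18, h18]
  have a19 : s₂.nvar 19 = nextRec N k := by rw [f₂.nvar 19, k19]
  have a33 : s₂.nvar 33 = prevRec N k := by rw [f₂.nvar 33, k33]
  have a20 : s₂.nvar 20 = (cell k).val := by
    rw [r₂]; simp [Cmd.run, NExp.eval, f₁.nvar 18, h18, T₁.cell k hk]
  refine Runs.seq (markBegin_spec R hk T₂ a18 a19 a20 ?_).frame fun s₃ ⟨hbeg, f₃⟩ =>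
    Runs.seq (markEnd_spec R hk (T₂.frame f₃) ?_ ?_ ?_ ?_).frame
      fun s₄ ⟨hend, f₄⟩ => (Runs.run rfl le_rfl).conseq fun s₅ ⟨q, f₅⟩ => ⟨?_, ?_, ?_, ?_⟩
  · rw [f₂.narr 15, f₁.narr 15]; exact hM.begins
  · rw [f₃.nvar 18, a18]
  · rw [f₃.nvar 33, a33]
  · rw [f₃.nvar 20, a20]
  · rw [f₃.narr 16, f₂.narr 16, f₁.narr 16]; exact hM.ends
  · exact ((T₂.frame f₃).frame f₄).frame
      f₅
  · rw [q]; simp [block, Cmd.run, NExp.eval, f₄.nvar 18, f₃.nvar 18, a18]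
  · rw [f₅.narr 15, f₄.narr 15]; exact hbeg
  · rw [f₅.narr 16]; exact hend

theorem markLoop_spec (R : Records V H N cell edge lo hi) {s : RamState}
    (hT : Tables V L H N cell edge lo hi s) (h18 : s.nvar 18 = 0) (h16 : ∀ k, s.narr 16 k = 0) :
    Runs (.loop (.nlt (.var 18) (.var 16)) markStep) s
      ((92 * Nat.clog 2 P.card + 583) * N + 3) fun s' => Tables V L H N cell edge lo hi s' ∧
      Marked V H N cell edge lo hi N s' := by
  let I : ℕ → RamState → Prop := fun t s' => ∃ k ≤ N, Tables V L H N cell edge lo hi s' ∧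
    s'.nvar 18 = k ∧ Marked V H N cell edge lo hi k s' ∧
    t = (92 * Nat.clog 2 P.card + 583) * (N - k) + 3
  refine Runs.loop I ?_ ?_ _ s ⟨0, Nat.zero_le _, hT, h18,
    ⟨fun j hj => absurd hj (Nat.not_lt_zero _), fun h => by simp [h16]⟩, rfl⟩
  · rintro t s' ⟨k, hk, T, h18, M, rfl⟩ hb
    simp only [BExp.eval, NExp.eval, h18, T.len] at hb
    refine ⟨_, (markStep_spec R hb T h18 M).conseq fun s'' ⟨T', h18', M'⟩ =>
      ⟨_, ?_, k + 1, hb, T', h18', M', rfl⟩⟩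
    rw [show N - k = (N - (k + 1)) + 1 by omega, Nat.mul_add]
    simp only [BExp.cost, NExp.cost]
    omega
  · rintro t s' ⟨k, hk, T, h18, M, rfl⟩ hb
    simp only [BExp.eval, NExp.eval, h18, T.len] at hb
    obtain rfl : k = N := by omega
    exact ⟨by simp only [BExp.cost, NExp.cost]; omega, T, M⟩

theorem Marked.finish {R : Records V H N cell edge lo hi} {s : RamState}
    (hM : Marked V H N cell edge lo hi N s) (h : Fin V.numEdges) :
    s.narr 16 h.val = 1 ↔ R.Finish h := by
  rw [hM.ends]
  constructor
  · rintro ⟨j, hj, h1, h2, h3⟩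
    have hJ := (R.junction (prevRec_lt hj)).eq_lo
    rw [nextRec_prevRec hj] at hJ
    refine ⟨prevRec N j, prevRec_lt hj, ?_, ?_, ?_⟩
    · rw [nextRec_prevRec hj]; exact h1.symm
    · rw [nextRec_prevRec hj]; exact h2
    · rw [hJ]; exact h3
  · rintro ⟨j, hj, h1, h2, h3⟩
    refine ⟨nextRec N j, nextRec_lt hj, ?_, h2, ?_⟩
    · rw [prevRec_nextRec hj]; exact h1.symm
    · rw [← (R.junction hj).eq_lo]; exact h3

/-! ## The traversal: cells at the boundary of the hull -/

variable {M : Set ℕ} {w l : List (Fin P.card)}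

/-- The memory during the traversal; `w` is the list at its start, `M` are the marks then. -/
structure Trav (V : VoronoiRep P) (L : PointLocator V) (H : HullRep Q) (N : ℕ)
    (cell : ℕ → Fin P.card) (edge : ℕ → ℕ) (lo hi : ℕ → ℝ) (M : Set ℕ) (w l : List (Fin P.card))
    (s : RamState) : Prop where
  tables : Tables V L H N cell edge lo hi s
  out : OutList V Q l s
  meets : ∀ c ∈ l, MeetsInt P Q (V.site c)
  prefix_le : w <+: l
  old : ∀ z ∈ M, s.narr 14 z ≠ 0

theorem Trav.frame {s s' : RamState} {c : Cmd} (h : Trav V L H N cell edge lo hi M w l s)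
    (hF : Frame c s s') (hc : c.safe = true := by rfl) (h16 : 16 ∉ c.nvars := by decide) (h13 : 13 ∉ c.narrs := by decide)
    (hr : c.rarrs = [] := by rfl) (h6 : 6 ∉ c.nvars := by decide) (h11 : 11 ∉ c.narrs := by decide) (h14 : 14 ∉ c.narrs := by decide) :
    Trav V L H N cell edge lo hi M w l s' :=
  ⟨h.tables.frame hF hc h16 h13 hr, h.out.frame hF h6 h11 h14, h.meets, h.prefix_le, by
    rw [hF.narr 14 h14]; exact h.old⟩

/-- Output a cell unless it is marked. -/
theorem outputNew_spec {s : RamState} (hT : Trav V L H N cell edge lo hi M w l s) {x : ℕ}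
    (hx : x = 20 ∨ x = 30) {c : Fin P.card} (hc : s.nvar x = c.val)
    (hm : MeetsInt P Q (V.site c) ∨ s.narr 14 c.val ≠ 0) :
    Runs (.ite (.neq (.load 14 (.var x)) (.const 0)) (output (.var x)) .skip) s 14 fun s' =>
      ∃ l', Trav V L H N cell edge lo hi M w l' s' ∧ l <+: l' ∧
        (MeetsInt P Q (V.site c) → c ∈ l') := by
  refine Runs.ite' (B₁ := 10) (B₂ := 1) (fun hb => ?_) fun hb => ?_
  · simp only [BExp.eval, NExp.eval, hc] at hb
    refine (output_spec hT.out (e := .var x) (c := c) hc (fun s' _ h2 h3 => ?_) hb).frame.mono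
      (by simp [NExp.cost]) fun s' ⟨⟨h1, h2⟩, hF⟩ => ⟨l ++ [c], ⟨hT.tables.frame hF rfl
        (by simp [output, block, Cmd.nvars]) (by simp [output, block, Cmd.narrs]) rfl, h1, fun d hd => ?_, hT.prefix_le.trans (List.prefix_append _ _),
        fun z hz => h2 z (hT.old z hz)⟩, List.prefix_append _ _, fun _ => by simp⟩
    · rcases hx with rfl | rfl
      exacts [h3, h2]
    · rcases List.mem_append.1 hd with h | h
      · exact hT.meets d h
      · rw [List.mem_singleton.1 h]
        exact hm.resolve_right fun h => h hb
  · simp only [BExp.eval, NExp.eval, hc] at hb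
    refine Runs.straight rfl le_rfl ⟨l, hT, List.prefix_rfl, fun ⟨y, hy, hyi⟩ => ?_⟩
    exact (hT.out.of_marked c hb).resolve_right fun h => h y hy (interior_subset hyi)

theorem visit_spec {s : RamState} (hT : Trav V L H N cell edge lo hi M w l s) {x : ℕ}
    {h : Fin V.numEdges} (hh : s.nvar x = h.val)
    (hm : MeetsInt P Q (V.sn h) ∨ s.narr 14 (V.nbr h).val ≠ 0) :
    Runs (visit (.var x)) s 17 fun s' => ∃ l', Trav V L H N cell edge lo hi M w l' s' ∧ l <+: l' ∧
      (MeetsInt P Q (V.sn h) → V.nbr h ∈ l') := by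
  refine Runs.mono (B := 3 + 14) (Runs.seq (Runs.run rfl)
    fun s₁ ⟨r₁, f₁⟩ => outputNew_spec (x := 30) (c := V.nbr h) (hT.frame f₁ rfl (by simp [Cmd.nvars])
      (by simp [Cmd.narrs]) rfl (by simp [Cmd.nvars]) (by simp [Cmd.narrs]) (by simp [Cmd.narrs]))
      (Or.inr rfl) ?_ ?_) (by omega) fun _ h => h
  · rw [r₁]; simp [Cmd.run, NExp.eval, hh, hT.tables.input.nbr]
  · rw [f₁.narr 14 (by simp [Cmd.narrs])]; exact hm

/-- The half-edges in `S` have been scanned, those in `A` come next. -/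
structure Scan (R : Records V H N cell edge lo hi) (L : PointLocator V) (M : Set ℕ)
    (w l : List (Fin P.card)) (S A : Finset (Fin V.numEdges)) (s : RamState) : Prop where
  trav : Trav V L H N cell edge lo hi M w l s
  marked : Marked V H N cell edge lo hi N s
  scanned : ∀ h : Fin V.numEdges, s.narr 17 h.val = 1 ↔ h ∈ S
  inside : ∀ h ∈ S, V.Inside Q h ∧ V.nbr h ∈ l
  closed : ∀ h ∈ S, ¬ R.Finish h → V.nxt h ∈ S ∪ A

variable {R : Records V H N cell edge lo hi} {S A : Finset (Fin V.numEdges)}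

theorem Marked.frame {k : ℕ} {s s' : RamState} {c : Cmd} (h : Marked V H N cell edge lo hi k s)
    (hF : Frame c s s') (h15 : 15 ∉ c.narrs := by decide) (h16 : 16 ∉ c.narrs := by decide) :
    Marked V H N cell edge lo hi k s' :=
  ⟨by rw [hF.narr 15 h15]; exact h.begins, by rw [hF.narr 16 h16]; exact h.ends⟩

theorem Scan.frame {s s' : RamState} {c : Cmd} (h : Scan R L M w l S A s)
    (hF : Frame c s s') (hc : c.safe = true := by rfl) (h16 : 16 ∉ c.nvars := by decide) (h13 : 13 ∉ c.narrs := by decide)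
    (hr : c.rarrs = [] := by rfl) (h6 : 6 ∉ c.nvars := by decide) (h11 : 11 ∉ c.narrs := by decide) (h14 : 14 ∉ c.narrs := by decide)
    (h15 : 15 ∉ c.narrs := by decide) (h16' : 16 ∉ c.narrs := by decide) (h17 : 17 ∉ c.narrs := by decide) : Scan R L M w l S A s' :=
  ⟨h.trav.frame hF hc h16 h13 hr h6 h11 h14, h.marked.frame hF h15 h16', by
    rw [hF.narr 17 h17]; exact h.scanned, h.inside, h.closed⟩

theorem Scan.card_le (hs : 3 ≤ H.size) {s : RamState} (h : Scan R L M w l S A s) :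
    S.card ≤ N + 6 * (innerSites P Q).card := by
  classical
  rw [← Finset.card_filter_add_card_filter_not (s := S) (fun h => R.Finish h)]
  refine Nat.add_le_add ?_ (VoronoiRep.card_inside_pairs_le _ fun e he => ?_)
  · choose! f hf using fun (h : Fin V.numEdges) (hh : R.Finish h) => hh
    conv_rhs => rw [← Finset.card_range N]
    refine Finset.card_le_card_of_injOn f (fun h hh => ?_) fun h hh h' hh' e => ?_
    · exact Finset.mem_coe.2 (Finset.mem_range.2 (hf h (Finset.mem_filter.1 hh).2).1)
    · have h1 := hf h (Finset.mem_filter.1 hh).2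
      have h2 := hf h' (Finset.mem_filter.1 hh').2
      rw [← e] at h2
      exact VoronoiRep.Bwd.unique (h1.2.2.1.trans h2.2.2.1.symm) h1.2.2.2 h2.2.2.2
  · obtain ⟨h1, h2⟩ := Finset.mem_filter.1 he
    have h3 := (h.inside e h1).1
    exact ⟨h3, Records.inside_nxt (R := R) hs h3 h2⟩

/-- The half-edge in the variable 21 is the next one to scan. -/
structure Pending (V : VoronoiRep P) (Q : Finset Plane) (c : Fin P.card) (h : Fin V.numEdges)
    (s : RamState) : Prop where
  flag : s.nvar 29 = 1
  eq : s.nvar 21 = h.val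
  owner : V.owner h = c
  inside : V.Inside Q h

theorem scanBody_spec (hs : 3 ≤ H.size) {s : RamState} {c : Fin P.card} {h : Fin V.numEdges}
    (hS : Scan R L M w l S {h} s) (hp : Pending V Q c h s) (h26 : s.nvar 26 = V.first c)
    (h27 : s.nvar 27 = V.deg c) :
    Runs scanBody s 50 fun s' =>
      ∃ l' A, Scan R L M w l' (insert h S) A s' ∧ l <+: l' ∧ ((s'.nvar 29 ≠ 1 ∧ A = ∅) ∨
        h ∉ S ∧ ∃ h', A = {h'} ∧ Pending V Q c h' s') := by
  refine Runs.ite' (B₁ := 2) (B₂ := 40) (fun hb => ?_) fun hb => ?_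
  · simp only [BExp.eval, NExp.eval, hp.eq, hS.scanned] at hb
    refine (Runs.run rfl).conseq fun s₁ ⟨q, f⟩ => ⟨l, ∅, ?_,
      List.prefix_rfl, Or.inl ⟨by rw [q]; simp [Cmd.run, NExp.eval], rfl⟩⟩
    rw [Finset.insert_eq_of_mem hb]
    have := hS.frame f
    refine ⟨this.trav, this.marked, this.scanned, this.inside, fun g hg hF => ?_⟩
    have := this.closed g hg hF
    rwa [Finset.union_comm, ← Finset.insert_eq, Finset.insert_eq_of_mem hb,
      ← Finset.union_empty S] at this
  · simp only [BExp.eval, NExp.eval, hp.eq, hS.scanned] at hb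
    refine Runs.mono (B := 3 + (17 + 19)) (Runs.seq (Runs.run rfl)
      fun s₁ ⟨r₁, f₁⟩ => Runs.seq (visit_spec (x := 21) (h := h) (hS.trav.frame f₁) ?_ (Or.inl hp.inside.nbr)).frame
      fun s₂ ⟨⟨l', hT, hl, hmem⟩, f₂⟩ => ?_) (by omega) fun _ h => h
    · rw [f₁.nvar 21, hp.eq]
    have h17 : s₂.narr 17 = Function.update (s.narr 17) h.val 1 := by
      rw [f₂.narr 17, r₁]; simp [Cmd.run, NExp.eval, hp.eq]
    have k21 : s₂.nvar 21 = h.val := by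
      rw [f₂.nvar 21, f₁.nvar 21, hp.eq]
    have k26 : s₂.nvar 26 = V.first c := by
      rw [f₂.nvar 26, f₁.nvar 26, h26]
    have k27 : s₂.nvar 27 = V.deg c := by
      rw [f₂.nvar 27, f₁.nvar 27, h27]
    have k29 : s₂.nvar 29 = 1 := by
      rw [f₂.nvar 29, f₁.nvar 29, hp.flag]
    have hM := (hS.marked.frame f₁).frame f₂
    have hold : ∀ A : Finset (Fin V.numEdges), (¬ R.Finish h → A = {V.nxt h}) →
        Scan R L M w l' (insert h S) A s₂ := by
      refine fun A hA => ⟨hT, hM, fun g => ?_, fun g hg => ?_, fun g hg hF => ?_⟩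
      · rw [h17, Finset.mem_insert]
        by_cases e : g = h
        · subst e; simp
        · rw [Function.update_of_ne fun e' => e (Fin.ext e'), hS.scanned]; tauto
      · rcases Finset.mem_insert.1 hg with rfl | hg
        · exact ⟨hp.inside, hmem hp.inside.nbr⟩
        · exact ⟨(hS.inside g hg).1, hl.subset (hS.inside g hg).2⟩
      · rcases Finset.mem_insert.1 hg with rfl | hg
        · simp [hA hF]
        · have := hS.closed g hg hF
          simp only [Finset.mem_union, Finset.mem_insert, Finset.mem_singleton] at this ⊢
          tauto
    refine Runs.ite' (B₁ := 2) (B₂ := 13) (fun hf => ?_) fun hf => ?_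
    · simp only [BExp.eval, NExp.eval, k21, hM.finish (R := R)] at hf
      exact (Runs.run rfl).conseq fun s₃ ⟨q, f⟩ => ⟨l', ∅,
        (hold ∅ fun h => absurd hf h).frame f, hl,
        Or.inl ⟨by rw [q]; simp [Cmd.run, NExp.eval], rfl⟩⟩
    · simp only [BExp.eval, NExp.eval, k21, hM.finish (R := R)] at hf
      obtain ⟨hn1, hn2⟩ := Records.inside_nxt hs hp.inside hf
      have hv := nxt_val h
      rw [hp.owner] at hv
      refine (Runs.frame (p := fun s' => s'.nvar 21 = (V.nxt h).val) ?_).conseq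
        fun s₃ ⟨q, f⟩ => ⟨l', {V.nxt h}, (hold _ fun _ => rfl).frame f, hl,
        Or.inr ⟨hb, _, rfl, by rw [f.nvar 29, k29], q, ?_, hn2⟩⟩
      · refine Runs.ite' (B₁ := 4) (B₂ := 2) (fun hb => ?_) fun hb => ?_
        all_goals
          simp only [BExp.eval, NExp.eval, k21, k26, k27] at hb
          refine Runs.straight rfl (by simp [Cmd.cost, NExp.cost]) ?_
          rw [hv]
          simp [Cmd.run, NExp.eval, k21, k26, hb]
      · rw [VoronoiRep.owner_nxt, hp.owner]

theorem scanLoop_spec (hs : 3 ≤ H.size) {s : RamState} {c : Fin P.card} {h₀ : Fin V.numEdges}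
    (hS : Scan R L M w l S ∅ s) (hp : Pending V Q c h₀ s) (h26 : s.nvar 26 = V.first c)
    (h27 : s.nvar 27 = V.deg c) :
    Halts scanLoop s fun t s' => ∃ l' S', Scan R L M w l' S' ∅ s' ∧ l <+: l' ∧ S ⊆ S' ∧ h₀ ∈ S' ∧
      S.card ≤ S'.card ∧ t ≤ 53 * (S'.card - S.card + 1) + 3 := by
  let I : ℕ → ℕ → RamState → Prop := fun k t s' => ∃ l' S' A, Scan R L M w l' S' A s' ∧
    l <+: l' ∧ S ⊆ S' ∧ h₀ ∈ (S' ∪ A : Finset (Fin V.numEdges)) ∧ s'.nvar 26 = V.first c ∧ s'.nvar 27 = V.deg c ∧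
    ((s'.nvar 29 ≠ 1 ∧ A = ∅ ∧ k = 0 ∧ t ≤ 53 * (S'.card - S.card + 1)) ∨
      ∃ h, A = {h} ∧ Pending V Q c h s' ∧ k = V.numEdges - S'.card + 1 ∧
        t ≤ 53 * (S'.card - S.card))
  have key := Halts.loop (b := .neq (.var 29) (.const 1)) (c :=
    scanBody)
    (q := fun t s' => ∃ l' S', Scan R L M w l' S' ∅ s' ∧ l <+: l' ∧ S ⊆ S' ∧ h₀ ∈ S' ∧
      S.card ≤ S'.card ∧ t ≤ 53 * (S'.card - S.card + 1) + 3) I ?_ ?_ _ 0 s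
    ⟨l, S, {h₀}, ⟨hS.trav, hS.marked, hS.scanned, hS.inside, fun g hg hF =>
      Finset.mem_union_left _ (by simpa using hS.closed g hg hF)⟩, List.prefix_rfl,
      Finset.Subset.refl _, by simp, h26, h27, Or.inr ⟨h₀, rfl, hp, rfl, by omega⟩⟩
  · exact key.mono fun t s' h => by rwa [zero_add] at h
  · rintro k t s' ⟨l', S', A, hS', hl, hSS, hh, g26, g27, h⟩ hb
    rcases h with ⟨h, -⟩ | ⟨h, rfl, hp', rfl, ht⟩
    · exact absurd hb h
    have hle := Finset.card_le_card hSS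
    refine (scanBody_spec hs hS' hp' g26 g27).frame.halts.mono fun t' s'' ⟨ht', ⟨l'', A, hS'', hl',
      hA⟩, f⟩ => ?_
    rw [Finset.union_comm, ← Finset.insert_eq] at hh
    have hi : S ⊆ insert h S' := hSS.trans (Finset.subset_insert _ _)
    have hic := Finset.card_le_card (Finset.subset_insert h S')
    have c26 : s''.nvar 26 = V.first c := by rw [f.nvar 26, g26]
    have c27 : s''.nvar 27 = V.deg c := by rw [f.nvar 27, g27]
    rcases hA with ⟨h29, rfl⟩ | ⟨hn, h', rfl, hp''⟩
    · refine ⟨0, by omega, l'', _, ∅, hS'', hl.trans hl', hi, Finset.mem_union_left _ hh, c26, c27,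
        Or.inl ⟨h29, rfl, rfl, ?_⟩⟩
      simp only [BExp.cost, NExp.cost]
      omega
    · have hcard := Finset.card_insert_of_notMem hn
      have hmax := Finset.card_le_univ (insert h S')
      rw [Fintype.card_fin] at hmax
      refine ⟨_, ?_, l'', _, _, hS'', hl.trans hl', hi, Finset.mem_union_left _ hh, c26, c27,
        Or.inr ⟨h', rfl, hp'', rfl, ?_⟩⟩
      · omega
      · simp only [BExp.cost, NExp.cost]
        omega
  · rintro k t s' ⟨l', S', A, hS', hl, hSS, hh, g26, g27, h⟩ hb
    rcases h with ⟨-, rfl, -, ht⟩ | ⟨h, rfl, hp', -⟩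
    · refine ⟨l', S', hS', hl, hSS, by simpa using hh, Finset.card_le_card hSS, ?_⟩
      simp only [BExp.cost, NExp.cost]
      omega
    · exact absurd hp'.flag hb

theorem scanStep_spec (hs : 3 ≤ H.size) {k : ℕ} (hk : k < N) {s : RamState}
    (hS : Scan R L M w l S ∅ s) (h18 : s.nvar 18 = k) :
    Halts scanStep s fun t s' => ∃ l' S', Scan R L M w l' S' ∅ s' ∧ s'.nvar 18 = k + 1 ∧
      l <+: l' ∧ S ⊆ S' ∧ S.card ≤ S'.card ∧ cell k ∈ l' ∧
      (cell (nextRec N k) ≠ cell k → ∀ h, V.owner h = cell k →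
        V.Fwd h (H.at' (edge k) (hi k)) → h ∈ S') ∧ t ≤ 53 * (S'.card - S.card) + 117 := by
  refine Runs.seq_halts (neighbours_spec hS.trav.tables h18) fun s₁ ⟨⟨k19, _⟩, f₁⟩ =>
    Runs.seq_halts (Runs.run (B := 3) rfl) fun s₂ ⟨r₂, f₂⟩ => ?_
  have S₂ := (hS.frame f₁).frame f₂
  have k18 : s₂.nvar 18 = k := by rw [f₂.nvar 18, f₁.nvar 18, h18]
  have k20 : s₂.nvar 20 = (cell k).val := by
    rw [r₂]
    simp [Cmd.run, NExp.eval, f₁.nvar 18, h18, f₁.narr 13, hS.trav.tables.cell k hk]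
  have hI := R.meets hs k hk
  refine Runs.seq_halts (outputNew_spec (x := 20) S₂.trav (Or.inl rfl) k20 (Or.inl hI)).frame
    fun s₃ ⟨⟨l₃, T₃, hl₃, hmem⟩, f₃⟩ => ?_
  have S₃ : Scan R L M w l₃ S ∅ s₃ := by
    refine ⟨T₃, S₂.marked.frame f₃, ?_, fun h hh => ⟨(S₂.inside h hh).1,
      hl₃.subset (S₂.inside h hh).2⟩, S₂.closed⟩
    rw [f₃.narr 17]; exact S₂.scanned
  have j18 : s₃.nvar 18 = k := by rw [f₃.nvar 18, k18]
  have j19 : s₃.nvar 19 = nextRec N k := by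
    rw [f₃.nvar 19, f₂.nvar 19, k19]
  have j20 : s₃.nvar 20 = (cell k).val := by rw [f₃.nvar 20, k20]
  refine Halts.seq (p := fun t s' => s'.nvar 18 = k ∧ ∃ l' S', Scan R L M w l' S' ∅ s' ∧
      l₃ <+: l' ∧ S ⊆ S' ∧ S.card ≤ S'.card ∧
      (cell (nextRec N k) ≠ cell k → ∀ h, V.owner h = cell k →
        V.Fwd h (H.at' (edge k) (hi k)) → h ∈ S') ∧ t ≤ 53 * (S'.card - S.card) + 76) ?_ ?_
  · refine Halts.ite (fun hb => ?_) fun hb => ?_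
    · simp only [BExp.eval, NExp.eval, j19, j20, T₃.tables.cell _ (nextRec_lt hk)] at hb
      refine (Runs.straight (B := 1) (p := fun s' => s' = s₃) rfl le_rfl rfl).halts.mono
        fun t s' ⟨ht, h⟩ => ?_
      subst h
      refine ⟨j18, l₃, S, S₃, List.prefix_rfl, Finset.Subset.refl _, le_rfl,
        fun h => absurd (Fin.ext hb) h, ?_⟩
      simp only [BExp.cost, NExp.cost]
      omega
    · simp only [BExp.eval, NExp.eval, j19, j20, T₃.tables.cell _ (nextRec_lt hk)] at hb
      have hne : cell (nextRec N k) ≠ cell k := fun e => hb (congrArg Fin.val e)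
      obtain ⟨h₀, e₀, o₀, F₀⟩ := S₃.marked.begins k hk hne
      refine Runs.seq_halts (Runs.run (B := 3) rfl)
        fun a₁ ⟨q₁, g₁⟩ => Runs.seq_halts (Runs.run (B := 3) rfl)
        fun a₂ ⟨q₂, g₂⟩ => Runs.seq_halts (Runs.run (B := 3) rfl)
        fun a₃ ⟨q₃, g₃⟩ => Runs.seq_halts (Runs.run (B := 2) rfl)
        fun a₄ ⟨q₄, g₄⟩ => ?_
      have S₇ := (((S₃.frame g₁).frame g₂).frame g₃).frame g₄
      refine (scanLoop_spec hs (c := cell k) (h₀ := h₀) S₇ ⟨?_, ?_, o₀, Records.Begin.inside (R := R)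
        hs ⟨k, hk, hne, o₀, F₀⟩⟩ ?_ ?_).frame.mono fun t s' ⟨⟨l', S', h1, h2, h3, h4, h5, h6⟩, f⟩ => ?_
      · rw [q₄]; simp [Cmd.run, NExp.eval]
      · rw [g₄.nvar 21, q₃]
        simp [Cmd.run, NExp.eval, g₂.nvar 18, g₁.nvar 18, j18, g₂.narr 15, g₁.narr 15, e₀]
      · rw [g₄.nvar 26, g₃.nvar 26, g₂.nvar 26, q₁]
        simp [Cmd.run, NExp.eval, j20, T₃.tables.input.first]
      · rw [g₄.nvar 27, g₃.nvar 27, q₂]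
        simp [Cmd.run, NExp.eval, g₁.nvar 20, j20, g₁.narr 1, T₃.tables.input.deg]
      · intro t₁ ht₁ t₂ ht₂ t₃ ht₃ t₄ ht₄
        refine ⟨?_, l', S', h1, h2, h3, h5, fun _ h ho hF => ?_, ?_⟩
        · rw [f.nvar 18, g₄.nvar 18, g₃.nvar 18, g₂.nvar 18, g₁.nvar 18, j18]
        · rwa [hF.unique (ho.trans o₀.symm) F₀]
        · simp only [BExp.cost, NExp.cost]
          omega
  · rintro t s₄ ⟨h18, l', S', h1, h2, h3, h4, h5, h6⟩
    refine (Runs.run (B := 4) rfl le_rfl).halts.mono fun t' s' ⟨ht', q, f⟩ t₃ ht₃ t₂ ht₂ t₁ ht₁ =>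
      ⟨l', S', h1.frame f, ?_, hl₃.trans h2, h3, h4, h2.subset (hmem hI), h5, ?_⟩
    · rw [q]; simp [block, Cmd.run, NExp.eval, h18]
    · omega

theorem scan_spec (hs : 3 ≤ H.size) {s : RamState} (hS : Scan R L M w l ∅ ∅ s)
    (h18 : s.nvar 18 = 0) :
    Halts (.loop (.nlt (.var 18) (.var 16)) scanStep) s fun t s' =>
      ∃ l' S, Scan R L M w l' S ∅ s' ∧ (∀ j < N, cell j ∈ l') ∧ (∀ h, R.Begin h → h ∈ S) ∧
        t ≤ 173 * N + 318 * (innerSites P Q).card + 3 := by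
  let I : ℕ → ℕ → RamState → Prop := fun n t s' => ∃ k ≤ N, ∃ l' S, n = N - k ∧ s'.nvar 18 = k ∧
    Scan R L M w l' S ∅ s' ∧ (∀ j < k, cell j ∈ l' ∧ (cell (nextRec N j) ≠ cell j → ∀ h,
      V.owner h = cell j → V.Fwd h (H.at' (edge j) (hi j)) → h ∈ S)) ∧ t ≤ 53 * S.card + 120 * k
  have key := Halts.loop (b := .nlt (.var 18) (.var 16)) (c := scanStep) (q := fun t s' =>
      ∃ l' S, Scan R L M w l' S ∅ s' ∧ (∀ j < N, cell j ∈ l') ∧ (∀ h, R.Begin h → h ∈ S) ∧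
        t ≤ 173 * N + 318 * (innerSites P Q).card + 3) I ?_ ?_ _ 0 s
    ⟨0, Nat.zero_le _, l, ∅, rfl, h18, hS, fun j hj => absurd hj (Nat.not_lt_zero _), Nat.zero_le _⟩
  · exact key.mono fun t s' h => by rwa [zero_add] at h
  · rintro _ t s' ⟨k, hk, l', S, rfl, h18, hS', hj, ht⟩ hb
    simp only [BExp.eval, NExp.eval, h18, hS'.trav.tables.len] at hb
    refine (scanStep_spec hs hb hS' h18).mono fun t' s'' ⟨l'', S', h1, h2, h3, h4, h5, h6, h7, h8⟩ =>
      ⟨_, ?_, k + 1, hb, l'', S', rfl, h2, h1, fun j hj' => ?_, ?_⟩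
    · omega
    · rcases (by omega : j < k ∨ j = k) with h | rfl
      · exact ⟨h3.subset (hj j h).1, fun hne h' ho hF => h4 ((hj j h).2 hne h' ho hF)⟩
      · exact ⟨h6, h7⟩
    · simp only [BExp.cost, NExp.cost]
      omega
  · rintro _ t s' ⟨k, hk, l', S, rfl, h18, hS', hj, ht⟩ hb
    simp only [BExp.eval, NExp.eval, h18, hS'.trav.tables.len] at hb
    obtain rfl : k = N := by omega
    refine ⟨l', S, hS', fun j h => (hj j h).1, fun h ⟨j, hj', hne, ho, hF⟩ => (hj j hj').2 hne h ho hF,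
      ?_⟩
    have := hS'.card_le hs
    simp only [BExp.cost, NExp.cost]
    omega

/-! ## The traversal: cells inside the hull -/

/-- The neighbours of a cell inside the hull meet the interior of the hull, unless they are mirror
images of recorded cells. -/
theorem Records.nbr_marked (R : Records V H N cell edge lo hi) (hs : 3 ≤ H.size)
    (hM : ∀ j < N, ∀ c, V.site c = mirror H (edge j) (V.site (cell j)) → c ≠ cell j → c.val ∈ M)
    {h : Fin V.numEdges} (hI : MeetsInt P Q (V.so h)) (hB : ¬ MeetsBd P Q (V.so h)) :
    MeetsInt P Q (V.sn h) ∨ (V.nbr h).val ∈ M := by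
  by_cases hin : V.Inside Q h
  · exact Or.inl hin.nbr
  right
  obtain ⟨i, hi', t₀, t₁, h0, h01, h1, e0, e1⟩ := VoronoiRep.exists_hull_edge hs
    ((V.edge_subset_owner h).trans (VoronoiRep.closed_subset_hull hI hB)) hin
  obtain ⟨j, hj, rfl, hl, hh⟩ := R.cover i hi' ((t₀ + t₁) / 2) (by linarith) (by linarith)
  have hlt := R.lo_lt_hi j hj
  have hab : max t₀ (lo j) < min t₁ (hi j) := by
    rw [max_lt_iff, lt_min_iff, lt_min_iff]
    exact ⟨⟨h01, by linarith⟩, by linarith, hlt⟩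
  have ha0 := le_max_left t₀ (lo j)
  have ha1 := le_max_right t₀ (lo j)
  have hb0 := min_le_left t₁ (hi j)
  have hb1 := min_le_right t₁ (hi j)
  have h5 := fun {t} (h0 : t₀ ≤ t) (h1 : t ≤ t₁) => mem_closed_between
    (V.edge_subset_owner h e0) (V.edge_subset_owner h e1) h0 h1
  have h6 := fun {t} (h0 : t₀ ≤ t) (h1 : t ≤ t₁) => gap_eq_zero_of_closed (V.so_mem h) (V.sn_mem h)
    (h5 h0 h1) (mem_closed_between (V.edge_subset_nbr h e0) (V.edge_subset_nbr h e1) h0 h1)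
  have hc : V.site (cell j) = V.so h := eq_of_inner hs (V.site_mem _) (V.so_mem h) (R.meets hs j hj)
    hI hab.ne (R.mem hj ha1 (hab.le.trans hb1)) (R.mem hj (ha1.trans hab.le) hb1)
    (h5 ha0 (hab.le.trans hb0)) (h5 (ha0.trans hab.le) hb0)
  have hm := (eq_mirror_of_ties (by omega) hab.ne (h6 ha0 (hab.le.trans hb0))
    (h6 (ha0.trans hab.le) hb0)).resolve_left (V.sn_ne_so h)
  refine hM j hj (V.nbr h) (by rw [hc]; exact hm) fun e => V.sn_ne_so h ?_
  rw [← hc, ← e]; rfl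

theorem queueStep_spec {s : RamState} (hT : Trav V L H N cell edge lo hi M w l s) {k : ℕ}
    {c : Fin P.card} (h17 : s.nvar 17 = k) (hk : l[k]? = some c)
    (hq : ∀ h, V.owner h = c → MeetsInt P Q (V.sn h) ∨ (V.nbr h).val ∈ M) :
    Runs queueStep s (24 * V.deg c + 21) fun s' => ∃ l', Trav V L H N cell edge lo hi M w l' s' ∧
      l <+: l' ∧ s'.nvar 17 = k + 1 ∧
      ∀ h, V.owner h = c → MeetsInt P Q (V.sn h) → V.nbr h ∈ l' := by
  obtain ⟨hkl, hc⟩ := List.getElem?_eq_some_iff.1 hk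
  refine Runs.mono (B := 3 + (3 + (5 + ((24 * V.deg c + 3) + 4))))
    (Runs.seq (Runs.run rfl) fun s₁ ⟨r₁, f₁⟩ =>
      Runs.seq (Runs.run rfl) fun s₂ ⟨r₂, f₂⟩ =>
      Runs.seq (Runs.run rfl) fun s₃ ⟨r₃, f₃⟩ => ?_)
    (by omega) fun _ h => h
  have T₁ := hT.frame f₁
  have T₂ := T₁.frame f₂
  have T₃ := T₂.frame f₃
  have k20 : s₁.nvar 20 = c.val := by
    rw [r₁]; simp [Cmd.run, NExp.eval, h17, hT.out.get k hkl, hc]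
  have k31 : s₂.nvar 31 = V.first c := by
    rw [r₂]; simp [Cmd.run, NExp.eval, k20, T₁.tables.input.first]
  have j31 : s₃.nvar 31 = V.first c := by rw [f₃.nvar 31, k31]
  have j32 : s₃.nvar 32 = V.first c + V.deg c := by
    rw [r₃]; simp [Cmd.run, NExp.eval, k31, f₂.nvar 20, k20, T₂.tables.input.deg]
  have j17 : s₃.nvar 17 = k := by
    rw [f₃.nvar 17, f₂.nvar 17, f₁.nvar 17, h17]
  let I : ℕ → RamState → Prop := fun t s' => ∃ i l', t = 24 * (V.deg c - i) + 3 ∧ i ≤ V.deg c ∧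
    s'.nvar 31 = V.first c + i ∧ s'.nvar 32 = V.first c + V.deg c ∧ s'.nvar 17 = k ∧
    Trav V L H N cell edge lo hi M w l' s' ∧ l <+: l' ∧
    ∀ h, V.owner h = c → h.val < V.first c + i → MeetsInt P Q (V.sn h) → V.nbr h ∈ l'
  refine Runs.seq (p := fun s' => s'.nvar 17 = k ∧ ∃ l', Trav V L H N cell edge lo hi M w l' s' ∧
    l <+: l' ∧ ∀ h, V.owner h = c → MeetsInt P Q (V.sn h) → V.nbr h ∈ l')
    (Runs.loop I ?_ ?_ _ _ ⟨0, l, rfl, Nat.zero_le _, j31, j32, j17, T₃, List.prefix_rfl,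
      fun h ho hlt => ?_⟩) fun s₄ ⟨g17, l', T₄, hl, hn⟩ =>
    (Runs.run rfl le_rfl).conseq fun s₅ ⟨q, f⟩ => ⟨l', T₄.frame f, hl, ?_, hn⟩
  · rintro _ s' ⟨i, l', rfl, hi, g31, g32, g17, T, hl, hn⟩ hb
    simp only [BExp.eval, NExp.eval, g31, g32, add_lt_add_iff_left] at hb
    have hlt : V.first c + i < V.numEdges := by have := V.block_le c; omega
    have ho : V.owner ⟨_, hlt⟩ = c := (V.mem_block _ _).2 ⟨by simp, by simpa using hb⟩
    refine ⟨17 + 4, Runs.seq (visit_spec (x := 31) T (h := ⟨_, hlt⟩) g31 ((hq _ ho).imp id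
      (T.old _))).frame fun a ⟨⟨l'', T', hl', hn'⟩, f⟩ => (Runs.run rfl le_rfl).conseq
      fun b ⟨q, f'⟩ => ⟨_, ?_, i + 1, l'', rfl, hb, ?_, ?_, ?_, T'.frame f', hl.trans hl', fun h hoh hlth hm => ?_⟩⟩
    · simp only [BExp.cost, NExp.cost]; omega
    · rw [q]; simp [Cmd.run, NExp.eval, f.nvar 31, g31, add_assoc]
    · rw [f'.nvar 32, f.nvar 32, g32]
    · rw [f'.nvar 17, f.nvar 17, g17]
    · rcases (by omega : h.val < V.first c + i ∨ h.val = V.first c + i) with h' | h'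
      · exact hl'.subset (hn h hoh h' hm)
      · obtain rfl : h = ⟨_, hlt⟩ := Fin.ext h'
        exact hn' hm
  · rintro _ s' ⟨i, l', rfl, hi, g31, g32, g17, T, hl, hn⟩ hb
    simp only [BExp.eval, NExp.eval, g31, g32, add_lt_add_iff_left] at hb
    refine ⟨by simp only [BExp.cost, NExp.cost]; omega, g17, l', T, hl, fun h ho hm => hn h ho ?_ hm⟩
    have := ((V.mem_block _ _).1 ho).2
    omega
  · have := ((V.mem_block _ _).1 ho).1
    omega
  · rw [q]; simp [block, Cmd.run, NExp.eval, g17]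

theorem card_owner_mem (D : Finset (Fin P.card)) :
    (Finset.univ.filter fun h => V.owner h ∈ D).card = ∑ c ∈ D, V.deg c := by
  rw [Finset.card_eq_sum_card_fiberwise (f := V.owner) (t := D) fun h hh => by simpa using hh]
  refine Finset.sum_congr rfl fun c hc => ?_
  conv_rhs => rw [show V.deg c = (Finset.range (V.deg c)).card by simp]
  refine Finset.card_bij' (fun h _ => h.val - V.first c) (fun j hj => ⟨V.first c + j, ?_⟩) ?_ ?_ ?_ ?_
  · have := V.block_le c; have := Finset.mem_range.1 hj; omega
  · intro h hh
    have := (V.mem_block h c).1 (Finset.mem_filter.1 hh).2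
    exact Finset.mem_range.2 (by omega)
  · intro j hj
    have hj := Finset.mem_range.1 hj
    have : V.owner ⟨V.first c + j, by have := V.block_le c; omega⟩ = c :=
      (V.mem_block _ _).2 ⟨by simp, by simpa using hj⟩
    simp [this, hc]
  · intro h hh
    have := (V.mem_block h c).1 (Finset.mem_filter.1 hh).2
    exact Fin.ext (by simp; omega)
  · intro j _; simp

theorem queue_spec (hs : 3 ≤ H.size) {s : RamState} (hT : Trav V L H N cell edge lo hi M w l s)
    (h17 : s.nvar 17 = w.length) (hw : ∀ c, MeetsBd P Q (V.site c) → c ∈ w)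
    (hq : ∀ h, MeetsInt P Q (V.so h) → ¬ MeetsBd P Q (V.so h) →
      MeetsInt P Q (V.sn h) ∨ (V.nbr h).val ∈ M) :
    Halts (.loop (.nlt (.var 17) (.var 6)) queueStep) s fun t s' =>
      ∃ l', Trav V L H N cell edge lo hi M w l' s' ∧ l <+: l' ∧
        (∀ c ∈ l', c ∉ w → ∀ h, V.owner h = c → MeetsInt P Q (V.sn h) → V.nbr h ∈ l') ∧
        t ≤ 264 * (innerSites P Q).card + 48 * H.size + 3 := by
  have hlen : ∀ {l' : List (Fin P.card)} {s'}, Trav V L H N cell edge lo hi M w l' s' →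
      l'.length ≤ (innerSites P Q).card := fun {l' s'} T => by
    classical
    rw [← List.toFinset_card_of_nodup T.out.nodup,
      ← Finset.card_image_of_injective _ V.site_injective]
    refine Finset.card_le_card fun p hp => ?_
    obtain ⟨c, hc, rfl⟩ := Finset.mem_image.1 hp
    exact mem_innerSites.2 ⟨V.site_mem c, T.meets c (List.mem_toFinset.1 hc)⟩
  let I : ℕ → ℕ → RamState → Prop := fun n t s' => ∃ k l' D, n = (innerSites P Q).card - k ∧
    Trav V L H N cell edge lo hi M w l' s' ∧ l <+: l' ∧ s'.nvar 17 = k ∧ w.length ≤ k ∧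
    k ≤ l'.length ∧
    (∀ c, c ∈ D ↔ ∃ j < k, w.length ≤ j ∧ l'[j]? = some c) ∧
    (∀ c ∈ D, ∀ h, V.owner h = c → MeetsInt P Q (V.sn h) → V.nbr h ∈ l') ∧
    t ≤ 24 * (∑ c ∈ D, V.deg c) + 24 * k
  have hnot : ∀ {l' : List (Fin P.card)} {s'}, Trav V L H N cell edge lo hi M w l' s' →
      ∀ {j c}, l'[j]? = some c → (w.length ≤ j ↔ c ∉ w) := fun {l' s'} T {j c} hc => by
    obtain ⟨r, rfl⟩ := T.prefix_le
    have hnd := T.out.nodup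
    obtain ⟨hj, rfl⟩ := List.getElem?_eq_some_iff.1 hc
    constructor
    · intro hle hm
      rw [List.getElem_append_right hle] at hm
      exact (List.nodup_append.1 hnd).2.2 _ hm _ (List.getElem_mem _) rfl
    · intro h
      by_contra hlt
      rw [List.getElem_append_left (by omega)] at h
      exact h (List.getElem_mem _)
  have hinner : ∀ {l' : List (Fin P.card)} {s'}, Trav V L H N cell edge lo hi M w l' s' →
      ∀ {c}, c ∈ l' → c ∉ w → MeetsInt P Q (V.site c) ∧ ¬ MeetsBd P Q (V.site c) :=
    fun T c hc hcw => ⟨T.meets c hc, fun h => hcw (hw c h)⟩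
  have key := Halts.loop (b := .nlt (.var 17) (.var 6)) (c := queueStep) (q := fun t s' =>
      ∃ l', Trav V L H N cell edge lo hi M w l' s' ∧ l <+: l' ∧
        (∀ c ∈ l', c ∉ w → ∀ h, V.owner h = c → MeetsInt P Q (V.sn h) → V.nbr h ∈ l') ∧
        t ≤ 264 * (innerSites P Q).card + 48 * H.size + 3) I ?_ ?_ _ 0 s
    ⟨_, l, ∅, rfl, hT, List.prefix_rfl, h17, le_rfl, hT.prefix_le.length_le, fun c => by simp; omega,
      by simp, Nat.zero_le _⟩
  · exact key.mono fun t s' h => by rwa [zero_add] at h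
  · rintro _ t s' ⟨k, l', D, rfl, T, hl, g17, hwk, hkl, hD, hn, ht⟩ hb
    simp only [BExp.eval, NExp.eval, g17, T.out.len] at hb
    have hlen' := hlen T
    have hc : l'[k]? = some l'[k] := List.getElem?_eq_getElem hb
    set c := l'[k]
    have hcw := (hnot T hc).1 hwk
    obtain ⟨i1, i2⟩ := hinner T (List.getElem_mem hb) hcw
    have hcD : c ∉ D := fun h => by
      obtain ⟨j, hj, -, e⟩ := (hD c).1 h
      obtain ⟨hj', e⟩ := List.getElem?_eq_some_iff.1 e
      exact hj.ne ((T.out.nodup.getElem_inj_iff).1 e)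
    refine (queueStep_spec T g17 hc fun h ho => hq h ?_ ?_).halts.mono fun t' s'' ⟨ht', l'', T', hl',
      g17', hn'⟩ => ⟨_, ?_, k + 1, l'', insert c D, rfl, T', hl.trans hl', g17', by omega,
        ?_, fun d => ?_, fun d hd h ho hm => ?_, ?_⟩
    · rw [show V.so h = V.site c by rw [← ho]; rfl]; exact i1
    · rw [show V.so h = V.site c by rw [← ho]; rfl]; exact i2
    · omega
    · have := hl'.length_le; omega
    · have hget : ∀ j < l'.length, l''[j]? = l'[j]? := fun j hj => by
        obtain ⟨r, rfl⟩ := hl'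
        rw [List.getElem?_append_left hj]
      rw [Finset.mem_insert, hD]
      constructor
      · rintro (rfl | ⟨j, hj, h1, h2⟩)
        · exact ⟨k, by omega, hwk, by rw [hget k hb, hc]⟩
        · exact ⟨j, by omega, h1, by rw [hget j (by omega), h2]⟩
      · rintro ⟨j, hj, h1, h2⟩
        rw [hget j (by omega)] at h2
        rcases (by omega : j < k ∨ j = k) with h | rfl
        · exact Or.inr ⟨j, h, h1, h2⟩
        · rw [hc] at h2; exact Or.inl (Option.some.inj h2).symm
    · rcases Finset.mem_insert.1 hd with rfl | hd
      · exact hn' h ho hm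
      · exact hl'.subset (hn d hd h ho hm)
    · rw [Finset.sum_insert hcD]
      simp only [BExp.cost, NExp.cost]
      omega
  · rintro _ t s' ⟨k, l', D, rfl, T, hl, g17, hwk, hkl, hD, hn, ht⟩ hb
    simp only [BExp.eval, NExp.eval, g17, T.out.len] at hb
    have hlen' := hlen T
    refine ⟨l', T, hl, fun c hc hcw => hn c ?_, ?_⟩
    · obtain ⟨j, hj, e⟩ := List.getElem_of_mem hc
      have e' : l'[j]? = some c := by rw [List.getElem?_eq_getElem hj, e]
      exact (hD c).2 ⟨j, by omega, (hnot T e').2 hcw, e'⟩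
    · have hA := VoronoiRep.card_edges_le hs (V := V) (Q := Q)
        (Finset.univ.filter fun h => V.owner h ∈ D) (fun h hh => ?_) fun h hh => ?_
      · rw [card_owner_mem] at hA
        simp only [BExp.cost, NExp.cost]
        omega
      · obtain ⟨j, -, h1, h2⟩ := (hD _).1 (Finset.mem_filter.1 hh).2
        obtain ⟨hj, e⟩ := List.getElem?_eq_some_iff.1 h2
        exact hinner T (e ▸ List.getElem_mem hj) ((hnot T h2).1 h1)
      · simpa [VoronoiRep.owner_nxt] using hh

/-! ## The traversal and its running time -/

theorem meetsBd_iff (hm : 0 < H.size) {p : Plane} : MeetsBd P Q p ↔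
    ∃ i < H.size, ∃ t, 0 ≤ t ∧ t ≤ 1 ∧ H.at' i t ∈ voronoiCell P p := by
  constructor
  · rintro ⟨x, hx, hf⟩
    obtain ⟨i, hi⟩ := (HullRep.frontier_eq (H := H) hm).1 hf
    obtain ⟨t, h0, h1, rfl⟩ := (HullRep.mem_edge_iff i.isLt).1 hi
    exact ⟨i, i.isLt, t, h0, h1, hx⟩
  · rintro ⟨i, hi, t, h0, h1, hx⟩
    exact ⟨_, hx, (HullRep.frontier_eq (H := H) hm).2
      ⟨⟨i, hi⟩, (HullRep.mem_edge_iff hi).2 ⟨t, h0, h1, rfl⟩⟩⟩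

theorem traverse_inner (hs : 3 ≤ H.size) {l : List (Fin P.card)} {recs : List (Rec P.card)}
    {s : RamState} (hW : WalkState V L H H.size l recs s) :
    Halts (block [
      .nset 17 (.var 6),
      .nset 18 (.const 0),
      .loop (.nlt (.var 18) (.var 16)) markStep,
      .nset 18 (.const 0),
      .loop (.nlt (.var 18) (.var 16)) scanStep,
      .loop (.nlt (.var 17) (.var 6)) queueStep]) s fun t s' => ∃ l', OutList V Q l' s' ∧
        (∀ c, c ∈ l' ↔ MeetsInt P Q (V.site c)) ∧
        t ≤ (92 * Nat.clog 2 P.card + 756) * recs.length + 582 * (innerSites P Q).card +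
          48 * H.size + 15 := by
  obtain ⟨d, -, -⟩ := hW.cell
  have R := (hW.walked (by omega)).records ⟨d, 0, 0, 0⟩
  have hg : ∀ j (hj : j < recs.length), recs.getD j ⟨d, 0, 0, 0⟩ = recs[j] :=
    fun j hj => by simp [hj]
  have hM := hW.outer (by omega)
  replace hM : ∀ j < recs.length, ∀ c, V.site c = mirror H (recs.getD j ⟨d, 0, 0, 0⟩).edge
      (V.site (recs.getD j ⟨d, 0, 0, 0⟩).cell) → c ≠ (recs.getD j ⟨d, 0, 0, 0⟩).cell →
      c.val ∈ {z | s.narr 14 z ≠ 0} := fun j hj =>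
    hM _ (by rw [hg j hj]; exact List.getElem_mem hj)
  have T : Tables V L H recs.length (fun j => (recs.getD j ⟨d, 0, 0, 0⟩).cell)
      (fun j => (recs.getD j ⟨d, 0, 0, 0⟩).edge) (fun j => (recs.getD j ⟨d, 0, 0, 0⟩).lo)
      (fun j => (recs.getD j ⟨d, 0, 0, 0⟩).hi) s := by
    refine ⟨hW.input, hW.list.len, fun j hj => ?_, fun j hj => ?_, fun j hj => ?_, fun j hj => ?_,
      fun j hj => ?_⟩ <;> obtain ⟨e1, e2, e3, e4, e5⟩ := hW.list.get j hj <;> rw [hg j hj] <;>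
      assumption
  have hbd : ∀ c, MeetsBd P Q (V.site c) ↔ c ∈ l := fun c => by
    rw [meetsBd_iff (H := H) (by omega), hW.mem]
  have T₀ : Trav V L H recs.length _ _ _ _ {z | s.narr 14 z ≠ 0} l l s :=
    ⟨T, hW.out, fun c hc => inner_of_meetsBd hs ((hbd c).2 hc), List.prefix_rfl, fun _ h => h⟩
  refine Runs.seq_halts (Runs.run (B := 2) rfl le_rfl) fun s₁ ⟨q₁, f₁⟩ =>
    Runs.seq_halts (Runs.run (B := 2) rfl le_rfl) fun s₂ ⟨q₂, f₂⟩ => ?_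
  have T₂ := (T₀.frame f₁).frame
    f₂
  refine Runs.seq_halts (markLoop_spec R T₂.tables (by rw [q₂]; simp [Cmd.run, NExp.eval]) ?_).frame
    fun s₃ ⟨⟨_, hMk⟩, f₃⟩ => Runs.seq_halts (Runs.run (B := 2) rfl le_rfl) fun s₄ ⟨q₄, f₄⟩ => ?_
  · rw [f₂.narr 16, f₁.narr 16]; exact hW.endmark
  have T₄ := (T₂.frame f₃).frame
    f₄
  have S₄ : Scan R L {z | s.narr 14 z ≠ 0} l l ∅ ∅ s₄ := by
    refine ⟨T₄, hMk.frame f₄, fun h => ?_, by simp, by simp⟩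
    rw [f₄.narr 17, f₃.narr 17, f₂.narr 17, f₁.narr 17, hW.scanned]
    simp
  refine Halts.seq (scan_spec hs S₄ (by rw [q₄]; simp [Cmd.run, NExp.eval])).frame
    fun t₅ s₅ ⟨⟨l₅, S, S₅, hcell, hbeg, ht₅⟩, f₅⟩ => ?_
  refine (queue_spec hs S₅.trav ?_ (fun c => (hbd c).1) fun h => R.nbr_marked hs hM).mono
    fun t₆ s₆ ⟨l₆, T₆, hl, hn, ht₆⟩ t₄ ht₄ t₃ ht₃ t₂ ht₂ t₁ ht₁ =>
    ⟨l₆, T₆.out, fun c => ⟨T₆.meets c, fun hc => ?_⟩, ?_⟩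
  · rw [f₅.nvar 17, f₄.nvar 17, f₃.nvar 17, f₂.nvar 17, q₁, ← hW.out.len]
    simp [Cmd.run, NExp.eval]
  · obtain ⟨j₀, hj₀, -⟩ := R.cover 0 (by omega) 0 le_rfl zero_le_one
    refine connected_inside (· ∈ l₆) (hl.subset (hcell j₀ hj₀)) (R.meets hs j₀ hj₀)
      (fun h ho hin => ?_) hc
    by_cases hb : V.owner h ∈ l
    · obtain ⟨i, hi, t, h0, h1, hx⟩ := (hW.mem _).1 hb
      obtain ⟨j, hj, rfl, hlo, hhi⟩ := R.cover i hi t h0 h1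
      have he := eq_of_mem_open_of_mem_closed (V.site_mem _) (V.site_mem _) hx (R.mem hj hlo hhi)
      refine hl.subset (S₅.inside h (R.scan_complete hs (S := (· ∈ S)) hbeg (fun g hg hF => ?_) hj
        (V.site_injective he.symm) hin)).2
      simpa using S₅.closed g hg hF
    · exact hn _ ho hb h rfl hin.nbr
  · have e : (92 * Nat.clog 2 P.card + 756) * recs.length =
        (92 * Nat.clog 2 P.card + 583) * recs.length + 173 * recs.length := by ring
    omega

theorem traverse_spec (hm : 0 < H.size) {l : List (Fin P.card)} {recs : List (Rec P.card)}
    {s : RamState} (hW : WalkState V L H H.size l recs s) :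
    Halts traverseCmd s fun t s' => Outputs V s' (seedPoints P Q) ∧
        t ≤ (92 * Nat.clog 2 P.card + 756) * recs.length + 582 * (innerSites P Q).card +
          48 * H.size + 18 := by
  have hsub : seedPoints P Q ⊆ P := fun p h => h.1
  refine Halts.ite (fun hb => ?_) fun hb => ?_
  · simp only [BExp.eval, NExp.eval, hW.input.hullSize] at hb
    refine (traverse_inner hb hW).mono fun t s' ⟨l', h1, h2, h3⟩ =>
      ⟨h1.outputs (fun c => ?_) hsub, ?_⟩
    · rw [h2, mem_seedPoints_iff hb]
      exact (and_iff_right (V.site_mem c)).symm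
    · simp only [BExp.cost, NExp.cost]
      omega
  · simp only [BExp.eval, NExp.eval, hW.input.hullSize] at hb
    refine (Runs.straight (B := 1) (p := fun s' => s' = s) rfl le_rfl rfl).halts.mono
      fun t s' ⟨ht, h⟩ => ?_
    subst h
    refine ⟨hW.out.outputs (fun c => ?_) hsub, ?_⟩
    · rw [mem_seedPoints_iff_of_le (H := H) hm (by omega), meetsBd_iff (H := H) hm, hW.mem]
      exact (and_iff_right (V.site_mem c)).symm
    · simp only [BExp.cost, NExp.cost]
      omega

/-- The number of records is linear in the size of the output. -/
theorem WalkState.card_le {l : List (Fin P.card)} {recs : List (Rec P.card)}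
    {s : RamState} (hW : WalkState V L H H.size l recs s) (hm : 0 < H.size)
    (h1 : H.size = 1 → recs = []) : recs.length ≤ 2 * (skyline P Q).ncard + H.size := by
  classical
  rcases (by omega : H.size = 1 ∨ 2 ≤ H.size) with h | h2
  · simp [h1 h]
  have hv := (hW.walked h2).valid
  have hnd : (recs.map fun r => (r.edge, V.site r.cell)).Nodup := by
    have := hW.distinct.map (f := fun x : ℕ × Fin P.card => (x.1, V.site x.2))
      (Function.injective_id.prodMap V.site_injective)
    rwa [List.map_map] at this
  have hlen := List.toFinset_card_of_nodup hnd
  rw [List.length_map] at hlen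
  have hmem : ∀ x ∈ (recs.map fun r => (r.edge, V.site r.cell)).toFinset,
      ∃ r ∈ recs, (r.edge, V.site r.cell) = x := fun x hx => by simpa using hx
  rw [← hlen]
  rcases (by omega : H.size = 2 ∨ 3 ≤ H.size) with h | h3
  · refine le_trans (b := (Finset.range 2 ×ˢ P.filter fun p => p ∈ skyline P Q).card)
      (Finset.card_le_card fun x hx => ?_) ?_
    · obtain ⟨r, hr, rfl⟩ := hmem x hx
      have hr := hv r hr
      simp only [Finset.mem_product, Finset.mem_range, Finset.mem_filter]
      exact ⟨h ▸ hr.edge_lt, V.site_mem _, mem_skyline_of_segment h (V.site_mem _) hr.lo_nonneg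
        hr.lo_lt_hi hr.hi_le hr.lo_mem hr.hi_mem⟩
    · rw [Finset.card_product, Finset.card_range]
      have := card_le_skyline (P := P) (Q := Q) (A := P.filter fun p => p ∈ skyline P Q)
        fun p hp => (Finset.mem_filter.1 hp).2
      omega
  · have := card_pieces_le h3 (recs.map fun r => (r.edge, V.site r.cell)).toFinset (innerSites P Q)
      (fun x hx => ?_) (fun p => mem_innerSites.1)
    · have := card_innerSites_le (P := P) (Q := Q)
      omega
    · obtain ⟨r, hr, rfl⟩ := hmem x hx
      have hr := hv r hr
      exact ⟨hr.edge_lt, mem_innerSites.2 ⟨V.site_mem _, hr.meets h3⟩, r.lo, r.hi, hr.lo_nonneg,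
        hr.lo_lt_hi, hr.hi_le, hr.lo_mem, hr.hi_mem⟩

theorem seedSkyline_spec (hm : 0 < H.size) :
    Halts (seedSkyline locateCmd edgeCmd traverseCmd) (inputState V L H) fun t s' =>
      Outputs V s' (seedPoints P Q) ∧ t ≤ ((skyline P Q).ncard + H.size) *
        (726 * L.depth + 276 * Nat.clog 2 P.card + 7515) := by
  refine Runs.seq_halts (startWalk_spec hm) fun s₁ ⟨hW, h4⟩ => Halts.seq (walkLoop_all hm hW h4)
    fun t₂ s₂ ⟨l, recs, hW', h1, ht₂⟩ => (traverse_spec hm hW').mono fun t₃ s₃ ⟨hO, ht₃⟩ t₁ ht₁ =>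
    ⟨hO, ?_⟩
  have hN := hW'.card_le hm h1
  have hF := card_innerSites_le (P := P) (Q := Q)
  unfold edgeTime at ht₂
  generalize (skyline P Q).ncard = S at *
  generalize H.size = m at *
  generalize recs.length = N at *
  generalize (innerSites P Q).card = F at *
  generalize L.depth = d at *
  generalize Nat.clog 2 P.card = c at *
  have e1 : (352 * d + 46 * c + 2650 + 7) * (N + m) ≤ (352 * d + 46 * c + 2650 + 7) * (2 * (S + m)) :=
    Nat.mul_le_mul_left _ (by omega)
  have e2 : (92 * c + 756) * N ≤ (92 * c + 756) * (2 * (S + m)) := Nat.mul_le_mul_left _ (by omega)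
  have e3 : 22 * d + 20 ≤ (S + m) * (22 * d + 20) := Nat.le_mul_of_pos_left _ (by omega)
  have e4 : (S + m) * (726 * d + 276 * c + 7515) = (352 * d + 46 * c + 2650 + 7) * (2 * (S + m)) +
      (92 * c + 756) * (2 * (S + m)) + (S + m) * (22 * d + 20) + 669 * (S + m) := by ring
  omega

theorem clog_le_log {n : ℕ} (hn : 0 < n) : (Nat.clog 2 n : ℝ) ≤ 4 * Real.log (n + 1) ∧
    1 ≤ 2 * Real.log ((n : ℝ) + 1) := by
  have h1 : (1 : ℝ) ≤ n := by exact_mod_cast hn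
  have hlog2 := Real.log_two_gt_d9
  have hle : Real.log 2 ≤ Real.log ((n : ℝ) + 1) := Real.log_le_log two_pos (by linarith)
  refine ⟨?_, by linarith⟩
  rcases Nat.eq_zero_or_pos (Nat.clog 2 n) with h | h
  · rw [h, Nat.cast_zero]; linarith
  have hp : 2 ^ (Nat.clog 2 n - 1) < n := by
    by_contra hc
    have := (Nat.clog_le_iff_le_pow (by norm_num)).2 (not_lt.1 hc)
    omega
  have hp' : (2 : ℝ) ^ (Nat.clog 2 n - 1) ≤ (n : ℝ) + 1 := by
    have : ((2 ^ (Nat.clog 2 n - 1) : ℕ) : ℝ) ≤ n := by exact_mod_cast hp.le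
    push_cast at this
    linarith
  have := Real.log_le_log (by positivity) hp'
  rw [Real.log_pow, Nat.cast_sub h, Nat.cast_one] at this
  have h2 : (1 : ℝ) ≤ Nat.clog 2 n := by exact_mod_cast h
  nlinarith

end

theorem mainTheorem7 :
    ∃ locate edge traverse : Cmd, ∀ K : ℝ, ∃ C : ℝ,
      ∀ (P Q : Finset Plane), P.Nonempty → Q.Nonempty →
      ∀ (V : VoronoiRep P) (L : PointLocator V) (H : HullRep Q),
      (L.depth : ℝ) ≤ K * Real.log ((P.card : ℝ) + 1) →
        -- a Voronoi cell containing the first hull vertex is located in logarithmic time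
        (∃ (t : ℕ) (s : RamState), Exec locate (inputState V L H) t s ∧
          (t : ℝ) ≤ C * Real.log ((P.card : ℝ) + 1) ∧
          ∃ (i : Fin P.card) (j : Fin H.size), s.nvar cellVar = i.val ∧ j.val = 0 ∧
            H.vertex j ∈ closedVoronoiCell P (V.site i)) ∧
        -- the first `k` hull edges contribute exactly the cells that they meet
        (∀ k ≤ H.size, ∃ (t : ℕ) (s : RamState),
          Exec (walkEdges locate edge k) (inputState V L H) t s ∧
          s.nvar edgeVar = k ∧
          Outputs V s {p | p ∈ P ∧ ∃ i : Fin H.size, i.val < k ∧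
            (voronoiCell P p ∩ H.edge i).Nonempty}) ∧
        -- the whole algorithm, its output and its running time
        (∃ (t : ℕ) (s : RamState),
          Exec (seedSkyline locate edge traverse) (inputState V L H) t s ∧
          Outputs V s (seedPoints P Q) ∧
          (t : ℝ) ≤ C * (((skyline P Q).ncard : ℝ) + (hullSize Q : ℝ)) *
            Real.log ((P.card : ℝ) + 1)) := by
  refine ⟨locateCmd, edgeCmd, traverseCmd, fun K => ⟨726 * K + 16134, fun P Q hP hQ V L H hK => ?_⟩⟩
  have hm : 0 < H.size := H.size_pos hQ
  obtain ⟨hc, h1⟩ := clog_le_log hP.card_pos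
  set x := Real.log ((P.card : ℝ) + 1)
  have hd : (0 : ℝ) ≤ L.depth := Nat.cast_nonneg _
  refine ⟨?_, fun k hk => ?_, ?_⟩
  · obtain ⟨t, s, he, ht, -, r, hr, hz⟩ := locateCmd_spec hm (input_inputState (V := V) (L := L) (H := H))
    have ht : (t : ℝ) ≤ 22 * L.depth + 18 := by exact_mod_cast ht
    refine ⟨t, s, he, by nlinarith, r, ⟨0, hm⟩, hr, rfl, ?_⟩
    rwa [HullRep.at_zero, HullRep.pt_of_lt hm] at hz
  · obtain ⟨t, s, he, l, recs, hW, h4⟩ := walkEdges_spec (V := V) (L := L) hm hk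
    refine ⟨t, s, he, h4, hW.out.outputs (fun c => ?_) fun p h => h.1⟩
    rw [hW.mem]
    constructor
    · rintro ⟨i, hi, t, h0, h1, hx⟩
      exact ⟨V.site_mem c, ⟨i, by omega⟩, hi, _, hx,
        (HullRep.mem_edge_iff (by omega)).2 ⟨t, h0, h1, rfl⟩⟩
    · rintro ⟨-, i, hi, y, hy, hy'⟩
      obtain ⟨t, h0, h1, rfl⟩ := (HullRep.mem_edge_iff i.isLt).1 hy'
      exact ⟨i, hi, t, h0, h1, hy⟩
  · obtain ⟨t, s, he, hO, ht⟩ := seedSkyline_spec (V := V) (L := L) hm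
    refine ⟨t, s, he, hO, ?_⟩
    rw [H.size_eq]
    have ht : (t : ℝ) ≤ (((skyline P Q).ncard : ℝ) + H.size) *
        (726 * L.depth + 276 * Nat.clog 2 P.card + 7515) := by exact_mod_cast ht
    have hA : (0 : ℝ) ≤ ((skyline P Q).ncard : ℝ) + H.size := by positivity
    calc (t : ℝ) ≤ _ := ht
      _ ≤ (((skyline P Q).ncard : ℝ) + H.size) * ((726 * K + 16134) * x) :=
        mul_le_mul_of_nonneg_left (by linarith) hA
      _ = _ := by ring
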